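/- **Theorem (Max-$k$-Cover algorithm).** Let $\omega$ be the exponent of matrix multiplication (over $\mathbb{Q}$). There is a constant $c$ such that for every fixed integer $k\ge 1$ the following holds. There is a deterministic algorithm (on a unit-cost word RAM with words of $O(\log N)$ bits, where $N$ denotes the input size) which, given a bipartite graph $G=(X\cup Y,E)$ with $|X|=n\ge 1$ and $|Y|=u$ as a list of its edges in arbitrary order, finds vertices $x_1,\dots,x_k\in X$ (pairwise distinct if $n\ge k$) that maximize $|N(x_1)\cup\dots\cup N(x_k)|$ over all choices of $k$ vertices of $X$, in time $$O\Big(n+u+|E|+\Big(\big(\min\{n,\Delta_f\cdot\min\{u^{1/3},\sqrt{\Delta_s}\}\}\big)^k+\big(\min\{n,\Delta_f\cdot\min\{\sqrt u,\Delta_s\}\}\big)^{k\omega/3}\Big)\cdot(\Delta_s\Delta_f)^{c}\Big),$$ where $\Delta_s=\max_{x\in X}\deg(x)$ and $\Delta_f=\max_{y\in Y}\deg(y)$. The constant $c$ does not depend on $k$; the constant hidden in the $O$, the word-length constant and the algorithm may depend on $k$ (but not on $G$). -/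

import Mathlib

/-! ### Bipartite graphs and Max-`k`-Cover -/

/-- A bipartite graph `G = (X ∪ Y, E)` with `X = Fin n` (the sets), `Y = Fin u` (the universe). -/
structure BipartiteGraph (n u : ℕ) where
  edges : Finset (Fin n × Fin u)

namespace BipartiteGraph

variable {n u : ℕ} (G : BipartiteGraph n u)

/-- The neighbourhood `N(x) ⊆ Y` of `x ∈ X`. -/
def nbrX (x : Fin n) : Finset (Fin u) := Finset.univ.filter fun y => (x, y) ∈ G.edges

/-- The neighbourhood `N(y) ⊆ X` of `y ∈ Y`. -/
def nbrY (y : Fin u) : Finset (Fin n) := Finset.univ.filter fun x => (x, y) ∈ G.edges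

/-- `Δ_s`, the maximum degree of a vertex in `X` (maximum set size). -/
def maxSetSize : ℕ := Finset.univ.sup fun x => (G.nbrX x).card

/-- `Δ_f`, the maximum degree of a vertex in `Y` (maximum frequency). -/
def maxFrequency : ℕ := Finset.univ.sup fun y => (G.nbrY y).card

/-- `|N(x₁) ∪ ⋯ ∪ N(x_k)|`. -/
def coverage {k : ℕ} (x : Fin k → Fin n) : ℕ := (Finset.univ.biUnion fun i => G.nbrX (x i)).card

/-- `es` lists every edge of `G` exactly once, in some order. -/
def IsEdgeList (es : List (Fin n × Fin u)) : Prop := es.Nodup ∧ es.toFinset = G.edges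

end BipartiteGraph

/-! ### The exponent of matrix multiplication -/

/-- The `q × q × q` matrix multiplication tensor over `ℚ` has rank at most `r`: there is a bilinear
algorithm for the product of two `q × q` matrices with `r` essential multiplications. -/
def MatMulRankLE (q r : ℕ) : Prop :=
  ∃ α β γ : Fin r → Matrix (Fin q) (Fin q) ℚ, ∀ A B : Matrix (Fin q) (Fin q) ℚ,
    A * B = ∑ t, ((∑ i, ∑ j, α t i j * A i j) * (∑ i, ∑ j, β t i j * B i j)) • γ t

/-- The matrix multiplication exponent `ω = inf_{q ≥ 2} log_q R(⟨q, q, q⟩)`, where `R` is the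
tensor rank: the infimum of all `τ` with `R(⟨q, q, q⟩) ≤ q ^ τ` for some `q ≥ 2`. -/
noncomputable def matMulExponent : ℝ :=
  sInf {τ : ℝ | ∃ q r : ℕ, 2 ≤ q ∧ MatMulRankLE q r ∧ (r : ℝ) ≤ (q : ℝ) ^ τ}

/-! ### Word RAM programs

A random access machine with finitely many registers and finitely many arrays (those that occur in
the program), all holding natural numbers, at unit cost per operation. Every number that
arises has to be smaller than the word bound `B`; a computation that exceeds it has no run. -/

/-- Memory contents: `reg x` is register `x`, and `arr a i` is cell `i` of array `a`. -/
structure RamState where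
  reg : ℕ → ℕ
  arr : ℕ → ℕ → ℕ

namespace RamState

def setReg (σ : RamState) (x v : ℕ) : RamState :=
  { σ with reg := Function.update σ.reg x v }

def setArr (σ : RamState) (a i v : ℕ) : RamState :=
  { σ with arr := Function.update σ.arr a (Function.update (σ.arr a) i v) }

end RamState

/-- Word operations; `sub` is truncated subtraction, `div` and `mod` are those of `ℕ`,
and `lt`, `eq` return `1` for true and `0` for false. -/
inductive RamOp
  | add | sub | mul | div | mod | lt | eq

def RamOp.eval : RamOp → ℕ → ℕ → ℕ
  | .add, a, b => a + b
  | .sub, a, b => a - b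
  | .mul, a, b => a * b
  | .div, a, b => a / b
  | .mod, a, b => a % b
  | .lt, a, b => if a < b then 1 else 0
  | .eq, a, b => if a = b then 1 else 0

/-- Expressions: constants, registers, array cells with computed address, word operations. -/
inductive RamExpr
  | const (v : ℕ)
  | reg (x : ℕ)
  | get (a : ℕ) (i : RamExpr)
  | op (o : RamOp) (e₁ e₂ : RamExpr)

namespace RamExpr

def eval (σ : RamState) : RamExpr → ℕ
  | const v => v
  | reg x => σ.reg x
  | get a i => σ.arr a (i.eval σ)
  | op o e₁ e₂ => o.eval (e₁.eval σ) (e₂.eval σ)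

/-- Every value that arises in the evaluation is smaller than the word bound `B`. -/
def Fits (B : ℕ) (σ : RamState) : RamExpr → Prop
  | const v => v < B
  | reg x => σ.reg x < B
  | get a i => i.Fits B σ ∧ σ.arr a (i.eval σ) < B
  | op o e₁ e₂ => e₁.Fits B σ ∧ e₂.Fits B σ ∧ o.eval (e₁.eval σ) (e₂.eval σ) < B

/-- Evaluation time: one unit for each constant, register access, array access and operation. -/
def cost : RamExpr → ℕ
  | const _ => 1
  | reg _ => 1
  | get _ i => i.cost + 1
  | op _ e₁ e₂ => e₁.cost + e₂.cost + 1

end RamExpr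

inductive RamProg
  | skip
  | assign (x : ℕ) (e : RamExpr)
  | store (a : ℕ) (i e : RamExpr)
  | seq (p q : RamProg)
  | ite (e : RamExpr) (p q : RamProg)
  | while (e : RamExpr) (p : RamProg)

/-- `RamExec B p σ σ' t`: with word bound `B`, program `p` started in memory `σ` halts
in memory `σ'` after exactly `t` time units. A condition is true when its value is nonzero. -/
inductive RamExec (B : ℕ) : RamProg → RamState → RamState → ℕ → Prop
  | skip (σ : RamState) : RamExec B .skip σ σ 1
  | assign (σ : RamState) (x : ℕ) (e : RamExpr) (he : e.Fits B σ) :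
      RamExec B (.assign x e) σ (σ.setReg x (e.eval σ)) (e.cost + 1)
  | store (σ : RamState) (a : ℕ) (i e : RamExpr) (hi : i.Fits B σ) (he : e.Fits B σ) :
      RamExec B (.store a i e) σ (σ.setArr a (i.eval σ) (e.eval σ)) (i.cost + e.cost + 1)
  | seq {p q : RamProg} {σ σ₁ σ₂ : RamState} {s t : ℕ}
      (hp : RamExec B p σ σ₁ s) (hq : RamExec B q σ₁ σ₂ t) : RamExec B (.seq p q) σ σ₂ (s + t)
  | ite_true {e : RamExpr} {p q : RamProg} {σ σ' : RamState} {t : ℕ}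
      (he : e.Fits B σ) (hc : e.eval σ ≠ 0) (hp : RamExec B p σ σ' t) :
      RamExec B (.ite e p q) σ σ' (e.cost + 1 + t)
  | ite_false {e : RamExpr} {p q : RamProg} {σ σ' : RamState} {t : ℕ}
      (he : e.Fits B σ) (hc : e.eval σ = 0) (hq : RamExec B q σ σ' t) :
      RamExec B (.ite e p q) σ σ' (e.cost + 1 + t)
  | while_true {e : RamExpr} {p : RamProg} {σ σ₁ σ₂ : RamState} {s t : ℕ}
      (he : e.Fits B σ) (hc : e.eval σ ≠ 0) (hp : RamExec B p σ σ₁ s)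
      (hw : RamExec B (.while e p) σ₁ σ₂ t) : RamExec B (.while e p) σ σ₂ (e.cost + 1 + s + t)
  | while_false {e : RamExpr} {p : RamProg} {σ : RamState}
      (he : e.Fits B σ) (hc : e.eval σ = 0) : RamExec B (.while e p) σ σ (e.cost + 1)

/-- The initial memory: registers `0, 1, 2` hold `n`, `u`, `|E|`, and arrays `0` and `1` hold the
endpoints in `X` and in `Y` of the listed edges; everything else is `0`. -/
def coverInput {n u : ℕ} (es : List (Fin n × Fin u)) : RamState where
  reg x := if x = 0 then n else if x = 1 then u else if x = 2 then es.length else 0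
  arr a i :=
    if a = 0 then ((es.map fun e => (e.1 : ℕ)).getD i 0)
    else if a = 1 then ((es.map fun e => (e.2 : ℕ)).getD i 0)
    else 0

/-- The input size `|X| + |Y| + |E|`. -/
def BipartiteGraph.inputSize {n u : ℕ} (G : BipartiteGraph n u) : ℕ := n + u + G.edges.card

section

/-! ### Expressions with bounded sums -/

/-! Write `M₁` and `M₂` for the two bases in the time bound. Powers of `Δ_s Δ_f` whose exponent does
not depend on `k` are free. The point is therefore to cut an optimal cover into pieces that can be
enumerated with about `M₁` choices per set, and a rest that splits into three balanced groups of
candidates, with only about `M₂` candidates for each member.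

Kernel. For every set size it is enough to keep the first `k Δ_s Δ_f + 1` sets of that size: a
member of a solution beyond these can be exchanged for a kept set of the same size that is disjoint
from the rest of the solution (`Cover.exists_opt_earlier_le`). What remains has polynomially many
sets and elements in `Δ_s Δ_f` and is computed in linear time.

Overlapping sets. Let `S` be a part of an optimal cover `T`, and let `s` be the largest number of
elements that some set `z` has outside the union of `S`. If a member of `T` outside `S` has at most
`s / 2` new elements, then exchanging it for `z` gains nothing. Hence some further member of `T`
contains at least `s / (2 k)` of the new elements of `z`, and there are at most `2 k Δ_f` sets of
this kind. Such members are added to `S` until either `S` covers all that `T` covers or every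
remaining member has more than `s / 2` new elements (`Cover.exists_overlapPath`). Another exchange
then puts the remaining members among the first sets in the order by decreasing residual size
(`Cover.exists_opt_inK`). This leaves at most `k s Δ_f + 1` candidates; counting incidences gives at
most `2 u Δ_f / s` of them as well, and together this is `O(M₂)` (`Cover.Kernel.cand_le`).

Large `s`. If `s ^ 3 > u ^ 2`, or if `n` attains the minimum in `M₁`, there are at most `2 M₁` sets
of large residual size, so all remaining members can be found by exhaustive search
(`Cover.Kernel.large_le`). Otherwise `s ≤ M₁ ^ 2 / Δ_f ^ 2` (`Cover.Kernel.elem_le`). Then a pair of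
sets that share an uncovered element with each other and with a set already chosen after `S` costs
`k s` choices for the element and `Δ_f ^ 2` for the pair, which is `M₁` per set up to a constant.
Growing chains by such pairs as long as possible splits the remaining members so that no residual
element is common to three different chains. Two partial chains are enumerated, and the rest falls
into groups `A`, `B`, `C` of almost equal size without residual elements common to all three
(`Cover.exists_balanced`).

Triangles. For such groups the value is the base plus `p(A, B) + q(A, C) - r(B, C)`, where each term
depends on two groups only (`Cover.val_le`, `Cover.le_val`). The terms take few values. For each
value of `q` and of `r` a product of 0/1 matrices shows which pairs `(A, B)` have a common third
group, and for each value of `p` one such pair is enough (`Cover.hoare_coreP`).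

Products come from Kronecker powers of a fixed bilinear algorithm with exponent at most `ω + 1 / k`,
made integral and executed modulo a number above all true entries (`Cover.hoare_multP`). If `s'`
sets are enumerated and the largest group has `g` members then `s' + 3 g ≤ k + 2`. So the cost `M₁ ^
s' * M₂ ^ (g (ω + 1 / k))` is at most `M₁ ^ k + M₂ ^ (k ω / 3)` times a power of `Δ_s Δ_f`
independent of `k` (`Cover.mul_rpow_mul_pow_le`).

All this is carried out in a small language of bounded sums and loops with a verified translation to
the word RAM (`BExpr.compile_spec`, `Tri`). -/

/-- Register and array expressions extended by sums over an initial segment of `ℕ`. -/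
inductive BExpr
  | const (v : ℕ)
  | reg (x : ℕ)
  | get (a : ℕ) (i : BExpr)
  | op (o : RamOp) (e₁ e₂ : BExpr)
  | sum (x : ℕ) (b e : BExpr)

/-- All memory cells are at most `V`. -/
def RamState.Bdd (V : ℕ) (τ : RamState) : Prop := (∀ x, τ.reg x ≤ V) ∧ ∀ a i, τ.arr a i ≤ V

@[simp] lemma RamState.setReg_reg (τ : RamState) (x v y : ℕ) :
    (τ.setReg x v).reg y = if y = x then v else τ.reg y := by
  simp [RamState.setReg, Function.update_apply]

@[simp] lemma RamState.setReg_arr (τ : RamState) (x v : ℕ) : (τ.setReg x v).arr = τ.arr := rfl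

@[simp] lemma RamState.setArr_reg (τ : RamState) (a i v : ℕ) : (τ.setArr a i v).reg = τ.reg := rfl

@[simp] lemma RamState.setArr_arr (τ : RamState) (a i v b j : ℕ) :
    (τ.setArr a i v).arr b j = if b = a ∧ j = i then v else τ.arr b j := by
  unfold RamState.setArr
  by_cases hb : b = a
  · subst hb
    by_cases hj : j = i <;> simp [hj]
  · simp [hb]

lemma RamState.setArr_arr_ne (τ : RamState) {a b : ℕ} (i v : ℕ) (h : b ≠ a) :
    (τ.setArr a i v).arr b = τ.arr b := by
  funext j
  simp [h]

lemma RamState.ext' {σ τ : RamState} (h₁ : σ.reg = τ.reg) (h₂ : σ.arr = τ.arr) : σ = τ := by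
  cases σ; cases τ; simp_all

lemma RamState.Bdd.setReg {V : ℕ} {τ : RamState} (h : τ.Bdd V) (x : ℕ) {v : ℕ} (hv : v ≤ V) :
    (τ.setReg x v).Bdd V := by
  refine ⟨fun y => ?_, fun a i => h.2 a i⟩
  simp only [RamState.setReg_reg]
  split_ifs
  · exact hv
  · exact h.1 y

lemma RamState.Bdd.setArr {V : ℕ} {τ : RamState} (h : τ.Bdd V) (a i : ℕ) {v : ℕ} (hv : v ≤ V) :
    (τ.setArr a i v).Bdd V := by
  refine ⟨fun y => h.1 y, fun b j => ?_⟩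
  simp only [RamState.setArr_arr]
  split_ifs
  · exact hv
  · exact h.2 b j

namespace BExpr

def eval : BExpr → RamState → ℕ
  | const v, _ => v
  | reg x, τ => τ.reg x
  | get a i, τ => τ.arr a (i.eval τ)
  | op o e₁ e₂, τ => o.eval (e₁.eval τ) (e₂.eval τ)
  | sum x b e, τ => ∑ i ∈ Finset.range (b.eval τ), e.eval (τ.setReg x i)

/-- All ranges of summation have length at most `R`. -/
def SumsLE (R : ℕ) : BExpr → RamState → Prop
  | const _, _ => True
  | reg _, _ => True
  | get _ i, τ => i.SumsLE R τ
  | op _ e₁ e₂, τ => e₁.SumsLE R τ ∧ e₂.SumsLE R τ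
  | sum x b e, τ => b.SumsLE R τ ∧ b.eval τ ≤ R ∧ ∀ i < b.eval τ, e.SumsLE R (τ.setReg x i)

/-- A bound for the evaluation time if all sums have at most `R` terms. -/
def tb (R : ℕ) : BExpr → ℕ
  | const _ => 2
  | reg _ => 2
  | get _ i => i.tb R + 3
  | op _ e₁ e₂ => e₁.tb R + e₂.tb R + 4
  | sum _ b e => b.tb R + R * (e.tb R + 12) + 10

/-- Values are at most `V ^ deg` if all memory cells are at most `V`. -/
def deg : BExpr → ℕ
  | const v => v + 1
  | reg _ => 1
  | get _ i => i.deg + 1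
  | op _ e₁ e₂ => e₁.deg + e₂.deg
  | sum _ b e => b.deg + e.deg

/-- The nesting depth of sums. -/
def depth : BExpr → ℕ
  | const _ => 0
  | reg _ => 0
  | get _ i => i.depth
  | op _ e₁ e₂ => max e₁.depth e₂.depth
  | sum _ b e => max b.depth (e.depth + 1)

lemma one_le_deg (e : BExpr) : 1 ≤ e.deg := by
  induction e <;> simp only [deg] <;> omega

/-- Only addition and multiplication can exceed both operands. For addition, two numbers that are at
least `2` have a sum at most their product. -/
lemma _root_.RamOp.eval_le_pow {V a b x y : ℕ} (hV : 2 ≤ V) (o : RamOp) (ha : 1 ≤ a) (hb : 1 ≤ b)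
    (hx : x ≤ V ^ a) (hy : y ≤ V ^ b) : o.eval x y ≤ V ^ (a + b) := by
  have h1 : V ^ a * V ^ b = V ^ (a + b) := (pow_add V a b).symm
  have h2 : 2 ≤ V ^ a := hV.trans (Nat.le_self_pow (by omega) V)
  have h3 : 2 ≤ V ^ b := hV.trans (Nat.le_self_pow (by omega) V)
  have h4 : V ^ a ≤ V ^ (a + b) := by rw [← h1]; nlinarith
  have h6 : 1 ≤ V ^ (a + b) := by omega
  cases o with
  | add => simp only [RamOp.eval]; rw [← h1]; nlinarith
  | sub => simp only [RamOp.eval]; omega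
  | mul => simp only [RamOp.eval]; rw [← h1]; exact Nat.mul_le_mul hx hy
  | div => simp only [RamOp.eval]; exact (Nat.div_le_self _ _).trans (hx.trans h4)
  | mod => simp only [RamOp.eval]; exact (Nat.mod_le _ _).trans (hx.trans h4)
  | lt => simp only [RamOp.eval]; split_ifs <;> omega
  | eq => simp only [RamOp.eval]; split_ifs <;> omega

/-- Degrees add because operations and sums at most multiply the bounds of their parts. A constant
`v` satisfies `v ≤ 2 ^ v ≤ V ^ v`; the extra one in its degree keeps all degrees positive. -/
lemma eval_le {V R : ℕ} (hV : 2 ≤ V) (hR : R ≤ V) (e : BExpr) :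
    ∀ τ : RamState, τ.Bdd V → e.SumsLE R τ → e.eval τ ≤ V ^ e.deg := by
  induction e with
  | const v =>
    intro τ _ _
    simp only [eval, deg]
    exact (Nat.lt_two_pow_self (n := v)).le.trans ((Nat.pow_le_pow_left hV v).trans
      (Nat.pow_le_pow_right (by omega) (by omega)))
  | reg x => intro τ h _; simpa [eval, deg] using h.1 x
  | get a i ih =>
    intro τ h _
    simp only [eval, deg]
    exact (h.2 _ _).trans (Nat.le_self_pow (by omega) V)
  | op o e₁ e₂ ih₁ ih₂ =>
    intro τ h hs
    exact RamOp.eval_le_pow hV o (one_le_deg _) (one_le_deg _) (ih₁ τ h hs.1) (ih₂ τ h hs.2)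
  | sum x b e ih₁ ih₂ =>
    intro τ h hs
    simp only [eval, deg]
    calc _ ≤ ∑ i ∈ Finset.range (b.eval τ), V ^ e.deg := by
          apply Finset.sum_le_sum
          intro i hi
          have hi := Finset.mem_range.1 hi
          exact ih₂ _ (h.setReg _ (by have := hs.2.1; omega)) (hs.2.2 i hi)
      _ = b.eval τ * V ^ e.deg := by simp
      _ ≤ _ := by rw [pow_add]; exact Nat.mul_le_mul_right _ (ih₁ τ h hs.1)

end BExpr

/-! ### Compilation to the word RAM -/

/-- The `d`-th auxiliary register. -/
def scr (d : ℕ) : ℕ := 2 * d + 5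

/-- The register that holds program variable `y`. -/
def varReg (y : ℕ) : ℕ := if y < 3 then y else 2 * y

/-- Auxiliary registers are the odd numbers from `5` on. Variables occupy `0, 1, 2`, where the input
is found, and the even numbers from `6` on. -/
lemma varReg_ne_scr (y d : ℕ) : varReg y ≠ scr d := by
  unfold varReg scr; split_ifs <;> omega

lemma varReg_injective : Function.Injective varReg := by
  intro a b h
  unfold varReg at h; split_ifs at h <;> omega

lemma scr_inj {a b : ℕ} : scr a = scr b ↔ a = b := by unfold scr; omega

/-- Code that leaves the value of an expression in auxiliary register `d` and changes only auxiliary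
registers from `d` on. -/
def BExpr.compile : (ℕ → ℕ) → ℕ → BExpr → RamProg
  | _, d, .const v => .assign (scr d) (.const v)
  | ρ, d, .reg x => .assign (scr d) (.reg (ρ x))
  | ρ, d, .get a i => .seq (i.compile ρ d) (.assign (scr d) (.get a (.reg (scr d))))
  | ρ, d, .op o e₁ e₂ => .seq (e₁.compile ρ d) (.seq (e₂.compile ρ (d + 1))
      (.assign (scr d) (.op o (.reg (scr d)) (.reg (scr (d + 1))))))
  | ρ, d, .sum x b e => .seq (b.compile ρ d) (.seq (.assign (scr (d + 1)) (.const 0))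
      (.seq (.assign (scr (d + 2)) (.const 0))
      (.seq (.while (.op .lt (.reg (scr (d + 2))) (.reg (scr d)))
        (.seq (e.compile (Function.update ρ x (scr (d + 2))) (d + 3))
        (.seq (.assign (scr (d + 1)) (.op .add (.reg (scr (d + 1))) (.reg (scr (d + 3)))))
          (.assign (scr (d + 2)) (.op .add (.reg (scr (d + 2))) (.const 1))))))
      (.assign (scr d) (.reg (scr (d + 1)))))))

/-- A counting loop whose body increments the counter. -/
lemma RamExec.count_loop {B c h n : ℕ} {body : RamProg} (J : ℕ → RamState → Prop) (t : ℕ → ℕ)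
    (hJ : ∀ i σ, J i σ → σ.reg c = i ∧ σ.reg h = n) (hn : n < B)
    (step : ∀ i < n, ∀ σ, J i σ → ∃ σ' s, RamExec B body σ σ' s ∧ s ≤ t i ∧ J (i + 1) σ')
    (σ : RamState) (h0 : J 0 σ) :
    ∃ σ' s, RamExec B (.while (.op .lt (.reg c) (.reg h)) body) σ σ' s ∧
      s ≤ (∑ i ∈ Finset.range n, (t i + 4)) + 4 ∧ J n σ' := by
  have key : ∀ m i, i + m = n → ∀ σ, J i σ →
      ∃ σ' s, RamExec B (.while (.op .lt (.reg c) (.reg h)) body) σ σ' s ∧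
      s ≤ (∑ j ∈ Finset.range m, (t (i + j) + 4)) + 4 ∧ J n σ' := by
    intro m
    induction m with
    | zero =>
      intro i hi σ hσ
      obtain ⟨h1, h2⟩ := hJ i σ hσ
      have hi : i = n := by omega
      subst hi
      refine ⟨σ, _, RamExec.while_false ?_ ?_, ?_, hσ⟩
      · simp [RamExpr.Fits, RamOp.eval, RamExpr.eval, h1, h2]; omega
      · simp [RamExpr.eval, RamOp.eval, h1, h2]
      · simp [RamExpr.cost]
    | succ m ih =>
      intro i hi σ hσ
      obtain ⟨h1, h2⟩ := hJ i σ hσ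
      obtain ⟨σ₁, s₁, e₁, l₁, j₁⟩ := step i (by omega) σ hσ
      obtain ⟨σ₂, s₂, e₂, l₂, j₂⟩ := ih (i + 1) (by omega) σ₁ j₁
      have hin : i < n := by omega
      refine ⟨σ₂, _, RamExec.while_true ?_ ?_ e₁ e₂, ?_, j₂⟩
      · simp [RamExpr.Fits, RamOp.eval, RamExpr.eval, h1, h2, hin]; omega
      · simp [RamExpr.eval, RamOp.eval, h1, h2, hin]
      · rw [Finset.sum_range_succ']
        simp only [RamExpr.cost, add_zero]
        have : ∑ j ∈ Finset.range m, (t (i + (j + 1)) + 4) =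
            ∑ j ∈ Finset.range m, (t (i + 1 + j) + 4) := by
          apply Finset.sum_congr rfl; intro j _; congr 2; ring
        omega
  simpa using key n 0 (by omega) σ h0

/-- Two memories are needed: `σ` is the actual one and `τ` the one in which the expression has its
meaning. They differ in the summation variables of enclosing sums, whose current values live in
auxiliary registers below `d`; `ρ` records where each variable is kept. -/
lemma BExpr.compile_spec {V R : ℕ} (hV : 2 ≤ V) (hR : R ≤ V) (e : BExpr) :
    ∀ (B d : ℕ) (ρ : ℕ → ℕ) (σ τ : RamState), V ^ e.deg < B → τ.Bdd V → e.SumsLE R τ →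
      (∀ y, τ.reg y = σ.reg (ρ y)) → τ.arr = σ.arr → (∀ y j, d ≤ j → ρ y ≠ scr j) →
      ∃ σ' t, RamExec B (e.compile ρ d) σ σ' t ∧ t ≤ e.tb R ∧ σ'.reg (scr d) = e.eval τ ∧
        σ'.arr = σ.arr ∧ ∀ z, (∀ j, d ≤ j → z ≠ scr j) → σ'.reg z = σ.reg z := by
  induction e with
  | const v =>
    intro B d ρ σ τ hB hb hs hr ha hρ
    have hv := BExpr.eval_le hV hR _ τ hb hs
    refine ⟨_, _, RamExec.assign σ _ _ (?_ : v < B), ?_, ?_, rfl, fun z hz => ?_⟩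
    · exact lt_of_le_of_lt hv hB
    · simp [RamExpr.cost, tb]
    · simp [RamExpr.eval, BExpr.eval]
    · simp [hz d le_rfl]
  | reg x =>
    intro B d ρ σ τ hB hb hs hr ha hρ
    have hv := BExpr.eval_le hV hR _ τ hb hs
    refine ⟨_, _, RamExec.assign σ _ _ (?_ : σ.reg (ρ x) < B), ?_, ?_, rfl, fun z hz => ?_⟩
    · rw [← hr]; exact lt_of_le_of_lt hv hB
    · simp [RamExpr.cost, tb]
    · simp [RamExpr.eval, BExpr.eval, hr]
    · simp [hz d le_rfl]
  | get a i ih =>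
    intro B d ρ σ τ hB hb hs hr ha hρ
    have hv := BExpr.eval_le hV hR _ τ hb hs
    have hB' : V ^ i.deg < B := lt_of_le_of_lt (Nat.pow_le_pow_right (by omega)
      (by simp only [deg]; omega)) hB
    obtain ⟨σ₁, t₁, e₁, l₁, r₁, a₁, f₁⟩ := ih B d ρ σ τ hB' hb hs hr ha hρ
    have hi := BExpr.eval_le hV hR i τ hb hs
    refine ⟨_, _, RamExec.seq e₁ (RamExec.assign σ₁ _ _ ?_), ?_, ?_, a₁, fun z hz => ?_⟩
    · simp only [RamExpr.Fits, RamExpr.eval, r₁, a₁, ← ha]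
      exact ⟨lt_of_le_of_lt hi hB', lt_of_le_of_lt hv hB⟩
    · simp only [RamExpr.cost, tb]; omega
    · simp [RamExpr.eval, BExpr.eval, r₁, a₁, ha]
    · simp [hz d le_rfl, f₁ z hz]
  | op o e₁ e₂ ih₁ ih₂ =>
    intro B d ρ σ τ hB hb hs hr ha hρ
    have hv := BExpr.eval_le hV hR _ τ hb hs
    have hB₁ : V ^ e₁.deg < B := lt_of_le_of_lt (Nat.pow_le_pow_right (by omega)
      (by simp only [deg]; omega)) hB
    have hB₂ : V ^ e₂.deg < B := lt_of_le_of_lt (Nat.pow_le_pow_right (by omega)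
      (by simp only [deg]; omega)) hB
    obtain ⟨σ₁, t₁, x₁, l₁, r₁, a₁, f₁⟩ := ih₁ B d ρ σ τ hB₁ hb hs.1 hr ha hρ
    obtain ⟨σ₂, t₂, x₂, l₂, r₂, a₂, f₂⟩ := ih₂ B (d + 1) ρ σ₁ τ hB₂ hb hs.2
      (fun y => by rw [f₁ _ (fun j hj => hρ y j hj), hr]) (by rw [a₁, ha])
      (fun y j hj => hρ y j (by omega))
    have h1 := BExpr.eval_le hV hR _ τ hb hs.1
    have h2 := BExpr.eval_le hV hR _ τ hb hs.2
    have r₁' : σ₂.reg (scr d) = e₁.eval τ := by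
      rw [f₂ _ (fun j hj => by rw [ne_eq, scr_inj]; omega), r₁]
    refine ⟨_, _, RamExec.seq x₁ (RamExec.seq x₂ (RamExec.assign σ₂ _ _ ?_)), ?_, ?_,
      a₂.trans a₁, fun z hz => ?_⟩
    · simp only [RamExpr.Fits, RamExpr.eval, r₁', r₂]
      exact ⟨lt_of_le_of_lt h1 hB₁, lt_of_le_of_lt h2 hB₂, lt_of_le_of_lt hv hB⟩
    · simp only [RamExpr.cost, tb]; omega
    · simp [RamExpr.eval, BExpr.eval, r₁', r₂]
    · simp [hz d le_rfl, f₂ z (fun j hj => hz j (by omega)), f₁ z hz]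
  | sum x b e ih₁ ih₂ =>
    intro B d ρ σ τ hB hb hs hr ha hρ
    have hv := BExpr.eval_le hV hR _ τ hb hs
    have hB₁ : V ^ b.deg < B := lt_of_le_of_lt (Nat.pow_le_pow_right (by omega)
      (by simp only [deg]; omega)) hB
    have hB₂ : V ^ e.deg < B := lt_of_le_of_lt (Nat.pow_le_pow_right (by omega)
      (by simp only [deg]; omega)) hB
    have hVB : V < B := lt_of_le_of_lt (Nat.le_self_pow (by have := one_le_deg e; omega) V) hB₂
    obtain ⟨σ₁, t₁, x₁, l₁, r₁, a₁, f₁⟩ := ih₁ B d ρ σ τ hB₁ hb hs.1 hr ha hρ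
    have hbR := hs.2.1
    set n := b.eval τ with hn
    set S : ℕ → ℕ := fun m => ∑ i ∈ Finset.range m, e.eval (τ.setReg x i) with hS
    -- Partial sums are increasing, so the bound for the final value keeps the accumulator within
    -- the word length throughout.
    have hSle : ∀ m ≤ n, S m < B := by
      intro m hm
      refine lt_of_le_of_lt ?_ (lt_of_le_of_lt hv hB)
      simp only [BExpr.eval, hS]
      exact Finset.sum_le_sum_of_subset (Finset.range_mono hm)
    let J : ℕ → RamState → Prop := fun i ς => ς.reg (scr d) = n ∧ ς.reg (scr (d + 1)) = S i ∧
      ς.reg (scr (d + 2)) = i ∧ ς.arr = σ.arr ∧ ∀ z, (∀ j, d ≤ j → z ≠ scr j) → ς.reg z = σ.reg z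
    obtain ⟨σ₂, t₂, x₂, l₂, j₂⟩ := RamExec.count_loop (B := B) (c := scr (d + 2)) (h := scr d)
      (n := n) (body := (.seq (e.compile (Function.update ρ x (scr (d + 2))) (d + 3))
        (.seq (.assign (scr (d + 1)) (.op .add (.reg (scr (d + 1))) (.reg (scr (d + 3)))))
          (.assign (scr (d + 2)) (.op .add (.reg (scr (d + 2))) (.const 1))))))
      J (fun _ => e.tb R + 8) (fun i ς h => ⟨h.2.2.1, h.1⟩) (by omega) (by
        intro i hi ς hς
        obtain ⟨g1, g2, g3, g4, g5⟩ := hς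
        obtain ⟨σ₃, t₃, x₃, l₃, r₃, a₃, f₃⟩ := ih₂ B (d + 3) (Function.update ρ x (scr (d + 2))) ς
          (τ.setReg x i) hB₂ (hb.setReg _ (by omega)) (hs.2.2 i hi)
          (by
            intro y
            by_cases hy : y = x
            · simp [hy, g3]
            · simp [hy, g5 _ (fun j hj => hρ y j hj), hr])
          (by simp [g4, ha])
          (by
            intro y j hj
            by_cases hy : y = x
            · simp only [hy, Function.update_self, ne_eq, scr_inj]; omega
            · simp only [ne_eq, hy, not_false_eq_true, Function.update_of_ne]
              exact hρ y j (by omega))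
        have hSi := hSle i hi.le
        have hSi1 := hSle (i + 1) hi
        have hee : e.eval (τ.setReg x i) < B :=
          lt_of_le_of_lt (BExpr.eval_le hV hR _ _ (hb.setReg _ (by omega)) (hs.2.2 i hi)) hB₂
        have k1 : σ₃.reg (scr (d + 1)) = S i := by
          rw [f₃ _ (fun j hj => by rw [ne_eq, scr_inj]; omega), g2]
        have k2 : σ₃.reg (scr (d + 2)) = i := by
          rw [f₃ _ (fun j hj => by rw [ne_eq, scr_inj]; omega), g3]
        have k0 : σ₃.reg (scr d) = n := by
          rw [f₃ _ (fun j hj => by rw [ne_eq, scr_inj]; omega), g1]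
        have hSs : S i + e.eval (τ.setReg x i) = S (i + 1) := by
          simp only [hS, Finset.sum_range_succ]
        refine ⟨_, _, RamExec.seq x₃ (RamExec.seq (RamExec.assign _ _ _ ?_)
          (RamExec.assign _ _ _ ?_)), ?_, ?_⟩
        · simp only [RamExpr.Fits, RamExpr.eval, k1, r₃, RamOp.eval]
          exact ⟨hSi, hee, by omega⟩
        · simp [RamExpr.Fits, RamExpr.eval, k2, RamOp.eval, scr_inj]
          omega
        · simp only [RamExpr.cost]; omega
        · refine ⟨?_, ?_, ?_, ?_, ?_⟩
          · simp [scr_inj, k0]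
          · simp [scr_inj, RamExpr.eval, RamOp.eval, k1, r₃, hSs]
          · simp [scr_inj, RamExpr.eval, RamOp.eval, k2]
          · simp [a₃, g4]
          · intro z hz
            simp [hz (d + 1) (by omega), hz (d + 2) (by omega),
              f₃ z (fun j hj => hz j (by omega)), g5 z hz])
      ((σ₁.setReg (scr (d + 1)) 0).setReg (scr (d + 2)) 0)
      (by
        refine ⟨?_, ?_, ?_, ?_, ?_⟩
        · simp [scr_inj, r₁]
        · simp [scr_inj, hS]
        · simp
        · simp [a₁]
        · intro z hz
          simp [hz (d + 1) (by omega), hz (d + 2) (by omega), f₁ z hz])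
    obtain ⟨g1, g2, g3, g4, g5⟩ := j₂
    refine ⟨_, _, RamExec.seq x₁ (RamExec.seq (RamExec.assign _ _ _ ?_)
      (RamExec.seq (RamExec.assign _ _ _ ?_) (RamExec.seq x₂ (RamExec.assign _ _ _ ?_)))),
      ?_, ?_, ?_, ?_⟩
    · show 0 < B
      omega
    · show 0 < B
      omega
    · show σ₂.reg _ < B
      rw [g2]; exact hSle n le_rfl
    · simp only [RamExpr.cost, tb]
      simp only [Finset.sum_const, Finset.card_range, smul_eq_mul] at l₂
      have : n * (e.tb R + 8 + 4) ≤ R * (e.tb R + 12) := Nat.mul_le_mul_right _ hbR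
      omega
    · simp [RamExpr.eval, g2, BExpr.eval, hS, hn]
    · simp [g4]
    · intro z hz
      simp [hz d le_rfl, g5 z hz]

/-! ### Structured programs -/

/-- There is no unbounded iteration: a loop evaluates its bound once and counts in an auxiliary
register that its body cannot reach. Termination and a time bound can thus be read off the text. -/
inductive BProg
  | skip
  | assign (x : ℕ) (e : BExpr)
  | store (a : ℕ) (i e : BExpr)
  | seq (p q : BProg)
  | ite (e : BExpr) (p q : BProg)
  | loop (x : ℕ) (b : BExpr) (p : BProg)

namespace BProg

def compile : ℕ → BProg → RamProg
  | _, skip => .skip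
  | d, assign x e => .seq (e.compile varReg d) (.assign (varReg x) (.reg (scr d)))
  | d, store a i e => .seq (i.compile varReg d) (.seq (e.compile varReg (d + 1))
      (.store a (.reg (scr d)) (.reg (scr (d + 1)))))
  | d, seq p q => .seq (p.compile d) (q.compile d)
  | d, ite e p q => .seq (e.compile varReg d) (.ite (.reg (scr d)) (p.compile d) (q.compile d))
  | d, loop x b p => .seq (b.compile varReg d) (.seq (.assign (scr (d + 1)) (.const 0))
      (.while (.op .lt (.reg (scr (d + 1))) (.reg (scr d)))
        (.seq (.assign (varReg x) (.reg (scr (d + 1)))) (.seq (p.compile (d + 2))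
          (.assign (scr (d + 1)) (.op .add (.reg (scr (d + 1))) (.const 1)))))))

/-- A maximum, not a sum: after every assignment and store the cells are at most `V` again, so
intermediate values never compound along a program. -/
def deg : BProg → ℕ
  | skip => 1
  | assign _ e => e.deg
  | store _ i e => max i.deg e.deg
  | seq p q => max p.deg q.deg
  | ite e p q => max e.deg (max p.deg q.deg)
  | loop _ b p => max b.deg p.deg

/-- The variables that a program may change. -/
def wr : BProg → List ℕ
  | skip => []
  | assign x _ => [x]
  | store _ _ _ => []
  | seq p q => p.wr ++ q.wr
  | ite _ p q => p.wr ++ q.wr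
  | loop x _ p => x :: p.wr

/-- The arrays that a program may change. -/
def wa : BProg → List ℕ
  | skip => []
  | assign _ _ => []
  | store a _ _ => [a]
  | seq p q => p.wa ++ q.wa
  | ite _ p q => p.wa ++ q.wa
  | loop _ _ p => p.wa

end BProg

/-- The values of the program variables and arrays. -/
def RamState.vars (σ : RamState) : RamState := ⟨fun y => σ.reg (varReg y), σ.arr⟩

@[simp] lemma RamState.vars_reg (σ : RamState) (y : ℕ) : σ.vars.reg y = σ.reg (varReg y) := rfl

@[simp] lemma RamState.vars_arr (σ : RamState) : σ.vars.arr = σ.arr := rfl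

lemma RamState.vars_setReg (σ : RamState) (x v : ℕ) :
    (σ.setReg (varReg x) v).vars = σ.vars.setReg x v := by
  apply RamState.ext'
  · funext y
    simp [varReg_injective.eq_iff]
  · rfl

lemma RamState.vars_setReg_scr (σ : RamState) (d v : ℕ) :
    (σ.setReg (scr d) v).vars = σ.vars := by
  apply RamState.ext'
  · funext y
    simp [varReg_ne_scr]
  · rfl

lemma RamState.vars_setArr (σ : RamState) (a i v : ℕ) :
    (σ.setArr a i v).vars = σ.vars.setArr a i v := rfl

/-- Total correctness: started in `τ`, where all cells are at most `V`, the program ends within time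
`T` in a state that satisfies `Q`, with all cells at most `V` again. -/
def Tri (V : ℕ) (p : BProg) (τ : RamState) (T : ℕ) (Q : RamState → Prop) : Prop :=
  2 ≤ V → τ.Bdd V → ∀ M, p.deg ≤ M → ∀ d σ, σ.vars = τ →
    ∃ σ' t, RamExec (V ^ (M + 1)) (p.compile d) σ σ' t ∧ t ≤ T ∧ Q σ'.vars ∧ σ'.vars.Bdd V ∧
      ∀ i < d, σ'.reg (scr i) = σ.reg (scr i)

namespace Tri

variable {V R T T' : ℕ} {τ : RamState} {Q Q' : RamState → Prop} {p q : BProg} {e : BExpr}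

lemma expr (hV : 2 ≤ V) (hb : τ.Bdd V) (hs : e.SumsLE R τ) (hR : R ≤ V) {M d : ℕ}
    (hM : e.deg ≤ M) {σ : RamState} (hσ : σ.vars = τ) :
    ∃ σ' t, RamExec (V ^ (M + 1)) (e.compile varReg d) σ σ' t ∧ t ≤ e.tb R ∧
      σ'.reg (scr d) = e.eval τ ∧ σ'.vars = τ ∧ e.eval τ < V ^ (M + 1) ∧
        ∀ i < d, σ'.reg (scr i) = σ.reg (scr i) := by
  subst hσ
  have hB : V ^ e.deg < V ^ (M + 1) := Nat.pow_lt_pow_right (by omega) (by omega)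
  obtain ⟨σ', t, h1, h2, h3, h4, h5⟩ := e.compile_spec hV hR (V ^ (M + 1)) d varReg σ σ.vars hB
    hb hs (fun y => rfl) rfl (fun y j _ => varReg_ne_scr y j)
  refine ⟨σ', t, h1, h2, h3, RamState.ext' (funext fun y => ?_) h4, ?_, fun i hi => ?_⟩
  · exact h5 _ (fun j _ => varReg_ne_scr y j)
  · exact lt_of_le_of_lt (e.eval_le hV hR _ hb hs) hB
  · exact h5 _ (fun j hj => by rw [ne_eq, scr_inj]; omega)

lemma mono (h : Tri V p τ T Q) (hT : T ≤ T') (hQ : ∀ τ', Q τ' → Q' τ') : Tri V p τ T' Q' := by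
  intro hV hb M hM d σ hσ
  obtain ⟨σ', t, h1, h2, h3, h4, h5⟩ := h hV hb M hM d σ hσ
  exact ⟨σ', t, h1, h2.trans hT, hQ _ h3, h4, h5⟩

lemma skip (hT : 1 ≤ T) (hQ : Q τ) : Tri V .skip τ T Q := by
  intro hV hb M hM d σ hσ
  subst hσ
  exact ⟨σ, 1, RamExec.skip σ, hT, hQ, hb, fun _ _ => rfl⟩

lemma assign {x : ℕ} (R : ℕ) (hs : e.SumsLE R τ) (hR : R ≤ V) (hv : τ.Bdd V → e.eval τ ≤ V)
    (hT : e.tb R + 2 ≤ T) (hQ : Q (τ.setReg x (e.eval τ))) : Tri V (.assign x e) τ T Q := by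
  intro hV hb M hM d σ hσ
  obtain ⟨σ₁, t₁, h1, h2, h3, h4, h5, h6⟩ := expr hV hb hs hR (d := d) hM hσ
  refine ⟨_, _, RamExec.seq h1 (RamExec.assign σ₁ _ _ (?_ : σ₁.reg _ < _)), ?_, ?_, ?_, ?_⟩
  · rw [h3]; exact h5
  · simp only [RamExpr.cost]; omega
  · rw [RamState.vars_setReg, h4]
    simpa [RamExpr.eval, h3] using hQ
  · rw [RamState.vars_setReg, h4]
    simpa [RamExpr.eval, h3] using hb.setReg x (hv hb)
  · intro i hi
    simp [(varReg_ne_scr x i).symm, h6 i hi]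

lemma store {a : ℕ} {i : BExpr} (R : ℕ) (hi : i.SumsLE R τ) (hs : e.SumsLE R τ) (hR : R ≤ V)
    (hv : τ.Bdd V → e.eval τ ≤ V) (hT : i.tb R + e.tb R + 3 ≤ T)
    (hQ : Q (τ.setArr a (i.eval τ) (e.eval τ))) : Tri V (.store a i e) τ T Q := by
  intro hV hb M hM d σ hσ
  simp only [BProg.deg, max_le_iff] at hM
  obtain ⟨σ₁, t₁, h1, h2, h3, h4, h5, h6⟩ := expr hV hb hi hR (d := d) hM.1 hσ
  obtain ⟨σ₂, t₂, g1, g2, g3, g4, g5, g6⟩ := expr hV hb hs hR (d := d + 1) hM.2 h4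
  have h3' : σ₂.reg (scr d) = i.eval τ := by rw [g6 d (by omega), h3]
  refine ⟨_, _, RamExec.seq h1 (RamExec.seq g1 (RamExec.store σ₂ _ _ _ (?_ : σ₂.reg _ < _)
    (?_ : σ₂.reg _ < _))), ?_, ?_, ?_, ?_⟩
  · rw [h3']; exact h5
  · rw [g3]; exact g5
  · simp only [RamExpr.cost]; omega
  · rw [RamState.vars_setArr, g4]
    simpa [RamExpr.eval, h3', g3] using hQ
  · rw [RamState.vars_setArr, g4]
    simpa [RamExpr.eval, h3', g3] using hb.setArr a _ (hv hb)
  · intro j hj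
    simp [g6 j (by omega), h6 j hj]

lemma seq {T₁ T₂ : ℕ} (h : Tri V p τ T₁ (fun τ' => Tri V q τ' T₂ Q)) (hT : T₁ + T₂ ≤ T) :
    Tri V (.seq p q) τ T Q := by
  intro hV hb M hM d σ hσ
  simp only [BProg.deg, max_le_iff] at hM
  obtain ⟨σ₁, t₁, h1, h2, h3, h4, h5⟩ := h hV hb M hM.1 d σ hσ
  obtain ⟨σ₂, t₂, g1, g2, g3, g4, g5⟩ := h3 hV h4 M hM.2 d σ₁ rfl
  exact ⟨σ₂, _, RamExec.seq h1 g1, by omega, g3, g4, fun i hi => by rw [g5 i hi, h5 i hi]⟩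

lemma ite {T₁ : ℕ} (R : ℕ) (hs : e.SumsLE R τ) (hR : R ≤ V)
    (hp : e.eval τ ≠ 0 → Tri V p τ T₁ Q) (hq : e.eval τ = 0 → Tri V q τ T₁ Q)
    (hT : e.tb R + T₁ + 2 ≤ T) : Tri V (.ite e p q) τ T Q := by
  intro hV hb M hM d σ hσ
  simp only [BProg.deg, max_le_iff] at hM
  obtain ⟨σ₁, t₁, h1, h2, h3, h4, h5, h6⟩ := expr hV hb hs hR (d := d) hM.1 hσ
  by_cases h0 : e.eval τ = 0
  · obtain ⟨σ₂, t₂, g1, g2, g3, g4, g5⟩ := hq h0 hV hb M hM.2.2 d σ₁ h4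
    refine ⟨σ₂, _, RamExec.seq h1 (RamExec.ite_false (?_ : σ₁.reg _ < _) ?_ g1), ?_, g3, g4, ?_⟩
    · rw [h3]; exact h5
    · simp [RamExpr.eval, h3, h0]
    · simp only [RamExpr.cost]; omega
    · intro i hi; rw [g5 i hi, h6 i hi]
  · obtain ⟨σ₂, t₂, g1, g2, g3, g4, g5⟩ := hp h0 hV hb M hM.2.1 d σ₁ h4
    refine ⟨σ₂, _, RamExec.seq h1 (RamExec.ite_true (?_ : σ₁.reg _ < _) ?_ g1), ?_, g3, g4, ?_⟩
    · rw [h3]; exact h5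
    · simp [RamExpr.eval, h3, h0]
    · simp only [RamExpr.cost]; omega
    · intro i hi; rw [g5 i hi, h6 i hi]

/-- The time of a round may depend on the round. In an enumeration most rounds only perform a
failing test, and the few expensive ones have to be counted separately. -/
lemma loop {x : ℕ} {b : BExpr} (R : ℕ) (I : ℕ → RamState → Prop) (t : ℕ → ℕ)
    (hs : b.SumsLE R τ) (hR : R ≤ V) (hn : b.eval τ ≤ V) (h0 : I 0 τ)
    (step : ∀ i < b.eval τ, ∀ τ', I i τ' → Tri V p (τ'.setReg x i) (t i) (I (i + 1)))
    (hQ : ∀ τ', I (b.eval τ) τ' → Q τ')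
    (hT : b.tb R + (∑ i ∈ Finset.range (b.eval τ), (t i + 10)) + 6 ≤ T) :
    Tri V (.loop x b p) τ T Q := by
  intro hV hb M hM d σ hσ
  simp only [BProg.deg, max_le_iff] at hM
  obtain ⟨σ₁, t₁, h1, h2, h3, h4, h5, h6⟩ := expr hV hb hs hR (d := d) hM.1 hσ
  set n := b.eval τ with hn'
  have hVM : V < V ^ (M + 1) := by
    have := BExpr.one_le_deg b
    calc V = V ^ 1 := (pow_one V).symm
      _ < _ := Nat.pow_lt_pow_right (by omega) (by omega)
  let J : ℕ → RamState → Prop := fun i ς => ς.reg (scr d) = n ∧ ς.reg (scr (d + 1)) = i ∧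
    I i ς.vars ∧ ς.vars.Bdd V ∧ ∀ j < d, ς.reg (scr j) = σ.reg (scr j)
  obtain ⟨σ₂, t₂, x₂, l₂, j₂⟩ := RamExec.count_loop (B := V ^ (M + 1)) (c := scr (d + 1))
    (h := scr d) (n := n) (body := (.seq (.assign (varReg x) (.reg (scr (d + 1))))
      (.seq (p.compile (d + 2))
        (.assign (scr (d + 1)) (.op .add (.reg (scr (d + 1))) (.const 1))))))
    J (fun i => t i + 6) (fun i ς h => ⟨h.2.1, h.1⟩) h5 (by
      intro i hi ς hς
      obtain ⟨g1, g2, g3, g4, g5⟩ := hς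
      have hv : (ς.setReg (varReg x) i).vars = ς.vars.setReg x i := RamState.vars_setReg _ _ _
      obtain ⟨σ₃, t₃, k1, k2, k3, k4, k5⟩ := step i hi _ g3 hV (g4.setReg x (by omega)) M hM.2
        (d + 2) _ hv
      refine ⟨_, _, RamExec.seq (RamExec.assign ς _ _ (?_ : ς.reg _ < _))
        (RamExec.seq (σ₁ := σ₃) (s := t₃) ?_ (RamExec.assign _ _ _ ?_)), ?_, ?_⟩
      · rw [g2]; omega
      · simpa [RamExpr.eval, g2] using k1
      · simp only [RamExpr.Fits, RamExpr.eval, RamOp.eval, k5 (d + 1) (by omega)]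
        simp [(varReg_ne_scr x _).symm, g2]
        omega
      · simp only [RamExpr.cost]; omega
      · refine ⟨?_, ?_, ?_, ?_, ?_⟩
        · simp [scr_inj, k5 d (by omega), (varReg_ne_scr x _).symm, g1]
        · simp [RamExpr.eval, RamOp.eval, k5 (d + 1) (by omega), (varReg_ne_scr x _).symm, g2]
        · rw [RamState.vars_setReg_scr]; exact k3
        · rw [RamState.vars_setReg_scr]; exact k4
        · intro j hj
          have : j ≠ d + 1 := by omega
          simp [scr_inj, this, k5 j (by omega), (varReg_ne_scr x _).symm, g5 j hj])
    (σ₁.setReg (scr (d + 1)) 0)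
    (by
      refine ⟨?_, ?_, ?_, ?_, ?_⟩
      · simp [scr_inj, h3]
      · simp
      · rw [RamState.vars_setReg_scr, h4]; exact h0
      · rw [RamState.vars_setReg_scr, h4]; exact hb
      · intro j hj
        have : j ≠ d + 1 := by omega
        simp [scr_inj, this, h6 j hj])
  obtain ⟨g1, g2, g3, g4, g5⟩ := j₂
  refine ⟨_, _, RamExec.seq h1 (RamExec.seq (RamExec.assign _ _ _ (?_ : 0 < _)) x₂), ?_,
    hQ _ g3, g4, g5⟩
  · omega
  · simp only [RamExpr.cost]
    have : ∑ i ∈ Finset.range n, (t i + 6 + 4) = ∑ i ∈ Finset.range n, (t i + 10) := rfl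
    omega

end Tri

/-! ### What a program leaves unchanged -/

def RamProg.wr : RamProg → Set ℕ
  | .skip => ∅
  | .assign x _ => {x}
  | .store _ _ _ => ∅
  | .seq p q => p.wr ∪ q.wr
  | .ite _ p q => p.wr ∪ q.wr
  | .while _ p => p.wr

def RamProg.wa : RamProg → Set ℕ
  | .skip => ∅
  | .assign _ _ => ∅
  | .store a _ _ => {a}
  | .seq p q => p.wa ∪ q.wa
  | .ite _ p q => p.wa ∪ q.wa
  | .while _ p => p.wa

lemma RamExec.frame {B : ℕ} {p : RamProg} {σ σ' : RamState} {t : ℕ} (h : RamExec B p σ σ' t) :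
    (∀ x ∉ p.wr, σ'.reg x = σ.reg x) ∧ ∀ a ∉ p.wa, σ'.arr a = σ.arr a := by
  induction h with
  | skip σ => exact ⟨fun _ _ => rfl, fun _ _ => rfl⟩
  | assign σ x e he =>
    refine ⟨fun y hy => ?_, fun _ _ => rfl⟩
    simp only [RamProg.wr, Set.mem_singleton_iff] at hy
    simp [hy]
  | store σ a i e hi he =>
    refine ⟨fun _ _ => rfl, fun b hb => ?_⟩
    simp only [RamProg.wa, Set.mem_singleton_iff] at hb
    exact RamState.setArr_arr_ne _ _ _ hb
  | seq hp hq ih₁ ih₂ =>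
    refine ⟨fun x hx => ?_, fun a ha => ?_⟩
    · simp only [RamProg.wr, Set.mem_union, not_or] at hx
      rw [ih₂.1 x hx.2, ih₁.1 x hx.1]
    · simp only [RamProg.wa, Set.mem_union, not_or] at ha
      rw [ih₂.2 a ha.2, ih₁.2 a ha.1]
  | ite_true he hc hp ih =>
    refine ⟨fun x hx => ?_, fun a ha => ?_⟩
    · simp only [RamProg.wr, Set.mem_union, not_or] at hx
      exact ih.1 x hx.1
    · simp only [RamProg.wa, Set.mem_union, not_or] at ha
      exact ih.2 a ha.1
  | ite_false he hc hp ih =>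
    refine ⟨fun x hx => ?_, fun a ha => ?_⟩
    · simp only [RamProg.wr, Set.mem_union, not_or] at hx
      exact ih.1 x hx.2
    · simp only [RamProg.wa, Set.mem_union, not_or] at ha
      exact ih.2 a ha.2
  | while_true he hc hp hw ih₁ ih₂ =>
    refine ⟨fun x hx => ?_, fun a ha => ?_⟩
    · rw [ih₂.1 x hx, ih₁.1 x hx]
    · rw [ih₂.2 a ha, ih₁.2 a ha]
  | while_false he hc => exact ⟨fun _ _ => rfl, fun _ _ => rfl⟩

lemma BExpr.wr_compile (e : BExpr) : ∀ ρ d, (e.compile ρ d).wr ⊆ Set.range scr := by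
  induction e with
  | const v => intro ρ d; simp [BExpr.compile, RamProg.wr]
  | reg x => intro ρ d; simp [BExpr.compile, RamProg.wr]
  | get a i ih => intro ρ d; simp [BExpr.compile, RamProg.wr, ih, Set.insert_subset_iff]
  | op o e₁ e₂ ih₁ ih₂ =>
    intro ρ d; simp [BExpr.compile, RamProg.wr, ih₁, ih₂, Set.insert_subset_iff]
  | sum x b e ih₁ ih₂ =>
    intro ρ d; simp [BExpr.compile, RamProg.wr, ih₁, ih₂, Set.insert_subset_iff]

lemma BExpr.wa_compile (e : BExpr) : ∀ ρ d, (e.compile ρ d).wa = ∅ := by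
  induction e <;> intro ρ d <;> simp_all [BExpr.compile, RamProg.wa]

lemma BProg.wr_compile (p : BProg) : ∀ d y, y ∉ p.wr → varReg y ∉ (p.compile d).wr := by
  have hs : ∀ (e : BExpr) ρ d y, varReg y ∉ (e.compile ρ d).wr := by
    intro e ρ d y h
    obtain ⟨j, hj⟩ := e.wr_compile ρ d h
    exact varReg_ne_scr y j hj.symm
  induction p with
  | skip => intro d y _; simp [BProg.compile, RamProg.wr]
  | assign x e =>
    intro d y h
    simp only [BProg.wr, List.mem_singleton] at h
    simp [BProg.compile, RamProg.wr, varReg_injective.eq_iff, h, hs]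
  | store a i e => intro d y _; simp [BProg.compile, RamProg.wr, hs]
  | seq p q ih₁ ih₂ =>
    intro d y h
    simp only [BProg.wr, List.mem_append, not_or] at h
    simp [BProg.compile, RamProg.wr, ih₁ d y h.1, ih₂ d y h.2]
  | ite e p q ih₁ ih₂ =>
    intro d y h
    simp only [BProg.wr, List.mem_append, not_or] at h
    simp [BProg.compile, RamProg.wr, ih₁ d y h.1, ih₂ d y h.2, hs]
  | loop x b p ih =>
    intro d y h
    simp only [BProg.wr, List.mem_cons, not_or] at h
    simp [BProg.compile, RamProg.wr, ih _ y h.2, hs, varReg_injective.eq_iff, h.1, varReg_ne_scr]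

lemma BProg.wa_compile (p : BProg) : ∀ d a, a ∉ p.wa → a ∉ (p.compile d).wa := by
  induction p with
  | skip => intro d y _; simp [BProg.compile, RamProg.wa]
  | assign x e => intro d y h; simp [BProg.compile, RamProg.wa, BExpr.wa_compile]
  | store a i e =>
    intro d y h
    simp only [BProg.wa, List.mem_singleton] at h
    simp [BProg.compile, RamProg.wa, BExpr.wa_compile, h]
  | seq p q ih₁ ih₂ =>
    intro d y h
    simp only [BProg.wa, List.mem_append, not_or] at h
    simp [BProg.compile, RamProg.wa, ih₁ d y h.1, ih₂ d y h.2]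
  | ite e p q ih₁ ih₂ =>
    intro d y h
    simp only [BProg.wa, List.mem_append, not_or] at h
    simp [BProg.compile, RamProg.wa, ih₁ d y h.1, ih₂ d y h.2, BExpr.wa_compile]
  | loop x b p ih =>
    intro d y h
    simp only [BProg.wa] at h
    simp [BProg.compile, RamProg.wa, ih _ y h, BExpr.wa_compile]

/-- A specification may be strengthened by what the program does not write. -/
lemma Tri.frame {V T : ℕ} {p : BProg} {τ : RamState} {Q : RamState → Prop} (h : Tri V p τ T Q) :
    Tri V p τ T (fun τ' => Q τ' ∧ (∀ x ∉ p.wr, τ'.reg x = τ.reg x) ∧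
      ∀ a ∉ p.wa, τ'.arr a = τ.arr a) := by
  intro hV hb M hM d σ hσ
  obtain ⟨σ', t, h1, h2, h3, h4, h5⟩ := h hV hb M hM d σ hσ
  refine ⟨σ', t, h1, h2, ⟨h3, fun x hx => ?_, fun a ha => ?_⟩, h4, h5⟩
  · rw [← hσ]; exact h1.frame.1 _ (p.wr_compile d x hx)
  · rw [← hσ]; exact h1.frame.2 _ (p.wa_compile d a ha)

end

section

/-! ### Structure of optimal covers -/

namespace Cover

open Finset

variable (nb : ℕ → Finset ℕ)

/-- The union of the sets `nb x` over the members `x` of a list. -/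
def cvr (S : List ℕ) : Finset ℕ := S.toFinset.biUnion nb

/-- The number of elements of `nb x` that are not covered by `S`. -/
def rs (S : List ℕ) (x : ℕ) : ℕ := (nb x \ cvr nb S).card

/-- The largest residual size. -/
def sm (n : ℕ) (S : List ℕ) : ℕ := (range n).sup (rs nb S)

/-- The first index of largest residual size. -/
def zm (n : ℕ) (S : List ℕ) : ℕ :=
  ((range n).filter fun x => ∀ x' < n, x' ≤ x → rs nb S x' ≠ sm nb n S).card

/-- `x` has a substantial overlap with the largest residual set. -/
def Overlap (k n : ℕ) (S : List ℕ) (x : ℕ) : Prop :=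
  x < n ∧ 0 < sm nb n S ∧ sm nb n S ≤ 2 * k * ((nb x ∩ nb (zm nb n S)) \ cvr nb S).card

/-- The position in the ordering by decreasing residual size. -/
def rank (n : ℕ) (S : List ℕ) (x : ℕ) : ℕ :=
  ((range n).filter fun x' => rs nb S x < rs nb S x' ∨ (rs nb S x' = rs nb S x ∧ x' < x)).card

/-- The candidates for the remaining members of an optimal cover. -/
def InK (k n F : ℕ) (S : List ℕ) (x : ℕ) : Prop :=
  x < n ∧ sm nb n S < 2 * rs nb S x ∧ rank nb n S x ≤ k * sm nb n S * F

/-- `T` covers as much as possible with at most `k` of the first `n` sets. -/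
def IsOpt (k n : ℕ) (T : Finset ℕ) : Prop :=
  T ⊆ range n ∧ T.card ≤ k ∧
    ∀ T' ⊆ range n, T'.card ≤ k → (T'.biUnion nb).card ≤ (T.biUnion nb).card

/-- The order of the list matters: each member overlaps the largest residual set as it was when that
member was chosen. This is the order in which the search makes its choices. -/
inductive OverlapPath (k n : ℕ) : List ℕ → Prop
  | nil : OverlapPath k n []
  | snoc {S : List ℕ} {x : ℕ} (hS : OverlapPath k n S) (hx : Overlap nb k n S x) :
      OverlapPath k n (S ++ [x])

variable {nb}

lemma mem_cvr {S : List ℕ} {y : ℕ} : y ∈ cvr nb S ↔ ∃ x ∈ S, y ∈ nb x := by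
  simp [cvr]

lemma cvr_append (S S' : List ℕ) : cvr nb (S ++ S') = cvr nb S ∪ cvr nb S' := by
  ext y; simp only [mem_cvr, List.mem_append, mem_union]; grind

lemma cvr_mono {S S' : List ℕ} (h : ∀ x ∈ S, x ∈ S') : cvr nb S ⊆ cvr nb S' := by
  intro y hy
  obtain ⟨x, hx, hy⟩ := mem_cvr.1 hy
  exact mem_cvr.2 ⟨x, h x hx, hy⟩

lemma rs_le_sm {n : ℕ} {S : List ℕ} {x : ℕ} (hx : x < n) : rs nb S x ≤ sm nb n S :=
  Finset.le_sup (f := rs nb S) (mem_range.2 hx)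

lemma rs_eq_zero {S : List ℕ} {x : ℕ} (hx : x ∈ S) : rs nb S x = 0 := by
  simp only [rs, card_eq_zero, sdiff_eq_empty_iff_subset]
  intro y hy
  exact mem_cvr.2 ⟨x, hx, hy⟩

/-- The indices that `zm` counts are exactly those before the first maximizer, hence their number is
that maximizer. The counting form was chosen because it can be written as a bounded sum. -/
lemma zm_spec {n : ℕ} (hn : 0 < n) (S : List ℕ) :
    zm nb n S < n ∧ rs nb S (zm nb n S) = sm nb n S := by
  have hex : ∃ x, x < n ∧ rs nb S x = sm nb n S := by
    obtain ⟨x, hx, h⟩ := Finset.exists_mem_eq_sup (range n) ⟨0, mem_range.2 hn⟩ (rs nb S)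
    exact ⟨x, mem_range.1 hx, h.symm⟩
  classical
  have h1 := Nat.find_spec hex
  have h2 : zm nb n S = Nat.find hex := by
    have : ((range n).filter fun x => ∀ x' < n, x' ≤ x → rs nb S x' ≠ sm nb n S) =
        range (Nat.find hex) := by
      ext x
      simp only [mem_filter, mem_range]
      constructor
      · rintro ⟨hx, h⟩
        by_contra hc
        exact h _ h1.1 (by omega) h1.2
      · intro hx
        refine ⟨by omega, fun x' hx' hle he => ?_⟩
        exact Nat.find_min hex (m := x') (by omega) ⟨hx', he⟩
    rw [zm, this, card_range]
  rw [h2]; exact h1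

lemma biUnion_insert_card {T : Finset ℕ} (x : ℕ) :
    ((insert x T).biUnion nb).card = (T.biUnion nb).card + (nb x \ T.biUnion nb).card := by
  rw [biUnion_insert, union_comm, ← union_sdiff_self_eq_union,
    card_union_of_disjoint disjoint_sdiff]

/-- Exchange `x` for the largest residual set `z`. Optimality shows that `z` adds at most `sm / 2`
to the other members of `T`, so these already contain half of its residual elements, and by
averaging one of them outside `S` contains a fraction `1 / (2 k)`. If `z` itself is in `T`, it is
the required member. -/
lemma exists_overlap {k n : ℕ} (hk : 1 ≤ k) (hn : 0 < n) {T : Finset ℕ} (hT : IsOpt nb k n T)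
    {S : List ℕ} (hS : S.toFinset ⊆ T) (hpos : 0 < sm nb n S) {x : ℕ} (hx : x ∈ T) (hxS : x ∉ S)
    (hxs : 2 * rs nb S x ≤ sm nb n S) : ∃ v ∈ T, v ∉ S ∧ Overlap nb k n S v := by
  obtain ⟨hzn, hz⟩ := zm_spec (nb := nb) hn S
  set z := zm nb n S with hzdef
  by_cases hzT : z ∈ T
  · refine ⟨z, hzT, fun h => ?_, hzn, hpos, ?_⟩
    · rw [rs_eq_zero h] at hz; omega
    · rw [← hzdef, inter_self]
      change _ ≤ 2 * k * rs nb S z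
      rw [hz]; nlinarith
  · set W := (T.erase x).biUnion nb with hW
    have hSW : cvr nb S ⊆ W := by
      intro y hy
      obtain ⟨v, hv, hy⟩ := mem_cvr.1 hy
      refine mem_biUnion.2 ⟨v, mem_erase.2 ⟨fun h => hxS (h ▸ hv), hS (List.mem_toFinset.2 hv)⟩, hy⟩
    -- The exchanged family competes with `T`; after removing the common part `W`, this says that
    -- `z` adds no more to `W` than `x` does.
    have c1 := hT.2.2 (insert z (T.erase x)) (by
      intro v hv
      rcases mem_insert.1 hv with h | h
      · rw [h]; exact mem_range.2 hzn
      · exact hT.1 (mem_of_mem_erase h)) (by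
      have := card_insert_le z (T.erase x)
      have h2 := card_erase_of_mem hx
      have h3 := hT.2.1
      have : 0 < T.card := card_pos.2 ⟨x, hx⟩
      omega)
    rw [biUnion_insert_card, ← hW] at c1
    have c2 : (T.biUnion nb).card = W.card + (nb x \ W).card := by
      conv_lhs => rw [← insert_erase hx]
      rw [biUnion_insert_card]
    have c3 : (nb x \ W).card ≤ rs nb S x := card_le_card (sdiff_subset_sdiff le_rfl hSW)
    have c4 : sm nb n S ≤ (nb z \ W).card + ((nb z ∩ W) \ cvr nb S).card := by
      rw [← hz, rs]
      refine (card_le_card ?_).trans (card_union_le _ _)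
      intro y hy
      simp only [mem_sdiff, mem_union, mem_inter] at hy ⊢
      tauto
    -- Otherwise each of the at most `k` members in `U` contains less than `sm / (2 k)` of the
    -- residual of `z`, and all of them together less than half of it.
    by_contra hcon
    push Not at hcon
    set U := T.erase x \ S.toFinset with hU
    have c5 : ((nb z ∩ W) \ cvr nb S).card ≤ ∑ v ∈ U, ((nb v ∩ nb z) \ cvr nb S).card := by
      refine (card_le_card ?_).trans card_biUnion_le
      intro y hy
      simp only [mem_sdiff, mem_inter, hW, mem_biUnion] at hy
      obtain ⟨⟨hyz, v, hv, hyv⟩, hyS⟩ := hy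
      simp only [mem_biUnion, mem_sdiff, mem_inter, hU]
      refine ⟨v, ⟨hv, fun h => hyS (mem_cvr.2 ⟨v, List.mem_toFinset.1 h, hyv⟩)⟩, ⟨hyv, hyz⟩, hyS⟩
    have c6 : ∀ v ∈ U, 2 * k * ((nb v ∩ nb z) \ cvr nb S).card < sm nb n S := by
      intro v hv
      simp only [hU, mem_sdiff, List.mem_toFinset] at hv
      have := hcon v (mem_of_mem_erase hv.1) hv.2
      by_contra h
      exact this ⟨mem_range.1 (hT.1 (mem_of_mem_erase hv.1)), hpos, by simpa using h⟩
    have c7 : U.card ≤ k := (card_le_card sdiff_subset).trans ((card_erase_le).trans hT.2.1)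
    rcases U.eq_empty_or_nonempty with hU0 | hUne
    · rw [hU0, sum_empty] at c5
      omega
    · have c8 : ∑ v ∈ U, 2 * k * ((nb v ∩ nb z) \ cvr nb S).card < ∑ v ∈ U, sm nb n S :=
        sum_lt_sum_of_nonempty hUne c6
      rw [← mul_sum, sum_const, smul_eq_mul] at c8
      have c9 : U.card * sm nb n S ≤ k * sm nb n S := Nat.mul_le_mul_right _ c7
      have c10 : sm nb n S ≤ 2 * ((nb z ∩ W) \ cvr nb S).card := by omega
      have c11 := Nat.mul_le_mul_left k c10
      have c12 := Nat.mul_le_mul_left (2 * k) c5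
      nlinarith

/-- Each application of `exists_overlap` moves one more member of `T` into the list, so the process
ends after at most `T.card` steps. -/
lemma exists_overlapPath {k n : ℕ} (hk : 1 ≤ k) (hn : 0 < n) {T : Finset ℕ}
    (hT : IsOpt nb k n T) : ∃ S, OverlapPath nb k n S ∧ S.Nodup ∧ S.toFinset ⊆ T ∧
      ((cvr nb S).card = (T.biUnion nb).card ∨
        (0 < sm nb n S ∧ ∀ x ∈ T, x ∉ S → sm nb n S < 2 * rs nb S x)) := by
  suffices h : ∀ m S, (T \ S.toFinset).card ≤ m → OverlapPath nb k n S → S.Nodup → S.toFinset ⊆ T →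
      ∃ S, OverlapPath nb k n S ∧ S.Nodup ∧ S.toFinset ⊆ T ∧
      ((cvr nb S).card = (T.biUnion nb).card ∨
        (0 < sm nb n S ∧ ∀ x ∈ T, x ∉ S → sm nb n S < 2 * rs nb S x)) from
    h _ [] le_rfl .nil List.nodup_nil (by simp)
  intro m
  induction m with
  | zero =>
    intro S hm hP hnd hS
    refine ⟨S, hP, hnd, hS, Or.inl ?_⟩
    have : T ⊆ S.toFinset := by
      rw [← sdiff_eq_empty_iff_subset, ← card_eq_zero]; omega
    rw [cvr, subset_antisymm hS this]
  | succ m ih =>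
    intro S hm hP hnd hS
    -- When no set has residual elements, the members of `T` outside `S` contribute nothing.
    by_cases h0 : sm nb n S = 0
    · refine ⟨S, hP, hnd, hS, Or.inl ?_⟩
      apply le_antisymm
      · exact card_le_card (biUnion_subset_biUnion_of_subset_left _ hS)
      · apply card_le_card
        intro y hy
        obtain ⟨x, hx, hy⟩ := mem_biUnion.1 hy
        have : rs nb S x ≤ 0 := h0 ▸ rs_le_sm (mem_range.1 (hT.1 hx))
        simp only [rs, nonpos_iff_eq_zero, card_eq_zero, sdiff_eq_empty_iff_subset] at this
        exact this hy
    · by_cases h1 : ∀ x ∈ T, x ∉ S → sm nb n S < 2 * rs nb S x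
      · exact ⟨S, hP, hnd, hS, Or.inr ⟨by omega, h1⟩⟩
      · push Not at h1
        obtain ⟨x, hx, hxS, hxs⟩ := h1
        obtain ⟨v, hvT, hvS, hv⟩ := exists_overlap hk hn hT hS (by omega) hx hxS hxs
        refine ih (S ++ [v]) ?_ (.snoc hP hv) ?_ ?_
        · have : (T \ (S ++ [v]).toFinset) ⊂ T \ S.toFinset := by
            refine ⟨fun y hy => ?_, fun h => ?_⟩
            · simp only [mem_sdiff, List.mem_toFinset, List.mem_append] at hy ⊢
              tauto
            · have := h (mem_sdiff.2 ⟨hvT, by simpa using hvS⟩)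
              simp at this
          have := card_lt_card this
          omega
        · rw [List.nodup_append]
          refine ⟨hnd, List.nodup_singleton _, ?_⟩
          intro a ha b hb
          rw [List.mem_singleton] at hb
          rintro rfl
          exact hvS (hb ▸ ha)
        · intro y hy
          simp only [List.mem_toFinset, List.mem_append, List.mem_singleton] at hy
          rcases hy with hy | hy
          · exact hS (List.mem_toFinset.2 hy)
          · rw [hy]; exact hvT

lemma card_hit_le {n F : ℕ} (hF : ∀ y, ((range n).filter fun x => y ∈ nb x).card ≤ F)
    (Y : Finset ℕ) : ((range n).filter fun x => ¬ Disjoint (nb x) Y).card ≤ Y.card * F := by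
  calc _ ≤ (Y.biUnion fun y => (range n).filter fun x => y ∈ nb x).card := by
        apply card_le_card
        intro x hx
        simp only [mem_filter, not_disjoint_iff, mem_biUnion] at hx ⊢
        obtain ⟨hx, y, h1, h2⟩ := hx
        exact ⟨y, h2, hx, h1⟩
    _ ≤ ∑ y ∈ Y, ((range n).filter fun x => y ∈ nb x).card := card_biUnion_le
    _ ≤ ∑ _y ∈ Y, F := sum_le_sum fun y _ => hF y
    _ = _ := by simp

lemma rank_lt_rank {n : ℕ} {S : List ℕ} {x x' : ℕ} (hx' : x' < n)
    (h : rs nb S x < rs nb S x' ∨ (rs nb S x' = rs nb S x ∧ x' < x)) :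
    rank nb n S x' < rank nb n S x := by
  apply card_lt_card
  refine ⟨fun w hw => ?_, fun hc => ?_⟩
  · simp only [mem_filter] at hw ⊢
    exact ⟨hw.1, by omega⟩
  · have := hc (mem_filter.2 ⟨mem_range.2 hx', h⟩)
    simp only [mem_filter] at this
    omega

/-- The other members of `T` cover at most `k * sm` elements outside the union of `S`, and at most
`k * sm * F` sets meet these elements. If more sets than that precede `x`, one of them avoids these
elements. It contributes its whole residual set, which is no smaller than that of `x`. -/
lemma exists_better {k n F : ℕ} (hF : ∀ y, ((range n).filter fun x => y ∈ nb x).card ≤ F)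
    {T : Finset ℕ} (hT : IsOpt nb k n T) {S : List ℕ} (hS : S.toFinset ⊆ T)
    (hR : ∀ x ∈ T, x ∉ S → sm nb n S < 2 * rs nb S x) {x : ℕ} (hx : x ∈ T) (hxS : x ∉ S)
    (hxr : k * sm nb n S * F < rank nb n S x) :
    ∃ x', IsOpt nb k n (insert x' (T.erase x)) ∧ x' ∉ T ∧ x' ∉ S ∧ S.toFinset ⊆ T.erase x ∧
      sm nb n S < 2 * rs nb S x' ∧ rank nb n S x' < rank nb n S x := by
  set W := (T.erase x).biUnion nb with hW
  have hST : S.toFinset ⊆ T.erase x := by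
    intro v hv
    exact mem_erase.2 ⟨fun h => hxS (h ▸ List.mem_toFinset.1 hv), hS hv⟩
  have hSW : cvr nb S ⊆ W := biUnion_subset_biUnion_of_subset_left _ hST
  have c1 : (W \ cvr nb S).card ≤ k * sm nb n S := by
    calc (W \ cvr nb S).card ≤ ((T.erase x).biUnion fun v => nb v \ cvr nb S).card := by
          apply card_le_card
          intro y hy
          simp only [mem_sdiff, hW, mem_biUnion] at hy ⊢
          obtain ⟨⟨v, hv, hy⟩, h⟩ := hy
          exact ⟨v, hv, hy, h⟩
      _ ≤ ∑ v ∈ T.erase x, (nb v \ cvr nb S).card := card_biUnion_le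
      _ ≤ ∑ _v ∈ T.erase x, sm nb n S := by
          apply sum_le_sum
          intro v hv
          exact rs_le_sm (mem_range.1 (hT.1 (mem_of_mem_erase hv)))
      _ = (T.erase x).card * sm nb n S := by simp
      _ ≤ _ := Nat.mul_le_mul_right _ (card_erase_le.trans hT.2.1)
  have c2 := card_hit_le hF (W \ cvr nb S)
  have c3 : (W \ cvr nb S).card * F < rank nb n S x :=
    lt_of_le_of_lt (Nat.mul_le_mul_right _ c1) hxr
  have : ∃ x' ∈ ((range n).filter fun x' => rs nb S x < rs nb S x' ∨
      (rs nb S x' = rs nb S x ∧ x' < x)),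
      x' ∉ ((range n).filter fun x => ¬ Disjoint (nb x) (W \ cvr nb S)) := by
    apply exists_mem_notMem_of_card_lt_card
    exact lt_of_le_of_lt c2 c3
  obtain ⟨x', h1, h2⟩ := this
  simp only [mem_filter, mem_range, not_and, not_not] at h1 h2
  have hdis := h2 h1.1
  have hx0 := hR x hx hxS
  have hrs : rs nb S x ≤ rs nb S x' := by omega
  have hne : x' ≠ x := by rintro rfl; omega
  have hxT : x' ∉ T := by
    intro h
    -- A member of `T` other than `x` has its residual elements inside `W`, so avoiding them would
    -- leave it none, against `hR`.
    have h3 : nb x' \ cvr nb S ⊆ W \ cvr nb S :=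
      sdiff_subset_sdiff (subset_biUnion_of_mem nb (mem_erase.2 ⟨hne, h⟩)) le_rfl
    have h4 : nb x' \ cvr nb S = ∅ := by
      rw [← disjoint_self_iff_empty]
      exact hdis.mono sdiff_subset h3
    have : rs nb S x' = 0 := by rw [rs, h4, card_empty]
    omega
  refine ⟨x', ⟨?_, ?_, ?_⟩, hxT, fun h => hxT (hS (List.mem_toFinset.2 h)), hST, by omega,
    rank_lt_rank h1.1 h1.2⟩
  · intro v hv
    rcases mem_insert.1 hv with h | h
    · rw [h]; exact mem_range.2 h1.1
    · exact hT.1 (mem_of_mem_erase h)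
  · have := card_insert_le x' (T.erase x)
    have h2 := card_erase_of_mem hx
    have h3 := hT.2.1
    have : 0 < T.card := card_pos.2 ⟨x, hx⟩
    omega
  · intro T' hT' hk'
    refine (hT.2.2 T' hT' hk').trans ?_
    conv_lhs => rw [← insert_erase hx]
    rw [biUnion_insert_card, biUnion_insert_card, ← hW]
    have c4 : (nb x \ W).card ≤ rs nb S x := card_le_card (sdiff_subset_sdiff le_rfl hSW)
    have c5 : rs nb S x' ≤ (nb x' \ W).card := by
      apply card_le_card
      intro y hy
      simp only [mem_sdiff] at hy ⊢
      exact ⟨hy.1, fun h => disjoint_left.1 hdis hy.1 (mem_sdiff.2 ⟨h, hy.2⟩)⟩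
    omega

/-- The exchange of `exists_better` lowers the sum of the ranks of the members outside `S`, hence it
can be repeated only finitely often. -/
lemma exists_opt_inK {k n F : ℕ} (hF : ∀ y, ((range n).filter fun x => y ∈ nb x).card ≤ F)
    {T : Finset ℕ} (hT : IsOpt nb k n T) {S : List ℕ} (hS : S.toFinset ⊆ T)
    (hR : ∀ x ∈ T, x ∉ S → sm nb n S < 2 * rs nb S x) :
    ∃ T', IsOpt nb k n T' ∧ S.toFinset ⊆ T' ∧ ∀ x ∈ T', x ∉ S → InK nb k n F S x := by
  suffices h : ∀ m T, (∑ x ∈ T \ S.toFinset, rank nb n S x) ≤ m → IsOpt nb k n T → S.toFinset ⊆ T →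
      (∀ x ∈ T, x ∉ S → sm nb n S < 2 * rs nb S x) →
      ∃ T', IsOpt nb k n T' ∧ S.toFinset ⊆ T' ∧ ∀ x ∈ T', x ∉ S → InK nb k n F S x from
    h _ T le_rfl hT hS hR
  intro m
  induction m using Nat.strong_induction_on with
  | _ m ih =>
    intro T hm hT hS hR
    by_cases hall : ∀ x ∈ T, x ∉ S → rank nb n S x ≤ k * sm nb n S * F
    · exact ⟨T, hT, hS, fun x hx hxS => ⟨mem_range.1 (hT.1 hx), hR x hx hxS, hall x hx hxS⟩⟩
    · push Not at hall
      obtain ⟨x, hx, hxS, hxr⟩ := hall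
      obtain ⟨x', h1, h2, h3, h4, h5, h6⟩ := exists_better hF hT hS hR hx hxS hxr
      have hsum : ∑ v ∈ insert x' (T.erase x) \ S.toFinset, rank nb n S v <
          ∑ v ∈ T \ S.toFinset, rank nb n S v := by
        have e1 : insert x' (T.erase x) \ S.toFinset =
            insert x' ((T \ S.toFinset).erase x) := by
          ext v
          simp only [mem_sdiff, mem_insert, mem_erase, List.mem_toFinset]
          constructor
          · tauto
          · rintro (h | h)
            · subst h; exact ⟨Or.inl rfl, h3⟩
            · tauto
        have hmem : x ∈ T \ S.toFinset := mem_sdiff.2 ⟨hx, by simpa using hxS⟩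
        rw [e1, sum_insert (by simp [h2]), ← add_sum_erase _ _ hmem]
        omega
      refine ih _ (lt_of_lt_of_le hsum hm) _ le_rfl h1 (h4.trans (subset_insert _ _)) ?_
      intro v hv hvS
      rcases mem_insert.1 hv with h | h
      · rw [h]; exact h5
      · exact hR v (mem_of_mem_erase h) hvS

/-! #### Chains -/

/-- A list grown from one member by adding pairs that have a common element with each other and
with an earlier member. -/
inductive Chain (nb : ℕ → Finset ℕ) : List ℕ → Prop
  | start (x : ℕ) : Chain nb [x]
  | step {C : List ℕ} {a b y : ℕ} (hC : Chain nb C) (hy : y ∈ cvr nb C) (ha : y ∈ nb a)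
      (hb : y ∈ nb b) : Chain nb (C ++ [a, b])

lemma Chain.length_odd {C : List ℕ} (h : Chain nb C) : ∃ m, C.length = 2 * m + 1 := by
  induction h with
  | start x => exact ⟨0, rfl⟩
  | step hC hy ha hb ih =>
    obtain ⟨m, hm⟩ := ih
    exact ⟨m + 1, by simp [hm]; ring⟩

/-- Sets are added in pairs after a single start, so a cut at odd length falls between two steps of
the construction. -/
lemma Chain.take {C : List ℕ} (h : Chain nb C) : ∀ c, 2 * c + 1 ≤ C.length →
    Chain nb (C.take (2 * c + 1)) := by
  induction h with
  | start x =>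
    intro c hc
    have : c = 0 := by simp at hc; omega
    subst this
    exact .start x
  | @step C a b y hC hy ha hb ih =>
    intro c hc
    obtain ⟨m, hm⟩ := hC.length_odd
    by_cases h : 2 * c + 1 ≤ C.length
    · rw [List.take_append_of_le_length h]
      exact ih c h
    · have : (C ++ [a, b]).take (2 * c + 1) = C ++ [a, b] := by
        apply List.take_of_length_le
        simp only [List.length_append, List.length_cons, List.length_nil] at hc ⊢
        omega
      rw [this]
      exact .step hC hy ha hb

/-- Extend the chain from `x` inside `R` as long as possible: an element common to a member and to
two different sets of `R` outside the chain would allow one more step. -/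
lemma exists_closed_chain (R : Finset ℕ) {x : ℕ} (hx : x ∈ R) :
    ∃ C, Chain nb C ∧ C.Nodup ∧ x ∈ C ∧ C.toFinset ⊆ R ∧
      ∀ a ∈ C, ∀ b ∈ R, ∀ c ∈ R, b ∉ C → c ∉ C → b ≠ c →
        ∀ y, ¬ (y ∈ nb a ∧ y ∈ nb b ∧ y ∈ nb c) := by
  suffices h : ∀ m C, R.card - C.length ≤ m → Chain nb C → C.Nodup → x ∈ C → C.toFinset ⊆ R →
      ∃ C, Chain nb C ∧ C.Nodup ∧ x ∈ C ∧ C.toFinset ⊆ R ∧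
      ∀ a ∈ C, ∀ b ∈ R, ∀ c ∈ R, b ∉ C → c ∉ C → b ≠ c →
        ∀ y, ¬ (y ∈ nb a ∧ y ∈ nb b ∧ y ∈ nb c) from
    h _ [x] le_rfl (.start x) (List.nodup_singleton _) (by simp) (by simpa using hx)
  intro m
  induction m with
  | zero =>
    intro C hm hC hnd hxC hCR
    refine ⟨C, hC, hnd, hxC, hCR, fun a _ b hb c _ hbC => ?_⟩
    have : C.toFinset = R := by
      apply eq_of_subset_of_card_le hCR
      rw [List.toFinset_card_of_nodup hnd]; omega
    exact absurd (List.mem_toFinset.1 (this ▸ hb)) hbC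
  | succ m ih =>
    intro C hm hC hnd hxC hCR
    by_cases hcl : ∀ a ∈ C, ∀ b ∈ R, ∀ c ∈ R, b ∉ C → c ∉ C → b ≠ c →
        ∀ y, ¬ (y ∈ nb a ∧ y ∈ nb b ∧ y ∈ nb c)
    · exact ⟨C, hC, hnd, hxC, hCR, hcl⟩
    · push Not at hcl
      obtain ⟨a, ha, b, hb, c, hc, hbC, hcC, hbc, y, hya, hyb, hyc⟩ := hcl
      refine ih (C ++ [b, c]) ?_ (.step hC (mem_cvr.2 ⟨a, ha, hya⟩) hyb hyc) ?_ (by simp [hxC]) ?_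
      · simp only [List.length_append, List.length_cons, List.length_nil]; omega
      · rw [List.nodup_append]
        refine ⟨hnd, by simpa using hbc, ?_⟩
        intro v hv w hw
        simp only [List.mem_cons, List.not_mem_nil, or_false] at hw
        rintro rfl
        rcases hw with h | h
        · exact hbC (h ▸ hv)
        · exact hcC (h ▸ hv)
      · intro v hv
        simp only [List.mem_toFinset, List.mem_append, List.mem_cons, List.not_mem_nil,
          or_false] at hv
        rcases hv with h | h | h
        · exact hCR (List.mem_toFinset.2 h)
        · rw [h]; exact hb
        · rw [h]; exact hc

/-- No element is common to members of three different chains. -/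
def Spread (nb : ℕ → Finset ℕ) (cs : List (List ℕ)) : Prop :=
  ∀ a ∈ cs.flatten, ∀ b ∈ cs.flatten, ∀ c ∈ cs.flatten,
    (∀ C ∈ cs, ¬ (a ∈ C ∧ b ∈ C)) → (∀ C ∈ cs, ¬ (b ∈ C ∧ c ∈ C)) → (∀ C ∈ cs, ¬ (a ∈ C ∧ c ∈ C)) →
      ∀ y, ¬ (y ∈ nb a ∧ y ∈ nb b ∧ y ∈ nb c)

/-- Split off closed chains one after the other. If an element were common to members of three
different chains, the one split off first would not have been closed, since the other two members
were still available. -/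
lemma exists_chains (R : Finset ℕ) : ∃ cs : List (List ℕ), (∀ C ∈ cs, Chain nb C) ∧
    cs.flatten.Nodup ∧ cs.flatten.toFinset = R ∧ Spread nb cs := by
  induction hm : R.card using Nat.strong_induction_on generalizing R with
  | _ m ih =>
    subst hm
    rcases R.eq_empty_or_nonempty with rfl | ⟨x, hx⟩
    · exact ⟨[], by simp, by simp, by simp, by simp [Spread]⟩
    · obtain ⟨C, h1, h2, h3, h4, h5⟩ := exists_closed_chain (nb := nb) R hx
      have hlt : (R \ C.toFinset).card < R.card := by
        apply card_lt_card
        refine ⟨sdiff_subset, fun h => ?_⟩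
        have := h hx
        simp [h3] at this
      obtain ⟨cs, g1, g2, g3, g4⟩ := ih _ hlt (R \ C.toFinset) rfl
      have hmem : ∀ v, v ∈ cs.flatten ↔ v ∈ R ∧ v ∉ C := by
        intro v
        rw [← List.mem_toFinset, g3]; simp
      refine ⟨C :: cs, ?_, ?_, ?_, ?_⟩
      · intro D hD
        rcases List.mem_cons.1 hD with h | h
        · rw [h]; exact h1
        · exact g1 D h
      · rw [List.flatten_cons, List.nodup_append]
        refine ⟨h2, g2, fun a ha b hb => ?_⟩
        rintro rfl
        exact ((hmem a).1 hb).2 ha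
      · rw [List.flatten_cons, List.toFinset_append, g3]
        exact union_sdiff_of_subset h4
      · intro a ha b hb c hc hab hbc hac y hy
        rw [List.flatten_cons, List.mem_append, hmem] at ha hb hc
        have hab' := hab C (by simp)
        have hbc' := hbc C (by simp)
        have hac' := hac C (by simp)
        have inR : ∀ v, v ∈ C ∨ v ∈ R ∧ v ∉ C → v ∈ R := by
          rintro v (h | h)
          · exact h4 (List.mem_toFinset.2 h)
          · exact h.1
        have hin : ∀ v, v ∈ C ∨ v ∈ R ∧ v ∉ C → ∃ D ∈ C :: cs, v ∈ D := by
          rintro v (h | h)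
          · exact ⟨C, by simp, h⟩
          · obtain ⟨D, hD, hv⟩ := List.mem_flatten.1 ((hmem v).2 h)
            exact ⟨D, by simp [hD], hv⟩
        have hne : ∀ v w, (v ∈ C ∨ v ∈ R ∧ v ∉ C) → (∀ D ∈ C :: cs, ¬ (v ∈ D ∧ w ∈ D)) → v ≠ w := by
          rintro v w hv h rfl
          obtain ⟨D, hD, hvD⟩ := hin v hv
          exact h D hD ⟨hvD, hvD⟩
        by_cases haC : a ∈ C
        · exact h5 a haC b (inR b hb) c (inR c hc) (fun h => hab' ⟨haC, h⟩)
            (fun h => hac' ⟨haC, h⟩) (hne b c hb hbc) y hy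
        by_cases hbC : b ∈ C
        · exact h5 b hbC a (inR a ha) c (inR c hc) haC (fun h => hbc' ⟨hbC, h⟩) (hne a c ha hac) y
            ⟨hy.2.1, hy.1, hy.2.2⟩
        by_cases hcC : c ∈ C
        · exact h5 c hcC a (inR a ha) b (inR b hb) haC hbC (hne a b ha hab) y
            ⟨hy.2.2, hy.1, hy.2.1⟩
        · refine g4 a ((hmem a).2 (ha.resolve_left haC)) b ((hmem b).2 (hb.resolve_left hbC)) c
            ((hmem c).2 (hc.resolve_left hcC))
            (fun D hD => hab D (by simp [hD])) (fun D hD => hbc D (by simp [hD]))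
            (fun D hD => hac D (by simp [hD])) y hy

/-- Lists may be distributed to three groups such that without its first list each group is at most
as large as the smallest group. -/
lemma exists_three_groups (cs : List (List ℕ)) : ∃ G₁ G₂ G₃ : List (List ℕ),
    (G₁ ++ G₂ ++ G₃).Perm cs ∧ G₁.tail.flatten.length ≤ G₃.flatten.length ∧
    G₂.tail.flatten.length ≤ G₃.flatten.length ∧ G₃.flatten.length ≤ G₁.flatten.length ∧
    G₃.flatten.length ≤ G₂.flatten.length := by
  induction cs with
  | nil => exact ⟨[], [], [], by simp⟩
  | cons C cs ih =>
    obtain ⟨G₁, G₂, G₃, hp, h1, h2, h3, h4⟩ := ih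
    have e1 : (G₁ ++ G₂ ++ C :: G₃).Perm (C :: cs) :=
      (List.perm_middle).trans (hp.cons C)
    have e2 : (C :: G₃ ++ G₂ ++ G₁).Perm (C :: cs) := by
      refine List.Perm.trans ?_ (hp.cons C)
      rw [List.append_assoc, List.cons_append]
      refine List.Perm.cons _ ?_
      refine (List.perm_append_comm).trans ?_
      exact List.Perm.append_right _ List.perm_append_comm
    have e3 : (G₁ ++ C :: G₃ ++ G₂).Perm (C :: cs) := by
      refine List.Perm.trans ?_ e1
      rw [List.append_assoc, List.append_assoc]
      exact List.Perm.append_left _ List.perm_append_comm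
    have hl : (C :: G₃).flatten.length = C.length + G₃.flatten.length := by simp
    -- The new list goes to the front of the smallest group. If that group is no longer the
    -- smallest, the roles are exchanged; its tail is the old smallest group, so the bound on tails
    -- survives.
    by_cases a1 : (C :: G₃).flatten.length ≤ G₁.flatten.length
    · by_cases a2 : (C :: G₃).flatten.length ≤ G₂.flatten.length
      · exact ⟨G₁, G₂, C :: G₃, e1, by omega, by omega, a1, a2⟩
      · exact ⟨G₁, C :: G₃, G₂, e3, by omega, by simpa using h4, by omega, by omega⟩
    · by_cases a2 : G₁.flatten.length ≤ G₂.flatten.length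
      · exact ⟨C :: G₃, G₂, G₁, e2, by simpa using h3, by omega, by omega, a2⟩
      · exact ⟨G₁, C :: G₃, G₂, e3, by omega, by simpa using h4, by omega, by omega⟩

/-- An initial part of a chain with `2 * c - 1` members, the empty list if `c = 0`. -/
def ChainPart (nb : ℕ → Finset ℕ) (c : ℕ) (C : List ℕ) : Prop :=
  c = 0 ∧ C = [] ∨ Chain nb C ∧ C.length + 1 = 2 * c

/-- The excess of `G` over `l` is contained in its first list, since the tail is not too long. An
odd initial part of that list is removed; parity costs at most one set, which is why the rest may
fall short of `l` by one. -/
lemma exists_trim {G : List (List ℕ)} (hG : ∀ C ∈ G, Chain nb C) {l : ℕ}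
    (h1 : G.tail.flatten.length ≤ l) (h2 : l ≤ G.flatten.length) :
    ∃ c pre rest, ChainPart nb c pre ∧ G.flatten = pre ++ rest ∧ rest.length ≤ l ∧
      l ≤ rest.length + 1 := by
  by_cases hl : l = G.flatten.length
  · exact ⟨0, [], G.flatten, Or.inl ⟨rfl, rfl⟩, rfl, by omega, by omega⟩
  · cases G with
    | nil => simp at h2 hl; omega
    | cons C G =>
      have hC := hG C (by simp)
      obtain ⟨m, hm⟩ := hC.length_odd
      simp only [List.tail_cons] at h1
      rw [List.flatten_cons, List.length_append] at h2 hl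
      set t := C.length + G.flatten.length - l with ht
      -- The excess `t` is at most the length of `C`, which is odd, so the next odd number not below
      -- `t` still fits.
      have hc : 2 * (t / 2) + 1 ≤ C.length := by omega
      refine ⟨t / 2 + 1, C.take (2 * (t / 2) + 1), C.drop (2 * (t / 2) + 1) ++ G.flatten,
        Or.inr ⟨hC.take _ hc, ?_⟩, ?_, ?_, ?_⟩
      · rw [List.length_take, min_eq_left hc]; ring
      · rw [List.flatten_cons, ← List.append_assoc, List.take_append_drop]
      · rw [List.length_append, List.length_drop]; omega
      · rw [List.length_append, List.length_drop]; omega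

/-- Distribute whole chains to three groups and trim the two larger ones to the size of the
smallest. The groups consist of different chains, so three members from different groups cannot have
a common element. Only one chain per trimmed group is cut, which is why two enumerated parts
suffice. -/
lemma exists_balanced (R : Finset ℕ) : ∃ c₁ c₂ pre₁ pre₂ A B C, ChainPart nb c₁ pre₁ ∧
    ChainPart nb c₂ pre₂ ∧ (pre₁ ++ pre₂ ++ A ++ B ++ C).Nodup ∧
    (pre₁ ++ pre₂ ++ A ++ B ++ C).toFinset = R ∧ A.length ≤ C.length ∧ B.length ≤ C.length ∧
    C.length ≤ A.length + 1 ∧ C.length ≤ B.length + 1 ∧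
    ∀ a ∈ A, ∀ b ∈ B, ∀ c ∈ C, ∀ y, ¬ (y ∈ nb a ∧ y ∈ nb b ∧ y ∈ nb c) := by
  obtain ⟨cs, h1, h2, h3, h4⟩ := exists_chains (nb := nb) R
  obtain ⟨G₁, G₂, G₃, hp, g1, g2, g3, g4⟩ := exists_three_groups cs
  have hmem : ∀ D, D ∈ cs ↔ D ∈ G₁ ∨ D ∈ G₂ ∨ D ∈ G₃ := by
    intro D
    rw [← hp.mem_iff]; simp
  obtain ⟨c₁, pre₁, A, p1, p2, p3, p4⟩ := exists_trim (nb := nb)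
    (fun C hC => h1 C ((hmem C).2 (Or.inl hC))) g1 g3
  obtain ⟨c₂, pre₂, B, q1, q2, q3, q4⟩ := exists_trim (nb := nb)
    (fun C hC => h1 C ((hmem C).2 (Or.inr (Or.inl hC)))) g2 g4
  have hperm : (pre₁ ++ pre₂ ++ A ++ B ++ G₃.flatten).Perm cs.flatten := by
    refine List.Perm.trans ?_ hp.flatten
    rw [List.flatten_append, List.flatten_append, p2, q2]
    apply List.Perm.append_right
    rw [List.append_assoc, List.append_assoc, List.append_assoc]
    apply List.Perm.append_left
    rw [← List.append_assoc, ← List.append_assoc]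
    exact List.Perm.append_right _ List.perm_append_comm
  have hnd2 : (G₁.flatten ++ G₂.flatten ++ G₃.flatten).Nodup := by
    have := (hp.flatten).nodup_iff.2 h2
    rwa [List.flatten_append, List.flatten_append] at this
  rw [List.nodup_append, List.nodup_append] at hnd2
  obtain ⟨⟨-, -, n12⟩, -, n3⟩ := hnd2
  refine ⟨c₁, c₂, pre₁, pre₂, A, B, G₃.flatten, p1, q1, hperm.nodup_iff.2 h2, ?_, p3, q3, p4, q4, ?_⟩
  · rw [← h3]; ext v; simp only [List.mem_toFinset]; exact hperm.mem_iff
  · intro a ha b hb c hc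
    have ha' : a ∈ G₁.flatten := by rw [p2]; simp [ha]
    have hb' : b ∈ G₂.flatten := by rw [q2]; simp [hb]
    have hcs : ∀ v, v ∈ cs.flatten ↔ v ∈ G₁.flatten ∨ v ∈ G₂.flatten ∨ v ∈ G₃.flatten := by
      intro v; rw [← hp.flatten.mem_iff]; simp only [List.flatten_append, List.mem_append]; tauto
    have m12 : ∀ v, v ∈ G₁.flatten → v ∉ G₂.flatten := fun v h h' => n12 v h v h' rfl
    have m13 : ∀ v, v ∈ G₁.flatten → v ∉ G₃.flatten :=
      fun v h h' => n3 v (List.mem_append_left _ h) v h' rfl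
    have m23 : ∀ v, v ∈ G₂.flatten → v ∉ G₃.flatten :=
      fun v h h' => n3 v (List.mem_append_right _ h) v h' rfl
    have fl : ∀ {G : List (List ℕ)} {D v}, D ∈ G → v ∈ D → v ∈ G.flatten :=
      fun hD hv => List.mem_flatten.2 ⟨_, hD, hv⟩
    refine h4 a ((hcs a).2 (Or.inl ha')) b ((hcs b).2 (Or.inr (Or.inl hb'))) c
      ((hcs c).2 (Or.inr (Or.inr hc))) ?_ ?_ ?_
    · rintro D hD ⟨u1, u2⟩
      rcases (hmem D).1 hD with h | h | h
      · exact m12 b (fl h u2) hb'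
      · exact m12 a ha' (fl h u1)
      · exact m13 a ha' (fl h u1)
    · rintro D hD ⟨u1, u2⟩
      rcases (hmem D).1 hD with h | h | h
      · exact m13 c (fl h u2) hc
      · exact m23 c (fl h u2) hc
      · exact m23 b hb' (fl h u1)
    · rintro D hD ⟨u1, u2⟩
      rcases (hmem D).1 hD with h | h | h
      · exact m13 c (fl h u2) hc
      · exact m12 a ha' (fl h u1)
      · exact m13 a ha' (fl h u1)

/-! #### Inclusion–exclusion for three groups -/

-- Each of the three quantities involves two groups only. This turns the search for three groups
-- into the search for a triangle, to which matrix products apply.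
variable (nb) in
def pVal (S A B : List ℕ) : ℕ := ((cvr nb A ∪ cvr nb B) \ cvr nb S).card

variable (nb) in
def qVal (S A C : List ℕ) : ℕ := ((cvr nb C \ cvr nb A) \ cvr nb S).card

variable (nb) in
def rVal (S B C : List ℕ) : ℕ := ((cvr nb C ∩ cvr nb B) \ cvr nb S).card

lemma card_cvr_four (S A B C : List ℕ) : (cvr nb (S ++ A ++ B ++ C)).card =
    (cvr nb S).card + pVal nb S A B +
      ((cvr nb C \ (cvr nb A ∪ cvr nb B)) \ cvr nb S).card := by
  rw [pVal, ← card_union_of_disjoint, ← card_union_of_disjoint]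
  · congr 1
    ext y
    simp only [cvr_append, mem_union, mem_sdiff]
    tauto
  · rw [disjoint_left]
    intro y
    simp only [mem_union, mem_sdiff]
    tauto
  · exact disjoint_sdiff

lemma qVal_eq (S A B C : List ℕ) : qVal nb S A C =
    ((cvr nb C \ (cvr nb A ∪ cvr nb B)) \ cvr nb S).card +
      (((cvr nb C ∩ cvr nb B) \ cvr nb A) \ cvr nb S).card := by
  rw [qVal, ← card_union_of_disjoint]
  · congr 1
    ext y
    simp only [mem_union, mem_sdiff, mem_inter]
    tauto
  · rw [disjoint_left]
    intro y
    simp only [mem_union, mem_sdiff, mem_inter]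
    tauto

/-- `rVal` subtracts all new elements common to `B` and `C`, including those that also lie in `A`
and should not be subtracted. So the pairwise expression never exceeds the true value, for arbitrary
groups. -/
lemma val_le (S A B C : List ℕ) : (cvr nb S).card + pVal nb S A B + qVal nb S A C ≤
    (cvr nb (S ++ A ++ B ++ C)).card + rVal nb S B C := by
  rw [card_cvr_four, qVal_eq S A B C]
  have : (((cvr nb C ∩ cvr nb B) \ cvr nb A) \ cvr nb S).card ≤ rVal nb S B C :=
    card_le_card (sdiff_subset_sdiff sdiff_subset le_rfl)
  omega

/-- Without new elements common to members of all three groups, nothing is subtracted wrongly and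
the pairwise expression is exact. -/
lemma le_val (S A B C : List ℕ)
    (h : ∀ a ∈ A, ∀ b ∈ B, ∀ c ∈ C, ∀ y, y ∉ cvr nb S → ¬ (y ∈ nb a ∧ y ∈ nb b ∧ y ∈ nb c)) :
    (cvr nb (S ++ A ++ B ++ C)).card + rVal nb S B C ≤
      (cvr nb S).card + pVal nb S A B + qVal nb S A C := by
  rw [card_cvr_four, qVal_eq S A B C]
  have : rVal nb S B C ≤ (((cvr nb C ∩ cvr nb B) \ cvr nb A) \ cvr nb S).card := by
    apply card_le_card
    intro y hy
    simp only [mem_sdiff, mem_inter] at hy ⊢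
    refine ⟨⟨hy.1, fun hA => ?_⟩, hy.2⟩
    obtain ⟨c, hc, hyc⟩ := mem_cvr.1 hy.1.1
    obtain ⟨b, hb, hyb⟩ := mem_cvr.1 hy.1.2
    obtain ⟨a, ha, hya⟩ := mem_cvr.1 hA
    exact h a ha b hb c hc y hy.2 ⟨hya, hyb, hyc⟩
  omega

/-- The decomposition of an optimal cover on which the algorithm is based. -/
theorem exists_decomposition {k n F : ℕ} (hk : 1 ≤ k) (hn : 0 < n)
    (hF : ∀ y, ((range n).filter fun x => y ∈ nb x).card ≤ F) {T : Finset ℕ}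
    (hT : IsOpt nb k n T) : ∃ S, OverlapPath nb k n S ∧
      (∃ R : List ℕ, (∀ x ∈ R, x < n ∧ sm nb n S < 2 * rs nb S x) ∧ S.length + R.length ≤ k ∧
        (T.biUnion nb).card ≤ (cvr nb (S ++ R)).card) ∧
      ∃ c₁ c₂ pre₁ pre₂ A B C, ChainPart (fun x => nb x \ cvr nb S) c₁ pre₁ ∧
        ChainPart (fun x => nb x \ cvr nb S) c₂ pre₂ ∧
        (∀ x ∈ pre₁ ++ pre₂ ++ A ++ B ++ C, InK nb k n F S x) ∧
        S.length + pre₁.length + pre₂.length + A.length + B.length + C.length ≤ k ∧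
        A.length ≤ C.length ∧ B.length ≤ C.length ∧
        C.length ≤ A.length + 1 ∧ C.length ≤ B.length + 1 ∧
        (T.biUnion nb).card + rVal nb (S ++ pre₁ ++ pre₂) B C ≤
          (cvr nb (S ++ pre₁ ++ pre₂)).card + pVal nb (S ++ pre₁ ++ pre₂) A B +
            qVal nb (S ++ pre₁ ++ pre₂) A C := by
  obtain ⟨S, hP, hnd, hS, hcase⟩ := exists_overlapPath hk hn hT
  refine ⟨S, hP, ?_⟩
  have hSk : S.length ≤ k := by
    rw [← List.toFinset_card_of_nodup hnd]
    exact (card_le_card hS).trans hT.2.1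
  rcases hcase with hcase | ⟨hpos, hR⟩
  -- Here `S` alone is as good as `T`, and all other parts are empty.
  · refine ⟨⟨[], by simp, by simpa using hSk, by simp [hcase]⟩, 0, 0, [], [], [], [], [],
      Or.inl ⟨rfl, rfl⟩, Or.inl ⟨rfl, rfl⟩, by simp, by simpa using hSk, le_rfl, le_rfl, by simp,
      by simp, ?_⟩
    simp only [List.append_nil, rVal, cvr, List.toFinset_nil, biUnion_empty, empty_inter,
      empty_sdiff, card_empty, add_zero, ← hcase]
    omega
  · obtain ⟨T', hT', hST, hK⟩ := exists_opt_inK hF hT hS hR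
    have hTT : (T.biUnion nb).card ≤ (T'.biUnion nb).card := hT'.2.2 T hT.1 hT.2.1
    constructor
    · refine ⟨(T' \ S.toFinset).toList, ?_, ?_, hTT.trans (card_le_card ?_)⟩
      · intro x hx
        simp only [mem_toList, mem_sdiff, List.mem_toFinset] at hx
        have := hK x hx.1 hx.2
        exact ⟨this.1, this.2.1⟩
      · rw [length_toList, card_sdiff_of_subset hST, List.toFinset_card_of_nodup hnd]
        have h1 := hT'.2.1
        have h2 := card_le_card hST
        rw [List.toFinset_card_of_nodup hnd] at h2
        omega
      · intro y hy
        obtain ⟨x, hx, hy⟩ := mem_biUnion.1 hy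
        refine mem_cvr.2 ⟨x, ?_, hy⟩
        simp only [List.mem_append, mem_toList, mem_sdiff, List.mem_toFinset]
        tauto
    · obtain ⟨c₁, c₂, pre₁, pre₂, A, B, C, b1, b2, b3, b4, b5, b6, b7, b8, b9⟩ :=
        exists_balanced (nb := fun x => nb x \ cvr nb S) (T' \ S.toFinset)
      refine ⟨c₁, c₂, pre₁, pre₂, A, B, C, b1, b2, ?_, ?_, b5, b6, b7, b8, ?_⟩
      · intro x hx
        have : x ∈ T' \ S.toFinset := by rw [← b4]; exact List.mem_toFinset.2 hx
        simp only [mem_sdiff, List.mem_toFinset] at this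
        exact hK x this.1 this.2
      · have h0 : (pre₁ ++ pre₂ ++ A ++ B ++ C).length = (T' \ S.toFinset).card := by
          rw [← b4, List.toFinset_card_of_nodup b3]
        rw [card_sdiff_of_subset hST, List.toFinset_card_of_nodup hnd] at h0
        simp only [List.length_append] at h0
        have h1 := hT'.2.1
        have h2 := card_le_card hST
        rw [List.toFinset_card_of_nodup hnd] at h2
        omega
      -- The chains refer to what is uncovered after `S`. An element outside the union of the longer
      -- list `S ++ pre₁ ++ pre₂` is uncovered by `S` too, so their disjointness carries over.
      · have := le_val (nb := nb) (S ++ pre₁ ++ pre₂) A B C (by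
          intro a ha b hb c hc y hy hyy
          have hyS : y ∉ cvr nb S := fun h => hy (cvr_mono (by simp +contextual) h)
          exact b9 a ha b hb c hc y ⟨mem_sdiff.2 ⟨hyy.1, hyS⟩, mem_sdiff.2 ⟨hyy.2.1, hyS⟩,
            mem_sdiff.2 ⟨hyy.2.2, hyS⟩⟩)
        refine le_trans ?_ this
        apply Nat.add_le_add_right
        refine hTT.trans (card_le_card ?_)
        intro y hy
        obtain ⟨x, hx, hy⟩ := mem_biUnion.1 hy
        refine mem_cvr.2 ⟨x, ?_, hy⟩
        by_cases hxS : x ∈ S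
        · simp [hxS]
        · have : x ∈ T' \ S.toFinset := by simp [hx, hxS]
          rw [← b4] at this
          simp only [List.mem_toFinset, List.mem_append] at this ⊢
          tauto

end Cover

end

section

/-! ### Counting -/

namespace Cover

open Finset

variable {nb : ℕ → Finset ℕ}

lemma sum_card_inter_le {n F : ℕ} (hF : ∀ y, ((range n).filter fun x => y ∈ nb x).card ≤ F)
    (Y : Finset ℕ) : ∑ x ∈ range n, (nb x ∩ Y).card ≤ Y.card * F := by
  calc ∑ x ∈ range n, (nb x ∩ Y).card = ∑ x ∈ range n, ∑ y ∈ Y, if y ∈ nb x then 1 else 0 := by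
        refine sum_congr rfl fun x _ => ?_
        rw [← card_filter, inter_comm, filter_mem_eq_inter]
    _ = ∑ y ∈ Y, ((range n).filter fun x => y ∈ nb x).card := by
        rw [sum_comm]
        exact sum_congr rfl fun y _ => (card_filter _ _).symm
    _ ≤ ∑ _y ∈ Y, F := sum_le_sum fun y _ => hF y
    _ = _ := by simp

-- Double counting: the largest residual set has `sm` elements, each in at most `F` sets, and every
-- overlapping set accounts for at least `sm / (2 k)` of these incidences.
open Classical in
lemma card_overlap_le {k n F : ℕ} (hn : 0 < n)
    (hF : ∀ y, ((range n).filter fun x => y ∈ nb x).card ≤ F) (S : List ℕ) :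
    ((range n).filter fun x => Overlap nb k n S x).card ≤ 2 * k * F := by
  by_cases h0 : 0 < sm nb n S
  · have h1 := sum_card_inter_le hF (nb (zm nb n S) \ cvr nb S)
    have h2 : (nb (zm nb n S) \ cvr nb S).card = sm nb n S := (zm_spec hn S).2
    rw [h2] at h1
    have h3 : ((range n).filter fun x => Overlap nb k n S x).card * sm nb n S ≤
        2 * k * (sm nb n S * F) := by
      calc _ = ∑ _x ∈ (range n).filter fun x => Overlap nb k n S x, sm nb n S := by simp
        _ ≤ ∑ x ∈ (range n).filter fun x => Overlap nb k n S x,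
            2 * k * (nb x ∩ (nb (zm nb n S) \ cvr nb S)).card := by
            apply sum_le_sum
            intro x hx
            rw [← inter_sdiff_assoc]
            exact (mem_filter.1 hx).2.2.2
        _ ≤ ∑ x ∈ range n, 2 * k * (nb x ∩ (nb (zm nb n S) \ cvr nb S)).card :=
            sum_le_sum_of_subset (filter_subset _ _)
        _ ≤ _ := by rw [← mul_sum]; exact Nat.mul_le_mul_left _ h1
    have : ((range n).filter fun x => Overlap nb k n S x).card * sm nb n S ≤
        2 * k * F * sm nb n S := by linarith
    exact Nat.le_of_mul_le_mul_right this h0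
  · have : ((range n).filter fun x => Overlap nb k n S x) = ∅ := by
      apply filter_false_of_mem
      rintro x - ⟨-, h, -⟩
      exact h0 h
    simp [this]

/-- Each such set has more than `sm / 2` elements, and all sets together have at most `E`. -/
lemma card_large_mul_le {n E : ℕ} (hE : ∑ x ∈ range n, (nb x).card ≤ E) (S : List ℕ) :
    ((range n).filter fun x => sm nb n S < 2 * rs nb S x).card * sm nb n S ≤ 2 * E := by
  calc _ = ∑ _x ∈ (range n).filter fun x => sm nb n S < 2 * rs nb S x, sm nb n S := by simp
    _ ≤ ∑ x ∈ (range n).filter fun x => sm nb n S < 2 * rs nb S x, 2 * (nb x).card := by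
        apply sum_le_sum
        intro x hx
        have h1 := (mem_filter.1 hx).2
        have h2 : rs nb S x ≤ (nb x).card := card_le_card sdiff_subset
        omega
    _ ≤ ∑ x ∈ range n, 2 * (nb x).card := sum_le_sum_of_subset (filter_subset _ _)
    _ ≤ _ := by rw [← mul_sum]; exact Nat.mul_le_mul_left _ hE

lemma rank_injOn (n : ℕ) (S : List ℕ) : Set.InjOn (rank nb n S) (range n : Set ℕ) := by
  intro a ha b hb h
  simp only [coe_range, Set.mem_Iio] at ha hb
  by_contra hne
  have : (rs nb S a < rs nb S b ∨ (rs nb S b = rs nb S a ∧ b < a)) ∨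
      (rs nb S b < rs nb S a ∨ (rs nb S a = rs nb S b ∧ a < b)) := by omega
  rcases this with h' | h'
  · have := rank_lt_rank hb h'; omega
  · have := rank_lt_rank ha h'; omega

-- Ties are broken by index, so different sets have different ranks, and membership bounds the rank.
open Classical in
lemma card_inK_le {k n F : ℕ} (S : List ℕ) :
    ((range n).filter fun x => InK nb k n F S x).card ≤ k * sm nb n S * F + 1 := by
  have h := card_le_card_of_injOn (s := (range n).filter fun x => InK nb k n F S x)
    (t := range (k * sm nb n S * F + 1)) (rank nb n S)
    (by
      intro x hx
      have hx := (mem_filter.1 (mem_coe.1 hx)).2.2.2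
      simp only [coe_range, Set.mem_Iio]
      omega)
    ((rank_injOn n S).mono (by
      intro x hx
      exact mem_coe.2 (mem_filter.1 (mem_coe.1 hx)).1))
  simpa using h

lemma card_cvr_sdiff_le {n : ℕ} (S S' : List ℕ) (hS' : ∀ x ∈ S', x < n) :
    (cvr nb S' \ cvr nb S).card ≤ S'.length * sm nb n S := by
  calc (cvr nb S' \ cvr nb S).card ≤ (S'.toFinset.biUnion fun v => nb v \ cvr nb S).card := by
        apply card_le_card
        intro y hy
        simp only [mem_sdiff, mem_cvr, mem_biUnion, List.mem_toFinset] at hy ⊢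
        obtain ⟨⟨v, hv, hy⟩, h⟩ := hy
        exact ⟨v, hv, hy, h⟩
    _ ≤ ∑ v ∈ S'.toFinset, (nb v \ cvr nb S).card := card_biUnion_le
    _ ≤ ∑ _v ∈ S'.toFinset, sm nb n S := by
        apply sum_le_sum
        intro v hv
        exact rs_le_sm (hS' v (List.mem_toFinset.1 hv))
    _ = S'.toFinset.card * sm nb n S := by simp
    _ ≤ _ := Nat.mul_le_mul_right _ (List.toFinset_card_le _)

/-! ### Reduction to few sets -/

lemma exists_isOpt (nb : ℕ → Finset ℕ) (k n : ℕ) : ∃ T, IsOpt nb k n T := by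
  obtain ⟨T, hT, hmax⟩ := exists_max_image ((range n).powerset.filter fun T => T.card ≤ k)
    (fun T => (T.biUnion nb).card) ⟨∅, by simp⟩
  simp only [mem_filter, mem_powerset] at hT hmax
  exact ⟨T, hT.1, hT.2, fun T' h1 h2 => hmax T' ⟨h1, h2⟩⟩

/-- The number of earlier sets of the same size. -/
def earlier (nb : ℕ → Finset ℕ) (x : ℕ) : ℕ :=
  ((range x).filter fun x' => (nb x').card = (nb x).card).card

/-- Let `x` be a member with more than `k d F` earlier sets of its size. The rest of the solution
covers at most `k d` elements, so at most `k d F` sets meet it, and some earlier set of the same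
size avoids it. This set may replace `x`. The number of members with too many predecessors
decreases. -/
lemma exists_opt_earlier_le {k n d F : ℕ}
    (hF : ∀ y, ((range n).filter fun x => y ∈ nb x).card ≤ F)
    (hd : ∀ x < n, (nb x).card ≤ d) :
    ∃ T, IsOpt nb k n T ∧ ∀ x ∈ T, earlier nb x ≤ k * d * F := by
  suffices h : ∀ m T, (T.filter fun x => ¬ earlier nb x ≤ k * d * F).card ≤ m → IsOpt nb k n T →
      ∃ T, IsOpt nb k n T ∧ ∀ x ∈ T, earlier nb x ≤ k * d * F by
    obtain ⟨T, hT⟩ := exists_isOpt nb k n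
    exact h _ T le_rfl hT
  intro m
  induction m with
  | zero =>
    intro T hm hT
    refine ⟨T, hT, ?_⟩
    intro x hx
    by_contra hc
    have : x ∈ T.filter fun x => ¬ earlier nb x ≤ k * d * F := mem_filter.2 ⟨hx, hc⟩
    rw [card_eq_zero.1 (Nat.le_zero.1 hm)] at this
    simp at this
  | succ m ih =>
    intro T hm hT
    by_cases hall : ∀ x ∈ T, earlier nb x ≤ k * d * F
    · exact ⟨T, hT, hall⟩
    push Not at hall
    obtain ⟨x, hx, hxe⟩ := hall
    have hxn := mem_range.1 (hT.1 hx)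
    set W := (T.erase x).biUnion nb with hW
    have c1 : W.card ≤ k * d := by
      calc W.card ≤ ∑ v ∈ T.erase x, (nb v).card := card_biUnion_le
        _ ≤ ∑ _v ∈ T.erase x, d := sum_le_sum fun v hv =>
            hd v (mem_range.1 (hT.1 (mem_of_mem_erase hv)))
        _ = (T.erase x).card * d := by simp
        _ ≤ _ := Nat.mul_le_mul_right _ (card_erase_le.trans hT.2.1)
    set H := (range n).filter fun x => ¬ Disjoint (nb x) W with hH
    have c2 : H.card ≤ k * d * F := (card_hit_le hF W).trans (Nat.mul_le_mul_right _ c1)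
    set Q := (range x).filter fun x' => (nb x').card = (nb x).card with hQ
    have hne : (Q \ H).Nonempty := by
      obtain ⟨v, h1, h2⟩ := exists_mem_notMem_of_card_lt_card (s := H) (t := Q)
        (lt_of_le_of_lt c2 hxe)
      exact ⟨v, mem_sdiff.2 ⟨h1, h2⟩⟩
    -- The first suitable set: every earlier set of the same size meets `W`, so there are at most `k
    -- d F` of these and `x'` is among the sets that are kept.
    set x' := (Q \ H).min' hne with hx'
    have hx'm := min'_mem (Q \ H) hne
    rw [← hx', mem_sdiff, hQ, mem_filter, mem_range] at hx'm
    obtain ⟨⟨hlt, hdeg⟩, hnH⟩ := hx'm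
    have hdis : Disjoint (nb x') W := by
      by_contra h
      exact hnH (mem_filter.2 ⟨mem_range.2 (by omega), h⟩)
    have hearly : earlier nb x' ≤ k * d * F := by
      refine le_trans (card_le_card ?_) c2
      intro v hv
      simp only [mem_filter, mem_range] at hv
      by_contra hvH
      have : x' ≤ v := min'_le _ _ (mem_sdiff.2 ⟨mem_filter.2 ⟨mem_range.2 (by omega), by omega⟩, hvH⟩)
      omega
    refine ih (insert x' (T.erase x)) ?_ ⟨?_, ?_, ?_⟩
    · have hsub : (insert x' (T.erase x)).filter (fun x => ¬ earlier nb x ≤ k * d * F) ⊂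
          T.filter (fun x => ¬ earlier nb x ≤ k * d * F) := by
        refine ⟨fun v hv => ?_, fun h => ?_⟩
        · simp only [mem_filter, mem_insert, mem_erase] at hv ⊢
          rcases hv.1 with h | h
          · rw [h] at hv; exact absurd hearly hv.2
          · exact ⟨h.2, hv.2⟩
        · have := h (mem_filter.2 ⟨hx, by omega⟩)
          simp only [mem_filter, mem_insert, mem_erase] at this
          omega
      have := card_lt_card hsub
      omega
    · intro v hv
      rcases mem_insert.1 hv with h | h
      · rw [h]; exact mem_range.2 (by omega)
      · exact hT.1 (mem_of_mem_erase h)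
    · have := card_insert_le x' (T.erase x)
      have h2 := card_erase_of_mem hx
      have h3 := hT.2.1
      have : 0 < T.card := card_pos.2 ⟨x, hx⟩
      omega
    · intro T' hT' hk'
      refine (hT.2.2 T' hT' hk').trans ?_
      conv_lhs => rw [← insert_erase hx]
      rw [biUnion_insert_card, biUnion_insert_card, ← hW, sdiff_eq_self_of_disjoint hdis, hdeg]
      exact Nat.add_le_add_left (card_le_card sdiff_subset) _

/-- A set is determined by its size together with its position among the sets of that size. -/
lemma card_earlier_le {n d m : ℕ} (hd : ∀ x < n, (nb x).card ≤ d) :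
    ((range n).filter fun x => earlier nb x ≤ m).card ≤ (d + 1) * (m + 1) := by
  have h := card_le_card_of_injOn (s := (range n).filter fun x => earlier nb x ≤ m)
    (t := range (d + 1) ×ˢ range (m + 1)) (fun x => ((nb x).card, earlier nb x))
    (by
      intro x hx
      have hx := mem_filter.1 (mem_coe.1 hx)
      have := hd x (mem_range.1 hx.1)
      simp only [mem_coe, mem_product, mem_range]
      omega)
    (by
      intro a _ b _ hab
      simp only [Prod.mk.injEq] at hab
      obtain ⟨h1, h2⟩ := hab
      have key : ∀ a b, (nb a).card = (nb b).card → a < b → earlier nb a < earlier nb b := by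
        intro a b h hlt
        apply card_lt_card
        refine ⟨fun v hv => ?_, fun hc => ?_⟩
        · simp only [mem_filter, mem_range] at hv ⊢
          omega
        · have := hc (mem_filter.2 ⟨mem_range.2 hlt, h⟩)
          simp at this
      rcases lt_trichotomy a b with h | h | h
      · have := key a b h1 h; omega
      · exact h
      · have := key b a h1.symm h; omega)
  simpa using h

end Cover

/-! ### Bilinear algorithms and Kronecker powers -/

section Kronecker

open Finset

lemma sum_range_mul_eq {K : Type*} [AddCommMonoid K] (a b : ℕ) (f : ℕ → K) :
    ∑ i ∈ range (a * b), f i = ∑ j ∈ range a, ∑ v ∈ range b, f (j * b + v) := by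
  induction a with
  | zero => simp
  | succ a ih => rw [Nat.succ_mul, sum_range_add, ih, sum_range_succ]

variable {K : Type*} [CommRing K]

/-- Entries of the `L`-th Kronecker power of the `m × n` matrix `Φ`. -/
def kronEntry (m n : ℕ) (Φ : ℕ → ℕ → K) (L T v : ℕ) : K :=
  ∏ i ∈ range L, Φ (T / m ^ i % m) (v / n ^ i % n)

lemma digit_top {m L t T : ℕ} (ht : t < m) (hT : T < m ^ L) : (t * m ^ L + T) / m ^ L % m = t := by
  have : 0 < m ^ L := by omega
  rw [Nat.add_comm, Nat.add_mul_div_right _ _ this, Nat.div_eq_of_lt hT, Nat.zero_add,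
    Nat.mod_eq_of_lt ht]

lemma digit_low {m L t T i : ℕ} (hi : i < L) : (t * m ^ L + T) / m ^ i % m = T / m ^ i % m := by
  rcases Nat.eq_zero_or_pos m with rfl | hm
  · simp [Nat.zero_pow (by omega : 0 < L)]
  · obtain ⟨j, rfl⟩ : ∃ j, L = i + 1 + j := ⟨L - i - 1, by omega⟩
    have : t * m ^ (i + 1 + j) + T = T + m ^ i * (m * (t * m ^ j)) := by ring
    rw [this, Nat.add_mul_div_left _ _ (pow_pos hm i), Nat.add_mul_mod_self_left]

lemma kronEntry_succ {m n : ℕ} (Φ : ℕ → ℕ → K) {L t T v₀ v : ℕ} (ht : t < m) (hT : T < m ^ L)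
    (hv₀ : v₀ < n) (hv : v < n ^ L) :
    kronEntry m n Φ (L + 1) (t * m ^ L + T) (v₀ * n ^ L + v) =
      kronEntry m n Φ L T v * Φ t v₀ := by
  rw [kronEntry, prod_range_succ, digit_top ht hT, digit_top hv₀ hv, kronEntry]
  congr 1
  refine prod_congr rfl fun i hi => ?_
  rw [digit_low (mem_range.1 hi), digit_low (mem_range.1 hi)]

/-- Applying a matrix to one digit after the other applies its Kronecker power. -/
lemma kron_transform {m n L : ℕ} (Φ : ℕ → ℕ → K) (F : ℕ → ℕ → K)
    (hF : ∀ l < L, ∀ i < m * (m ^ l * n ^ (L - l - 1)), F (l + 1) i =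
      ∑ j ∈ range n, Φ (i / (m ^ l * n ^ (L - l - 1))) j *
        F l (i % (m ^ l * n ^ (L - l - 1)) * n + j)) :
    ∀ l ≤ L, ∀ T < m ^ l, ∀ w < n ^ (L - l), F l (T * n ^ (L - l) + w) =
      ∑ v ∈ range (n ^ l), kronEntry m n Φ l T v * F 0 (w * n ^ l + v) := by
  intro l
  induction l with
  | zero =>
    intro _ T hT w _
    have : T = 0 := by simpa using hT
    simp [this, kronEntry]
  | succ l ih =>
    intro hl T hT w hw
    have e1 : L - (l + 1) = L - l - 1 := by omega
    rw [e1] at hw ⊢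
    set P := n ^ (L - l - 1) with hP
    have hm : 0 < m := by
      rcases Nat.eq_zero_or_pos m with rfl | h
      · simp at hT
      · exact h
    -- The last round produces the leading digit of `T`; the remaining digits address the vector of
    -- the round before.
    set t := T / m ^ l with ht
    set T' := T % m ^ l with hT'
    have hTe : T = t * m ^ l + T' := by rw [ht, hT', mul_comm]; exact (Nat.div_add_mod _ _).symm
    have hT'l : T' < m ^ l := Nat.mod_lt _ (pow_pos hm l)
    have htm : t < m := by
      rw [ht, Nat.div_lt_iff_lt_mul (pow_pos hm l), ← pow_succ']; exact hT
    have hidx : T * P + w = t * (m ^ l * P) + (T' * P + w) := by rw [hTe]; ring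
    have hR : T' * P + w < m ^ l * P := by
      calc T' * P + w < T' * P + P := by omega
        _ = (T' + 1) * P := by ring
        _ ≤ _ := Nat.mul_le_mul_right _ hT'l
    have hRpos : 0 < m ^ l * P := by omega
    have hlt : T * P + w < m * (m ^ l * P) := by
      rw [hidx]
      calc _ < t * (m ^ l * P) + m ^ l * P := by omega
        _ = (t + 1) * (m ^ l * P) := by ring
        _ ≤ _ := Nat.mul_le_mul_right _ htm
    rw [hF l (by omega) _ hlt]
    have hdiv : (T * P + w) / (m ^ l * P) = t := by
      rw [hidx, add_comm, Nat.add_mul_div_right _ _ hRpos, Nat.div_eq_of_lt hR, zero_add]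
    have hmod : (T * P + w) % (m ^ l * P) = T' * P + w := by
      rw [hidx, add_comm, Nat.add_mul_mod_self_right, Nat.mod_eq_of_lt hR]
    rw [hdiv, hmod]
    have hPn : n ^ (L - l) = P * n := by
      rw [hP, ← pow_succ]; congr 1; omega
    rw [show n ^ (l + 1) = n * n ^ l from pow_succ' n l, sum_range_mul_eq]
    refine sum_congr rfl fun j hj => ?_
    have hj := mem_range.1 hj
    have hw' : w * n + j < n ^ (L - l) := by
      rw [hPn]
      calc w * n + j < w * n + n := by omega
        _ = (w + 1) * n := by ring
        _ ≤ _ := Nat.mul_le_mul_right _ hw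
    have := ih (by omega) T' hT'l (w * n + j) hw'
    rw [show (T' * P + w) * n + j = T' * n ^ (L - l) + (w * n + j) by rw [hPn]; ring, this,
      mul_sum]
    refine sum_congr rfl fun v hv => ?_
    have hv := mem_range.1 hv
    rw [hTe, kronEntry_succ Φ htm hT'l hj hv,
      show w * (n * n ^ l) + (j * n ^ l + v) = (w * n + j) * n ^ l + v by ring]
    ring

/-- Row and column that belong to a sequence of pairs of digits. -/
def rowIdx (q L v : ℕ) : ℕ := ∑ l ∈ range L, v / (q * q) ^ l % (q * q) / q * q ^ l

def colIdx (q L v : ℕ) : ℕ := ∑ l ∈ range L, v / (q * q) ^ l % (q * q) % q * q ^ l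

lemma rowIdx_succ {q L v₀ v : ℕ} (h₀ : v₀ < q * q) (hv : v < (q * q) ^ L) :
    rowIdx q (L + 1) (v₀ * (q * q) ^ L + v) = v₀ / q * q ^ L + rowIdx q L v := by
  rw [rowIdx, sum_range_succ, digit_top h₀ hv, add_comm, rowIdx]
  congr 1
  refine sum_congr rfl fun i hi => ?_
  rw [digit_low (mem_range.1 hi)]

lemma colIdx_succ {q L v₀ v : ℕ} (h₀ : v₀ < q * q) (hv : v < (q * q) ^ L) :
    colIdx q (L + 1) (v₀ * (q * q) ^ L + v) = v₀ % q * q ^ L + colIdx q L v := by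
  rw [colIdx, sum_range_succ, digit_top h₀ hv, add_comm, colIdx]
  congr 1
  refine sum_congr rfl fun i hi => ?_
  rw [digit_low (mem_range.1 hi)]

lemma exists_idx {q : ℕ} (L : ℕ) : ∀ i < q ^ L, ∀ j < q ^ L,
    ∃ v < (q * q) ^ L, rowIdx q L v = i ∧ colIdx q L v = j := by
  induction L with
  | zero =>
    intro i hi j hj
    refine ⟨0, by simp, ?_, ?_⟩
    · have : i = 0 := by simpa using hi
      simp [rowIdx, this]
    · have : j = 0 := by simpa using hj
      simp [colIdx, this]
  | succ L ih =>
    intro i hi j hj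
    have hq : 0 < q := by
      rcases Nat.eq_zero_or_pos q with rfl | h
      · simp at hi
      · exact h
    have hqL := pow_pos hq L
    obtain ⟨v, hv, h1, h2⟩ := ih (i % q ^ L) (Nat.mod_lt _ hqL) (j % q ^ L) (Nat.mod_lt _ hqL)
    have a1 : i / q ^ L < q := by
      rw [Nat.div_lt_iff_lt_mul hqL, ← pow_succ']; exact hi
    have a2 : j / q ^ L < q := by
      rw [Nat.div_lt_iff_lt_mul hqL, ← pow_succ']; exact hj
    have h0 : i / q ^ L * q + j / q ^ L < q * q := by nlinarith
    have b1 : (i / q ^ L * q + j / q ^ L) / q = i / q ^ L := by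
      rw [add_comm, Nat.add_mul_div_right _ _ hq, Nat.div_eq_of_lt a2, zero_add]
    have b2 : (i / q ^ L * q + j / q ^ L) % q = j / q ^ L := by
      rw [add_comm, Nat.add_mul_mod_self_right, Nat.mod_eq_of_lt a2]
    refine ⟨(i / q ^ L * q + j / q ^ L) * (q * q) ^ L + v, ?_, ?_, ?_⟩
    · rw [pow_succ']
      calc _ < (i / q ^ L * q + j / q ^ L) * (q * q) ^ L + (q * q) ^ L := by omega
        _ = (i / q ^ L * q + j / q ^ L + 1) * (q * q) ^ L := by ring
        _ ≤ _ := Nat.mul_le_mul_right _ h0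
    · rw [rowIdx_succ h0 hv, b1, h1, mul_comm]; exact Nat.div_add_mod _ _
    · rw [colIdx_succ h0 hv, b2, h2, mul_comm]; exact Nat.div_add_mod _ _

lemma rowIdx_lt {q : ℕ} (hq : 0 < q) (L v : ℕ) : rowIdx q L v < q ^ L := by
  induction L with
  | zero => simp [rowIdx]
  | succ L ih =>
    rw [rowIdx, sum_range_succ]
    change rowIdx q L v + _ < _
    have : v / (q * q) ^ L % (q * q) / q < q :=
      (Nat.div_lt_iff_lt_mul hq).2 (Nat.mod_lt _ (Nat.mul_pos hq hq))
    calc _ < q ^ L + v / (q * q) ^ L % (q * q) / q * q ^ L := by omega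
      _ = (v / (q * q) ^ L % (q * q) / q + 1) * q ^ L := by ring
      _ ≤ q * q ^ L := Nat.mul_le_mul_right _ this
      _ = _ := (pow_succ' q L).symm

lemma colIdx_lt {q : ℕ} (hq : 0 < q) (L v : ℕ) : colIdx q L v < q ^ L := by
  induction L with
  | zero => simp [colIdx]
  | succ L ih =>
    rw [colIdx, sum_range_succ]
    change colIdx q L v + _ < _
    have : v / (q * q) ^ L % (q * q) % q < q := Nat.mod_lt _ hq
    calc _ < q ^ L + v / (q * q) ^ L % (q * q) % q * q ^ L := by omega
      _ = (v / (q * q) ^ L % (q * q) % q + 1) * q ^ L := by ring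
      _ ≤ q * q ^ L := Nat.mul_le_mul_right _ this
      _ = _ := (pow_succ' q L).symm

/-- `α, β, γ` are the coefficients of a bilinear algorithm for `D` times the product of
`q × q` matrices, with pairs of indices encoded as numbers below `q * q`. -/
def IsBilinearAlg (q r : ℕ) (D : K) (α β γ : ℕ → ℕ → K) : Prop :=
  ∀ e < q * q, ∀ v < q * q, ∀ w < q * q, ∑ t ∈ range r, γ t e * α t v * β t w =
    if v / q = e / q ∧ v % q = w / q ∧ w % q = e % q then D else 0

/-- The tensor identity leaves only those pairs `(v, w)` in which the column of `v` is the row of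
`w`, namely the terms of one entry of a product. `Z` is arbitrary, so that its values may themselves
be products of blocks. -/
lemma IsBilinearAlg.sum_sum {q r : ℕ} {D : K} {α β γ : ℕ → ℕ → K} (h : IsBilinearAlg q r D α β γ)
    {e : ℕ} (he : e < q * q) (Z : ℕ → ℕ → K) :
    ∑ v ∈ range (q * q), ∑ w ∈ range (q * q), (∑ t ∈ range r, γ t e * α t v * β t w) * Z v w =
      D * ∑ c ∈ range q, Z (e / q * q + c) (c * q + e % q) := by
  have hq : 0 < q := by
    rcases Nat.eq_zero_or_pos q with rfl | h
    · simp at he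
    · exact h
  have ha : e / q < q := (Nat.div_lt_iff_lt_mul hq).2 he
  have hb : e % q < q := Nat.mod_lt _ hq
  have d1 : ∀ a b, b < q → (a * q + b) / q = a := by
    intro a b hb
    rw [add_comm, Nat.add_mul_div_right _ _ hq, Nat.div_eq_of_lt hb, zero_add]
  have d2 : ∀ a b, b < q → (a * q + b) % q = b := by
    intro a b hb
    rw [add_comm, Nat.add_mul_mod_self_right, Nat.mod_eq_of_lt hb]
  have d3 : ∀ a b, a < q → b < q → a * q + b < q * q := by
    intro a b ha hb; nlinarith
  rw [sum_range_mul_eq, sum_eq_single (e / q)]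
  · rw [mul_sum]
    refine sum_congr rfl fun c hc => ?_
    have hc := mem_range.1 hc
    rw [sum_range_mul_eq, sum_eq_single c]
    · rw [sum_eq_single (e % q)]
      · rw [h e he _ (d3 _ _ ha hc) _ (d3 _ _ hc hb), d1 _ _ hc, d1 _ _ hb, d2 _ _ hc, d2 _ _ hb]
        simp
      · intro b hb' hne
        have hb' := mem_range.1 hb'
        rw [h e he _ (d3 _ _ ha hc) _ (d3 _ _ hc hb'), if_neg, zero_mul]
        rw [d2 _ _ hb']; tauto
      · intro h; exact absurd (mem_range.2 hb) h
    · intro a ha' hne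
      have ha' := mem_range.1 ha'
      refine sum_eq_zero fun b hb' => ?_
      have hb' := mem_range.1 hb'
      rw [h e he _ (d3 _ _ ha hc) _ (d3 _ _ ha' hb'), if_neg, zero_mul]
      rw [d2 _ _ hc, d1 _ _ hb']; tauto
    · intro h; exact absurd (mem_range.2 hc) h
  · intro a ha' hne
    have ha' := mem_range.1 ha'
    refine sum_eq_zero fun c hc => sum_eq_zero fun w hw => ?_
    have hc := mem_range.1 hc
    rw [h e he _ (d3 _ _ ha' hc) _ (mem_range.1 hw), if_neg, zero_mul]
    rw [d1 _ _ hc]; tauto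
  · intro h; exact absurd (mem_range.2 ha) h

/-- The Kronecker power of a bilinear algorithm multiplies matrices of size `q ^ L`. -/
lemma IsBilinearAlg.kron {q r : ℕ} {D : K} {α β γ : ℕ → ℕ → K} (h : IsBilinearAlg q r D α β γ)
    (L : ℕ) : ∀ (X Y : ℕ → ℕ → K), ∀ e < (q * q) ^ L,
      ∑ T ∈ range (r ^ L), kronEntry (q * q) r (fun e t => γ t e) L e T *
        ((∑ v ∈ range ((q * q) ^ L), kronEntry r (q * q) α L T v * X (rowIdx q L v) (colIdx q L v)) *
        (∑ w ∈ range ((q * q) ^ L), kronEntry r (q * q) β L T w * Y (rowIdx q L w) (colIdx q L w))) =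
      D ^ L * ∑ c ∈ range (q ^ L), X (rowIdx q L e) c * Y c (colIdx q L e) := by
  induction L with
  | zero =>
    intro X Y e he
    simp [kronEntry, rowIdx, colIdx]
  | succ L ih =>
    intro X Y e he
    have hqq : 0 < q * q := by
      rcases Nat.eq_zero_or_pos (q * q) with h | h
      · rw [h] at he; simp at he
      · exact h
    set N := (q * q) ^ L with hN
    have hNpos : 0 < N := pow_pos hqq L
    set e₀ := e / N with he₀
    set e' := e % N with he'
    have hee : e = e₀ * N + e' := by rw [he₀, he', mul_comm]; exact (Nat.div_add_mod _ _).symm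
    have he'l : e' < N := Nat.mod_lt _ hNpos
    have he₀l : e₀ < q * q := by
      rw [he₀, Nat.div_lt_iff_lt_mul hNpos, hN, ← pow_succ']; exact he
    have split : ∀ (β : ℕ → ℕ → K) (Y : ℕ → ℕ → K), ∀ t < r, ∀ T < r ^ L,
        ∑ w ∈ range ((q * q) ^ (L + 1)), kronEntry r (q * q) β (L + 1) (t * r ^ L + T) w *
          Y (rowIdx q (L + 1) w) (colIdx q (L + 1) w) =
        ∑ w₀ ∈ range (q * q), β t w₀ * ∑ w ∈ range N, kronEntry r (q * q) β L T w *
          Y (w₀ / q * q ^ L + rowIdx q L w) (w₀ % q * q ^ L + colIdx q L w) := by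
      intro β Y t ht T hT
      rw [pow_succ' (q * q) L, sum_range_mul_eq]
      refine sum_congr rfl fun w₀ hw₀ => ?_
      rw [mul_sum]
      refine sum_congr rfl fun w hw => ?_
      have hw₀ := mem_range.1 hw₀
      have hw := mem_range.1 hw
      rw [kronEntry_succ β ht hT hw₀ hw, rowIdx_succ hw₀ hw, colIdx_succ hw₀ hw]
      ring
    -- The leading digit selects one of `q * q` blocks. The induction hypothesis multiplies blocks,
    -- and the base algorithm combines the block products.
    set X' : ℕ → ℕ → ℕ → K := fun v₀ a b => X (v₀ / q * q ^ L + a) (v₀ % q * q ^ L + b) with hX'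
    set Y' : ℕ → ℕ → ℕ → K := fun v₀ a b => Y (v₀ / q * q ^ L + a) (v₀ % q * q ^ L + b) with hY'
    set A : ℕ → ℕ → K := fun T v₀ => ∑ v ∈ range N, kronEntry r (q * q) α L T v *
      X' v₀ (rowIdx q L v) (colIdx q L v) with hA
    set B : ℕ → ℕ → K := fun T v₀ => ∑ v ∈ range N, kronEntry r (q * q) β L T v *
      Y' v₀ (rowIdx q L v) (colIdx q L v) with hB
    have step1 : ∑ T ∈ range (r ^ (L + 1)), kronEntry (q * q) r (fun e t => γ t e) (L + 1) e T *
        ((∑ v ∈ range ((q * q) ^ (L + 1)), kronEntry r (q * q) α (L + 1) T v *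
          X (rowIdx q (L + 1) v) (colIdx q (L + 1) v)) *
        (∑ w ∈ range ((q * q) ^ (L + 1)), kronEntry r (q * q) β (L + 1) T w *
          Y (rowIdx q (L + 1) w) (colIdx q (L + 1) w))) =
        ∑ v₀ ∈ range (q * q), ∑ w₀ ∈ range (q * q),
          (∑ t ∈ range r, γ t e₀ * α t v₀ * β t w₀) *
          ∑ T ∈ range (r ^ L), kronEntry (q * q) r (fun e t => γ t e) L e' T *
            (A T v₀ * B T w₀) := by
      rw [pow_succ' r L, sum_range_mul_eq]
      calc _ = ∑ t ∈ range r, ∑ T ∈ range (r ^ L), ∑ v₀ ∈ range (q * q), ∑ w₀ ∈ range (q * q),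
            (γ t e₀ * α t v₀ * β t w₀) * (kronEntry (q * q) r (fun e t => γ t e) L e' T *
            (A T v₀ * B T w₀)) := by
            refine sum_congr rfl fun t ht => sum_congr rfl fun T hT => ?_
            have ht := mem_range.1 ht
            have hT := mem_range.1 hT
            rw [split α X t ht T hT, split β Y t ht T hT, hee,
              kronEntry_succ (fun e t => γ t e) he₀l he'l ht hT, sum_mul_sum, mul_sum]
            refine sum_congr rfl fun v₀ _ => ?_
            rw [mul_sum]
            refine sum_congr rfl fun w₀ _ => ?_
            simp only [hA, hB, hX', hY']
            ring
        _ = ∑ v₀ ∈ range (q * q), ∑ w₀ ∈ range (q * q), ∑ t ∈ range r, ∑ T ∈ range (r ^ L),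
            (γ t e₀ * α t v₀ * β t w₀) * (kronEntry (q * q) r (fun e t => γ t e) L e' T *
            (A T v₀ * B T w₀)) := by
            have : ∀ t ∈ range r, ∑ T ∈ range (r ^ L), ∑ v₀ ∈ range (q * q), ∑ w₀ ∈ range (q * q),
                (γ t e₀ * α t v₀ * β t w₀) * (kronEntry (q * q) r (fun e t => γ t e) L e' T *
                (A T v₀ * B T w₀)) = ∑ v₀ ∈ range (q * q), ∑ w₀ ∈ range (q * q),
                ∑ T ∈ range (r ^ L), (γ t e₀ * α t v₀ * β t w₀) *
                (kronEntry (q * q) r (fun e t => γ t e) L e' T * (A T v₀ * B T w₀)) := by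
              intro t _
              rw [sum_comm]
              exact sum_congr rfl fun v₀ _ => sum_comm
            rw [sum_congr rfl this, sum_comm]
            exact sum_congr rfl fun v₀ _ => sum_comm
        _ = _ := by
            refine sum_congr rfl fun v₀ _ => sum_congr rfl fun w₀ _ => ?_
            rw [sum_mul]
            exact sum_congr rfl fun t _ => (mul_sum _ _ _).symm
    rw [step1]
    have step2 : ∀ v₀ w₀, ∑ T ∈ range (r ^ L), kronEntry (q * q) r (fun e t => γ t e) L e' T *
        (A T v₀ * B T w₀) = D ^ L * ∑ c ∈ range (q ^ L), X' v₀ (rowIdx q L e') c *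
          Y' w₀ c (colIdx q L e') := fun v₀ w₀ => ih (X' v₀) (Y' w₀) e' he'l
    simp only [step2]
    rw [h.sum_sum he₀l (fun v₀ w₀ => D ^ L * ∑ c ∈ range (q ^ L), X' v₀ (rowIdx q L e') c *
          Y' w₀ c (colIdx q L e')), ← mul_sum, ← mul_assoc, ← pow_succ']
    congr 1
    rw [pow_succ' q L, sum_range_mul_eq]
    refine sum_congr rfl fun c₀ hc₀ => sum_congr rfl fun c _ => ?_
    have hc₀ := mem_range.1 hc₀
    have hq : 0 < q := by omega
    rw [hee, rowIdx_succ he₀l he'l, colIdx_succ he₀l he'l]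
    simp only [hX', hY']
    rw [add_comm (e₀ / q * q) c₀, Nat.add_mul_div_right _ _ hq, Nat.div_eq_of_lt hc₀, zero_add,
      Nat.add_mul_mod_self_right, Nat.mod_eq_of_lt hc₀, add_comm (c₀ * q) (e₀ % q),
      Nat.add_mul_div_right _ _ hq, Nat.div_eq_of_lt (Nat.mod_lt _ hq), zero_add,
      Nat.add_mul_mod_self_right, Nat.mod_mod]

end Kronecker

lemma exists_clear_denominators {ι : Type*} (s : Finset ι) (f : ι → ℚ) :
    ∃ d : ℕ, 0 < d ∧ ∀ i ∈ s, ∃ z : ℤ, (z : ℚ) = d * f i := by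
  classical
  induction s using Finset.induction_on with
  | empty => exact ⟨1, one_pos, by simp⟩
  | insert a s _ ih =>
    obtain ⟨d, hd, h⟩ := ih
    refine ⟨d * (f a).den, Nat.mul_pos hd (f a).den_pos, ?_⟩
    intro i hi
    rcases Finset.mem_insert.1 hi with rfl | hi
    · refine ⟨d * (f i).num, ?_⟩
      push_cast
      have := Rat.mul_den_eq_num (f i)
      rw [mul_assoc, mul_comm ((f i).den : ℚ), this]
    · obtain ⟨z, hz⟩ := h i hi
      refine ⟨(f a).den * z, ?_⟩
      push_cast
      rw [hz]; ring

/-- A common denominator `d` of all coefficients makes them integral. Each of the three families is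
scaled by `d`, so the product comes out multiplied by `d ^ 3`. -/
lemma MatMulRankLE.exists_bilinearAlg {q r : ℕ} (h : MatMulRankLE q r) :
    ∃ (d : ℕ) (α β γ : ℕ → ℕ → ℤ), 0 < d ∧ IsBilinearAlg q r (d : ℤ) α β γ := by
  obtain ⟨α, β, γ, h⟩ := h
  let F : Fin 3 → Fin r → Fin q → Fin q → ℚ :=
    ![fun t i j => α t i j, fun t i j => β t i j, fun t i j => γ t i j]
  obtain ⟨d, hd, hint⟩ := exists_clear_denominators
    (Finset.univ : Finset (Fin 3 × Fin r × Fin q × Fin q))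
    (fun i => F i.1 i.2.1 i.2.2.1 i.2.2.2)
  choose z hz using fun i => hint i (Finset.mem_univ i)
  let Z : Fin 3 → ℕ → ℕ → ℤ := fun s t v =>
    if ht : t < r then if hv : v < q * q then
      z (s, ⟨t, ht⟩, ⟨v / q, (Nat.div_lt_iff_lt_mul (Nat.pos_of_ne_zero (by
        rintro rfl; simp at hv))).2 hv⟩, ⟨v % q, Nat.mod_lt _ (Nat.pos_of_ne_zero (by
        rintro rfl; simp at hv))⟩) else 0 else 0
  refine ⟨d ^ 3, Z 0, Z 1, Z 2, pow_pos hd 3, ?_⟩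
  intro e he v hv w hw
  have hq : 0 < q := Nat.pos_of_ne_zero (by rintro rfl; simp at he)
  have dv : ∀ v, v < q * q → v / q < q := fun v hv => (Nat.div_lt_iff_lt_mul hq).2 hv
  have md : ∀ v, v % q < q := fun v => Nat.mod_lt _ hq
  have hZ : ∀ (s : Fin 3) (t : Fin r) (v : ℕ) (hv : v < q * q), (Z s t v : ℚ) =
      d * F s t ⟨v / q, dv v hv⟩ ⟨v % q, md v⟩ := by
    intro s t v hv
    simp only [Z, t.2, hv, dif_pos]
    exact hz (s, t, ⟨v / q, dv v hv⟩, ⟨v % q, md v⟩)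
  rw [← Int.cast_inj (α := ℚ)]
  push_cast
  rw [Finset.sum_range fun t => (Z 2 t e : ℚ) * (Z 0 t v : ℚ) * (Z 1 t w : ℚ)]
  simp only [hZ 2 _ e he, hZ 0 _ v hv, hZ 1 _ w hw]
  -- Evaluation at two matrix units extracts a single coefficient of the tensor.
  have key := congrFun (congrFun (h (Matrix.single ⟨v / q, dv v hv⟩ ⟨v % q, md v⟩ 1)
    (Matrix.single ⟨w / q, dv w hw⟩ ⟨w % q, md w⟩ 1)) ⟨e / q, dv e he⟩) ⟨e % q, md e⟩
  simp only [Matrix.sum_apply, Matrix.smul_apply, smul_eq_mul, Matrix.single_apply, mul_ite,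
    mul_one, mul_zero] at key
  have one : ∀ (f : Fin q → Fin q → ℚ) (a b : Fin q),
      ∑ i, ∑ j, (if a = i ∧ b = j then f i j else 0) = f a b := by
    intro f a b
    rw [Finset.sum_eq_single a, Finset.sum_eq_single b] <;> simp +contextual
    · intro c hc; simp [Ne.symm hc]
    · intro c hc; simp [Ne.symm hc]
  have oneα : ∀ t, ∑ i, ∑ j, (if (⟨v / q, dv v hv⟩ : Fin q) = i ∧ (⟨v % q, md v⟩ : Fin q) = j
      then α t i j else 0) = α t ⟨v / q, dv v hv⟩ ⟨v % q, md v⟩ :=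
    fun t => one (fun i j => α t i j) _ _
  have oneβ : ∀ t, ∑ i, ∑ j, (if (⟨w / q, dv w hw⟩ : Fin q) = i ∧ (⟨w % q, md w⟩ : Fin q) = j
      then β t i j else 0) = β t ⟨w / q, dv w hw⟩ ⟨w % q, md w⟩ :=
    fun t => one (fun i j => β t i j) _ _
  simp only [oneα, oneβ] at key
  have e1 : ∑ t, (d : ℚ) * F 2 t ⟨e / q, dv e he⟩ ⟨e % q, md e⟩ *
      (d * F 0 t ⟨v / q, dv v hv⟩ ⟨v % q, md v⟩) *
      (d * F 1 t ⟨w / q, dv w hw⟩ ⟨w % q, md w⟩) = d ^ 3 *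
      ∑ t, α t ⟨v / q, dv v hv⟩ ⟨v % q, md v⟩ * β t ⟨w / q, dv w hw⟩ ⟨w % q, md w⟩ *
        γ t ⟨e / q, dv e he⟩ ⟨e % q, md e⟩ := by
    rw [Finset.mul_sum]
    refine Finset.sum_congr rfl fun t _ => ?_
    simp only [F, Matrix.cons_val]
    ring
  rw [e1, ← key, Matrix.mul_apply]
  simp only [Matrix.single_apply]
  by_cases hc : v / q = e / q ∧ v % q = w / q ∧ w % q = e % q
  · rw [if_pos hc, Finset.sum_eq_single ⟨v % q, md v⟩]
    · simp [hc.1, hc.2.1, hc.2.2]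
    · intro b _ hb
      rw [if_neg (fun h' => hb h'.2.symm), zero_mul]
    · simp
  · rw [if_neg hc]
    rw [Finset.sum_eq_zero, mul_zero]
    intro b _
    by_cases h1 : (⟨v / q, dv v hv⟩ : Fin q) = ⟨e / q, dv e he⟩ ∧ (⟨v % q, md v⟩ : Fin q) = b
    · rw [if_pos h1, if_neg, mul_zero]
      rintro ⟨h2, h3⟩
      apply hc
      rw [← h1.2] at h2
      simp only [Fin.mk.injEq] at h1 h2 h3
      exact ⟨h1.1, h2.symm, h3⟩
    · rw [if_neg h1, zero_mul]

/-- The `r` linear forms in the left factor determine it, because multiplication by the identity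
recovers it. The bound ensures that no intermediate vector of a Kronecker transform is longer than
`r ^ L`. -/
lemma MatMulRankLE.mul_self_le {q r : ℕ} (h : MatMulRankLE q r) : q * q ≤ r := by
  obtain ⟨α, β, γ, h⟩ := h
  let f : Matrix (Fin q) (Fin q) ℚ →ₗ[ℚ] (Fin r → ℚ) :=
    { toFun := fun A t => ∑ i, ∑ j, α t i j * A i j
      map_add' := by
        intro A B; funext t
        simp [mul_add, Finset.sum_add_distrib]
      map_smul' := by
        intro c A; funext t
        simp only [Matrix.smul_apply, smul_eq_mul, RingHom.id_apply, Pi.smul_apply,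
          Finset.mul_sum]
        refine Finset.sum_congr rfl fun i _ => Finset.sum_congr rfl fun j _ => ?_
        ring }
  have hf : Function.Injective f := by
    rw [injective_iff_map_eq_zero]
    intro A hA
    have h1 := h A 1
    have h2 : ∀ t, ∑ i, ∑ j, α t i j * A i j = 0 := fun t => congrFun hA t
    simpa [h2] using h1
  have := LinearMap.finrank_le_finrank_of_injective hf
  simpa [Module.finrank_matrix] using this

/-- The schoolbook algorithm. It makes the set that defines `matMulExponent` nonempty, without which
its infimum would say nothing. -/
lemma matMulRankLE_two : MatMulRankLE 2 8 := by
  let ε : Fin 8 ≃ Fin 2 × Fin 2 × Fin 2 :=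
    (Fintype.equivFinOfCardEq (by simp)).symm
  refine ⟨fun t => Matrix.single (ε t).1 (ε t).2.1 1, fun t => Matrix.single (ε t).2.1 (ε t).2.2 1,
    fun t => Matrix.single (ε t).1 (ε t).2.2 1, fun A B => ?_⟩
  rw [Equiv.sum_comp ε (fun s => ((∑ i, ∑ j, (Matrix.single s.1 s.2.1 (1 : ℚ)) i j * A i j) *
    (∑ i, ∑ j, (Matrix.single s.2.1 s.2.2 (1 : ℚ)) i j * B i j)) • Matrix.single s.1 s.2.2 (1 : ℚ))]
  ext i j
  fin_cases i <;> fin_cases j <;>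
    simp [Fintype.sum_prod_type, Fin.sum_univ_two, Matrix.mul_apply, Matrix.single_apply]

/-- There are bilinear algorithms with exponent arbitrarily close to the infimum. -/
lemma exists_matMulRankLE {δ : ℝ} (hδ : 0 < δ) : ∃ q r : ℕ, 2 ≤ q ∧ MatMulRankLE q r ∧
    (r : ℝ) ≤ (q : ℝ) ^ (matMulExponent + δ) := by
  have hne : {τ : ℝ | ∃ q r : ℕ, 2 ≤ q ∧ MatMulRankLE q r ∧ (r : ℝ) ≤ (q : ℝ) ^ τ}.Nonempty :=
    ⟨3, 2, 8, le_rfl, matMulRankLE_two, by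
      rw [show (3 : ℝ) = ((3 : ℕ) : ℝ) by norm_num, Real.rpow_natCast]; norm_num⟩
  obtain ⟨τ, ⟨q, r, h1, h2, h3⟩, hτ⟩ := Real.lt_sInf_add_pos hne hδ
  refine ⟨q, r, h1, h2, h3.trans (Real.rpow_le_rpow_of_exponent_le ?_ hτ.le)⟩
  exact_mod_cast (by omega : 1 ≤ q)

end

section

/-! ### Derived proof rules -/

namespace BExpr

/-- The expression evaluates to `v`, all sums having at most `R` terms. -/
def Ev (R : ℕ) (τ : RamState) (e : BExpr) (v : ℕ) : Prop := e.SumsLE R τ ∧ e.eval τ = v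

/-- The expression is nonzero if and only if `P` holds. -/
def Tst (R : ℕ) (τ : RamState) (e : BExpr) (P : Prop) : Prop := e.SumsLE R τ ∧ (e.eval τ ≠ 0 ↔ P)

abbrev add (a b : BExpr) : BExpr := op .add a b
abbrev sub (a b : BExpr) : BExpr := op .sub a b
abbrev mul (a b : BExpr) : BExpr := op .mul a b
abbrev div (a b : BExpr) : BExpr := op .div a b
abbrev mod (a b : BExpr) : BExpr := op .mod a b
abbrev lt (a b : BExpr) : BExpr := op .lt a b
abbrev eq (a b : BExpr) : BExpr := op .eq a b
abbrev le (a b : BExpr) : BExpr := op .lt a (op .add b (const 1))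
abbrev not (a : BExpr) : BExpr := op .eq a (const 0)

/-- The number of `i` below the value of `b` for which `e` is nonzero. -/
abbrev count (x : ℕ) (b e : BExpr) : BExpr := sum x b (op .lt (const 0) e)

variable {R : ℕ} {τ : RamState} {a b e : BExpr} {v w : ℕ} {P Q : Prop}

lemma Ev.const : Ev R τ (.const v) v := ⟨trivial, rfl⟩
lemma Ev.reg {x : ℕ} : Ev R τ (.reg x) (τ.reg x) := ⟨trivial, rfl⟩
lemma Ev.reg' {x : ℕ} (h : τ.reg x = v) : Ev R τ (.reg x) v := ⟨trivial, h⟩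
lemma Ev.get {x : ℕ} (h : Ev R τ a v) : Ev R τ (.get x a) (τ.arr x v) :=
  ⟨h.1, by simp [eval, h.2]⟩
lemma Ev.get' {x : ℕ} (h : Ev R τ a v) (h' : τ.arr x v = w) : Ev R τ (.get x a) w :=
  ⟨h.1, by simp [eval, h.2, h']⟩
lemma Ev.add (ha : Ev R τ a v) (hb : Ev R τ b w) : Ev R τ (a.add b) (v + w) :=
  ⟨⟨ha.1, hb.1⟩, by simp [eval, RamOp.eval, ha.2, hb.2]⟩
lemma Ev.sub (ha : Ev R τ a v) (hb : Ev R τ b w) : Ev R τ (a.sub b) (v - w) :=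
  ⟨⟨ha.1, hb.1⟩, by simp [eval, RamOp.eval, ha.2, hb.2]⟩
lemma Ev.mul (ha : Ev R τ a v) (hb : Ev R τ b w) : Ev R τ (a.mul b) (v * w) :=
  ⟨⟨ha.1, hb.1⟩, by simp [eval, RamOp.eval, ha.2, hb.2]⟩
lemma Ev.div (ha : Ev R τ a v) (hb : Ev R τ b w) : Ev R τ (a.div b) (v / w) :=
  ⟨⟨ha.1, hb.1⟩, by simp [eval, RamOp.eval, ha.2, hb.2]⟩
lemma Ev.mod (ha : Ev R τ a v) (hb : Ev R τ b w) : Ev R τ (a.mod b) (v % w) :=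
  ⟨⟨ha.1, hb.1⟩, by simp [eval, RamOp.eval, ha.2, hb.2]⟩

lemma Ev.sum {x n : ℕ} {f : ℕ → ℕ} (hb : Ev R τ b n) (hn : n ≤ R)
    (he : ∀ i < n, Ev R (τ.setReg x i) e (f i)) : Ev R τ (.sum x b e) (∑ i ∈ Finset.range n, f i) := by
  obtain ⟨h1, h2⟩ := hb
  refine ⟨⟨h1, by omega, fun i hi => (he i (by omega)).1⟩, ?_⟩
  simp only [eval, h2]
  exact Finset.sum_congr rfl fun i hi => (he i (Finset.mem_range.1 hi)).2

lemma Ev.congr (h : Ev R τ a v) (hv : v = w) : Ev R τ a w := hv ▸ h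

lemma Ev.count {x n : ℕ} {P : ℕ → Prop} [DecidablePred P] (hb : Ev R τ b n) (hn : n ≤ R)
    (he : ∀ i < n, Tst R (τ.setReg x i) e (P i)) :
    Ev R τ (.count x b e) ((Finset.range n).filter P).card := by
  rw [Finset.card_filter]
  refine Ev.sum hb hn fun i hi => ⟨⟨trivial, (he i hi).1⟩, ?_⟩
  simp only [eval, RamOp.eval, Nat.pos_iff_ne_zero]
  exact if_congr (he i hi).2 rfl rfl

lemma Tst.lt (ha : Ev R τ a v) (hb : Ev R τ b w) : Tst R τ (a.lt b) (v < w) :=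
  ⟨⟨ha.1, hb.1⟩, by simp [eval, RamOp.eval, ha.2, hb.2]⟩
lemma Tst.le (ha : Ev R τ a v) (hb : Ev R τ b w) : Tst R τ (a.le b) (v ≤ w) :=
  ⟨⟨ha.1, hb.1, trivial⟩, by simp [eval, RamOp.eval, ha.2, hb.2]⟩
lemma Tst.eq (ha : Ev R τ a v) (hb : Ev R τ b w) : Tst R τ (a.eq b) (v = w) :=
  ⟨⟨ha.1, hb.1⟩, by simp [eval, RamOp.eval, ha.2, hb.2]⟩
lemma Tst.not (ha : Tst R τ a P) : Tst R τ (a.not) (¬ P) :=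
  ⟨⟨ha.1, trivial⟩, by
    rw [← ha.2]; by_cases h : a.eval τ = 0 <;> simp [eval, RamOp.eval, h]⟩
lemma Tst.and (ha : Tst R τ a P) (hb : Tst R τ b Q) : Tst R τ (a.mul b) (P ∧ Q) :=
  ⟨⟨ha.1, hb.1⟩, by rw [← ha.2, ← hb.2]; simp [eval, RamOp.eval]⟩
lemma Tst.or (ha : Tst R τ a P) (hb : Tst R τ b Q) : Tst R τ (a.add b) (P ∨ Q) :=
  ⟨⟨ha.1, hb.1⟩, by rw [← ha.2, ← hb.2]; simp [eval, RamOp.eval]; tauto⟩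
lemma Tst.ne_zero (ha : Ev R τ a v) : Tst R τ a (v ≠ 0) := ⟨ha.1, by rw [ha.2]⟩
lemma Tst.ex {x n : ℕ} {P : ℕ → Prop} (hb : Ev R τ b n) (hn : n ≤ R)
    (he : ∀ i < n, Tst R (τ.setReg x i) e (P i)) : Tst R τ (.sum x b e) (∃ i < n, P i) := by
  obtain ⟨h1, h2⟩ := hb
  refine ⟨⟨h1, by omega, fun i hi => (he i (by omega)).1⟩, ?_⟩
  simp only [eval, h2, ne_eq, Finset.sum_eq_zero_iff, Finset.mem_range, not_forall]
  constructor
  · rintro ⟨i, hi, h⟩; exact ⟨i, hi, (he i hi).2.1 h⟩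
  · rintro ⟨i, hi, h⟩; exact ⟨i, hi, (he i hi).2.2 h⟩
lemma Tst.iff (h : Tst R τ a P) (hPQ : P ↔ Q) : Tst R τ a Q := ⟨h.1, h.2.trans hPQ⟩

lemma tb_le {R : ℕ} (hR : 1 ≤ R) (e : BExpr) : e.tb R ≤ e.tb 1 * R ^ e.depth := by
  have one : ∀ d, 1 ≤ R ^ d := fun d => Nat.one_le_pow _ _ hR
  induction e with
  | const v => simp [tb, depth]
  | reg x => simp [tb, depth]
  | get a i ih => simp only [tb, depth]; nlinarith [one i.depth]
  | op o e₁ e₂ ih₁ ih₂ =>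
    simp only [tb, depth]
    have a1 := Nat.mul_le_mul_left (e₁.tb 1)
      (Nat.pow_le_pow_right hR (le_max_left e₁.depth e₂.depth))
    have a2 := Nat.mul_le_mul_left (e₂.tb 1)
      (Nat.pow_le_pow_right hR (le_max_right e₁.depth e₂.depth))
    nlinarith [one (max e₁.depth e₂.depth)]
  | sum x b e ih₁ ih₂ =>
    simp only [tb, depth]
    have a1 := Nat.mul_le_mul_left (b.tb 1)
      (Nat.pow_le_pow_right hR (le_max_left b.depth (e.depth + 1)))
    have a2 := Nat.mul_le_mul_left (e.tb 1 + 12)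
      (Nat.pow_le_pow_right hR (le_max_right b.depth (e.depth + 1)))
    have a3 : R * (e.tb R + 12) ≤ (e.tb 1 + 12) * R ^ (e.depth + 1) := by
      rw [pow_succ]; nlinarith [one e.depth]
    nlinarith [one (max b.depth (e.depth + 1))]

end BExpr

namespace BProg

/-- Loops with variables from `100` on are long. -/
def loopBound (R W x : ℕ) : ℕ := if x < 100 then R else W

/-- A time bound if all sums and short loops have length at most `R` and long loops length at most
`W`. -/
def time (R W : ℕ) : BProg → ℕ
  | skip => 1
  | assign _ e => e.tb R + 2
  | store _ i e => i.tb R + e.tb R + 3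
  | seq p q => p.time R W + q.time R W
  | ite e p q => e.tb R + (p.time R W + q.time R W) + 2
  | loop x b p => b.tb R + loopBound R W x * (p.time R W + 10) + 6

/-- The degree of the time bound in `R`. -/
def rd : BProg → ℕ
  | skip => 0
  | assign _ e => e.depth
  | store _ i e => max i.depth e.depth
  | seq p q => max p.rd q.rd
  | ite e p q => max e.depth (max p.rd q.rd)
  | loop x b p => max b.depth (p.rd + if x < 100 then 1 else 0)

/-- The degree of the time bound in `W`. -/
def wd : BProg → ℕ
  | skip => 0
  | assign _ _ => 0
  | store _ _ _ => 0
  | seq p q => max p.wd q.wd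
  | ite _ p q => max p.wd q.wd
  | loop x _ p => p.wd + if x < 100 then 0 else 1

lemma time_le {R W a b : ℕ} (hR : 1 ≤ R) (hW : 1 ≤ W) (p : BProg) :
    p.rd ≤ a → p.wd ≤ b → p.time R W ≤ p.time 1 1 * (R ^ a * W ^ b) := by
  have one : ∀ a b, 1 ≤ R ^ a * W ^ b := fun a b =>
    Nat.one_le_iff_ne_zero.2 (Nat.mul_ne_zero (pow_pos hR a).ne' (pow_pos hW b).ne')
  have ex : ∀ (e : BExpr) a b, e.depth ≤ a → e.tb R ≤ e.tb 1 * (R ^ a * W ^ b) := by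
    intro e a b h
    refine (e.tb_le hR).trans (Nat.mul_le_mul_left _ ?_)
    calc R ^ e.depth ≤ R ^ a := Nat.pow_le_pow_right hR h
      _ ≤ _ := Nat.le_mul_of_pos_right _ (pow_pos hW b)
  induction p generalizing a b with
  | skip => intro _ _; simpa [time] using one a b
  | assign x e =>
    intro h _
    simp only [rd, time] at h ⊢
    nlinarith [ex e a b h, one a b]
  | store x i e =>
    intro h _
    simp only [rd, time, max_le_iff] at h ⊢
    nlinarith [ex e a b h.2, ex i a b h.1, one a b]
  | seq p q ih₁ ih₂ =>
    intro h h'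
    simp only [rd, wd, time, max_le_iff] at h h' ⊢
    nlinarith [ih₁ h.1 h'.1, ih₂ h.2 h'.2]
  | ite e p q ih₁ ih₂ =>
    intro h h'
    simp only [rd, wd, time, max_le_iff] at h h' ⊢
    nlinarith [ih₁ h.2.1 h'.1, ih₂ h.2.2 h'.2, ex e a b h.1, one a b]
  | loop x e p ih =>
    intro h h'
    simp only [rd, wd, time, max_le_iff, loopBound] at h h' ⊢
    have h1 := ex e a b h.1
    by_cases hx : x < 100
    · simp only [hx, if_true] at h h' ⊢
      obtain ⟨a, rfl⟩ : ∃ a', a = a' + 1 := ⟨a - 1, by omega⟩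
      have h2 := ih (a := a) (b := b) (by omega) (by omega)
      have h3 : R * (p.time R W + 10) ≤ (p.time 1 1 + 10) * (R ^ (a + 1) * W ^ b) := by
        calc _ ≤ R * (p.time 1 1 * (R ^ a * W ^ b) + 10 * (R ^ a * W ^ b)) :=
              Nat.mul_le_mul_left _ (by nlinarith [one a b])
          _ = _ := by ring
      nlinarith [one (a + 1) b]
    · simp only [hx, if_false] at h h' ⊢
      obtain ⟨b, rfl⟩ : ∃ b', b = b' + 1 := ⟨b - 1, by omega⟩
      have h2 := ih (a := a) (b := b) (by omega) (by omega)
      have h3 : W * (p.time R W + 10) ≤ (p.time 1 1 + 10) * (R ^ a * W ^ (b + 1)) := by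
        calc _ ≤ W * (p.time 1 1 * (R ^ a * W ^ b) + 10 * (R ^ a * W ^ b)) :=
              Nat.mul_le_mul_left _ (by nlinarith [one a b])
          _ = _ := by ring
      nlinarith [one a (b + 1)]

end BProg

/-- Total correctness within the syntactic time bound. -/
def Hoare (V R W : ℕ) (p : BProg) (τ : RamState) (Q : RamState → Prop) : Prop :=
  R ≤ V → W ≤ V → Tri V p τ (p.time R W) Q

namespace Hoare

variable {V R W : ℕ} {τ : RamState} {Q Q' : RamState → Prop} {p q : BProg} {e : BExpr}

lemma mono (h : Hoare V R W p τ Q) (hQ : ∀ τ', Q τ' → Q' τ') : Hoare V R W p τ Q' :=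
  fun h1 h2 => (h h1 h2).mono le_rfl hQ

lemma frame (h : Hoare V R W p τ Q) :
    Hoare V R W p τ (fun τ' => Q τ' ∧ (∀ x ∉ p.wr, τ'.reg x = τ.reg x) ∧
      ∀ a ∉ p.wa, τ'.arr a = τ.arr a) :=
  fun h1 h2 => (h h1 h2).frame

lemma skip (hQ : Q τ) : Hoare V R W .skip τ Q := fun _ _ => Tri.skip le_rfl hQ

lemma assign {x v : ℕ} (he : e.Ev R τ v) (hv : τ.Bdd V → v ≤ V) (hQ : Q (τ.setReg x v)) :
    Hoare V R W (.assign x e) τ Q := by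
  obtain ⟨h1, rfl⟩ := he
  exact fun hR _ => Tri.assign R h1 hR hv le_rfl hQ

lemma store {a v w : ℕ} {i : BExpr} (hi : i.Ev R τ w) (he : e.Ev R τ v) (hv : τ.Bdd V → v ≤ V)
    (hQ : Q (τ.setArr a w v)) : Hoare V R W (.store a i e) τ Q := by
  obtain ⟨h1, rfl⟩ := he
  obtain ⟨h2, rfl⟩ := hi
  exact fun hR _ => Tri.store R h2 h1 hR hv le_rfl hQ

lemma seq (h : Hoare V R W p τ (fun τ' => Hoare V R W q τ' Q)) : Hoare V R W (.seq p q) τ Q :=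
  fun hR hW => Tri.seq ((h hR hW).mono le_rfl fun _ h' => h' hR hW) le_rfl

lemma ite {P : Prop} (he : e.Tst R τ P) (hp : P → Hoare V R W p τ Q)
    (hq : ¬ P → Hoare V R W q τ Q) : Hoare V R W (.ite e p q) τ Q := by
  intro hR hW
  refine Tri.ite R he.1 hR (fun h => (hp (he.2.1 h) hR hW).mono (Nat.le_add_right _ _) fun _ => id)
    (fun h => (hq (fun h' => he.2.2 h' h) hR hW).mono (Nat.le_add_left _ _) fun _ => id) le_rfl

lemma loop {x n : ℕ} {b : BExpr} (I : ℕ → RamState → Prop) (hb : b.Ev R τ n)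
    (hn : n ≤ BProg.loopBound R W x) (h0 : I 0 τ)
    (step : ∀ i < n, ∀ τ', I i τ' → Hoare V R W p (τ'.setReg x i) (I (i + 1)))
    (hQ : ∀ τ', I n τ' → Q τ') : Hoare V R W (.loop x b p) τ Q := by
  obtain ⟨h1, rfl⟩ := hb
  intro hR hW
  have hV : BProg.loopBound R W x ≤ V := by unfold BProg.loopBound; split_ifs <;> assumption
  refine Tri.loop R I (fun _ => p.time R W) h1 hR (hn.trans hV) h0
    (fun i hi τ' h => step i hi τ' h hR hW) hQ ?_
  simp only [Finset.sum_const, Finset.card_range, smul_eq_mul, BProg.time]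
  have := Nat.mul_le_mul_right (p.time R W + 10) hn
  omega

end Hoare

end

section

/-! ### Expressions for residual covers -/

namespace Cover

open Finset BExpr

/-- The reduced instance: `np` sets over the universe `{0, …, up - 1}`, given by the adjacency array
`adj` with row length `u`, together with the parameters of the original graph. -/
structure Inst where
  n : ℕ
  u : ℕ
  ds : ℕ
  F : ℕ
  np : ℕ
  up : ℕ
  adj : ℕ → ℕ

namespace Inst

variable (I : Inst)

def nb (x : ℕ) : Finset ℕ := (range I.up).filter fun y => I.adj (x * I.u + y) ≠ 0

/-- The instance is stored in memory. -/
structure Ctx (τ : RamState) : Prop where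
  n : τ.reg 0 = I.n
  u : τ.reg 1 = I.u
  ds : τ.reg 3 = I.ds
  F : τ.reg 4 = I.F
  np : τ.reg 5 = I.np
  up : τ.reg 6 = I.up
  adj : τ.arr 9 = I.adj

/-- The ranges of all sums are short. -/
structure Short (k R : ℕ) : Prop where
  np : I.np + 1 ≤ R
  up : I.up + 1 ≤ R
  k : k + 1 ≤ R

variable {I}

lemma Ctx.setReg {τ : RamState} (h : I.Ctx τ) {x : ℕ} (v : ℕ) (hx : 7 ≤ x) :
    I.Ctx (τ.setReg x v) := by
  have h0 : 0 ≠ x := by omega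
  have h1 : 1 ≠ x := by omega
  have h3 : 3 ≠ x := by omega
  have h4 : 4 ≠ x := by omega
  have h5 : 5 ≠ x := by omega
  have h6 : 6 ≠ x := by omega
  constructor <;> simp [*, h.n, h.u, h.ds, h.F, h.np, h.up, h.adj]

lemma Ctx.setArr {τ : RamState} (h : I.Ctx τ) {a : ℕ} (i v : ℕ) (ha : 9 ≠ a) :
    I.Ctx (τ.setArr a i v) :=
  ⟨h.n, h.u, h.ds, h.F, h.np, h.up, by rw [RamState.setArr_arr_ne _ _ _ ha, h.adj]⟩

lemma nb_subset (x : ℕ) : I.nb x ⊆ range I.up := filter_subset _ _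

lemma rs_le_up (S : List ℕ) (x : ℕ) : rs I.nb S x ≤ I.up :=
  (card_le_card (sdiff_subset.trans (nb_subset x))).trans (by simp)

end Inst

/-- Array `a` starts with the list `S`. -/
def View (a : ℕ) (τ : RamState) (S : List ℕ) : Prop := ∀ j (h : j < S.length), τ.arr a j = S[j]

lemma View.snoc {a : ℕ} {τ : RamState} {S : List ℕ} (h : View a τ S) (x : ℕ) :
    View a (τ.setArr a S.length x) (S ++ [x]) := by
  intro j hj
  simp only [List.length_append, List.length_singleton] at hj
  simp only [RamState.setArr_arr, true_and, List.getElem_append]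
  split_ifs with h1 h2 h2
  · omega
  · simp
  · exact h j h2
  · omega

lemma View.of_append {a : ℕ} {τ : RamState} {S S' : List ℕ} (h : View a τ (S ++ S')) : View a τ S := by
  intro j hj
  rw [h j (by simp; omega), List.getElem_append_left]

lemma View.mem_cvr_take {τ : RamState} {S : List ℕ} (h : View 10 τ S) {nb : ℕ → Finset ℕ} {i : ℕ}
    (hi : i ≤ S.length) {y : ℕ} : y ∈ cvr nb (S.take i) ↔ ∃ j < i, y ∈ nb (τ.arr 10 j) := by
  rw [mem_cvr]
  constructor
  · rintro ⟨x, hx, hy⟩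
    obtain ⟨j, hj, rfl⟩ := List.mem_iff_getElem.1 hx
    simp only [List.length_take] at hj
    refine ⟨j, by omega, ?_⟩
    rw [h j (by omega)]
    simpa using hy
  · rintro ⟨j, hj, hy⟩
    rw [h j (by omega)] at hy
    refine ⟨_, List.mem_iff_getElem.2 ⟨j, by simp; omega, rfl⟩, by simpa using hy⟩

/-- In what follows `i` is the number of chosen sets read from array `10`, while `x` and `y` name
registers that hold a set and an element. Summation variables are numbered from `50` on, differently
in each of these expressions, so that nesting captures nothing. -/
def adjE (x y : ℕ) : BExpr := .get 9 (((BExpr.reg x).mul (.reg 1)).add (.reg y))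

def covE (i y : ℕ) : BExpr :=
  .sum 50 (.const i) (.get 9 (((BExpr.get 10 (.reg 50)).mul (.reg 1)).add (.reg y)))

def rsE (i x : ℕ) : BExpr := .count 51 (.reg 6) ((adjE x 51).mul (covE i 51).not)

def smE (i : ℕ) : BExpr := .count 52 (.reg 6) (.sum 53 (.reg 5) ((BExpr.reg 52).lt (rsE i 53)))

def zmE (i : ℕ) : BExpr := .count 54 (.reg 5)
  (BExpr.sum 55 ((BExpr.reg 54).add (.const 1)) ((rsE i 55).eq (smE i))).not

def ovE (k i x : ℕ) : BExpr := ((BExpr.const 0).lt (smE i)).mul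
  ((smE i).le ((BExpr.const (2 * k)).mul (.count 56 (.reg 6) (((adjE x 56).mul
    (.get 9 (((zmE i).mul (.reg 1)).add (.reg 56)))).mul (covE i 56).not))))

def rankE (i x : ℕ) : BExpr := .count 57 (.reg 5) (((rsE i x).lt (rsE i 57)).add
  (((rsE i 57).eq (rsE i x)).mul ((BExpr.reg 57).lt (.reg x))))

def bigE (i x : ℕ) : BExpr := (smE i).lt ((BExpr.const 2).mul (rsE i x))

def inKE (k i x : ℕ) : BExpr :=
  (bigE i x).mul ((rankE i x).le (((BExpr.const k).mul (smE i)).mul (.reg 4)))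

def sqE (e : BExpr) : BExpr := e.mul e
def cubeE (e : BExpr) : BExpr := (e.mul e).mul e

/-- The thresholds are cube and square roots; comparing cubes and squares of natural numbers avoids
them. -/
def bruteE (i : ℕ) : BExpr := (((cubeE (.reg 0)).le ((cubeE (.reg 4)).mul (.reg 1))).mul
  ((sqE (.reg 0)).le ((sqE (.reg 4)).mul (.reg 3)))).add ((sqE (.reg 1)).lt (cubeE (smE i)))

/-- The residual instance after choosing `S` is small enough for exhaustive search. -/
def Inst.Brute (I : Inst) (S : List ℕ) : Prop :=
  (I.n * I.n * I.n ≤ I.F * I.F * I.F * I.u ∧ I.n * I.n ≤ I.F * I.F * I.ds) ∨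
    I.u * I.u < sm I.nb I.np S * sm I.nb I.np S * sm I.nb I.np S

/-! ### Correctness of the expressions for residual quantities -/

section eval

variable {I : Inst} {k R : ℕ} {τ : RamState} {S : List ℕ} {i x : ℕ}

lemma tst_adjE (h : I.Ctx τ) (x y : ℕ) (hy : τ.reg y < I.up) :
    (adjE x y).Tst R τ (τ.reg y ∈ I.nb (τ.reg x)) := by
  refine (Tst.ne_zero (Ev.get ((Ev.reg.mul Ev.reg).add Ev.reg))).iff ?_
  simp [Inst.nb, hy, h.u, h.adj]

lemma tst_covE (h : I.Ctx τ) (hR : I.Short k R) (hv : View 10 τ S) (hi : i ≤ S.length) (hik : i ≤ k)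
    {y : ℕ} (hy : τ.reg y < I.up) (hy50 : y ≠ 50) :
    (covE i y).Tst R τ (τ.reg y ∈ cvr I.nb (S.take i)) := by
  refine (Tst.ex (P := fun j => I.adj (τ.arr 10 j * I.u + τ.reg y) ≠ 0) Ev.const
    (by have := hR.k; omega) fun j hj => ?_).iff ?_
  · refine (Tst.ne_zero (Ev.get (((Ev.get Ev.reg).mul Ev.reg).add Ev.reg))).iff ?_
    simp [h.u, h.adj, hy50]
  · rw [hv.mem_cvr_take hi]
    simp [Inst.nb, hy]

lemma ev_rsE (h : I.Ctx τ) (hR : I.Short k R) (hv : View 10 τ S) (hi : i ≤ S.length) (hik : i ≤ k)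
    (hx : x ≠ 51) : (rsE i x).Ev R τ (rs I.nb (S.take i) (τ.reg x)) := by
  refine (Ev.count (P := fun y => y ∈ I.nb (τ.reg x) ∧ y ∉ cvr I.nb (S.take i)) (Ev.reg' h.up)
    (by have := hR.up; omega) fun y hy => ?_).congr ?_
  · have h' := h.setReg (x := 51) y (by norm_num)
    have e1 : (τ.setReg 51 y).reg 51 = y := by simp
    have e2 : (τ.setReg 51 y).reg x = τ.reg x := by simp [hx]
    have a := tst_adjE (R := R) h' x 51 (by rw [e1]; exact hy)
    have b := tst_covE (y := 51) h' hR hv hi hik (by rw [e1]; exact hy) (by norm_num)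
    rw [e1, e2] at a
    rw [e1] at b
    exact a.and b.not
  · rw [rs]
    congr 1
    ext y
    simp only [mem_filter, mem_sdiff]
    exact ⟨fun h => h.2, fun h => ⟨Inst.nb_subset _ h.1, h⟩⟩

/-- The language has no maximum, but a maximum equals the number of naturals below it, which is a
bounded sum. -/
lemma card_filter_lt_sup (n m : ℕ) (f : ℕ → ℕ) (hf : ∀ x < n, f x ≤ m) :
    ((range m).filter fun v => ∃ x < n, v < f x).card = (range n).sup f := by
  have : ((range m).filter fun v => ∃ x < n, v < f x) = range ((range n).sup f) := by
    ext v
    simp only [mem_filter, mem_range]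
    rw [Finset.lt_sup_iff]
    simp only [mem_range]
    constructor
    · rintro ⟨-, x, hx, h⟩; exact ⟨x, hx, h⟩
    · rintro ⟨x, hx, h⟩; exact ⟨h.trans_le (hf x hx), x, hx, h⟩
  rw [this, card_range]

lemma ev_smE (h : I.Ctx τ) (hR : I.Short k R) (hv : View 10 τ S) (hi : i ≤ S.length) (hik : i ≤ k) :
    (smE i).Ev R τ (sm I.nb I.np (S.take i)) := by
  refine (Ev.count (P := fun v => ∃ x < I.np, v < rs I.nb (S.take i) x) (Ev.reg' h.up)
    (by have := hR.up; omega) fun v hv' => ?_).congr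
    (card_filter_lt_sup _ _ _ fun x _ => Inst.rs_le_up _ _)
  have h' := h.setReg (x := 52) v (by norm_num)
  refine Tst.ex (Ev.reg' h'.np) (by have := hR.np; omega) fun x hx => ?_
  have h'' := h'.setReg (x := 53) x (by norm_num)
  have e := ev_rsE (x := 53) h'' hR hv hi hik (by norm_num)
  simpa using Tst.lt (Ev.reg (x := 52)) e

lemma ev_zmE (h : I.Ctx τ) (hR : I.Short k R) (hv : View 10 τ S) (hi : i ≤ S.length) (hik : i ≤ k) :
    (zmE i).Ev R τ (zm I.nb I.np (S.take i)) := by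
  refine Ev.count (Ev.reg' h.np) (by have := hR.np; omega) fun x hx => ?_
  have h' := h.setReg (x := 54) x (by norm_num)
  refine (Tst.ex (n := x + 1) (P := fun x' => rs I.nb (S.take i) x' = sm I.nb I.np (S.take i))
    ((Ev.reg.add Ev.const).congr (by simp)) (by have := hR.np; omega) fun x' hx' => ?_).not.iff ?_
  · have h'' := h'.setReg (x := 55) x' (by norm_num)
    have e := ev_rsE (x := 55) h'' hR hv hi hik (by norm_num)
    simpa using Tst.eq e (ev_smE h'' hR hv hi hik)
  · constructor
    · intro hc x' _ h2 h3; exact hc ⟨x', by omega, h3⟩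
    · rintro hc ⟨x', h1, h2⟩; exact hc x' (by omega) (by omega) h2

lemma tst_ovE (h : I.Ctx τ) (hR : I.Short k R) (hv : View 10 τ S) (hi : i ≤ S.length) (hik : i ≤ k)
    (hx : x < 50) (hxn : τ.reg x < I.np) :
    (ovE k i x).Tst R τ (Overlap I.nb k I.np (S.take i) (τ.reg x)) := by
  have e := ev_smE h hR hv hi hik
  refine ((Tst.lt Ev.const e).and (Tst.le e (Ev.const.mul (Ev.count
    (P := fun y => (y ∈ I.nb (τ.reg x) ∧ y ∈ I.nb (zm I.nb I.np (S.take i))) ∧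
      y ∉ cvr I.nb (S.take i)) (Ev.reg' h.up) (by have := hR.up; omega) fun y hy => ?_)))).iff ?_
  · have h' := h.setReg (x := 56) y (by norm_num)
    have e1 : (τ.setReg 56 y).reg 56 = y := by simp
    have e2 : (τ.setReg 56 y).reg x = τ.reg x := by simp; omega
    have a := tst_adjE (R := R) h' x 56 (by rw [e1]; exact hy)
    have b := tst_covE (y := 56) h' hR hv hi hik (by rw [e1]; exact hy) (by norm_num)
    rw [e1, e2] at a
    rw [e1] at b
    refine (a.and ((Tst.ne_zero (Ev.get (((ev_zmE h' hR hv hi hik).mul Ev.reg).add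
      (Ev.reg' e1)))).iff ?_)).and b.not
    simp [Inst.nb, hy, h.u, h.adj]
  · rw [Overlap]
    have : ((range I.up).filter fun y => (y ∈ I.nb (τ.reg x) ∧
        y ∈ I.nb (zm I.nb I.np (S.take i))) ∧ y ∉ cvr I.nb (S.take i)) =
        (I.nb (τ.reg x) ∩ I.nb (zm I.nb I.np (S.take i))) \ cvr I.nb (S.take i) := by
      ext y
      simp only [mem_filter, mem_sdiff, mem_inter]
      exact ⟨fun h => h.2, fun h => ⟨Inst.nb_subset _ h.1.1, h⟩⟩
    rw [this]
    simp [hxn]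

lemma ev_rankE (h : I.Ctx τ) (hR : I.Short k R) (hv : View 10 τ S) (hi : i ≤ S.length) (hik : i ≤ k)
    (hx : x < 50) : (rankE i x).Ev R τ (rank I.nb I.np (S.take i) (τ.reg x)) := by
  refine Ev.count (Ev.reg' h.np) (by have := hR.np; omega) fun x' hx' => ?_
  have h' := h.setReg (x := 57) x' (by norm_num)
  have e1 := ev_rsE (x := 57) h' hR hv hi hik (by norm_num)
  have e2 := ev_rsE (x := x) h' hR hv hi hik (by omega)
  have hne : x ≠ 57 := by omega
  simpa [hne] using (Tst.lt e2 e1).or ((Tst.eq e1 e2).and (Tst.lt (Ev.reg (x := 57)) (Ev.reg (x := x))))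

lemma tst_bigE (h : I.Ctx τ) (hR : I.Short k R) (hv : View 10 τ S) (hi : i ≤ S.length) (hik : i ≤ k)
    (hx : x < 50) : (bigE i x).Tst R τ
      (sm I.nb I.np (S.take i) < 2 * rs I.nb (S.take i) (τ.reg x)) :=
  Tst.lt (ev_smE h hR hv hi hik) (Ev.const.mul (ev_rsE h hR hv hi hik (by omega)))

lemma tst_inKE (h : I.Ctx τ) (hR : I.Short k R) (hv : View 10 τ S) (hi : i ≤ S.length) (hik : i ≤ k)
    (hx : x < 50) (hxn : τ.reg x < I.np) : (inKE k i x).Tst R τ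
      (InK I.nb k I.np I.F (S.take i) (τ.reg x)) := by
  refine ((tst_bigE h hR hv hi hik hx).and (Tst.le (ev_rankE h hR hv hi hik hx)
    ((Ev.const.mul (ev_smE h hR hv hi hik)).mul (Ev.reg' h.F)))).iff ?_
  simp [InK, hxn]

lemma tst_bruteE (h : I.Ctx τ) (hR : I.Short k R) (hv : View 10 τ S) (hi : i ≤ S.length)
    (hik : i ≤ k) : (bruteE i).Tst R τ (I.Brute (S.take i)) := by
  have e := ev_smE h hR hv hi hik
  have en := Ev.reg' (R := R) h.n
  have eF := Ev.reg' (R := R) h.F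
  have eu := Ev.reg' (R := R) h.u
  have ed := Ev.reg' (R := R) h.ds
  exact ((Tst.le ((en.mul en).mul en) (((eF.mul eF).mul eF).mul eu)).and
    (Tst.le (en.mul en) ((eF.mul eF).mul ed))).or (Tst.lt (eu.mul eu) ((e.mul e).mul e))

end eval

/-! ### Enumeration of partial solutions -/

/-- The kinds of choices: a set that overlaps the largest residual set, a set of large residual
size, an arbitrary set, an element covered by the sets chosen so far, a set that contains the
element chosen last. -/
inductive Kind
  | overlap | large | start | elem | hit

namespace Kind

def bdE : Kind → BExpr
  | elem => .reg 6
  | _ => .reg 5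

/-- For `hit` the factor `l` makes the test fail as long as no element has been chosen; otherwise
the element chosen last is at index `l - 1`. The factors `bruteE` let a kind be chosen only in the
case for which its number of choices is bounded. -/
def testE (k i₁ i l : ℕ) : Kind → BExpr
  | overlap => ovE k i 20
  | large => (bruteE i₁).mul (bigE i₁ 20)
  | start => .const 1
  | elem => ((covE i 20).mul (covE i₁ 20).not).mul (bruteE i₁).not
  | hit => (BExpr.const l).mul
      (.get 9 (((BExpr.reg 20).mul (.reg 1)).add (.get 11 (.const (l - 1)))))

def bd (I : Inst) : Kind → ℕ
  | elem => I.up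
  | _ => I.np

def Ok (I : Inst) (k i₁ : ℕ) (S Y : List ℕ) (x : ℕ) : Kind → Prop
  | overlap => Overlap I.nb k I.np S x
  | large => I.Brute (S.take i₁) ∧ sm I.nb I.np (S.take i₁) < 2 * rs I.nb (S.take i₁) x
  | start => True
  | elem => (x ∈ cvr I.nb S ∧ x ∉ cvr I.nb (S.take i₁)) ∧ ¬ I.Brute (S.take i₁)
  | hit => ∃ y, Y.getLast? = some y ∧ y ∈ I.nb x

def pushS (S : List ℕ) (x : ℕ) : Kind → List ℕ
  | elem => S
  | _ => S ++ [x]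

def pushY (Y : List ℕ) (x : ℕ) : Kind → List ℕ
  | elem => Y ++ [x]
  | _ => Y

end Kind

/-- All levels share register `20`: a choice is saved in array `10` or `11` before the next level
starts, and each loop restores the register from its own hidden counter. -/
def enumP (leaf : BProg) (k i₁ : ℕ) : List Kind → ℕ → ℕ → BProg
  | [], _, _ => leaf
  | κ :: w, i, l => .loop 20 κ.bdE (.ite (κ.testE k i₁ i l)
      (match κ with
        | .elem => .seq (.store 11 (.const l) (.reg 20)) (enumP leaf k i₁ w i (l + 1))
        | _ => .seq (.store 10 (.const i) (.reg 20)) (enumP leaf k i₁ w (i + 1) l)) .skip)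

/-- Every way to choose according to the word `w` leads to a pair of lists for which `G` holds. -/
def Explored (I : Inst) (k i₁ : ℕ) (G : List ℕ → Prop) : List Kind → List ℕ → List ℕ → Prop
  | [], S, _ => G S
  | κ :: w, S, Y => ∀ x < κ.bd I, κ.Ok I k i₁ S Y x →
      Explored I k i₁ G w (κ.pushS S x) (κ.pushY Y x)

/-- Register `7` is a lower bound for the coverage of the `k` sets listed in array `12`. -/
def Inst.Best (I : Inst) (k : ℕ) (τ : RamState) : Prop :=
  (∀ j < k, τ.arr 12 j < I.np) ∧ τ.reg 7 ≤ (cvr I.nb ((List.range k).map (τ.arr 12))).card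

structure EnumInv (I : Inst) (k : ℕ) (S Y : List ℕ) (τ : RamState) : Prop where
  ctx : I.Ctx τ
  best : I.Best k τ
  sets : View 10 τ S
  elems : View 11 τ Y

lemma Explored.mono {I : Inst} {k i₁ : ℕ} {G G' : List ℕ → Prop} (h : ∀ S, G S → G' S)
    {w : List Kind} : ∀ {S Y}, Explored I k i₁ G w S Y → Explored I k i₁ G' w S Y := by
  induction w with
  | nil => exact fun h' => h _ h'
  | cons κ w ih => exact fun h' x hx hok => ih (h' x hx hok)

/-- The tests are paid for in up to `R` rounds, the recursive call only in the `b κ` rounds whose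
test succeeds. -/
def enumTime (R E T : ℕ) (b : Kind → ℕ) : List Kind → ℕ
  | [] => T
  | κ :: w => 8 + R * (E + 13) + b κ * (10 + enumTime R E T b w)

def Kind.wt : Kind → ℕ
  | .elem => 0
  | _ => 1

def Kind.setCount (w : List Kind) : ℕ := (w.map Kind.wt).sum

/-- Large sets and elements are chosen only after `i₁` sets. -/
def Kind.WellFormed (i₁ : ℕ) : List Kind → ℕ → Prop
  | [], _ => True
  | κ :: w, i => (κ = .large ∨ κ = .elem → i₁ ≤ i) ∧ WellFormed i₁ w (i + κ.wt)

lemma tst_testE {I : Inst} {k R i₁ : ℕ} {τ : RamState} {S Y : List ℕ} (h : EnumInv I k S Y τ)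
    (hR : I.Short k R) (hi : i₁ ≤ k) (hi₁ : S.length ≤ k) (κ : Kind)
    (hκ : κ = .large ∨ κ = .elem → i₁ ≤ S.length) (hYu : ∀ y ∈ Y, y < I.up)
    {x : ℕ} (hx : x < κ.bd I) :
    (κ.testE k i₁ S.length Y.length).Tst R (τ.setReg 20 x) (κ.Ok I k i₁ S Y x) := by
  have h' := h.ctx.setReg (x := 20) x (by norm_num)
  have e : (τ.setReg 20 x).reg 20 = x := by simp
  cases κ with
  | overlap =>
    have := tst_ovE (x := 20) (S := S) h' hR h.sets le_rfl hi₁ (by norm_num) (by rw [e]; exact hx)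
    rw [e, List.take_length] at this
    exact this
  | large =>
    have := tst_bigE (x := 20) (S := S) h' hR h.sets (hκ (Or.inl rfl)) hi (by norm_num)
    rw [e] at this
    exact (tst_bruteE h' hR h.sets (hκ (Or.inl rfl)) hi).and this
  | start => exact ⟨trivial, by simp [Kind.testE, Kind.Ok, eval]⟩
  | elem =>
    have a := tst_covE (y := 20) h' hR h.sets le_rfl hi₁ (by rw [e]; exact hx) (by norm_num)
    have b := tst_covE (y := 20) h' hR h.sets (hκ (Or.inr rfl)) hi (by rw [e]; exact hx)
      (by norm_num)
    rw [e] at a b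
    rw [List.take_length] at a
    exact (a.and b.not).and (tst_bruteE h' hR h.sets (hκ (Or.inr rfl)) hi).not
  | hit =>
    by_cases hY : Y = []
    · subst hY
      exact ⟨⟨trivial, ⟨trivial, trivial⟩, trivial⟩, by simp [Kind.testE, Kind.Ok, eval, RamOp.eval]⟩
    have hpos := List.length_pos_iff.2 hY
    have hlt : Y.length - 1 < Y.length := by omega
    refine ((Tst.ne_zero Ev.const).and (Tst.ne_zero (Ev.get (((Ev.reg' e).mul (Ev.reg' h'.u)).add
      (Ev.get' Ev.const (h.elems (Y.length - 1) hlt)))))).iff ?_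
    have : Y.getLast? = some Y[Y.length - 1] := by
      rw [List.getLast?_eq_some_getLast hY, List.getLast_eq_getElem]
    have hm : Y[Y.length - 1] < I.up := hYu _ (List.getElem_mem _)
    simp only [Kind.Ok, this, Option.some.injEq, exists_eq_left', Inst.nb, mem_filter, mem_range,
      hm, true_and]
    simp [h.ctx.adj, hpos.ne']

lemma EnumInv.setReg {I : Inst} {k : ℕ} {S Y : List ℕ} {τ : RamState} (h : EnumInv I k S Y τ)
    {x : ℕ} (v : ℕ) (hx : 7 < x) : EnumInv I k S Y (τ.setReg x v) :=
  ⟨h.ctx.setReg v (by omega), ⟨h.best.1, by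
    have : 7 ≠ x := by omega
    simpa [this] using h.best.2⟩, h.sets, h.elems⟩

lemma EnumInv.pop {I : Inst} {k : ℕ} {S Y : List ℕ} {τ : RamState} {κ : Kind} {x : ℕ}
    (h : EnumInv I k (κ.pushS S x) (κ.pushY Y x) τ) : EnumInv I k S Y τ := by
  refine ⟨h.ctx, h.best, ?_, ?_⟩
  · have := h.sets
    cases κ <;> first | exact this | exact View.of_append this
  · have := h.elems
    cases κ <;> first | exact this | exact View.of_append this

lemma Kind.length_pushS (κ : Kind) (S : List ℕ) (x : ℕ) :
    (κ.pushS S x).length = S.length + κ.wt := by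
  cases κ <;> simp [Kind.pushS, Kind.wt]

-- The best value in register `7` never decreases, so a goal that is monotone in it and has been
-- reached in one branch still holds after all later ones. The cost of a level is counted by the
-- choices that satisfy `Kind.Ok`, not by the length of its loop.
open Classical in
lemma tri_enumP {I : Inst} {V k R i₁ E T i' : ℕ} {b : Kind → ℕ} {leaf : BProg}
    {G : List ℕ → ℕ → Prop} (hG : ∀ S b b', b ≤ b' → G S b → G S b') (hR : I.Short k R)
    (hRV : R ≤ V) (hi₁ : i₁ ≤ k) (hi' : i' ≤ k) (hE : ∀ (κ : Kind) i l, (κ.testE k i₁ i l).tb R ≤ E)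
    (hb : ∀ (κ : Kind) S Y, (∀ x ∈ S, x < I.np) → S.length ≤ k →
      ((range (κ.bd I)).filter fun x => κ.Ok I k i₁ S Y x).card ≤ b κ)
    (hleaf : ∀ S Y τ, (∀ x ∈ S, x < I.np) → S.length = i' → EnumInv I k S Y τ →
      Tri V leaf τ T fun τ' => EnumInv I k S Y τ' ∧ τ.reg 7 ≤ τ'.reg 7 ∧ G S (τ'.reg 7)) :
    ∀ (w : List Kind) (S Y : List ℕ) (τ : RamState), EnumInv I k S Y τ → (∀ x ∈ S, x < I.np) →
      (∀ y ∈ Y, y < I.up) → S.length + Kind.setCount w = i' → Kind.WellFormed i₁ w S.length →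
      Tri V (enumP leaf k i₁ w S.length Y.length) τ (enumTime R E T b w) fun τ' =>
        EnumInv I k S Y τ' ∧ τ.reg 7 ≤ τ'.reg 7 ∧
          Explored I k i₁ (fun S' => G S' (τ'.reg 7)) w S Y := by
  intro w
  induction w with
  | nil =>
    intro S Y τ h hS _ hl _
    exact hleaf S Y τ hS (by simpa [Kind.setCount] using hl) h
  | cons κ w ih =>
    intro S Y τ h hS hY hl hwf
    have hSk : S.length ≤ k := by omega
    have hbd : κ.bdE.eval τ = κ.bd I := by
      cases κ <;> simp [Kind.bdE, Kind.bd, eval, h.ctx.np, h.ctx.up]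
    have hbR : κ.bd I ≤ R := by
      have := hR.np; have := hR.up
      cases κ <;> simp only [Kind.bd] <;> omega
    have htb : κ.bdE.tb R = 2 := by cases κ <;> rfl
    refine Tri.loop R (fun j τ' => EnumInv I k S Y τ' ∧ τ.reg 7 ≤ τ'.reg 7 ∧
      ∀ x < j, κ.Ok I k i₁ S Y x → Explored I k i₁ (fun S' => G S' (τ'.reg 7)) w
        (κ.pushS S x) (κ.pushY Y x))
      (fun j => E + 3 + if κ.Ok I k i₁ S Y j then 10 + enumTime R E T b w else 0)
      (by cases κ <;> trivial) hRV (by omega) ⟨h, le_rfl, by simp⟩ ?_ ?_ ?_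
    · rintro j hj τ₁ ⟨h1, h2, h3⟩
      rw [hbd] at hj
      have ht := tst_testE (i₁ := i₁) h1 hR hi₁ hSk κ hwf.1 hY hj
      have h1' := h1.setReg (x := 20) j (by norm_num)
      refine Tri.ite (T₁ := 1 + if κ.Ok I k i₁ S Y j then 10 + enumTime R E T b w else 0) R ht.1 hRV
        (fun hne => ?_) (fun h0 => ?_) (by have := hE κ S.length Y.length; omega)
      · have hok := ht.2.1 hne
        rw [if_pos hok]
        have main : ∀ τ₂, EnumInv I k (κ.pushS S j) (κ.pushY Y j) τ₂ → τ₂.reg 7 = τ₁.reg 7 →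
            Tri V (enumP leaf k i₁ w (κ.pushS S j).length (κ.pushY Y j).length) τ₂
              (enumTime R E T b w) (fun τ' => EnumInv I k S Y τ' ∧ τ.reg 7 ≤ τ'.reg 7 ∧
                ∀ x < j + 1, κ.Ok I k i₁ S Y x →
                  Explored I k i₁ (fun S' => G S' (τ'.reg 7)) w (κ.pushS S x) (κ.pushY Y x)) := by
          intro τ₂ hinv hr
          refine (ih (κ.pushS S j) (κ.pushY Y j) τ₂ hinv ?_ ?_ ?_ ?_).mono le_rfl ?_
          · intro x hx
            cases κ <;> simp only [Kind.pushS, Kind.bd, List.mem_append, List.mem_singleton] at hx hj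
              <;> first | exact hS x hx | (rcases hx with hx | rfl; exacts [hS x hx, hj])
          · intro x hx
            cases κ <;> simp only [Kind.pushY, Kind.bd, List.mem_append, List.mem_singleton] at hx hj
              <;> first | exact hY x hx | (rcases hx with hx | rfl; exacts [hY x hx, hj])
          · rw [Kind.length_pushS]
            simp only [Kind.setCount, List.map_cons, List.sum_cons] at hl ⊢
            omega
          · rw [Kind.length_pushS]; exact hwf.2
          · rintro τ' ⟨g1, g2, g3⟩
            refine ⟨g1.pop, by omega, fun x hx hokx => ?_⟩
            rcases Nat.lt_succ_iff_lt_or_eq.1 hx with hx | rfl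
            · exact (h3 x hx hokx).mono fun S' => hG S' _ _ (by omega)
            · exact g3
        have e20 : (τ₁.setReg 20 j).reg 20 = j := by simp
        have e7 : (τ₁.setReg 20 j).reg 7 = τ₁.reg 7 := by simp
        have setcase : ∀ a L, (a = 10 ∨ a = 11) → EnumInv I k (κ.pushS S j) (κ.pushY Y j)
            ((τ₁.setReg 20 j).setArr a L j) →
            Tri V (.seq (.store a (.const L) (.reg 20))
              (enumP leaf k i₁ w (κ.pushS S j).length (κ.pushY Y j).length)) (τ₁.setReg 20 j)
              (1 + (10 + enumTime R E T b w)) (fun τ' => EnumInv I k S Y τ' ∧ τ.reg 7 ≤ τ'.reg 7 ∧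
                ∀ x < j + 1, κ.Ok I k i₁ S Y x →
                  Explored I k i₁ (fun S' => G S' (τ'.reg 7)) w (κ.pushS S x) (κ.pushY Y x)) := by
          intro a L ha hinv
          refine Tri.seq (T₁ := 7) (T₂ := enumTime R E T b w) (Tri.store R trivial trivial hRV (fun hbd => hbd.1 20)
            (by simp [tb]) ?_) (by omega)
          refine main _ ?_ ?_
          · simpa [eval] using hinv
          · simp
        have hb10 : ∀ L, I.Best k ((τ₁.setReg 20 j).setArr 10 L j) := fun L =>
          ⟨by simpa using h1'.best.1, by
            have := h1'.best.2
            rwa [← RamState.setArr_arr_ne (a := 10) (b := 12) _ L j (by norm_num)] at this⟩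
        have hb11 : ∀ L, I.Best k ((τ₁.setReg 20 j).setArr 11 L j) := fun L =>
          ⟨by simpa using h1'.best.1, by
            have := h1'.best.2
            rwa [← RamState.setArr_arr_ne (a := 11) (b := 12) _ L j (by norm_num)] at this⟩
        have ne11 : View 11 ((τ₁.setReg 20 j).setArr 10 S.length j) Y := by
          intro l hl'; simpa using h1'.elems l hl'
        have ne10 : View 10 ((τ₁.setReg 20 j).setArr 11 Y.length j) S := by
          intro l hl'; simpa using h1'.sets l hl'
        cases κ with
        | elem =>
          have := setcase 11 Y.length (Or.inr rfl)
            ⟨h1'.ctx.setArr _ _ (by norm_num), hb11 _, ne10, h1'.elems.snoc j⟩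
          simpa [Kind.pushS, Kind.pushY] using this
        | _ =>
          have := setcase 10 S.length (Or.inl rfl)
            ⟨h1'.ctx.setArr _ _ (by norm_num), hb10 _, h1'.sets.snoc j, ne11⟩
          simpa [Kind.pushS, Kind.pushY] using this
      · have hnok : ¬ κ.Ok I k i₁ S Y j := fun hc => ht.2.2 hc h0
        rw [if_neg hnok]
        refine Tri.skip le_rfl ⟨h1', by simpa using h2, fun x hx hokx => ?_⟩
        rcases Nat.lt_succ_iff_lt_or_eq.1 hx with hx | rfl
        · simpa using h3 x hx hokx
        · exact absurd hokx hnok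
    · rintro τ' ⟨h1, h2, h3⟩
      rw [hbd] at h3
      exact ⟨h1, h2, h3⟩
    · rw [hbd, htb]
      have hc := hb κ S Y hS hSk
      have hsum : ∑ j ∈ range (κ.bd I), (E + 3 +
          (if κ.Ok I k i₁ S Y j then 10 + enumTime R E T b w else 0) + 10) =
          κ.bd I * (E + 13) + ((range (κ.bd I)).filter fun x => κ.Ok I k i₁ S Y x).card *
            (10 + enumTime R E T b w) := by
        rw [card_filter, sum_mul, ← card_range (κ.bd I), ← smul_eq_mul, ← sum_const, card_range,
          ← sum_add_distrib]
        refine sum_congr rfl fun j _ => ?_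
        split_ifs <;> omega
      rw [hsum, enumTime]
      have h1 := Nat.mul_le_mul_right (E + 13) hbR
      have h2 := Nat.mul_le_mul_right (10 + enumTime R E T b w) hc
      omega

end Cover

end

section

/-! ### Kronecker power transforms -/

open Finset BExpr

namespace BExpr

/-- Unrolled into the text of the program: its length is fixed with the bilinear algorithm, and it
adds nothing to the nesting depth. -/
def sumE : ℕ → (ℕ → BExpr) → BExpr
  | 0, _ => .const 0
  | n + 1, f => (sumE n f).add (f n)

lemma Ev.sumE {R : ℕ} {τ : RamState} {f : ℕ → BExpr} {g : ℕ → ℕ} :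
    ∀ {n : ℕ}, (∀ t < n, (f t).Ev R τ (g t)) → (sumE n f).Ev R τ (∑ t ∈ range n, g t)
  | 0, _ => Ev.const
  | n + 1, h => by
    rw [sum_range_succ]
    exact (Ev.sumE fun t ht => h t (by omega)).add (h n (by omega))

lemma depth_sumE {a : ℕ} {f : ℕ → BExpr} (h : ∀ t, (f t).depth ≤ a) : ∀ n, (sumE n f).depth ≤ a
  | 0 => Nat.zero_le _
  | n + 1 => max_le (depth_sumE h n) (h n)

/-- Table lookup. -/
def tableE (m n : ℕ) (c : ℕ → ℕ → ℕ) (i j : BExpr) : BExpr :=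
  sumE m fun t => sumE n fun v => (BExpr.const (c t v)).mul ((i.eq (.const t)).mul (j.eq (.const v)))

lemma Ev.eqE {R : ℕ} {τ : RamState} {a b : BExpr} {v w : ℕ} (ha : a.Ev R τ v) (hb : b.Ev R τ w) :
    (a.eq b).Ev R τ (if v = w then 1 else 0) :=
  ⟨⟨ha.1, hb.1⟩, by simp [eval, RamOp.eval, ha.2, hb.2]⟩

/-- The indicator of a test. -/
lemma Ev.ind {R : ℕ} {τ : RamState} {a : BExpr} {P : Prop} [Decidable P] (h : a.Tst R τ P) :
    ((BExpr.const 0).lt a).Ev R τ (if P then 1 else 0) :=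
  ⟨⟨trivial, h.1⟩, by
    simp only [eval, RamOp.eval, Nat.pos_iff_ne_zero]
    exact if_congr h.2 rfl rfl⟩

lemma ev_tableE {R : ℕ} {τ : RamState} {m n : ℕ} {c : ℕ → ℕ → ℕ} {i j : BExpr} {a b : ℕ}
    (hi : i.Ev R τ a) (hj : j.Ev R τ b) (ha : a < m) (hb : b < n) :
    (tableE m n c i j).Ev R τ (c a b) := by
  refine (Ev.sumE fun t _ => Ev.sumE fun v _ =>
    Ev.const.mul ((Ev.eqE hi Ev.const).mul (Ev.eqE hj Ev.const))).congr ?_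
  rw [sum_eq_single a, sum_eq_single b]
  · simp
  · intro v _ hv; simp [hv.symm]
  · intro h; exact absurd (mem_range.2 hb) h
  · intro t _ ht
    refine sum_eq_zero fun v _ => ?_
    simp [ht.symm]
  · intro h; exact absurd (mem_range.2 ha) h

lemma depth_tableE {m n : ℕ} {c : ℕ → ℕ → ℕ} {i j : BExpr} (hi : i.depth = 0) (hj : j.depth = 0) :
    (tableE m n c i j).depth ≤ 0 :=
  depth_sumE (fun t => depth_sumE (fun v => by simp [depth, hi, hj]) _) _

/-- Lookup of an integer coefficient modulo the modulus in register `24`. -/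
def coefE (m n : ℕ) (c : ℕ → ℕ → ℤ) (i j : BExpr) : BExpr :=
  (tableE m n (fun t v => (c t v).toNat) i j).add
    ((tableE m n (fun t v => (-c t v).toNat) i j).mul ((BExpr.reg 24).sub (.const 1)))

lemma depth_coefE {m n : ℕ} {c : ℕ → ℕ → ℤ} {i j : BExpr} (hi : i.depth = 0) (hj : j.depth = 0) :
    (coefE m n c i j).depth = 0 := by
  have h1 := depth_tableE (m := m) (n := n) (c := fun t v => (c t v).toNat) hi hj
  have h2 := depth_tableE (m := m) (n := n) (c := fun t v => (-c t v).toNat) hi hj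
  simp only [coefE, depth]
  omega

end BExpr

/-- Cells hold natural numbers, so the negative part of a coefficient is multiplied by `P - 1`,
which represents `-1`. -/
lemma cast_toNat_coef {P : ℕ} (hP : 0 < P) (z : ℤ) :
    ((z.toNat + (-z).toNat * (P - 1) : ℕ) : ZMod P) = (z : ZMod P) := by
  have h1 : ((P - 1 : ℕ) : ZMod P) = -1 := by
    rw [Nat.cast_sub hP]; simp
  push_cast
  rw [h1]
  have h2 : z = (z.toNat : ℤ) - ((-z).toNat : ℤ) := (Int.toNat_sub_toNat_neg z).symm
  conv_rhs => rw [h2]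
  push_cast
  ring

/-- Replace the vector in array `a` by its image under the `L`-th Kronecker power of an `m × n`
matrix, modulo the number in register `24`; `L` is in register `21`. -/
def transformP (a m n : ℕ) (c : ℕ → ℕ → ℤ) (e₀ : BExpr) : BProg :=
  .seq (.assign 29 e₀) (.loop 30 (.reg 21)
    (.seq (.loop 100 (((BExpr.reg 29).div (.const n)).mul (.const m))
      (.store 18 (.reg 100) ((BExpr.sum 61 (.const n)
        ((coefE m n c ((BExpr.reg 100).div ((BExpr.reg 29).div (.const n))) (.reg 61)).mul
          (.get a ((((BExpr.reg 100).mod ((BExpr.reg 29).div (.const n))).mul (.const n)).add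
            (.reg 61))))).mod (.reg 24))))
    (.seq (.loop 100 (((BExpr.reg 29).div (.const n)).mul (.const m))
      (.store a (.reg 100) (.get 18 (.reg 100))))
      (.assign 29 (((BExpr.reg 29).div (.const n)).mul (.const m))))))

/-- One round applies the small matrix to one digit. Array `18` receives the new vector before it is
copied back, since each new entry needs `n` old ones. -/
lemma hoare_transformP {V R W a m n L P : ℕ} {c : ℕ → ℕ → ℤ} {e₀ : BExpr} {τ : RamState}
    (ha : a ≠ 18) (hWV : W ≤ V) (hPV : P ≤ V) (hP : 0 < P) (hnR : n ≤ R) (hLR : L ≤ R)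
    (hm : 0 < m) (hn : 0 < n) (he₀ : e₀.Ev R τ (n ^ L)) (hL : τ.reg 21 = L) (h24 : τ.reg 24 = P)
    (hsz : ∀ l ≤ L, m ^ l * n ^ (L - l) ≤ W) (hlt : ∀ v < n ^ L, τ.arr a v < P) :
    Hoare V R W (transformP a m n c e₀) τ fun τ' => ∀ T < m ^ L, τ'.arr a T < P ∧
      (τ'.arr a T : ZMod P) = ∑ v ∈ range (n ^ L),
        kronEntry m n (fun i j => ((c i j : ℤ) : ZMod P)) L T v * (τ.arr a v : ZMod P) := by
  have hsz' : ∀ l < L, m ^ l * n ^ (L - l - 1) * m ≤ W := by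
    intro l hl
    have := hsz (l + 1) hl
    rw [show L - (l + 1) = L - l - 1 by omega, pow_succ] at this
    calc _ = m ^ l * m * n ^ (L - l - 1) := by ring
      _ ≤ _ := this
  refine Hoare.seq (Hoare.assign he₀ (fun _ => ?_) ?_)
  · have := hsz 0 (Nat.zero_le _)
    simp only [pow_zero, one_mul, Nat.sub_zero] at this
    omega
  -- `F l` is the vector after `l` rounds, modulo `P`. The invariant keeps the whole history and its
  -- recursion, because `kron_transform` resolves all rounds at once.
  refine Hoare.loop (fun l τ' => τ'.reg 21 = L ∧ τ'.reg 24 = P ∧ τ'.reg 29 = m ^ l * n ^ (L - l) ∧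
    (∀ i < m ^ l * n ^ (L - l), τ'.arr a i < P) ∧
    ∃ F : ℕ → ℕ → ZMod P, (∀ v, F 0 v = (τ.arr a v : ZMod P)) ∧
      (∀ l' < l, ∀ i < m * (m ^ l' * n ^ (L - l' - 1)), F (l' + 1) i =
        ∑ j ∈ range n, ((c (i / (m ^ l' * n ^ (L - l' - 1))) j : ℤ) : ZMod P) *
          F l' (i % (m ^ l' * n ^ (L - l' - 1)) * n + j)) ∧
      ∀ i < m ^ l * n ^ (L - l), F l i = (τ'.arr a i : ZMod P)) (n := L) (Ev.reg' (by simpa using hL))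
    (by simpa [BProg.loopBound] using hLR) ?_ ?_ ?_
  · refine ⟨by simpa using hL, by simpa using h24, by simp, by simpa using hlt,
      fun _ v => (τ.arr a v : ZMod P), fun _ => rfl, by simp, by simp⟩
  · rintro l hl τ₁ ⟨h1, h2, h3, h4, F, hF0, hF1, hF2⟩
    set B := m ^ l * n ^ (L - l - 1) with hB
    have hBpos : 0 < B := Nat.mul_pos (pow_pos hm _) (pow_pos hn _)
    have hBn : m ^ l * n ^ (L - l) = B * n := by
      rw [hB, mul_assoc, ← pow_succ]; congr 2; omega
    have hBm : m ^ (l + 1) * n ^ (L - (l + 1)) = B * m := by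
      rw [hB, pow_succ, show L - (l + 1) = L - l - 1 by omega]; ring
    rw [hBn] at h3 h4 hF2
    have hBW : B * m ≤ W := hsz' l hl
    have ediv : ∀ σ : RamState, σ.reg 29 = B * n → ((BExpr.reg 29).div (.const n)).Ev R σ B := by
      intro σ hσ
      exact ((Ev.reg' hσ).div Ev.const).congr (Nat.mul_div_cancel _ hn)
    let val : ℕ → ℕ := fun i => (∑ j ∈ range n, ((c (i / B) j).toNat + (-c (i / B) j).toNat * (P - 1)) *
      τ₁.arr a (i % B * n + j)) % P
    have hidx : ∀ i j, j < n → i % B * n + j < B * n := by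
      intro i j hj
      have := Nat.mod_lt i hBpos
      calc i % B * n + j < i % B * n + n := by omega
        _ = (i % B + 1) * n := by ring
        _ ≤ B * n := Nat.mul_le_mul_right _ this
    refine Hoare.seq (Hoare.loop (fun i τ' => τ'.reg 21 = L ∧ τ'.reg 24 = P ∧ τ'.reg 29 = B * n ∧
      τ'.arr a = τ₁.arr a ∧ ∀ i' < i, τ'.arr 18 i' = val i') (n := B * m)
      ((ediv _ (by simpa using h3)).mul Ev.const) (by simpa [BProg.loopBound] using hBW)
      ⟨by simpa using h1, by simpa using h2, by simpa using h3, rfl, by simp⟩ ?_ ?_)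
    · rintro i hi τ₂ ⟨g1, g2, g3, g4, g5⟩
      refine Hoare.store (v := val i) (w := i) (Ev.reg' (by simp)) ?_ ?_ ?_
      · refine Ev.mod (Ev.sum Ev.const hnR fun j hj => Ev.mul ?_ (Ev.get' (((Ev.mod (Ev.reg' (v := i) ?_)
          (ediv _ ?_)).mul Ev.const).add (Ev.reg' (v := j) ?_)) ?_)) (Ev.reg' (by simpa using g2))
        · have eA : ((BExpr.reg 100).div ((BExpr.reg 29).div (.const n))).Ev R
              ((τ₂.setReg 100 i).setReg 61 j) (i / B) :=
            Ev.div (Ev.reg' (by simp)) (ediv _ (by simpa using g3))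
          have eB : (BExpr.reg 61).Ev R ((τ₂.setReg 100 i).setReg 61 j) j := Ev.reg' (by simp)
          have hlt' : i / B < m := (Nat.div_lt_iff_lt_mul hBpos).2 (by rw [mul_comm]; exact hi)
          exact (ev_tableE eA eB hlt' hj).add ((ev_tableE eA eB hlt' hj).mul
            ((Ev.reg' (by simpa using g2)).sub Ev.const))
        · simp
        · simpa using g3
        · simp
        · simp [g4]
      · intro _
        exact (Nat.mod_lt _ hP).le.trans hPV
      · refine ⟨by simpa using g1, by simpa using g2, by simpa using g3, ?_, ?_⟩
        · rw [RamState.setArr_arr_ne _ _ _ ha]; exact g4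
        · intro i' hi'
          simp only [RamState.setArr_arr, true_and]
          split_ifs with h
          · rw [h]
          · exact g5 i' (by omega)
    · rintro τ₂ ⟨g1, g2, g3, g4, g5⟩
      refine Hoare.seq (Hoare.loop (fun i τ' => τ'.reg 21 = L ∧ τ'.reg 24 = P ∧ τ'.reg 29 = B * n ∧
        τ'.arr 18 = τ₂.arr 18 ∧ ∀ i' < i, τ'.arr a i' = val i') (n := B * m)
        ((ediv _ g3).mul Ev.const) (by simpa [BProg.loopBound] using hBW)
        ⟨g1, g2, g3, rfl, by simp⟩ ?_ ?_)
      · rintro i hi τ₃ ⟨k1, k2, k3, k4, k5⟩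
        refine Hoare.store (v := val i) (w := i) (Ev.reg' (by simp))
          (Ev.get' (Ev.reg' (v := i) (by simp)) (by simp [k4, g5 i hi])) ?_ ?_
        · intro _
          exact (Nat.mod_lt _ hP).le.trans hPV
        · refine ⟨by simpa using k1, by simpa using k2, by simpa using k3, ?_, ?_⟩
          · rw [RamState.setArr_arr_ne _ _ _ ha.symm]; exact k4
          · intro i' hi'
            simp only [RamState.setArr_arr, true_and]
            split_ifs with h
            · rw [h]
            · exact k5 i' (by omega)
      · rintro τ₃ ⟨k1, k2, k3, k4, k5⟩
        refine Hoare.assign ((ediv _ k3).mul Ev.const) (fun _ => hBW.trans hWV) ?_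
        rw [hBm]
        refine ⟨by simpa using k1, by simpa using k2, by simp, ?_,
          Function.update F (l + 1) fun i => ((τ₃.arr a i : ℕ) : ZMod P), ?_, ?_, ?_⟩
        · intro i hi
          simp only [RamState.setReg_arr]
          rw [k5 i hi]
          exact Nat.mod_lt _ hP
        · intro v; simpa using hF0 v
        · intro l' hl' i hi
          rcases Nat.lt_succ_iff_lt_or_eq.1 hl' with hl'' | rfl
          · rw [Function.update_of_ne (by omega), Function.update_of_ne (by omega)]
            exact hF1 l' hl'' i hi
          · rw [Function.update_self, Function.update_of_ne (by omega)]
            rw [k5 i (by rw [mul_comm]; exact hi)]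
            simp only [val, ZMod.natCast_mod]
            push_cast
            refine sum_congr rfl fun j hj => ?_
            have hj := mem_range.1 hj
            rw [hF2 _ (hidx i j hj)]
            have := cast_toNat_coef hP (c (i / B) j)
            push_cast at this
            rw [this]
        · intro i hi
          simp
  · rintro τ' ⟨h1, h2, h3, h4, F, hF0, hF1, hF2⟩ T hT
    simp only [Nat.sub_self, pow_zero, mul_one] at h4 hF2
    refine ⟨h4 T hT, ?_⟩
    rw [← hF2 T hT]
    have := kron_transform (fun i j => ((c i j : ℤ) : ZMod P)) F hF1 L le_rfl T hT 0 (by simp)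
    simpa [hF0] using this

end

section

/-! ### Completing a partial solution by matrix multiplication -/

open Finset BExpr

/-- An integral bilinear algorithm for `d` times the product of `q × q` matrices. -/
structure BilinearAlg where
  q : ℕ
  r : ℕ
  d : ℕ
  α : ℕ → ℕ → ℤ
  β : ℕ → ℕ → ℤ
  γ : ℕ → ℕ → ℤ
  two_le : 2 ≤ q
  d_pos : 0 < d
  sq_le : q * q ≤ r
  isAlg : IsBilinearAlg q r (d : ℤ) α β γ

lemma IsBilinearAlg.cast {q r : ℕ} {D : ℤ} {α β γ : ℕ → ℕ → ℤ} (h : IsBilinearAlg q r D α β γ)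
    (K : Type*) [CommRing K] : IsBilinearAlg q r (D : K) (fun i j => (α i j : K))
      (fun i j => (β i j : K)) (fun i j => (γ i j : K)) := by
  intro e he v hv w hw
  have := congrArg (Int.cast (R := K)) (h e he v hv w hw)
  push_cast at this
  exact this

namespace Cover

section

variable {I : Inst} {V R W k : ℕ} {S Y : List ℕ} {τ τ' : RamState}

lemma EnumInv.setArr (h : EnumInv I k S Y τ) {a : ℕ} (i v : ℕ) (ha : 12 < a) :
    EnumInv I k S Y (τ.setArr a i v) := by
  refine ⟨h.ctx.setArr i v (by omega), ?_, ?_, ?_⟩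
  · unfold Inst.Best
    rw [RamState.setArr_arr_ne _ _ _ (by omega : 12 ≠ a)]
    exact h.best
  · intro j hj
    rw [RamState.setArr_arr_ne _ _ _ (by omega : 10 ≠ a)]
    exact h.sets j hj
  · intro j hj
    rw [RamState.setArr_arr_ne _ _ _ (by omega : 11 ≠ a)]
    exact h.elems j hj

/-- Collect the candidates in array `13` and count them in register `8`. -/
def candP (k i₁ : ℕ) : BProg := .seq (.assign 8 (.const 0)) (.loop 31 (.reg 5)
  (.ite (inKE k i₁ 31) (.seq (.store 13 (.reg 8) (.reg 31))
    (.assign 8 ((BExpr.reg 8).add (.const 1)))) .skip))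

open Classical in
lemma hoare_candP {i₁ : ℕ} (h : EnumInv I k S Y τ) (hR : I.Short k R) (hRV : R ≤ V)
    (hi : i₁ ≤ S.length) (hik : i₁ ≤ k) :
    Hoare V R W (candP k i₁) τ fun τ' => EnumInv I k S Y τ' ∧ τ'.reg 7 = τ.reg 7 ∧
      τ'.reg 8 = ((range I.np).filter fun x => InK I.nb k I.np I.F (S.take i₁) x).card ∧
      (∀ j < τ'.reg 8, InK I.nb k I.np I.F (S.take i₁) (τ'.arr 13 j)) ∧
      ∀ x, InK I.nb k I.np I.F (S.take i₁) x → ∃ j < τ'.reg 8, τ'.arr 13 j = x := by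
  refine Hoare.seq (Hoare.assign Ev.const (fun _ => Nat.zero_le _) ?_)
  have h8 := h.setReg (x := 8) 0 (by norm_num)
  refine Hoare.loop (fun m τ' => EnumInv I k S Y τ' ∧ τ'.reg 7 = τ.reg 7 ∧
      τ'.reg 8 = ((range m).filter fun x => InK I.nb k I.np I.F (S.take i₁) x).card ∧
      (∀ j < τ'.reg 8, InK I.nb k I.np I.F (S.take i₁) (τ'.arr 13 j)) ∧
      ∀ x < m, InK I.nb k I.np I.F (S.take i₁) x → ∃ j < τ'.reg 8, τ'.arr 13 j = x)
    (Ev.reg' h8.ctx.np) (by have := hR.np; simp [BProg.loopBound]; omega)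
    ⟨h8, by simp, by simp, by simp, by simp⟩ ?_ ?_
  · rintro m hm τ₁ ⟨g1, g2, g3, g4, g5⟩
    have g1' := g1.setReg (x := 31) m (by norm_num)
    have e31 : (τ₁.setReg 31 m).reg 31 = m := by simp
    have t := tst_inKE (x := 31) g1'.ctx hR g1'.sets hi hik (by norm_num) (by rw [e31]; exact hm)
    rw [e31] at t
    refine Hoare.ite t (fun hK => ?_) (fun hK => ?_)
    · refine Hoare.seq (Hoare.store (v := m) (w := τ₁.reg 8) (Ev.reg' (by simp)) (Ev.reg' e31)
        (fun hb => by have := hb.1 31; rwa [e31] at this) ?_)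
      have hc : τ₁.reg 8 ≤ m := by rw [g3]; exact (card_filter_le _ _).trans (by simp)
      refine Hoare.assign (v := τ₁.reg 8 + 1) ((Ev.reg' (by simp)).add Ev.const)
        (fun _ => by have := hR.np; omega) ?_
      refine ⟨(g1'.setArr _ _ (by norm_num)).setReg _ (by norm_num), by simpa using g2, ?_, ?_, ?_⟩
      · rw [range_add_one, filter_insert, if_pos hK, card_insert_of_notMem (by simp)]
        simp [g3]
      · intro j hj
        simp only [RamState.setReg_reg, if_true] at hj
        simp only [RamState.setReg_arr, RamState.setArr_arr, true_and]
        split_ifs with hj'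
        · exact hK
        · exact g4 j (by omega)
      · intro x hx hxK
        rcases Nat.lt_succ_iff_lt_or_eq.1 hx with hx | rfl
        · obtain ⟨j, hj, hjx⟩ := g5 x hx hxK
          refine ⟨j, by simp; omega, ?_⟩
          have : j ≠ τ₁.reg 8 := by omega
          simpa [this] using hjx
        · exact ⟨τ₁.reg 8, by simp, by simp⟩
    · refine Hoare.skip ⟨g1', by simpa using g2, ?_, by simpa using g4, ?_⟩
      · rw [range_add_one, filter_insert, if_neg hK]
        simpa using g3
      · intro x hx hxK
        rcases Nat.lt_succ_iff_lt_or_eq.1 hx with hx | rfl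
        · simpa using g5 x hx hxK
        · exact absurd hxK hK
  · rintro τ₁ ⟨g1, g2, g3, g4, g5⟩
    exact ⟨g1, g2, g3, g4, fun x hx => g5 x hx.1 hx⟩

/-- Powers of register `8` in array `14`. -/
def powP (k : ℕ) : BProg := .seq (.store 14 (.const 0) (.const 1)) (.loop 31 (.const k)
  (.store 14 ((BExpr.reg 31).add (.const 1)) ((BExpr.get 14 (.reg 31)).mul (.reg 8))))

lemma hoare_powP {c : ℕ} (h8 : τ.reg 8 = c) (hkR : k ≤ R) (hV : ∀ j ≤ k, c ^ j ≤ V) :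
    Hoare V R W (powP k) τ fun τ' => ∀ j ≤ k, τ'.arr 14 j = c ^ j := by
  refine Hoare.seq (Hoare.store Ev.const Ev.const (fun _ => by simpa using hV 0 (Nat.zero_le _)) ?_)
  refine Hoare.loop (fun m τ' => τ'.reg 8 = c ∧ ∀ j ≤ m, τ'.arr 14 j = c ^ j) Ev.const
    (by simpa [BProg.loopBound] using hkR) ⟨h8, by simp⟩ ?_ ?_
  · rintro m hm τ₁ ⟨g1, g2⟩
    refine Hoare.store (w := m + 1) (v := c ^ m * c) ((Ev.reg' (by simp)).add Ev.const)
      ((Ev.get' (Ev.reg' (v := m) (by simp)) (by simp [g2])).mul (Ev.reg' (by simpa using g1)))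
      (fun _ => by rw [← pow_succ]; exact hV _ hm) ⟨by simpa using g1, fun j hj => ?_⟩
    simp only [RamState.setArr_arr, true_and]
    split_ifs with h
    · rw [h, pow_succ]
    · exact g2 j (by omega)
  · rintro τ₁ ⟨_, g2⟩
    exact g2

/-- The number `L` of levels in register `21`, with `r ^ L` and `d ^ L` in registers `22`, `23` and
powers of `q` in array `15`; the modulus in register `24` and `q ^ (2 L)` in register `33`. -/
def levelP (A : BilinearAlg) (g : ℕ) : BProg :=
  .seq (.assign 21 (.const 0)) (.seq (.assign 22 (.const 1)) (.seq (.assign 23 (.const 1))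
  (.seq (.store 15 (.const 0) (.const 1))
  (.seq (.loop 100 (.get 14 (.const g)) (.ite ((BExpr.get 15 (.reg 21)).lt (.get 14 (.const g)))
    (.seq (.store 15 ((BExpr.reg 21).add (.const 1)) ((BExpr.get 15 (.reg 21)).mul (.const A.q)))
    (.seq (.assign 22 ((BExpr.reg 22).mul (.const A.r)))
    (.seq (.assign 23 ((BExpr.reg 23).mul (.const A.d)))
      (.assign 21 ((BExpr.reg 21).add (.const 1)))))) .skip))
  (.seq (.assign 24 (((BExpr.reg 23).mul (.get 15 (.reg 21))).add (.const 1)))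
    (.assign 33 ((BExpr.get 15 (.reg 21)).mul (.get 15 (.reg 21)))))))))

/-- The number of rounds is `N`, more than needed; the guard freezes all registers once `q ^ L`
reaches `N`, so the state after `m` rounds depends on `min m L`. That `N` rounds suffice follows
from `clog q N ≤ N`. -/
lemma hoare_levelP (A : BilinearAlg) {g N L : ℕ} (h14 : τ.arr 14 g = N) (hL : Nat.clog A.q N = L)
    (hNW : N ≤ W) (hLV : L ≤ V) (hrV : A.r ^ L ≤ V) (hPV : A.d ^ L * A.q ^ L + 1 ≤ V) :
    Hoare V R W (levelP A g) τ fun τ' => τ'.reg 21 = L ∧ τ'.reg 22 = A.r ^ L ∧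
      τ'.reg 24 = A.d ^ L * A.q ^ L + 1 ∧ τ'.reg 33 = (A.q * A.q) ^ L ∧
      ∀ j ≤ L, τ'.arr 15 j = A.q ^ j := by
  have hq := A.two_le
  have hr : 1 ≤ A.r := le_trans (by nlinarith) A.sq_le
  have hd := A.d_pos
  have hdpos : ∀ j, 1 ≤ A.d ^ j := fun j => Nat.one_le_pow _ _ hd
  have hqpos : ∀ j, 1 ≤ A.q ^ j := fun j => Nat.one_le_pow _ _ (by omega)
  have b1 : ∀ j ≤ L, A.r ^ j ≤ V := fun j hj => (Nat.pow_le_pow_right hr hj).trans hrV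
  have b2 : ∀ j ≤ L, A.d ^ j * A.q ^ j ≤ V := fun j hj =>
    (Nat.mul_le_mul (Nat.pow_le_pow_right hd hj) (Nat.pow_le_pow_right (by omega) hj)).trans
      (by omega)
  have b3 : ∀ j ≤ L, A.d ^ j ≤ V := fun j hj =>
    le_trans (Nat.le_mul_of_pos_right _ (hqpos j)) (b2 j hj)
  have b4 : ∀ j ≤ L, A.q ^ j ≤ V := fun j hj =>
    le_trans (Nat.le_mul_of_pos_left _ (hdpos j)) (b2 j hj)
  have hV1 : 1 ≤ V := by omega
  refine Hoare.seq (Hoare.assign Ev.const (fun _ => Nat.zero_le _) ?_)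
  refine Hoare.seq (Hoare.assign Ev.const (fun _ => hV1) ?_)
  refine Hoare.seq (Hoare.assign Ev.const (fun _ => hV1) ?_)
  refine Hoare.seq (Hoare.store Ev.const Ev.const (fun _ => hV1) ?_)
  refine Hoare.seq (Hoare.loop (fun m τ' => τ'.arr 14 g = N ∧ τ'.reg 21 = min m L ∧
    τ'.reg 22 = A.r ^ min m L ∧ τ'.reg 23 = A.d ^ min m L ∧ ∀ j ≤ min m L, τ'.arr 15 j = A.q ^ j)
    (n := N) (Ev.get' Ev.const (by simpa using h14)) (by simpa [BProg.loopBound] using hNW)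
    ⟨by simpa using h14, by simp, by simp, by simp, by simp⟩ ?_ ?_)
  · rintro m hm τ₁ ⟨g1, g2, g3, g4, g5⟩
    have e15 : ∀ {a v}, (BExpr.get 15 (.reg 21)).Ev R ((τ₁.setReg 100 a)) v ↔
        v = A.q ^ min m L := by
      intro a v
      constructor
      · rintro ⟨_, h⟩
        rw [← h]
        simp [BExpr.eval, g2, g5]
      · rintro rfl
        exact Ev.get' (Ev.reg' (v := min m L) (by simpa using g2)) (by simp [g5])
    refine Hoare.ite (Tst.lt (e15.2 rfl) (Ev.get' Ev.const (by simpa using g1))) (fun hlt => ?_)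
      (fun hge => ?_)
    · rw [← Nat.lt_clog_iff_pow_lt (by omega), hL] at hlt
      have hmL : m < L := by omega
      have e1 : min m L = m := by omega
      have e2 : min (m + 1) L = m + 1 := by omega
      rw [e1] at g2 g3 g4 g5 e15
      rw [e2]
      refine Hoare.seq (Hoare.store (w := m + 1) ((Ev.reg' (by simpa using g2)).add Ev.const)
        ((e15.2 rfl).mul Ev.const) (fun _ => by rw [← pow_succ]; exact b4 _ hmL) ?_)
      refine Hoare.seq (Hoare.assign (v := A.r ^ m * A.r) ((Ev.reg' (by simpa using g3)).mul Ev.const)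
        (fun _ => by rw [← pow_succ]; exact b1 _ hmL) ?_)
      refine Hoare.seq (Hoare.assign (v := A.d ^ m * A.d) ((Ev.reg' (by simpa using g4)).mul Ev.const)
        (fun _ => by rw [← pow_succ]; exact b3 _ hmL) ?_)
      refine Hoare.assign (v := m + 1) ((Ev.reg' (by simpa using g2)).add Ev.const)
        (fun _ => by omega) ⟨by simpa using g1, by simp, by simp [pow_succ], by simp [pow_succ], ?_⟩
      intro j hj
      simp only [RamState.setReg_arr, RamState.setArr_arr, true_and]
      split_ifs with h
      · rw [h, pow_succ]
      · exact g5 j (by omega)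
    · rw [← Nat.lt_clog_iff_pow_lt (by omega), hL] at hge
      have e2 : min (m + 1) L = min m L := by omega
      rw [e2]
      exact Hoare.skip ⟨by simpa using g1, by simpa using g2, by simpa using g3, by simpa using g4,
        by simpa using g5⟩
  · rintro τ₁ ⟨g1, g2, g3, g4, g5⟩
    have hLN : L ≤ N := by
      rw [← hL]
      exact Nat.clog_le_of_le_pow (Nat.lt_pow_self (by omega)).le
    have e1 : min N L = L := by omega
    rw [e1] at g2 g3 g4 g5
    refine Hoare.seq (Hoare.assign (v := A.d ^ L * A.q ^ L + 1) (((Ev.reg' g4).mul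
      (Ev.get' (Ev.reg' g2) (g5 L le_rfl))).add Ev.const) (fun _ => hPV) ?_)
    refine Hoare.assign (v := A.q ^ L * A.q ^ L) ((Ev.get' (Ev.reg' (v := L) (by simpa using g2))
      (by simpa using g5 L le_rfl)).mul (Ev.get' (Ev.reg' (v := L) (by simpa using g2))
      (by simpa using g5 L le_rfl))) (fun _ => ?_) ⟨by simpa using g2, by simpa using g3, by simp,
        by simp [mul_pow], by simpa using g5⟩
    rw [← mul_pow]
    exact (Nat.pow_le_pow_left A.sq_le L).trans hrV

/-- The candidates, their number `c` and the parameters of the multiplication are in memory. -/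
structure LeafInv (I : Inst) (A : BilinearAlg) (k : ℕ) (S Y : List ℕ) (c L : ℕ) (K : ℕ → ℕ)
    (τ : RamState) : Prop where
  inv : EnumInv I k S Y τ
  r8 : τ.reg 8 = c
  a13 : τ.arr 13 = K
  a14 : ∀ j ≤ k, τ.arr 14 j = c ^ j
  r21 : τ.reg 21 = L
  r22 : τ.reg 22 = A.r ^ L
  r24 : τ.reg 24 = A.d ^ L * A.q ^ L + 1
  r33 : τ.reg 33 = (A.q * A.q) ^ L
  a15 : ∀ j ≤ L, τ.arr 15 j = A.q ^ j

variable {A : BilinearAlg} {c L : ℕ} {K : ℕ → ℕ}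

lemma LeafInv.setReg (h : LeafInv I A k S Y c L K τ) {x : ℕ} (v : ℕ) (hx : 25 ≤ x) (hx' : x ≠ 33) :
    LeafInv I A k S Y c L K (τ.setReg x v) := by
  have e1 : 8 ≠ x := by omega
  have e2 : 21 ≠ x := by omega
  have e3 : 22 ≠ x := by omega
  have e4 : 24 ≠ x := by omega
  exact ⟨h.inv.setReg v (by omega), by simp [e1, h.r8], h.a13, h.a14, by simp [e2, h.r21],
    by simp [e3, h.r22], by simp [e4, h.r24], by simp [hx'.symm, h.r33], h.a15⟩

lemma LeafInv.setArr (h : LeafInv I A k S Y c L K τ) {a : ℕ} (i v : ℕ) (ha : 16 ≤ a) :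
    LeafInv I A k S Y c L K (τ.setArr a i v) := by
  have e1 : 13 ≠ a := by omega
  have e2 : 14 ≠ a := by omega
  have e3 : 15 ≠ a := by omega
  refine ⟨h.inv.setArr i v (by omega), h.r8, ?_, ?_, h.r21, h.r22, h.r24, h.r33, ?_⟩
  · rw [RamState.setArr_arr_ne _ _ _ e1]; exact h.a13
  · rw [RamState.setArr_arr_ne _ _ _ e2]; exact h.a14
  · rw [RamState.setArr_arr_ne _ _ _ e3]; exact h.a15

lemma LeafInv.of_frame (h : LeafInv I A k S Y c L K τ) {p : BProg}
    (hr : ∀ x ∉ p.wr, τ'.reg x = τ.reg x) (ha : ∀ a ∉ p.wa, τ'.arr a = τ.arr a)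
    (hwr : ∀ x ∈ p.wr, 25 ≤ x ∧ x ≠ 33) (hwa : ∀ a ∈ p.wa, a = 10 ∨ 16 ≤ a)
    (hv : View 10 τ' S) : LeafInv I A k S Y c L K τ' := by
  have hr' : ∀ x, x < 25 ∨ x = 33 → τ'.reg x = τ.reg x := fun x hx =>
    hr x fun hm => by have := hwr x hm; omega
  have ha' : ∀ a, a ≠ 10 → a < 16 → τ'.arr a = τ.arr a := fun a h1 h2 =>
    ha a fun hm => by have := hwa a hm; omega
  have hc := h.inv.ctx
  have hb := h.inv.best
  have he := h.inv.elems
  refine ⟨⟨⟨?_, ?_, ?_, ?_, ?_, ?_, ?_⟩, ?_, hv, ?_⟩, ?_, ?_, ?_, ?_, ?_, ?_, ?_, ?_⟩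
  · rw [hr' 0 (by norm_num), hc.n]
  · rw [hr' 1 (by norm_num), hc.u]
  · rw [hr' 3 (by norm_num), hc.ds]
  · rw [hr' 4 (by norm_num), hc.F]
  · rw [hr' 5 (by norm_num), hc.np]
  · rw [hr' 6 (by norm_num), hc.up]
  · rw [ha' 9 (by norm_num) (by norm_num), hc.adj]
  · unfold Inst.Best
    rw [ha' 12 (by norm_num) (by norm_num), hr' 7 (by norm_num)]; exact hb
  · unfold View
    rw [ha' 11 (by norm_num) (by norm_num)]; exact he
  · rw [hr' 8 (by norm_num), h.r8]
  · rw [ha' 13 (by norm_num) (by norm_num), h.a13]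
  · rw [ha' 14 (by norm_num) (by norm_num)]; exact h.a14
  · rw [hr' 21 (by norm_num), h.r21]
  · rw [hr' 22 (by norm_num), h.r22]
  · rw [hr' 24 (by norm_num), h.r24]
  · rw [hr' 33 (by norm_num), h.r33]
  · rw [ha' 15 (by norm_num) (by norm_num)]; exact h.a15

/-- The list of `len` candidates encoded by the number `a` in base `c`. -/
def decode (K : ℕ → ℕ) (c len a : ℕ) : List ℕ := (List.range len).map fun j => K (a / c ^ j % c)

def decodedE (len a y : ℕ) : BExpr := .sum 63 (.const len) (.get 9
  (((BExpr.get 13 (((BExpr.reg a).div (.get 14 (.reg 63))).mod (.reg 8))).mul (.reg 1)).add (.reg y)))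

lemma tst_decodedE (h : LeafInv I A k S Y c L K τ) (hR : I.Short k R) {len a y : ℕ} (hlen : len ≤ k)
    (hy : τ.reg y < I.up) (hy' : y ≠ 63) (ha : a ≠ 63) :
    (decodedE len a y).Tst R τ (τ.reg y ∈ cvr I.nb (decode K c len (τ.reg a))) := by
  refine (Tst.ex (P := fun j => τ.reg y ∈ I.nb (K (τ.reg a / c ^ j % c))) Ev.const
    (by have := hR.k; omega) fun j hj => ?_).iff ?_
  · refine (Tst.ne_zero (Ev.get (((Ev.get (((Ev.reg' (v := τ.reg a) (by simp [ha])).div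
      (Ev.get' (v := j) (w := c ^ j) (Ev.reg' (by simp)) (by simp [h.a14 j (by omega)]))).mod
      (Ev.reg' (v := c) (by simp [h.r8])))).mul (Ev.reg' (v := I.u) (by simp [h.inv.ctx.u]))).add
      (Ev.reg' (v := τ.reg y) (by simp [hy']))))).iff ?_
    simp [Inst.nb, hy, h.a13, h.inv.ctx.adj]
  · simp [mem_cvr, decode]

/-- Registers `34` and `35` are the row and column of a matrix. They encode `A` and `C` in the first
factor (`qValE`), `C` and `B` in the second (`rValE`), and `A` and `B` in the product (`pValE`). -/
def pValE (i g₁ g₂ : ℕ) : BExpr :=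
  .count 64 (.reg 6) (((decodedE g₁ 34 64).add (decodedE g₂ 35 64)).mul (covE i 64).not)

def qValE (i g₁ g : ℕ) : BExpr :=
  .count 64 (.reg 6) (((decodedE g 35 64).mul (decodedE g₁ 34 64).not).mul (covE i 64).not)

def rValE (i g₂ g : ℕ) : BExpr :=
  .count 64 (.reg 6) (((decodedE g 34 64).mul (decodedE g₂ 35 64)).mul (covE i 64).not)

lemma cvr_subset (T : List ℕ) : cvr I.nb T ⊆ range I.up := by
  intro y hy
  obtain ⟨x, _, hx⟩ := mem_cvr.1 hy
  exact Inst.nb_subset x hx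

section values

variable (h : LeafInv I A k S Y c L K τ) (hR : I.Short k R) (hS : S.length ≤ k)
include h hR hS

lemma ev_pValE {g₁ g₂ : ℕ} (h₁ : g₁ ≤ k) (h₂ : g₂ ≤ k) : (pValE S.length g₁ g₂).Ev R τ
    (pVal I.nb S (decode K c g₁ (τ.reg 34)) (decode K c g₂ (τ.reg 35))) := by
  refine (Ev.count (P := fun y => (y ∈ cvr I.nb (decode K c g₁ (τ.reg 34)) ∨
    y ∈ cvr I.nb (decode K c g₂ (τ.reg 35))) ∧ y ∉ cvr I.nb S) (Ev.reg' h.inv.ctx.up)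
    (by have := hR.up; omega) fun y hy => ?_).congr ?_
  · have h' := h.setReg (x := 64) y (by norm_num) (by norm_num)
    have e1 : (τ.setReg 64 y).reg 64 = y := by simp
    have a := tst_decodedE (a := 34) (y := 64) h' hR h₁ (by rw [e1]; exact hy) (by norm_num)
      (by norm_num)
    have b := tst_decodedE (a := 35) (y := 64) h' hR h₂ (by rw [e1]; exact hy) (by norm_num)
      (by norm_num)
    have d := tst_covE (y := 64) h'.inv.ctx hR h'.inv.sets le_rfl hS (by rw [e1]; exact hy)
      (by norm_num)
    rw [List.take_length] at d
    simpa using (a.or b).and d.not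
  · rw [pVal]
    congr 1
    ext y
    simp only [mem_filter, mem_sdiff, mem_union]
    exact ⟨fun h => h.2, fun h => ⟨h.1.elim (fun h => cvr_subset _ h) fun h => cvr_subset _ h, h⟩⟩

lemma ev_qValE {g₁ g : ℕ} (h₁ : g₁ ≤ k) (h₂ : g ≤ k) : (qValE S.length g₁ g).Ev R τ
    (qVal I.nb S (decode K c g₁ (τ.reg 34)) (decode K c g (τ.reg 35))) := by
  refine (Ev.count (P := fun y => (y ∈ cvr I.nb (decode K c g (τ.reg 35)) ∧
    y ∉ cvr I.nb (decode K c g₁ (τ.reg 34))) ∧ y ∉ cvr I.nb S) (Ev.reg' h.inv.ctx.up)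
    (by have := hR.up; omega) fun y hy => ?_).congr ?_
  · have h' := h.setReg (x := 64) y (by norm_num) (by norm_num)
    have e1 : (τ.setReg 64 y).reg 64 = y := by simp
    have a := tst_decodedE (a := 34) (y := 64) h' hR h₁ (by rw [e1]; exact hy) (by norm_num)
      (by norm_num)
    have b := tst_decodedE (a := 35) (y := 64) h' hR h₂ (by rw [e1]; exact hy) (by norm_num)
      (by norm_num)
    have d := tst_covE (y := 64) h'.inv.ctx hR h'.inv.sets le_rfl hS (by rw [e1]; exact hy)
      (by norm_num)
    rw [List.take_length] at d
    simpa using (b.and a.not).and d.not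
  · rw [qVal]
    congr 1
    ext y
    simp only [mem_filter, mem_sdiff]
    exact ⟨fun h => h.2, fun h => ⟨cvr_subset _ h.1.1, h⟩⟩

lemma ev_rValE {g₂ g : ℕ} (h₁ : g₂ ≤ k) (h₂ : g ≤ k) : (rValE S.length g₂ g).Ev R τ
    (rVal I.nb S (decode K c g₂ (τ.reg 35)) (decode K c g (τ.reg 34))) := by
  refine (Ev.count (P := fun y => (y ∈ cvr I.nb (decode K c g (τ.reg 34)) ∧
    y ∈ cvr I.nb (decode K c g₂ (τ.reg 35))) ∧ y ∉ cvr I.nb S) (Ev.reg' h.inv.ctx.up)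
    (by have := hR.up; omega) fun y hy => ?_).congr ?_
  · have h' := h.setReg (x := 64) y (by norm_num) (by norm_num)
    have e1 : (τ.setReg 64 y).reg 64 = y := by simp
    have a := tst_decodedE (a := 34) (y := 64) h' hR h₂ (by rw [e1]; exact hy) (by norm_num)
      (by norm_num)
    have b := tst_decodedE (a := 35) (y := 64) h' hR h₁ (by rw [e1]; exact hy) (by norm_num)
      (by norm_num)
    have d := tst_covE (y := 64) h'.inv.ctx hR h'.inv.sets le_rfl hS (by rw [e1]; exact hy)
      (by norm_num)
    rw [List.take_length] at d
    simpa using (a.and b).and d.not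
  · rw [rVal]
    congr 1
    ext y
    simp only [mem_filter, mem_sdiff, mem_inter]
    exact ⟨fun h => h.2, fun h => ⟨cvr_subset _ h.1.1, h⟩⟩

end values

end

end Cover

end

section

open Finset BExpr

namespace Cover

variable {I : Inst} {A : BilinearAlg} {V R W k c L : ℕ} {K : ℕ → ℕ} {S Y : List ℕ}
  {τ τ' : RamState}

/-! ### The matrix product -/

def rowE (q : ℕ) : BExpr := .sum 60 (.reg 21) (((((BExpr.reg 100).div
  ((BExpr.get 15 (.reg 60)).mul (.get 15 (.reg 60)))).mod (.const (q * q))).div (.const q)).mul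
    (.get 15 (.reg 60)))

def colE (q : ℕ) : BExpr := .sum 60 (.reg 21) (((((BExpr.reg 100).div
  ((BExpr.get 15 (.reg 60)).mul (.get 15 (.reg 60)))).mod (.const (q * q))).mod (.const q)).mul
    (.get 15 (.reg 60)))

lemma ev_rowE (h : LeafInv I A k S Y c L K τ) (hL : L ≤ R) :
    (rowE A.q).Ev R τ (rowIdx A.q L (τ.reg 100)) := by
  refine Ev.sum (Ev.reg' h.r21) hL fun l hl => ?_
  have e : (BExpr.get 15 (.reg 60)).Ev R (τ.setReg 60 l) (A.q ^ l) :=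
    Ev.get' (Ev.reg' (v := l) (by simp)) (by simp [h.a15 l hl.le])
  rw [mul_pow]
  exact ((((Ev.reg' (by simp)).div (e.mul e)).mod Ev.const).div Ev.const).mul e

lemma ev_colE (h : LeafInv I A k S Y c L K τ) (hL : L ≤ R) :
    (colE A.q).Ev R τ (colIdx A.q L (τ.reg 100)) := by
  refine Ev.sum (Ev.reg' h.r21) hL fun l hl => ?_
  have e : (BExpr.get 15 (.reg 60)).Ev R (τ.setReg 60 l) (A.q ^ l) :=
    Ev.get' (Ev.reg' (v := l) (by simp)) (by simp [h.a15 l hl.le])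
  rw [mul_pow]
  exact ((((Ev.reg' (by simp)).div (e.mul e)).mod Ev.const).mod Ev.const).mul e

/-- The row and column of entry number `100` in registers `34` and `35`. -/
def idxP (q : ℕ) : BProg := .seq (.assign 34 (rowE q)) (.assign 35 (colE q))

lemma hoare_idxP {v : ℕ} {Q : RamState → Prop} (h : LeafInv I A k S Y c L K τ) (hL : L ≤ R)
    (hV : A.q ^ L ≤ V) (h100 : τ.reg 100 = v)
    (hQ : Q ((τ.setReg 34 (rowIdx A.q L v)).setReg 35 (colIdx A.q L v))) :
    Hoare V R W (idxP A.q) τ Q := by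
  have hq : 0 < A.q := by have := A.two_le; omega
  have e := ev_rowE h hL
  rw [h100] at e
  refine Hoare.seq (Hoare.assign e (fun _ => (rowIdx_lt hq L v).le.trans hV) ?_)
  have e' := ev_colE (h.setReg (x := 34) (rowIdx A.q L v) (by norm_num) (by norm_num)) hL
  rw [show ((τ.setReg 34 (rowIdx A.q L v)).reg 100) = v by simp [h100]] at e'
  exact Hoare.assign e' (fun _ => (colIdx_lt hq L v).le.trans hV) hQ

/-- Fill array `a` with the 0/1 matrix given by a test on registers `34` and `35`. -/
def fillP (q a : ℕ) (test : BExpr) : BProg := .loop 100 (.reg 33)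
  (.seq (idxP q) (.store a (.reg 100) ((BExpr.const 0).lt test)))

open Classical in
lemma hoare_fillP {a s t : ℕ} {test : BExpr} {P : ℕ → ℕ → Prop} (h : LeafInv I A k S Y c L K τ)
    (ha : 16 ≤ a) (hL : L ≤ R) (hqV : A.q ^ L ≤ V) (hV : 1 ≤ V) (hW : (A.q * A.q) ^ L ≤ W)
    (h25 : τ.reg 25 = s) (h26 : τ.reg 26 = t)
    (ht : ∀ τ', LeafInv I A k S Y c L K τ' → τ'.reg 25 = s → τ'.reg 26 = t →
      test.Tst R τ' (P (τ'.reg 34) (τ'.reg 35))) :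
    Hoare V R W (fillP A.q a test) τ fun τ' => ∀ v < (A.q * A.q) ^ L,
      τ'.arr a v = if P (rowIdx A.q L v) (colIdx A.q L v) then 1 else 0 := by
  refine Hoare.loop (fun m τ' => LeafInv I A k S Y c L K τ' ∧ τ'.reg 25 = s ∧ τ'.reg 26 = t ∧
    ∀ v < m, τ'.arr a v = if P (rowIdx A.q L v) (colIdx A.q L v) then 1 else 0)
    (Ev.reg' h.r33) (by simpa [BProg.loopBound] using hW) ⟨h, h25, h26, by simp⟩ ?_
    (fun _ h' => h'.2.2.2)
  rintro v hv τ₁ ⟨g1, g2, g3, g4⟩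
  refine Hoare.seq (hoare_idxP (v := v) (g1.setReg v (by norm_num) (by norm_num)) hL hqV (by simp) ?_)
  have g1' := ((g1.setReg (x := 100) v (by norm_num) (by norm_num)).setReg (x := 34)
    (rowIdx A.q L v) (by norm_num) (by norm_num)).setReg (x := 35) (colIdx A.q L v) (by norm_num)
      (by norm_num)
  have t1 := ht _ g1' (by simpa using g2) (by simpa using g3)
  refine Hoare.store (w := v) (v := if P (rowIdx A.q L v) (colIdx A.q L v) then 1 else 0)
    (Ev.reg' (by simp)) ((Ev.ind t1).congr ?_) (fun _ => by split_ifs <;> omega)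
    ⟨g1'.setArr _ _ ha, by simpa using g2, by simpa using g3, fun v' hv' => ?_⟩
  · simp
  · simp only [RamState.setArr_arr, true_and]
    by_cases h1 : v' = v
    · rw [if_pos h1, h1]
    · rw [if_neg h1]
      exact g4 v' (by omega)

/-- Multiply the matrices given by two tests; the product, in array `16`, is scaled. -/
def multP (A : BilinearAlg) (test₁ test₂ : BExpr) : BProg :=
  .seq (fillP A.q 16 test₁) (.seq (fillP A.q 17 test₂)
  (.seq (transformP 16 A.r (A.q * A.q) A.α (.reg 33))
  (.seq (transformP 17 A.r (A.q * A.q) A.β (.reg 33))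
  (.seq (.loop 100 (.reg 22) (.store 16 (.reg 100)
    (((BExpr.get 16 (.reg 100)).mul (.get 17 (.reg 100))).mod (.reg 24))))
  (transformP 16 (A.q * A.q) A.r (fun e t => A.γ t e) (.reg 22))))))

/-- The sizes of all arrays and loops fit. -/
structure LeafFit (A : BilinearAlg) (V R W L : ℕ) : Prop where
  LR : L ≤ R
  rR : A.r ≤ R
  WV : W ≤ V
  RV : R ≤ V
  rW : A.r ^ L ≤ W
  pV : A.d ^ L * A.q ^ L + 1 ≤ V

namespace LeafFit

variable (hf : LeafFit A V R W L)
include hf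

lemma qV : A.q ^ L ≤ V := by
  have h1 : 1 ≤ A.d ^ L := Nat.one_le_pow _ _ A.d_pos
  have := hf.pV
  nlinarith [Nat.zero_le (A.q ^ L)]

lemma qqW : (A.q * A.q) ^ L ≤ W := (Nat.pow_le_pow_left A.sq_le L).trans hf.rW

lemma qqR : A.q * A.q ≤ R := A.sq_le.trans hf.rR

lemma one_le : 1 ≤ V := by have := hf.pV; omega

lemma sz₁ {l : ℕ} (hl : l ≤ L) : A.r ^ l * (A.q * A.q) ^ (L - l) ≤ W := by
  calc _ ≤ A.r ^ l * A.r ^ (L - l) := Nat.mul_le_mul_left _ (Nat.pow_le_pow_left A.sq_le _)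
    _ = A.r ^ L := by rw [← pow_add]; congr 1; omega
    _ ≤ W := hf.rW

lemma sz₂ {l : ℕ} (hl : l ≤ L) : (A.q * A.q) ^ l * A.r ^ (L - l) ≤ W := by
  calc _ ≤ A.r ^ l * A.r ^ (L - l) := Nat.mul_le_mul_right _ (Nat.pow_le_pow_left A.sq_le _)
    _ = A.r ^ L := by rw [← pow_add]; congr 1; omega
    _ ≤ W := hf.rW

end LeafFit

-- An entry of the product of 0/1 matrices is the number `N` of middle indices that satisfy both
-- tests. The Kronecker power yields `d ^ L * N` modulo `P = d ^ L * q ^ L + 1`. As `N ≤ q ^ L`,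
-- nothing is lost by reduction.
open Classical in
lemma hoare_multP {s t : ℕ} {test₁ test₂ : BExpr} {P₁ P₂ : ℕ → ℕ → Prop}
    (h : LeafInv I A k S Y c L K τ) (hf : LeafFit A V R W L)
    (h25 : τ.reg 25 = s) (h26 : τ.reg 26 = t)
    (ht₁ : ∀ τ', LeafInv I A k S Y c L K τ' → τ'.reg 25 = s → τ'.reg 26 = t →
      test₁.Tst R τ' (P₁ (τ'.reg 34) (τ'.reg 35)))
    (ht₂ : ∀ τ', LeafInv I A k S Y c L K τ' → τ'.reg 25 = s → τ'.reg 26 = t →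
      test₂.Tst R τ' (P₂ (τ'.reg 34) (τ'.reg 35))) :
    Hoare V R W (multP A test₁ test₂) τ fun τ' => ∀ e < (A.q * A.q) ^ L,
      τ'.arr 16 e ≠ 0 ↔ ∃ z < A.q ^ L, P₁ (rowIdx A.q L e) z ∧ P₂ z (colIdx A.q L e) := by
  set P := A.d ^ L * A.q ^ L + 1 with hP
  have hPpos : 0 < P := by omega
  have hqpos : 0 < A.q := by have := A.two_le; omega
  have hqq : 0 < A.q * A.q := Nat.mul_pos hqpos hqpos
  have hrpos : 0 < A.r := lt_of_lt_of_le hqq A.sq_le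
  have hqL : 1 ≤ A.q ^ L := Nat.one_le_pow _ _ hqpos
  have hdL : 1 ≤ A.d ^ L := Nat.one_le_pow _ _ A.d_pos
  have hP1 : 1 < P := by rw [hP]; nlinarith
  -- both matrices
  refine Hoare.seq ((hoare_fillP h le_rfl hf.LR hf.qV hf.one_le hf.qqW h25 h26 ht₁).frame.mono ?_)
  rintro τ₁ ⟨f1, r1, a1⟩
  have h1 : LeafInv I A k S Y c L K τ₁ := h.of_frame r1 a1
    (by simp [fillP, idxP, BProg.wr]) (by simp [fillP, idxP, BProg.wa])
    (by unfold View; rw [a1 10 (by simp [fillP, idxP, BProg.wa])]; exact h.inv.sets)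
  refine Hoare.seq ((hoare_fillP (a := 17) h1 (by norm_num) hf.LR hf.qV hf.one_le hf.qqW
    (by rw [r1 25 (by simp [fillP, idxP, BProg.wr]), h25])
    (by rw [r1 26 (by simp [fillP, idxP, BProg.wr]), h26]) ht₂).frame.mono ?_)
  rintro τ₂ ⟨f2, r2, a2⟩
  have h2 : LeafInv I A k S Y c L K τ₂ := h1.of_frame r2 a2
    (by simp [fillP, idxP, BProg.wr]) (by simp [fillP, idxP, BProg.wa])
    (by unfold View; rw [a2 10 (by simp [fillP, idxP, BProg.wa])]; exact h1.inv.sets)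
  have f1' : ∀ v < (A.q * A.q) ^ L,
      τ₂.arr 16 v = if P₁ (rowIdx A.q L v) (colIdx A.q L v) then 1 else 0 := by
    rw [a2 16 (by simp [fillP, idxP, BProg.wa])]; exact f1
  -- transforms
  refine Hoare.seq ((hoare_transformP (P := P) (L := L) (by norm_num) hf.WV hf.pV hPpos hf.qqR hf.LR
    hrpos hqq (Ev.reg' h2.r33) h2.r21 h2.r24 (fun l hl => hf.sz₁ hl) (fun v hv => by
      rw [f1' v hv]; split_ifs <;> omega)).frame.mono ?_)
  rintro τ₃ ⟨f3, r3, a3⟩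
  have h3 : LeafInv I A k S Y c L K τ₃ := h2.of_frame r3 a3
    (by simp [transformP, BProg.wr]) (by simp [transformP, BProg.wa])
    (by unfold View; rw [a3 10 (by simp [transformP, BProg.wa])]; exact h2.inv.sets)
  have e17 : τ₃.arr 17 = τ₂.arr 17 := a3 17 (by simp [transformP, BProg.wa])
  refine Hoare.seq ((hoare_transformP (P := P) (L := L) (by norm_num) hf.WV hf.pV hPpos hf.qqR hf.LR
    hrpos hqq (Ev.reg' h3.r33) h3.r21 h3.r24 (fun l hl => hf.sz₁ hl) (fun v hv => by
      rw [e17, f2 v hv]; split_ifs <;> omega)).frame.mono ?_)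
  rintro τ₄ ⟨f4, r4, a4⟩
  have h4 : LeafInv I A k S Y c L K τ₄ := h3.of_frame r4 a4
    (by simp [transformP, BProg.wr]) (by simp [transformP, BProg.wa])
    (by unfold View; rw [a4 10 (by simp [transformP, BProg.wa])]; exact h3.inv.sets)
  have e16 : τ₄.arr 16 = τ₃.arr 16 := a4 16 (by simp [transformP, BProg.wa])
  -- pointwise product
  refine Hoare.seq (Hoare.loop (fun m τ' => LeafInv I A k S Y c L K τ' ∧ τ'.arr 17 = τ₄.arr 17 ∧
    (∀ v < m, τ'.arr 16 v = τ₄.arr 16 v * τ₄.arr 17 v % P) ∧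
    ∀ v, m ≤ v → τ'.arr 16 v = τ₄.arr 16 v) (Ev.reg' h4.r22)
    (by simpa [BProg.loopBound] using hf.rW) ⟨h4, rfl, by simp, by simp⟩ ?_ ?_)
  · rintro v hv σ ⟨g1, g2, g3, g4⟩
    refine Hoare.store (w := v) (v := τ₄.arr 16 v * τ₄.arr 17 v % P) (Ev.reg' (by simp))
      (((Ev.get' (Ev.reg' (v := v) (by simp)) (by simp [g4])).mul
        (Ev.get' (Ev.reg' (v := v) (by simp)) (by simp [g2]))).mod (Ev.reg' (by simp [g1.r24, hP])))
      (fun _ => (Nat.mod_lt _ hPpos).le.trans hf.pV)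
      ⟨(g1.setReg _ (by norm_num) (by norm_num)).setArr _ _ le_rfl, by
        rw [RamState.setArr_arr_ne _ _ _ (by norm_num)]; exact g2, fun v' hv' => ?_, fun v' hv' => ?_⟩
    · simp only [RamState.setArr_arr, true_and]
      split_ifs with hh
      · rw [hh]
      · exact g3 v' (by omega)
    · have : v' ≠ v := by omega
      simp [this, g4 v' (by omega)]
  rintro τ₅ ⟨h5, _, f5, _⟩
  refine (hoare_transformP (P := P) (L := L) (by norm_num) hf.WV hf.pV hPpos hf.rR hf.LR
    hqq hrpos (Ev.reg' h5.r22) h5.r21 h5.r24 (fun l hl => hf.sz₂ hl) (fun v hv => by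
      rw [f5 v hv]; exact Nat.mod_lt _ hPpos)).mono ?_
  intro τ₆ f6 e he
  obtain ⟨hlt, hval⟩ := f6 e he
  let X : ℕ → ℕ → ZMod P := fun a b => if P₁ a b then 1 else 0
  let Z : ℕ → ℕ → ZMod P := fun a b => if P₂ a b then 1 else 0
  have hkron := (A.isAlg.cast (ZMod P)).kron L X Z e he
  have hsum : ((τ₆.arr 16 e : ℕ) : ZMod P) = ((A.d : ℤ) : ZMod P) ^ L *
      ∑ z ∈ range (A.q ^ L), X (rowIdx A.q L e) z * Z z (colIdx A.q L e) := by
    rw [hval, ← hkron]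
    refine sum_congr rfl fun T hT => ?_
    have hT := mem_range.1 hT
    congr 1
    rw [f5 T hT, ZMod.natCast_mod, Nat.cast_mul, e16, (f3 T hT).2, (f4 T hT).2]
    congr 1
    · refine sum_congr rfl fun v hv => ?_
      rw [f1' v (mem_range.1 hv)]
      simp [X]
    · refine sum_congr rfl fun v hv => ?_
      rw [e17, f2 v (mem_range.1 hv)]
      simp [Z]
  set N := ((range (A.q ^ L)).filter fun z =>
    P₁ (rowIdx A.q L e) z ∧ P₂ z (colIdx A.q L e)).card with hN
  have hcount : ∑ z ∈ range (A.q ^ L), X (rowIdx A.q L e) z * Z z (colIdx A.q L e) = (N : ZMod P) := by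
    rw [hN, card_filter]
    push_cast
    refine sum_congr rfl fun z _ => ?_
    simp only [X, Z]
    by_cases p1 : P₁ (rowIdx A.q L e) z <;> by_cases p2 : P₂ z (colIdx A.q L e) <;> simp [p1, p2]
  have hNle : N ≤ A.q ^ L := (card_filter_le _ _).trans (by simp)
  -- Both numbers are below `P`, so congruence is equality.
  have heq : τ₆.arr 16 e = A.d ^ L * N := by
    have h' : ((τ₆.arr 16 e : ℕ) : ZMod P) = ((A.d ^ L * N : ℕ) : ZMod P) := by
      rw [hsum, hcount]; push_cast; rfl
    rw [ZMod.natCast_eq_natCast_iff'] at h'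
    have hb : A.d ^ L * N < P := by
      have := Nat.mul_le_mul_left (A.d ^ L) hNle
      omega
    rwa [Nat.mod_eq_of_lt hlt, Nat.mod_eq_of_lt hb] at h'
  rw [heq, Nat.mul_ne_zero_iff]
  constructor
  · rintro ⟨_, h0⟩
    obtain ⟨z, hz⟩ := card_pos.1 (Nat.pos_of_ne_zero h0)
    exact ⟨z, by simpa using (mem_filter.1 hz).1, (mem_filter.1 hz).2⟩
  · rintro ⟨z, hz, hz'⟩
    exact ⟨by omega, (card_pos.2 ⟨z, mem_filter.2 ⟨mem_range.2 hz, hz'⟩⟩).ne'⟩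

/-! ### Trying a complete solution -/

/-- Append the sets encoded by register `a` to the `base` sets in array `10`. -/
def appendP (base len a : ℕ) : BProg := .loop 31 (.const len) (.store 10
  ((BExpr.const base).add (.reg 31))
  (.get 13 (((BExpr.reg a).div (.get 14 (.reg 31))).mod (.reg 8))))

lemma hoare_appendP {S' : List ℕ} {len a : ℕ} (h : LeafInv I A k S Y c L K τ)
    (hv : View 10 τ (S ++ S')) (hR : I.Short k R) (hlen : len ≤ k) (ha : a ≠ 31) :
    Hoare V R W (appendP (S ++ S').length len a) τ fun τ' => LeafInv I A k S Y c L K τ' ∧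
      View 10 τ' (S ++ (S' ++ decode K c len (τ.reg a))) := by
  have key : Hoare V R W (appendP (S ++ S').length len a) τ fun τ' =>
      View 10 τ' (S ++ (S' ++ decode K c len (τ.reg a))) := by
    refine Hoare.loop (fun m τ' => τ'.arr 13 = K ∧ τ'.reg 8 = c ∧ τ'.reg a = τ.reg a ∧
      (∀ j ≤ k, τ'.arr 14 j = c ^ j) ∧ View 10 τ' (S ++ (S' ++ decode K c m (τ.reg a)))) Ev.const
      (by have := hR.k; simp [BProg.loopBound]; omega)
      ⟨h.a13, h.r8, rfl, h.a14, by simpa [decode] using hv⟩ ?_ (fun _ h' => h'.2.2.2.2)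
    rintro j hj σ ⟨g1, g2, g3, g4, g5⟩
    refine Hoare.store (w := (S ++ S').length + j) (v := K (τ.reg a / c ^ j % c))
      (Ev.const.add (Ev.reg' (by simp))) (Ev.get' (((Ev.reg' (v := τ.reg a) (by simp [ha, g3])).div
        (Ev.get' (v := j) (w := c ^ j) (Ev.reg' (by simp)) (by simp [g4 j (by omega)]))).mod
        (Ev.reg' (v := c) (by simp [g2]))) (by simp [g1]))
      (fun hb => by have := hb.2 13 (τ.reg a / c ^ j % c); simpa [g1] using this) ⟨?_, ?_, ?_, ?_, ?_⟩
    · rw [RamState.setArr_arr_ne _ _ _ (by norm_num)]; exact g1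
    · simpa using g2
    · simpa [ha] using g3
    · rw [RamState.setArr_arr_ne _ _ _ (by norm_num)]; exact g4
    · have g5' : View 10 (σ.setReg 31 j) (S ++ (S' ++ decode K c j (τ.reg a))) := g5
      have := g5'.snoc (K (τ.reg a / c ^ j % c))
      rw [show (S ++ (S' ++ decode K c j (τ.reg a))).length = (S ++ S').length + j by
        simp [decode, add_assoc]] at this
      convert this using 1
      simp [decode, List.range_succ]
  refine key.frame.mono ?_
  rintro σ ⟨g1, g2, g3⟩
  exact ⟨h.of_frame g2 g3 (by simp [appendP, BProg.wr]) (by simp [appendP, BProg.wa]) g1.of_append, g1⟩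

/-- Complete the partial solution of `i` sets by the sets encoded by registers `36`, `37`, `101` and
keep it if it is better than the best one known. -/
def tryP (i g₁ g₂ g : ℕ) : BProg :=
  .seq (appendP i g₁ 36) (.seq (appendP (i + g₁) g₂ 37) (.seq (appendP (i + g₁ + g₂) g 101)
  (.ite ((BExpr.reg 7).lt (.count 62 (.reg 6) (covE (i + g₁ + g₂ + g) 62)))
    (.seq (.assign 7 (.count 62 (.reg 6) (covE (i + g₁ + g₂ + g) 62)))
      (.loop 31 (.const (i + g₁ + g₂ + g)) (.store 12 (.reg 31) (.get 10 (.reg 31))))) .skip)))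

lemma length_decode (K : ℕ → ℕ) (c len a : ℕ) : (decode K c len a).length = len := by
  simp [decode]

lemma hoare_tryP {i g₁ g₂ g a b z : ℕ} (h : LeafInv I A k S Y c L K τ) (hR : I.Short k R)
    (hRV : R ≤ V) (hi : S.length = i) (hk : i + g₁ + g₂ + g ≤ k) (hS : ∀ x ∈ S, x < I.np)
    (h36 : τ.reg 36 = a) (h37 : τ.reg 37 = b) (h101 : τ.reg 101 = z)
    (ha : ∀ x ∈ decode K c g₁ a, x < I.np) (hb : ∀ x ∈ decode K c g₂ b, x < I.np)
    (hz : ∀ x ∈ decode K c g z, x < I.np) :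
    Hoare V R W (tryP i g₁ g₂ g) τ fun τ' => LeafInv I A k S Y c L K τ' ∧ τ.reg 7 ≤ τ'.reg 7 ∧
      (cvr I.nb (S ++ decode K c g₁ a ++ decode K c g₂ b ++ decode K c g z)).card ≤ τ'.reg 7 := by
  subst hi
  have hv : View 10 τ (S ++ []) := by simpa using h.inv.sets
  have s1 := hoare_appendP (V := V) (W := W) (len := g₁) (a := 36) h hv hR (by omega) (by norm_num)
  rw [List.append_nil, List.nil_append, h36] at s1
  refine Hoare.seq (s1.frame.mono ?_)
  rintro τ₁ ⟨⟨h1, v1⟩, r1, -⟩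
  have s2 := hoare_appendP (V := V) (W := W) (len := g₂) (a := 37) h1 v1 hR (by omega) (by norm_num)
  rw [List.length_append, length_decode, r1 37 (by simp [appendP, BProg.wr]), h37] at s2
  refine Hoare.seq (s2.frame.mono ?_)
  rintro τ₂ ⟨⟨h2, v2⟩, r2, -⟩
  have s3 := hoare_appendP (V := V) (W := W) (len := g) (a := 101) h2 v2 hR (by omega) (by norm_num)
  rw [List.length_append, List.length_append, length_decode, length_decode,
    r2 101 (by simp [appendP, BProg.wr]), r1 101 (by simp [appendP, BProg.wr]), h101,
    ← add_assoc] at s3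
  refine Hoare.seq (s3.frame.mono ?_)
  rintro τ₃ ⟨⟨h3, v3⟩, r3, -⟩
  have e7 : τ₃.reg 7 = τ.reg 7 := by
    rw [r3 7 (by simp [appendP, BProg.wr]), r2 7 (by simp [appendP, BProg.wr]),
      r1 7 (by simp [appendP, BProg.wr])]
  set T := S ++ (decode K c g₁ a ++ decode K c g₂ b ++ decode K c g z) with hT
  have hT' : S ++ decode K c g₁ a ++ decode K c g₂ b ++ decode K c g z = T := by
    simp [hT, List.append_assoc]
  have hTl : T.length = S.length + g₁ + g₂ + g := by
    simp [hT, length_decode]; ring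
  have hTn : ∀ x ∈ T, x < I.np := by
    intro x hx
    simp only [hT, List.mem_append] at hx
    rcases hx with hx | (hx | hx) | hx
    exacts [hS x hx, ha x hx, hb x hx, hz x hx]
  rw [hT', ← hTl]
  have ecnt : (BExpr.count 62 (.reg 6) (covE T.length 62)).Ev R τ₃ (cvr I.nb T).card := by
    refine (Ev.count (P := fun y => y ∈ cvr I.nb T) (Ev.reg' h3.inv.ctx.up)
      (by have := hR.up; omega) fun y hy => ?_).congr ?_
    · have h' := h3.inv.ctx.setReg (x := 62) y (by norm_num)
      have e1 : (τ₃.setReg 62 y).reg 62 = y := by simp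
      have := tst_covE (y := 62) h' hR v3 le_rfl (by omega) (by rw [e1]; exact hy) (by norm_num)
      rwa [e1, List.take_length] at this
    · congr 1
      ext y
      simp only [mem_filter]
      exact ⟨fun h => h.2, fun h => ⟨cvr_subset _ h, h⟩⟩
  refine Hoare.ite (Tst.lt (Ev.reg' e7) ecnt) (fun hlt => ?_) (fun hge => ?_)
  · refine Hoare.seq (Hoare.assign ecnt (fun _ => ?_) ?_)
    · have h1 := card_le_card (cvr_subset (I := I) T)
      rw [card_range] at h1
      have := hR.up
      omega
    have key : Hoare V R W (.loop 31 (.const T.length) (.store 12 (.reg 31) (.get 10 (.reg 31))))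
        (τ₃.setReg 7 (cvr I.nb T).card) fun τ' => (∀ j (hj : j < T.length), τ'.arr 12 j = T[j]) ∧
          ∀ j, T.length ≤ j → τ'.arr 12 j = τ₃.arr 12 j := by
      refine Hoare.loop (fun m τ' => View 10 τ' T ∧
        (∀ j (hj : j < T.length), j < m → τ'.arr 12 j = T[j]) ∧
        ∀ j, m ≤ j → τ'.arr 12 j = τ₃.arr 12 j) Ev.const
        (by have := hR.k; simp [BProg.loopBound]; omega) ⟨v3, by simp, by simp⟩ ?_
        (fun _ h' => ⟨fun j hj => h'.2.1 j hj hj, h'.2.2⟩)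
      rintro m hm σ ⟨g1, g2, g3⟩
      refine Hoare.store (w := m) (v := T[m]) (Ev.reg' (by simp))
        (Ev.get' (Ev.reg' (v := m) (by simp)) (by simpa using g1 m hm))
        (fun hb => by have := hb.2 10 m; simp only [RamState.setReg_arr] at this; rwa [g1 m hm] at this)
        ⟨?_, ?_, ?_⟩
      · unfold View
        rw [RamState.setArr_arr_ne _ _ _ (by norm_num)]; exact g1
      · intro j hj hjm
        simp only [RamState.setArr_arr, true_and]
        split_ifs with hh
        · subst hh; rfl
        · exact g2 j hj (by omega)
      · intro j hj
        have : j ≠ m := by omega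
        simpa [this] using g3 j (by omega)
    refine key.frame.mono ?_
    rintro σ ⟨⟨g1, g2⟩, hr, ha'⟩
    have hr' : ∀ x, x ≠ 31 → x ≠ 7 → σ.reg x = τ₃.reg x := by
      intro x hx hx'
      rw [hr x (by simp [BProg.wr, hx])]
      simp [hx']
    have ha'' : ∀ x, x ≠ 12 → σ.arr x = τ₃.arr x := by
      intro x hx
      rw [ha' x (by simp [BProg.wa, hx])]
      simp
    have e7' : σ.reg 7 = (cvr I.nb T).card := by
      rw [hr 7 (by simp [BProg.wr])]; simp
    refine ⟨⟨⟨⟨?_, ?_, ?_, ?_, ?_, ?_, ?_⟩, ⟨?_, ?_⟩, ?_, ?_⟩, ?_, ?_, ?_, ?_, ?_, ?_, ?_, ?_⟩, ?_, ?_⟩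
    · rw [hr' 0 (by norm_num) (by norm_num), h3.inv.ctx.n]
    · rw [hr' 1 (by norm_num) (by norm_num), h3.inv.ctx.u]
    · rw [hr' 3 (by norm_num) (by norm_num), h3.inv.ctx.ds]
    · rw [hr' 4 (by norm_num) (by norm_num), h3.inv.ctx.F]
    · rw [hr' 5 (by norm_num) (by norm_num), h3.inv.ctx.np]
    · rw [hr' 6 (by norm_num) (by norm_num), h3.inv.ctx.up]
    · rw [ha'' 9 (by norm_num), h3.inv.ctx.adj]
    · intro j hj
      rcases lt_or_ge j T.length with hj' | hj'
      · rw [g1 j hj']; exact hTn _ (List.getElem_mem _)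
      · rw [g2 j hj']; exact h3.inv.best.1 j hj
    · rw [e7']
      -- Array `12` may keep old entries beyond the end of `T`. They are valid sets and only enlarge
      -- the union, so register `7` remains a lower bound.
      refine card_le_card (cvr_mono fun x hx => ?_)
      obtain ⟨j, hj, rfl⟩ := List.mem_iff_getElem.1 hx
      rw [List.mem_map]
      exact ⟨j, List.mem_range.2 (by omega), g1 j hj⟩
    · unfold View
      rw [ha'' 10 (by norm_num)]; exact h3.inv.sets
    · unfold View
      rw [ha'' 11 (by norm_num)]; exact h3.inv.elems
    · rw [hr' 8 (by norm_num) (by norm_num), h3.r8]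
    · rw [ha'' 13 (by norm_num), h3.a13]
    · rw [ha'' 14 (by norm_num)]; exact h3.a14
    · rw [hr' 21 (by norm_num) (by norm_num), h3.r21]
    · rw [hr' 22 (by norm_num) (by norm_num), h3.r22]
    · rw [hr' 24 (by norm_num) (by norm_num), h3.r24]
    · rw [hr' 33 (by norm_num) (by norm_num), h3.r33]
    · rw [ha'' 15 (by norm_num)]; exact h3.a15
    · rw [e7']; omega
    · rw [e7']
  · refine Hoare.skip ⟨h3, by omega, by omega⟩

end Cover

end

/-! ### Finding the best completion of a partial solution -/

section

open Finset BExpr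

namespace Cover

variable {I : Inst} {A : BilinearAlg} {V R W k c L : ℕ} {K : ℕ → ℕ} {S Y : List ℕ}
  {τ τ' : RamState}

lemma decode_succ (K : ℕ → ℕ) (c len a : ℕ) :
    decode K c (len + 1) a = K (a % c) :: decode K c len (a / c) := by
  simp [decode, List.range_succ_eq_map, Function.comp_def, Nat.div_div_eq_div_mul, pow_succ']

lemma exists_decode (K : ℕ → ℕ) (c : ℕ) : ∀ T : List ℕ, (∀ x ∈ T, ∃ j < c, K j = x) →
    ∃ a < c ^ T.length, decode K c T.length a = T := by
  intro T
  induction T with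
  | nil => intro _; exact ⟨0, by simp, by simp [decode]⟩
  | cons x T ih =>
    intro h
    obtain ⟨a, ha, hd⟩ := ih fun y hy => h y (List.mem_cons_of_mem _ hy)
    obtain ⟨j, hj, rfl⟩ := h x List.mem_cons_self
    refine ⟨j + c * a, ?_, ?_⟩
    · simp only [List.length_cons, pow_succ']
      calc j + c * a < c + c * a := by omega
        _ = c * (a + 1) := by ring
        _ ≤ _ := Nat.mul_le_mul_left _ ha
    · rw [List.length_cons, decode_succ, Nat.add_mul_mod_self_left, Nat.mod_eq_of_lt hj,
        Nat.add_mul_div_left _ _ (by omega), Nat.div_eq_of_lt hj, zero_add, hd]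

lemma mem_decode {K : ℕ → ℕ} {c g len a x : ℕ} (ha : a < c ^ g) (hlen : len ≤ g)
    (hx : x ∈ decode K c len a) : ∃ j < c, K j = x := by
  simp only [decode, List.mem_map, List.mem_range] at hx
  obtain ⟨j, hj, rfl⟩ := hx
  refine ⟨_, Nat.mod_lt _ (Nat.pos_of_ne_zero ?_), rfl⟩
  rintro rfl
  rw [Nat.zero_pow (by omega)] at ha
  omega

/-- For every value of the first quantity, look for a nonzero entry of the product that attains it
and try all its completions. -/
def findP (q i g₁ g₂ g : ℕ) : BProg := .loop 27 ((BExpr.reg 6).add (.const 1))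
  (.seq (.assign 28 (.const 0))
  (.seq (.loop 100 (.reg 33) (.seq (idxP q)
    (.ite ((BExpr.get 16 (.reg 100)).mul ((pValE i g₁ g₂).eq (.reg 27)))
      (.seq (.assign 28 (.const 1)) (.seq (.assign 36 (.reg 34)) (.assign 37 (.reg 35)))) .skip)))
  (.ite (.reg 28) (.loop 101 (.get 14 (.const g)) (tryP i g₁ g₂ g)) .skip)))

lemma pVal_le (T A B : List ℕ) : pVal I.nb T A B ≤ I.up := by
  refine (card_le_card (sdiff_subset.trans (union_subset (cvr_subset A) (cvr_subset B)))).trans ?_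
  simp

lemma qVal_le (T A C : List ℕ) : qVal I.nb T A C ≤ I.up := by
  refine (card_le_card (sdiff_subset.trans (sdiff_subset.trans (cvr_subset C)))).trans ?_
  simp

lemma rVal_le (T B C : List ℕ) : rVal I.nb T B C ≤ I.up := by
  refine (card_le_card (sdiff_subset.trans (inter_subset_left.trans (cvr_subset C)))).trans ?_
  simp

/-- For fixed values of the other two quantities only `p` matters, so one nonzero entry for each
value of `p` represents all entries with that value. By `hM` nonzero entries have indices that
encode lists of candidates. -/
lemma hoare_findP {i g₁ g₂ g : ℕ} (h : LeafInv I A k S Y c L K τ) (hf : LeafFit A V R W L)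
    (hR : I.Short k R) (hi : S.length = i) (hk : i + g₁ + g₂ + g ≤ k) (hg₁ : g₁ ≤ g) (hg₂ : g₂ ≤ g)
    (hS : ∀ x ∈ S, x < I.np) (hK : ∀ j < c, K j < I.np) (hNW : c ^ g ≤ W)
    (hM : ∀ e < (A.q * A.q) ^ L, τ.arr 16 e ≠ 0 → rowIdx A.q L e < c ^ g ∧ colIdx A.q L e < c ^ g) :
    Hoare V R W (findP A.q i g₁ g₂ g) τ fun τ' => LeafInv I A k S Y c L K τ' ∧
      τ.reg 7 ≤ τ'.reg 7 ∧ ∀ e < (A.q * A.q) ^ L, τ.arr 16 e ≠ 0 →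
        ∃ e' < (A.q * A.q) ^ L, τ.arr 16 e' ≠ 0 ∧
          pVal I.nb S (decode K c g₁ (rowIdx A.q L e')) (decode K c g₂ (colIdx A.q L e')) =
          pVal I.nb S (decode K c g₁ (rowIdx A.q L e)) (decode K c g₂ (colIdx A.q L e)) ∧
          ∀ z < c ^ g, (cvr I.nb (S ++ decode K c g₁ (rowIdx A.q L e') ++
            decode K c g₂ (colIdx A.q L e') ++ decode K c g z)).card ≤ τ'.reg 7 := by
  have hRV := hf.RV
  have hup := hR.up
  set p : ℕ → ℕ := fun e =>
    pVal I.nb S (decode K c g₁ (rowIdx A.q L e)) (decode K c g₂ (colIdx A.q L e)) with hp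
  have hple : ∀ e, p e ≤ I.up := fun e => pVal_le _ _ _
  have hdec : ∀ len ≤ g, ∀ a < c ^ g, ∀ x ∈ decode K c len a, x < I.np := by
    intro len hlen a ha x hx
    obtain ⟨j, hj, rfl⟩ := mem_decode ha hlen hx
    exact hK j hj
  refine Hoare.loop (fun m τ' => LeafInv I A k S Y c L K τ' ∧ τ'.arr 16 = τ.arr 16 ∧
      τ.reg 7 ≤ τ'.reg 7 ∧ ∀ e < (A.q * A.q) ^ L, τ.arr 16 e ≠ 0 → p e < m →
        ∃ e' < (A.q * A.q) ^ L, τ.arr 16 e' ≠ 0 ∧ p e' = p e ∧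
          ∀ z < c ^ g, (cvr I.nb (S ++ decode K c g₁ (rowIdx A.q L e') ++
            decode K c g₂ (colIdx A.q L e') ++ decode K c g z)).card ≤ τ'.reg 7)
    ((Ev.reg' h.inv.ctx.up).add Ev.const) (by simpa [BProg.loopBound] using hup)
    ⟨h, rfl, le_rfl, by simp⟩ ?_ (fun τ' h' => ⟨h'.1, h'.2.2.1, fun e he hne =>
      h'.2.2.2 e he hne (by have := hple e; omega)⟩)
  rintro m hm τ₁ ⟨h1, a16, hb1, hd1⟩
  refine Hoare.seq (Hoare.assign Ev.const (fun _ => Nat.zero_le _) ?_)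
  have h1' := (h1.setReg (x := 27) m (by norm_num) (by norm_num)).setReg (x := 28) 0 (by norm_num)
    (by norm_num)
  refine Hoare.seq (Hoare.loop (fun v τ' => LeafInv I A k S Y c L K τ' ∧ τ'.arr 16 = τ.arr 16 ∧
    τ'.reg 7 = τ₁.reg 7 ∧ τ'.reg 27 = m ∧
    ((τ'.reg 28 = 0 ∧ ∀ e < v, τ.arr 16 e ≠ 0 → p e ≠ m) ∨ (τ'.reg 28 ≠ 0 ∧
      ∃ e < (A.q * A.q) ^ L, τ.arr 16 e ≠ 0 ∧ p e = m ∧ τ'.reg 36 = rowIdx A.q L e ∧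
        τ'.reg 37 = colIdx A.q L e))) (Ev.reg' h1'.r33)
    (by simpa [BProg.loopBound] using hf.qqW) ⟨h1', a16, by simp, by simp, by simp⟩ ?_ ?_)
  · rintro v hv τ₂ ⟨h2, b16, b7, b27, hor⟩
    refine Hoare.seq (hoare_idxP (v := v) (h2.setReg v (by norm_num) (by norm_num)) hf.LR hf.qV
      (by simp) ?_)
    have h2' := ((h2.setReg (x := 100) v (by norm_num) (by norm_num)).setReg (x := 34)
      (rowIdx A.q L v) (by norm_num) (by norm_num)).setReg (x := 35) (colIdx A.q L v) (by norm_num)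
      (by norm_num)
    have ep := ev_pValE h2' hR (by omega) (g₁ := g₁) (g₂ := g₂) (by omega) (by omega)
    rw [hi] at ep
    have rl := (rowIdx_lt (by have := A.two_le; omega : 0 < A.q) L v).le.trans hf.qV
    have cl := (colIdx_lt (by have := A.two_le; omega : 0 < A.q) L v).le.trans hf.qV
    refine Hoare.ite (P := τ.arr 16 v ≠ 0 ∧ p v = m) ((Tst.ne_zero (Ev.get' (Ev.reg' (v := v)
      (by simp)) (by simp [b16]))).and ((Tst.eq ep (Ev.reg' (v := m) (by simp [b27]))).iff
        (by simp [hp]))) (fun hc => ?_) (fun hc => ?_)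
    · refine Hoare.seq (Hoare.assign Ev.const (fun _ => hf.one_le) ?_)
      refine Hoare.seq (Hoare.assign (v := rowIdx A.q L v) (Ev.reg' (by simp)) (fun _ => rl) ?_)
      refine Hoare.assign (v := colIdx A.q L v) (Ev.reg' (by simp)) (fun _ => cl) ?_
      refine ⟨((h2'.setReg _ (by norm_num) (by norm_num)).setReg _ (by norm_num)
        (by norm_num)).setReg _ (by norm_num) (by norm_num), by simpa using b16, by simpa using b7,
        by simpa using b27, Or.inr ⟨by simp, v, hv, hc.1, hc.2, by simp, by simp⟩⟩
    · refine Hoare.skip ⟨h2', by simpa using b16, by simpa using b7, by simpa using b27, ?_⟩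
      rcases hor with ⟨h28, hall⟩ | h28
      · refine Or.inl ⟨by simpa using h28, fun e he hne hpe => ?_⟩
        rcases Nat.lt_succ_iff_lt_or_eq.1 he with he | rfl
        · exact hall e he hne hpe
        · exact hc ⟨hne, hpe⟩
      · exact Or.inr (by simpa using h28)
  · rintro τ₂ ⟨h2, b16, b7, b27, hor⟩
    refine Hoare.ite (Tst.ne_zero Ev.reg) (fun hne28 => ?_) (fun h28 => ?_)
    · obtain ⟨e₀, he₀, hne₀, hp₀, e36, e37⟩ := (hor.resolve_left fun hc => hne28 hc.1).2
      obtain ⟨rlt, clt⟩ := hM e₀ he₀ hne₀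
      refine Hoare.loop (fun z τ' => LeafInv I A k S Y c L K τ' ∧ τ'.arr 16 = τ.arr 16 ∧
        τ₂.reg 7 ≤ τ'.reg 7 ∧ τ'.reg 36 = rowIdx A.q L e₀ ∧ τ'.reg 37 = colIdx A.q L e₀ ∧
        ∀ z' < z, (cvr I.nb (S ++ decode K c g₁ (rowIdx A.q L e₀) ++
            decode K c g₂ (colIdx A.q L e₀) ++ decode K c g z')).card ≤ τ'.reg 7)
        (Ev.get' Ev.const (h2.a14 g (by omega))) (by simpa [BProg.loopBound] using hNW)
        ⟨h2, b16, le_rfl, e36, e37, by simp⟩ ?_ ?_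
      · rintro z hz τ₃ ⟨h3, c16, c7, c36, c37, hall⟩
        refine (hoare_tryP (a := rowIdx A.q L e₀) (b := colIdx A.q L e₀) (z := z)
          (h3.setReg z (by norm_num) (by norm_num)) hR hRV hi hk hS (by simpa using c36)
          (by simpa using c37) (by simp) (hdec g₁ hg₁ _ rlt) (hdec g₂ hg₂ _ clt)
          (hdec g le_rfl _ hz)).frame.mono ?_
        rintro τ₄ ⟨⟨h4, d7, d7'⟩, r4, a4⟩
        simp only [RamState.setReg_reg, show (7 : ℕ) ≠ 101 by norm_num, if_false] at d7
        refine ⟨h4, ?_, by omega, ?_, ?_, fun z' hz' => ?_⟩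
        · rw [a4 16 (by simp [tryP, appendP, BProg.wa])]; exact c16
        · rw [r4 36 (by simp [tryP, appendP, BProg.wr])]; simpa using c36
        · rw [r4 37 (by simp [tryP, appendP, BProg.wr])]; simpa using c37
        · rcases Nat.lt_succ_iff_lt_or_eq.1 hz' with hz' | rfl
          · exact (hall z' hz').trans d7
          · exact d7'
      · rintro τ₃ ⟨h3, c16, c7, c36, c37, hall⟩
        refine ⟨h3, c16, by omega, fun e he hne hpe => ?_⟩
        rcases Nat.lt_succ_iff_lt_or_eq.1 hpe with hpe | hpe
        · obtain ⟨e', he', k1, k2, k3⟩ := hd1 e he hne hpe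
          exact ⟨e', he', k1, k2, fun z hz => (k3 z hz).trans (by omega)⟩
        · exact ⟨e₀, he₀, hne₀, by rw [hp₀, hpe], hall⟩
    · rw [not_not] at h28
      have hall := (hor.resolve_right fun hc => hc.1 h28).2
      refine Hoare.skip ⟨h2, b16, by omega, fun e he hne hpe => ?_⟩
      rcases Nat.lt_succ_iff_lt_or_eq.1 hpe with hpe | hpe
      · obtain ⟨e', he', k1, k2, k3⟩ := hd1 e he hne hpe
        exact ⟨e', he', k1, k2, fun z hz => (k3 z hz).trans (by omega)⟩
      · exact absurd hpe (hall e he hne)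

/-- The matrices have size `q ^ L`, in general more than the number `c ^ g` of codes; the
comparisons fill the surplus rows and columns with zeros. -/
def testAC (i g₁ g : ℕ) : BExpr := (((BExpr.reg 34).lt (.get 14 (.const g))).mul
  ((BExpr.reg 35).lt (.get 14 (.const g)))).mul ((qValE i g₁ g).eq (.reg 25))

def testCB (i g₂ g : ℕ) : BExpr := (((BExpr.reg 34).lt (.get 14 (.const g))).mul
  ((BExpr.reg 35).lt (.get 14 (.const g)))).mul ((rValE i g₂ g).eq (.reg 26))

def coreP (A : BilinearAlg) (i g₁ g₂ g : ℕ) : BProg :=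
  .loop 25 ((BExpr.reg 6).add (.const 1)) (.loop 26 ((BExpr.reg 6).add (.const 1))
    (.seq (multP A (testAC i g₁ g) (testCB i g₂ g)) (findP A.q i g₁ g₂ g)))

/-- `b` is at least the value of every completion of `S` by candidates. -/
def LeafGoal (I : Inst) (k i₁ g₁ g₂ g : ℕ) (S : List ℕ) (b : ℕ) : Prop :=
  ∀ A B C : List ℕ, (∀ x ∈ A ++ B ++ C, InK I.nb k I.np I.F (S.take i₁) x) → A.length = g₁ →
    B.length = g₂ → C.length = g →
    (cvr I.nb S).card + pVal I.nb S A B + qVal I.nb S A C ≤ b + rVal I.nb S B C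

lemma LeafGoal.mono {i₁ g₁ g₂ g b b' : ℕ} (hb : b ≤ b') (h : LeafGoal I k i₁ g₁ g₂ g S b) :
    LeafGoal I k i₁ g₁ g₂ g S b' := fun A B C h1 h2 h3 h4 => by
  have := h A B C h1 h2 h3 h4
  omega

/-- All pairs of values `(s, t)` of `q` and `r` are tried, and each takes at most `up + 1` values.
For one pair, a triple with these values makes the entry at `(A, B)` nonzero, and the representative
with the same `p` has a third group with the same `s` and `t`. Its true coverage is at least the
pairwise value, by `val_le`. -/
lemma hoare_coreP {i i₁ g₁ g₂ g : ℕ} (h : LeafInv I A k S Y c L K τ) (hf : LeafFit A V R W L)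
    (hR : I.Short k R) (hi : S.length = i) (hk : i + g₁ + g₂ + g ≤ k) (hg₁ : g₁ ≤ g) (hg₂ : g₂ ≤ g)
    (hS : ∀ x ∈ S, x < I.np) (hK : ∀ j < c, InK I.nb k I.np I.F (S.take i₁) (K j))
    (hK' : ∀ x, InK I.nb k I.np I.F (S.take i₁) x → ∃ j < c, K j = x)
    (hN : c ^ g ≤ A.q ^ L) (hNW : c ^ g ≤ W) :
    Hoare V R W (coreP A i g₁ g₂ g) τ fun τ' => EnumInv I k S Y τ' ∧ τ.reg 7 ≤ τ'.reg 7 ∧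
      LeafGoal I k i₁ g₁ g₂ g S (τ'.reg 7) := by
  have hup := hR.up
  let G : ℕ → ℕ → ℕ → Prop := fun s t b => ∀ a < c ^ g, ∀ e < c ^ g, ∀ z < c ^ g,
    qVal I.nb S (decode K c g₁ a) (decode K c g z) = s →
    rVal I.nb S (decode K c g₂ e) (decode K c g z) = t →
    (cvr I.nb S).card + pVal I.nb S (decode K c g₁ a) (decode K c g₂ e) + s ≤ b + t
  have hG : ∀ s t b b', b ≤ b' → G s t b → G s t b' := by
    intro s t b b' hb hh a ha e he z hz h1 h2
    have := hh a ha e he z hz h1 h2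
    omega
  have hmul : ∀ s t τ₁, s ≤ I.up → t ≤ I.up → LeafInv I A k S Y c L K τ₁ → τ₁.reg 25 = s →
      τ₁.reg 26 = t → Hoare V R W (.seq (multP A (testAC i g₁ g) (testCB i g₂ g))
        (findP A.q i g₁ g₂ g)) τ₁ fun τ' => LeafInv I A k S Y c L K τ' ∧ τ₁.reg 7 ≤ τ'.reg 7 ∧
          G s t (τ'.reg 7) := by
    intro s t τ₁ hs ht h1 h25 h26
    refine Hoare.seq ((hoare_multP (s := s) (t := t)
      (P₁ := fun a z => (a < c ^ g ∧ z < c ^ g) ∧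
        qVal I.nb S (decode K c g₁ a) (decode K c g z) = s)
      (P₂ := fun z e => (z < c ^ g ∧ e < c ^ g) ∧
        rVal I.nb S (decode K c g₂ e) (decode K c g z) = t) h1 hf h25 h26 ?_ ?_).frame.mono ?_)
    · intro σ hσ e25 e26
      have e := ev_qValE hσ hR (by omega) (g₁ := g₁) (g := g) (by omega) (by omega)
      rw [hi] at e
      have eN : (BExpr.get 14 (.const g)).Ev R σ (c ^ g) := Ev.get' Ev.const (hσ.a14 g (by omega))
      exact ((Tst.lt Ev.reg eN).and (Tst.lt Ev.reg eN)).and (Tst.eq e (Ev.reg' e25))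
    · intro σ hσ e25 e26
      have e := ev_rValE hσ hR (by omega) (g₂ := g₂) (g := g) (by omega) (by omega)
      rw [hi] at e
      have eN : (BExpr.get 14 (.const g)).Ev R σ (c ^ g) := Ev.get' Ev.const (hσ.a14 g (by omega))
      exact ((Tst.lt Ev.reg eN).and (Tst.lt Ev.reg eN)).and (Tst.eq e (Ev.reg' e26))
    · rintro τ₂ ⟨hM, r2, a2⟩
      have h2 : LeafInv I A k S Y c L K τ₂ := h1.of_frame r2 a2
        (by simp [multP, fillP, idxP, transformP, BProg.wr])
        (by simp [multP, fillP, idxP, transformP, BProg.wa])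
        (by unfold View
            rw [a2 10 (by simp [multP, fillP, idxP, transformP, BProg.wa])]
            exact h1.inv.sets)
      have e7 : τ₂.reg 7 = τ₁.reg 7 :=
        r2 7 (by simp [multP, fillP, idxP, transformP, BProg.wr])
      refine (hoare_findP h2 hf hR hi hk hg₁ hg₂ hS (fun j hj => (hK j hj).1) hNW ?_).mono ?_
      · intro e he hne
        obtain ⟨z, _, h3, h4⟩ := (hM e he).1 hne
        exact ⟨h3.1.1, h4.1.2⟩
      · rintro τ₃ ⟨h3, b7, hF⟩
        refine ⟨h3, by omega, ?_⟩
        intro a ha e he z hz hq hr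
        obtain ⟨v, hv, hrow, hcol⟩ := exists_idx L a (ha.trans_le hN) e (he.trans_le hN)
        have hne : τ₂.arr 16 v ≠ 0 := (hM v hv).2 ⟨z, hz.trans_le hN, ⟨⟨by rwa [hrow], hz⟩,
          by rwa [hrow]⟩, ⟨hz, by rwa [hcol]⟩, by rwa [hcol]⟩
        -- The representative may differ from the triple under consideration; only the three values
        -- have to agree.
        obtain ⟨v', hv', hne', hpe, hall⟩ := hF v hv hne
        obtain ⟨z', _, h4, h5⟩ := (hM v' hv').1 hne'
        have h6 := hall z' h4.1.2
        have h7 := val_le (nb := I.nb) S (decode K c g₁ (rowIdx A.q L v'))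
          (decode K c g₂ (colIdx A.q L v')) (decode K c g z')
        rw [h4.2, h5.2, hpe, hrow, hcol] at h7
        omega
  refine Hoare.loop (fun s τ' => LeafInv I A k S Y c L K τ' ∧ τ.reg 7 ≤ τ'.reg 7 ∧
    ∀ s' < s, ∀ t ≤ I.up, G s' t (τ'.reg 7)) ((Ev.reg' h.inv.ctx.up).add Ev.const)
    (by simpa [BProg.loopBound] using hup) ⟨h, le_rfl, by simp⟩ ?_ ?_
  · rintro s hs τ₁ ⟨h1, b1, g1⟩
    have h1' := h1.setReg (x := 25) s (by norm_num) (by norm_num)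
    refine Hoare.loop (fun t τ' => LeafInv I A k S Y c L K τ' ∧ τ₁.reg 7 ≤ τ'.reg 7 ∧
      τ'.reg 25 = s ∧ ∀ t' < t, G s t' (τ'.reg 7)) ((Ev.reg' h1'.inv.ctx.up).add Ev.const)
      (by simpa [BProg.loopBound] using hup) ⟨h1', by simp, by simp, by simp⟩ ?_ ?_
    · rintro t ht τ₂ ⟨h2, b2, e2, g2⟩
      refine (hmul s t _ (by omega) (by omega) (h2.setReg t (by norm_num) (by norm_num))
        (by simpa using e2) (by simp)).frame.mono ?_
      rintro τ₃ ⟨⟨h3, b3, g3⟩, r3, _⟩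
      simp only [RamState.setReg_reg, show (7 : ℕ) ≠ 26 by norm_num, if_false] at b3
      refine ⟨h3, by omega, ?_, fun t' ht' => ?_⟩
      · rw [r3 25 (by simp [multP, fillP, idxP, transformP, findP, tryP, appendP, BProg.wr])]
        simpa using e2
      · rcases Nat.lt_succ_iff_lt_or_eq.1 ht' with ht' | rfl
        · exact hG _ _ _ _ b3 (g2 t' ht')
        · exact g3
    · rintro τ₂ ⟨h2, b2, e2, g2⟩
      refine ⟨h2, by omega, fun s' hs' t ht => ?_⟩
      rcases Nat.lt_succ_iff_lt_or_eq.1 hs' with hs' | rfl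
      · exact hG _ _ _ _ b2 (g1 s' hs' t ht)
      · exact g2 t (by omega)
  · rintro τ₁ ⟨h1, b1, g1⟩
    refine ⟨h1.inv, b1, ?_⟩
    intro Al Bl Cl hin hA hB hC
    have hlist : ∀ T : List ℕ, (∀ x ∈ T, x ∈ Al ++ Bl ++ Cl) → T.length ≤ g →
        ∃ a < c ^ g, decode K c T.length a = T := by
      intro T hT hl
      obtain ⟨a, ha, hd⟩ := exists_decode K c T fun x hx => hK' x (hin x (hT x hx))
      -- Raising `c ^ T.length` to `c ^ g` needs `c > 0`. Without candidates the largest group is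
      -- empty, and so are the others.
      rcases Nat.eq_zero_or_pos c with rfl | hc
      · rcases Nat.eq_zero_or_pos g with rfl | hg
        · have : T = [] := List.length_eq_zero_iff.1 (by omega)
          subst this
          exact ⟨0, by simp, by simp [decode]⟩
        · have hCne : Cl ≠ [] := by rintro rfl; simp at hC; omega
          obtain ⟨x, hx⟩ := List.exists_mem_of_ne_nil _ hCne
          obtain ⟨j, hj, _⟩ := hK' x (hin x (by simp [hx]))
          omega
      · exact ⟨a, ha.trans_le (Nat.pow_le_pow_right hc hl), hd⟩
    obtain ⟨a, ha, da⟩ := hlist Al (by simp +contextual) (by omega)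
    obtain ⟨e, he, de⟩ := hlist Bl (by simp +contextual) (by omega)
    obtain ⟨z, hz, dz⟩ := hlist Cl (by simp +contextual) (by omega)
    rw [hA] at da
    rw [hB] at de
    rw [hC] at dz
    have := g1 (qVal I.nb S Al Cl) (by have := qVal_le (I := I) S Al Cl; omega)
      (rVal I.nb S Bl Cl) (rVal_le _ _ _) a ha e he z hz (by rw [da, dz]) (by rw [de, dz])
    rwa [da, de] at this

/-- Complete a partial solution by three groups of `g₁`, `g₂` and `g` candidates. -/
def leafP (A : BilinearAlg) (k i₁ i g₁ g₂ g : ℕ) : BProg :=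
  .seq (candP k i₁) (.seq (powP k) (.seq (levelP A g) (coreP A i g₁ g₂ g)))

lemma LeafFit.of_le {L' : ℕ} (hf : LeafFit A V R W L) (h : L' ≤ L) : LeafFit A V R W L' := by
  have hq : 1 ≤ A.q := by have := A.two_le; omega
  have hr : 1 ≤ A.r := le_trans (by nlinarith) A.sq_le
  refine ⟨h.trans hf.LR, hf.rR, hf.WV, hf.RV, (Nat.pow_le_pow_right hr h).trans hf.rW, ?_⟩
  have := Nat.mul_le_mul (Nat.pow_le_pow_right A.d_pos h) (Nat.pow_le_pow_right hq h)
  have := hf.pV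
  omega

-- The number of candidates is known only when the program runs. The sizes are required to fit for
-- its bound `K₀`, and the number of levels is monotone in it.
open Classical in
lemma hoare_leafP {i i₁ g₁ g₂ g K₀ : ℕ} (h : EnumInv I k S Y τ)
    (hf : LeafFit A V R W (Nat.clog A.q (K₀ ^ g)))
    (hR : I.Short k R) (hi : S.length = i) (hi₁ : i₁ ≤ i) (hk : i + g₁ + g₂ + g ≤ k) (hg₁ : g₁ ≤ g)
    (hg₂ : g₂ ≤ g) (hS : ∀ x ∈ S, x < I.np) (hV : (I.np + 1) ^ k ≤ V)
    (hK₀ : ((range I.np).filter fun x => InK I.nb k I.np I.F (S.take i₁) x).card ≤ K₀) :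
    Hoare V R W (leafP A k i₁ i g₁ g₂ g) τ fun τ' => EnumInv I k S Y τ' ∧ τ.reg 7 ≤ τ'.reg 7 ∧
      LeafGoal I k i₁ g₁ g₂ g S (τ'.reg 7) := by
  have hq := A.two_le
  refine Hoare.seq ((hoare_candP h hR hf.RV (by omega) (by omega)).mono ?_)
  rintro τ₁ ⟨h1, e1, c1, k1, k1'⟩
  set c := τ₁.reg 8 with hc
  have hcn : c ≤ I.np := by rw [c1]; exact (card_filter_le _ _).trans (by simp)
  have hcV : ∀ j ≤ k, c ^ j ≤ V := by
    intro j hj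
    calc c ^ j ≤ (I.np + 1) ^ j := Nat.pow_le_pow_left (by omega) j
      _ ≤ (I.np + 1) ^ k := Nat.pow_le_pow_right (by omega) hj
      _ ≤ V := hV
  refine Hoare.seq ((hoare_powP (c := c) rfl (by have := hR.k; omega) hcV).frame.mono ?_)
  rintro τ₂ ⟨p2, r2, a2⟩
  set L := Nat.clog A.q (c ^ g) with hL
  have hf' : LeafFit A V R W L := hf.of_le (Nat.clog_mono_right _
    (Nat.pow_le_pow_left (c1 ▸ hK₀) g))
  have hN : c ^ g ≤ A.q ^ L := Nat.le_pow_clog (by omega) _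
  have hNW : c ^ g ≤ W := by
    refine hN.trans (le_trans ?_ hf'.qqW)
    exact Nat.pow_le_pow_left (Nat.le_mul_self _) L
  refine Hoare.seq ((hoare_levelP (N := c ^ g) (L := L) A (p2 g (by omega)) rfl hNW
    (hf'.LR.trans hf'.RV) (hf'.rW.trans hf'.WV) hf'.pV).frame.mono ?_)
  rintro τ₃ ⟨⟨s21, s22, s24, s33, s15⟩, r3, a3⟩
  have hreg : ∀ x, x ≤ 8 → τ₃.reg x = τ₁.reg x := by
    intro x hx
    rw [r3 x (by simp [levelP, BProg.wr]; omega), r2 x (by simp [powP, BProg.wr]; omega)]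
  have harr : ∀ x, x ≤ 13 → τ₃.arr x = τ₁.arr x := by
    intro x hx
    rw [a3 x (by simp [levelP, BProg.wa]; omega), a2 x (by simp [powP, BProg.wa]; omega)]
  have hinv : EnumInv I k S Y τ₃ := by
    have hx := h1.ctx
    refine ⟨⟨?_, ?_, ?_, ?_, ?_, ?_, ?_⟩, ?_, ?_, ?_⟩
    · rw [hreg 0 (by norm_num), hx.n]
    · rw [hreg 1 (by norm_num), hx.u]
    · rw [hreg 3 (by norm_num), hx.ds]
    · rw [hreg 4 (by norm_num), hx.F]
    · rw [hreg 5 (by norm_num), hx.np]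
    · rw [hreg 6 (by norm_num), hx.up]
    · rw [harr 9 (by norm_num), hx.adj]
    · unfold Inst.Best
      rw [harr 12 (by norm_num), hreg 7 (by norm_num)]; exact h1.best
    · unfold View
      rw [harr 10 (by norm_num)]; exact h1.sets
    · unfold View
      rw [harr 11 (by norm_num)]; exact h1.elems
  have hleaf : LeafInv I A k S Y c L (τ₁.arr 13) τ₃ :=
    ⟨hinv, hreg 8 le_rfl, harr 13 le_rfl, by
      rw [a3 14 (by simp [levelP, BProg.wa])]; exact p2, s21, s22, s24, s33, s15⟩
  refine (hoare_coreP (i₁ := i₁) hleaf hf' hR hi hk hg₁ hg₂ hS k1 k1' hN hNW).mono ?_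
  rintro τ₄ ⟨h4, b4, g4⟩
  rw [hreg 7 (by norm_num), e1] at b4
  exact ⟨h4, b4, g4⟩

end Cover

end

section

open Finset BExpr

namespace Cover

variable {I : Inst} {A : BilinearAlg} {V R W k : ℕ} {S Y : List ℕ} {τ : RamState}

/-! ### The search -/

/-- Choices that build a chain of `2 * c - 1` sets. -/
def chainWord : ℕ → List Kind
  | 0 => []
  | c + 1 => .start :: (List.replicate c [Kind.elem, .hit, .hit]).flatten

/-- The shape of a solution: `i₁` overlapping sets, `i₂` large sets, two chains given by `c₁` and
`c₂`, and three groups of candidates. -/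
structure Plan where
  i₁ : ℕ
  i₂ : ℕ
  c₁ : ℕ
  c₂ : ℕ
  g₁ : ℕ
  g₂ : ℕ
  g : ℕ

namespace Plan

def word (p : Plan) : List Kind :=
  List.replicate p.i₁ .overlap ++ (List.replicate p.i₂ .large ++ (chainWord p.c₁ ++ chainWord p.c₂))

def sets (p : Plan) : ℕ := p.i₁ + p.i₂ + (2 * p.c₁ - 1) + (2 * p.c₂ - 1)

/-- The balance of the groups gives `sets + 3 * g ≤ k + 2`, which is what produces the factor `1 /
3` in the exponent. -/
def Valid (k : ℕ) (p : Plan) : Prop :=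
  p.sets + p.g₁ + p.g₂ + p.g ≤ k ∧ p.g₁ ≤ p.g ∧ p.g₂ ≤ p.g ∧ p.g ≤ p.g₁ + 1 ∧ p.g ≤ p.g₂ + 1

instance (k : ℕ) (p : Plan) : Decidable (p.Valid k) := by unfold Valid; infer_instance

def all (k : ℕ) : List Plan :=
  let l := List.range (k + 1)
  (l.flatMap fun a => l.flatMap fun b => l.flatMap fun c => l.flatMap fun d => l.flatMap fun e =>
    l.flatMap fun f => l.map fun g => Plan.mk a b c d e f g).filter fun p => decide (p.Valid k)

lemma mem_all {k : ℕ} {p : Plan} : p ∈ all k ↔ p.Valid k := by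
  simp only [all, List.mem_filter, List.mem_flatMap, List.mem_map, List.mem_range, decide_eq_true_eq]
  constructor
  · exact fun h => h.2
  · intro h
    refine ⟨?_, h⟩
    obtain ⟨h1, -⟩ := h
    unfold sets at h1
    exact ⟨p.i₁, by omega, p.i₂, by omega, p.c₁, by omega, p.c₂, by omega, p.g₁, by omega,
      p.g₂, by omega, p.g, by omega, rfl⟩

end Plan

lemma setCount_append (w w' : List Kind) :
    Kind.setCount (w ++ w') = Kind.setCount w + Kind.setCount w' := by
  simp [Kind.setCount]

lemma setCount_chainWord (c : ℕ) : Kind.setCount (chainWord c) = 2 * c - 1 := by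
  cases c with
  | zero => rfl
  | succ c =>
    have : ∀ m, Kind.setCount (List.replicate m [Kind.elem, .hit, .hit]).flatten = 2 * m := by
      intro m
      induction m with
      | zero => rfl
      | succ m ih =>
        rw [List.replicate_succ, List.flatten_cons, setCount_append, ih]
        simp [Kind.setCount, Kind.wt]; ring
    simp only [chainWord]
    have h2 : ∀ w, Kind.setCount (.start :: w) = 1 + Kind.setCount w := fun w => by
      simp [Kind.setCount, Kind.wt]
    rw [h2, this]; omega

lemma Plan.setCount_word (p : Plan) : Kind.setCount p.word = p.sets := by
  simp only [word, setCount_append, setCount_chainWord, sets]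
  simp [Kind.setCount, Kind.wt]
  ring

lemma wellFormed_of_le {i₁ : ℕ} : ∀ (w : List Kind) (i : ℕ), i₁ ≤ i → Kind.WellFormed i₁ w i
  | [], _, _ => trivial
  | _ :: w, _, h => ⟨fun _ => h, wellFormed_of_le w _ (by omega)⟩

lemma Plan.wellFormed_word (p : Plan) : Kind.WellFormed p.i₁ p.word 0 := by
  have : ∀ m i w, p.i₁ = i + m → Kind.WellFormed p.i₁ (List.replicate m .overlap ++ w) i := by
    intro m
    induction m with
    | zero => intro i w h; exact wellFormed_of_le _ _ (by omega)
    | succ m ih =>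
      intro i w h
      exact ⟨by simp, ih _ _ (by simp [Kind.wt]; omega)⟩
  exact this _ _ _ (by omega)

/-! #### Solutions are reached -/

section reach

variable {i₁ : ℕ} {G : List ℕ → Prop}

/-- `Explored` quantifies over all branches; this lemma and the following ones specialize it to the
branch that makes the given choices. -/
lemma Explored.overlap (h : OverlapPath I.nb k I.np S) : ∀ w,
    Explored I k i₁ G (List.replicate S.length .overlap ++ w) [] Y → Explored I k i₁ G w S Y := by
  induction h with
  | nil => intro w h; exact h
  | @snoc S x hS hx ih =>
    intro w h
    rw [List.length_append, List.length_singleton, List.replicate_succ', List.append_assoc] at h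
    exact ih _ h x hx.1 hx

lemma Explored.large {S₀ : List ℕ} (hi : S₀.length = i₁) (hb : I.Brute S₀) {T : List ℕ}
    (hT : ∀ x ∈ T, x < I.np ∧ sm I.nb I.np S₀ < 2 * rs I.nb S₀ x) : ∀ (Q : List ℕ) w,
    Explored I k i₁ G (List.replicate T.length .large ++ w) (S₀ ++ Q) Y →
      Explored I k i₁ G w (S₀ ++ Q ++ T) Y := by
  induction T with
  | nil => intro Q w h; simpa using h
  | cons x T ih =>
    intro Q w h
    have hx := hT x List.mem_cons_self
    have h' := h x hx.1 (by
      simp only [Kind.Ok]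
      rw [← hi, List.take_left]
      exact ⟨hb, hx.2⟩)
    have := ih (fun y hy => hT y (List.mem_cons_of_mem _ hy)) (Q ++ [x]) w (by
      simpa [Kind.pushS, Kind.pushY] using h')
    simpa using this

/-- A step of a chain is made by the letters `elem`, `hit`, `hit`: first the shared element, then
the two sets that contain it. -/
lemma Explored.chain {S₀ : List ℕ} (hi : S₀.length = i₁) (hb : ¬ I.Brute S₀) {C : List ℕ}
    (hC : Chain (fun x => I.nb x \ cvr I.nb S₀) C) : ∀ (m : ℕ) (Q : List ℕ) (w : List Kind)
    (Y : List ℕ), C.length = 2 * m + 1 → (∀ x ∈ C, x < I.np) →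
    Explored I k i₁ G (chainWord (m + 1) ++ w) (S₀ ++ Q) Y →
      ∃ Y', Explored I k i₁ G w (S₀ ++ Q ++ C) Y' := by
  induction hC with
  | start x =>
    intro m Q w Y hm hx h
    have : m = 0 := by simp at hm; omega
    subst this
    exact ⟨Y, h x (hx x (by simp)) trivial⟩
  | @step C a b y hC hy ha hb' ih =>
    intro m Q w Y hm hx h
    obtain ⟨m', hm'⟩ := hC.length_odd
    have : m = m' + 1 := by
      simp only [List.length_append, List.length_cons, List.length_nil] at hm; omega
    subst this
    have e : chainWord (m' + 1 + 1) ++ w = chainWord (m' + 1) ++ (.elem :: .hit :: .hit :: w) := by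
      simp [chainWord, List.replicate_succ']
    rw [e] at h
    obtain ⟨Y', h'⟩ := ih m' Q _ Y hm' (fun x hx' => hx x (by simp [hx'])) h
    simp only [mem_cvr, mem_sdiff] at hy ha hb'
    obtain ⟨v, hv, hyv, hyS⟩ := hy
    have h1 := h' y (mem_range.1 (Inst.nb_subset v hyv)) (by
      simp only [Kind.Ok]
      rw [List.append_assoc, ← hi, List.take_left]
      refine ⟨⟨?_, fun hc => hyS (mem_cvr.1 hc)⟩, hb⟩
      exact mem_cvr.2 ⟨v, by simp [hv], hyv⟩)
    have h2 := h1 a (hx a (by simp)) ⟨y, by simp [Kind.pushY], ha.1⟩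
    have h3 := h2 b (hx b (by simp)) ⟨y, by simp [Kind.pushY], hb'.1⟩
    exact ⟨_, by simpa [Kind.pushS] using h3⟩

lemma Explored.chainPart {S₀ : List ℕ} (hi : S₀.length = i₁) (hb : ¬ I.Brute S₀) {C : List ℕ}
    {c : ℕ} (hC : ChainPart (fun x => I.nb x \ cvr I.nb S₀) c C) (hx : ∀ x ∈ C, x < I.np)
    (Q : List ℕ) (w : List Kind) (h : Explored I k i₁ G (chainWord c ++ w) (S₀ ++ Q) Y) :
    ∃ Y', Explored I k i₁ G w (S₀ ++ Q ++ C) Y' := by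
  rcases hC with ⟨rfl, rfl⟩ | ⟨hC, hl⟩
  · exact ⟨Y, by simpa [chainWord] using h⟩
  · obtain ⟨m, rfl⟩ : ∃ m, c = m + 1 := ⟨c - 1, by omega⟩
    exact Explored.chain hi hb hC m Q w Y (by omega) hx h

end reach

lemma ChainPart.length_eq {nb : ℕ → Finset ℕ} {c : ℕ} {C : List ℕ} (h : ChainPart nb c C) :
    C.length = 2 * c - 1 := by
  rcases h with ⟨rfl, rfl⟩ | ⟨-, h⟩
  · rfl
  · omega

/-- If all plans have been explored then the best value found is optimal. -/
theorem le_of_explored {b : ℕ} (hk : 1 ≤ k) (hn : 0 < I.np)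
    (hF : ∀ y, ((range I.np).filter fun x => y ∈ I.nb x).card ≤ I.F) {T : Finset ℕ}
    (hT : IsOpt I.nb k I.np T)
    (h : ∀ p : Plan, p.Valid k → Explored I k p.i₁
      (fun S => LeafGoal I k p.i₁ p.g₁ p.g₂ p.g S b) p.word [] []) :
    (T.biUnion I.nb).card ≤ b := by
  obtain ⟨S, hS, ⟨Q, hQ, hQl, hQc⟩, c₁, c₂, P₁, P₂, A, B, C, hP₁, hP₂, hK, hl, hAC, hBC, hCA, hCB,
    hval⟩ := exists_decomposition hk hn hF hT
  -- In this case the remaining members are all enumerated as large sets and the groups are empty.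
  -- Otherwise there are no large sets, and chains and groups supply the rest.
  by_cases hb : I.Brute S
  · have h1 := h ⟨S.length, Q.length, 0, 0, 0, 0, 0⟩ ⟨by simp [Plan.sets]; omega, by simp⟩
    have h2 := Explored.overlap hS _ h1
    have h3 := Explored.large rfl hb hQ [] _ (by simpa using h2)
    have h4 := h3 [] [] [] (by simp) rfl rfl rfl
    simp only [List.append_nil] at h4
    have e : rVal I.nb (S ++ Q) [] [] = 0 := by simp [rVal, cvr]
    omega
  · have h1 := h ⟨S.length, 0, c₁, c₂, A.length, B.length, C.length⟩ ⟨by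
      simp only [Plan.sets]; rw [hP₁.length_eq, hP₂.length_eq] at hl; omega, hAC, hBC, hCA, hCB⟩
    have h2 := Explored.overlap hS _ h1
    obtain ⟨Y₁, h3⟩ := Explored.chainPart rfl hb hP₁ (fun x hx => (hK x (by simp [hx])).1) [] _
      (by simpa using h2)
    obtain ⟨Y₂, h4⟩ := Explored.chainPart (w := []) rfl hb hP₂
      (fun x hx => (hK x (by simp [hx])).1) P₁ (by simpa using h3)
    have h5 := h4 A B C (fun x hx => by
      rw [List.append_assoc S, List.take_left]
      exact hK x (by simp at hx ⊢; tauto)) rfl rfl rfl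
    omega

/-! #### The program -/

def planP (A : BilinearAlg) (k : ℕ) (p : Plan) : BProg :=
  enumP (leafP A k p.i₁ p.sets p.g₁ p.g₂ p.g) k p.i₁ p.word 0 0

def seqList : List BProg → BProg
  | [] => .skip
  | p :: l => .seq p (seqList l)

/-- Explore all plans. -/
def searchP (A : BilinearAlg) (k : ℕ) : BProg := seqList ((Plan.all k).map (planP A k))

def testTime (R : ℕ) : ℕ := (Kind.overlap.testE 0 0 0 0).tb R + (Kind.large.testE 0 0 0 0).tb R +
  (Kind.start.testE 0 0 0 0).tb R + (Kind.elem.testE 0 0 0 0).tb R + (Kind.hit.testE 0 0 0 0).tb R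

/-- The parameters occur only as constants, so they affect values but not the shape of the
expression and its time bound. -/
lemma testE_tb_le (κ : Kind) (k i₁ i l R : ℕ) : (κ.testE k i₁ i l).tb R ≤ testTime R := by
  have : (κ.testE k i₁ i l).tb R = (κ.testE 0 0 0 0).tb R := by cases κ <;> rfl
  rw [this, testTime]
  cases κ <;> omega

/-- Bounds for the number of choices of each kind. -/
def Kind.cap (I : Inst) (k b₁ b₂ : ℕ) : Kind → ℕ
  | overlap => 2 * k * I.F
  | large => b₁
  | start => I.np
  | elem => k * b₂
  | hit => I.F

/-- The length of long loops in a leaf if there are at most `K₀` candidates. -/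
def leafWidth (A : BilinearAlg) (K₀ g : ℕ) : ℕ := A.r ^ Nat.clog A.q (K₀ ^ g)

def planTime (A : BilinearAlg) (I : Inst) (k R K₀ b₁ b₂ : ℕ) (p : Plan) : ℕ :=
  enumTime R (testTime R)
    ((leafP A k p.i₁ p.sets p.g₁ p.g₂ p.g).time R (leafWidth A K₀ p.g)) (Kind.cap I k b₁ b₂) p.word

/-- `K₀` bounds the candidates, `b₁` the large sets in the case of exhaustive search, and `b₂` the
residual size in the other case. The disjunction in `cand` reflects the two bounds for candidates,
by rank and by size. -/
structure SearchFit (A : BilinearAlg) (I : Inst) (k V R K₀ b₁ b₂ : ℕ) : Prop where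
  np : 0 < I.np
  F : ∀ y, ((range I.np).filter fun x => y ∈ I.nb x).card ≤ I.F
  short : I.Short k R
  pow : (I.np + 1) ^ k ≤ V
  cand : ∀ S, k * sm I.nb I.np S * I.F + 1 ≤ K₀ ∨
    ((range I.np).filter fun x => sm I.nb I.np S < 2 * rs I.nb S x).card ≤ K₀
  large : ∀ S, I.Brute S →
    ((range I.np).filter fun x => sm I.nb I.np S < 2 * rs I.nb S x).card ≤ b₁
  elem : ∀ S, ¬ I.Brute S → sm I.nb I.np S ≤ b₂
  leaf : ∀ g ≤ k, LeafFit A V R (leafWidth A K₀ g) (Nat.clog A.q (K₀ ^ g))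

-- `large` and `elem` have no admissible choice on the wrong side of `Inst.Brute`, so each cap has
-- to be justified in its own case only.
open Classical in
lemma SearchFit.card_le {K₀ b₁ b₂ i₁ : ℕ} (hf : SearchFit A I k V R K₀ b₁ b₂) (κ : Kind)
    (hS : ∀ x ∈ S, x < I.np) (hl : S.length ≤ k) :
    ((range (κ.bd I)).filter fun x => κ.Ok I k i₁ S Y x).card ≤ κ.cap I k b₁ b₂ := by
  cases κ with
  | overlap => exact card_overlap_le hf.np hf.F S
  | large =>
    by_cases hb : I.Brute (S.take i₁)
    · refine (card_le_card ?_).trans (hf.large _ hb)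
      intro x hx
      have hx' := mem_filter.1 hx
      exact mem_filter.2 ⟨hx'.1, hx'.2.2⟩
    · rw [filter_eq_empty_iff.2 (fun x _ hx => hb hx.1)]
      simp
  | start => exact (card_filter_le _ _).trans (by simp [Kind.bd, Kind.cap])
  | elem =>
    by_cases hb : I.Brute (S.take i₁)
    · rw [filter_eq_empty_iff.2 (fun x _ hx => hx.2 hb)]
      simp
    · calc _ ≤ (cvr I.nb S \ cvr I.nb (S.take i₁)).card := by
            refine card_le_card fun x hx => ?_
            exact mem_sdiff.2 (mem_filter.1 hx).2.1
        _ ≤ S.length * sm I.nb I.np (S.take i₁) := card_cvr_sdiff_le _ _ hS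
        _ ≤ k * b₂ := Nat.mul_le_mul hl (hf.elem _ hb)
  | hit =>
    cases hY : Y.getLast? with
    | none =>
      rw [filter_eq_empty_iff.2 (fun x _ hx => by obtain ⟨y, h, _⟩ := hx; simp [hY] at h)]
      simp
    | some y =>
      refine (card_le_card ?_).trans (hf.F y)
      intro x hx
      simp only [mem_filter, Kind.Ok, Kind.bd, hY, Option.some.injEq, exists_eq_left'] at hx ⊢
      exact hx

open Classical in
lemma SearchFit.card_inK {K₀ b₁ b₂ : ℕ} (hf : SearchFit A I k V R K₀ b₁ b₂) (S : List ℕ) :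
    ((range I.np).filter fun x => InK I.nb k I.np I.F S x).card ≤ K₀ := by
  rcases hf.cand S with h | h
  · exact (card_inK_le S).trans h
  · refine (card_le_card ?_).trans h
    intro x hx
    simp only [mem_filter] at hx ⊢
    exact ⟨hx.1, hx.2.2.1⟩

lemma tri_planP {K₀ b₁ b₂ : ℕ} (hf : SearchFit A I k V R K₀ b₁ b₂) {p : Plan} (hp : p.Valid k)
    (h : EnumInv I k [] [] τ) :
    Tri V (planP A k p) τ (planTime A I k R K₀ b₁ b₂ p) fun τ' => EnumInv I k [] [] τ' ∧
      τ.reg 7 ≤ τ'.reg 7 ∧ Explored I k p.i₁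
        (fun S => LeafGoal I k p.i₁ p.g₁ p.g₂ p.g S (τ'.reg 7)) p.word [] [] := by
  obtain ⟨h1, h2, h3, -⟩ := hp
  have hlf := hf.leaf p.g (by omega)
  have hi : p.i₁ ≤ p.sets := by unfold Plan.sets; omega
  refine tri_enumP (i' := p.sets) (G := fun S b => LeafGoal I k p.i₁ p.g₁ p.g₂ p.g S b)
    (fun S b b' hb hG => hG.mono hb) hf.short hlf.RV (by omega) (by omega)
    (fun κ i l => testE_tb_le κ k p.i₁ i l R) (fun κ S Y hS hl => hf.card_le κ hS hl) ?_ p.word [] []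
    τ h (by simp) (by simp) (by simpa using p.setCount_word) p.wellFormed_word
  intro S Y σ hS hl hσ
  exact hoare_leafP hσ hlf hf.short hl hi (by omega) h2 h3 hS hf.pow (hf.card_inK _) hlf.RV hlf.WV

/-- The search finds the optimum. -/
theorem tri_searchP {K₀ b₁ b₂ : ℕ} (hf : SearchFit A I k V R K₀ b₁ b₂) (hk : 1 ≤ k)
    (h : EnumInv I k [] [] τ) :
    Tri V (searchP A k) τ (1 + ((Plan.all k).map (planTime A I k R K₀ b₁ b₂)).sum) fun τ' =>
      EnumInv I k [] [] τ' ∧ ∀ T, IsOpt I.nb k I.np T → (T.biUnion I.nb).card ≤ τ'.reg 7 := by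
  have key : ∀ l : List Plan, (∀ p ∈ l, p.Valid k) → ∀ τ, EnumInv I k [] [] τ →
      Tri V (seqList (l.map (planP A k))) τ (1 + (l.map (planTime A I k R K₀ b₁ b₂)).sum) fun τ' =>
        EnumInv I k [] [] τ' ∧ τ.reg 7 ≤ τ'.reg 7 ∧ ∀ p ∈ l, Explored I k p.i₁
          (fun S => LeafGoal I k p.i₁ p.g₁ p.g₂ p.g S (τ'.reg 7)) p.word [] [] := by
    intro l
    induction l with
    | nil => intro _ τ hτ; exact Tri.skip (by simp) ⟨hτ, le_rfl, by simp⟩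
    | cons p l ih =>
      intro hl τ hτ
      refine Tri.seq (T₁ := planTime A I k R K₀ b₁ b₂ p)
        (T₂ := 1 + (l.map (planTime A I k R K₀ b₁ b₂)).sum)
        ((tri_planP hf (hl p List.mem_cons_self) hτ).mono le_rfl ?_) (by simp; omega)
      rintro τ₁ ⟨g1, g2, g3⟩
      refine (ih (fun p hp => hl p (List.mem_cons_of_mem _ hp)) τ₁ g1).mono le_rfl ?_
      rintro τ₂ ⟨k1, k2, k3⟩
      refine ⟨k1, g2.trans k2, fun p' hp' => ?_⟩
      rcases List.mem_cons.1 hp' with rfl | hp'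
      · exact g3.mono fun S hG => hG.mono k2
      · exact k3 p' hp'
  refine (key _ (fun p hp => Plan.mem_all.1 hp) τ h).mono le_rfl ?_
  rintro τ' ⟨g1, -, g3⟩
  exact ⟨g1, fun T hT => le_of_explored hk hf.np hf.F hT fun p hp => g3 p (Plan.mem_all.2 hp)⟩

end Cover

end

section

open Finset BExpr

namespace Cover

/-! ### The kernel -/

/-- The edges, listed without repetition by their endpoints. -/
structure Edges (n u m : ℕ) (X Y : ℕ → ℕ) : Prop where
  X_lt : ∀ e < m, X e < n
  Y_lt : ∀ e < m, Y e < u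
  inj : ∀ e < m, ∀ e' < m, X e = X e' → Y e = Y e' → e = e'

/-- The neighbourhood of `x`. -/
def nbh (m : ℕ) (X Y : ℕ → ℕ) (x : ℕ) : Finset ℕ := ((range m).filter fun e => X e = x).image Y

lemma mem_nbh {m : ℕ} {X Y : ℕ → ℕ} {x y : ℕ} : y ∈ nbh m X Y x ↔ ∃ e < m, X e = x ∧ Y e = y := by
  simp [nbh, and_assoc]

def deg (m : ℕ) (X : ℕ → ℕ) (x : ℕ) : ℕ := ((range m).filter fun e => X e = x).card

variable {n u m : ℕ} {X Y : ℕ → ℕ}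

lemma Edges.card_nbh (h : Edges n u m X Y) (x : ℕ) : (nbh m X Y x).card = deg m X x := by
  rw [nbh, card_image_of_injOn, deg]
  intro e he e' he' hY
  simp only [coe_filter, mem_range, Set.mem_ofPred_eq] at he he'
  exact h.inj e he.1 e' he'.1 (he.2.trans he'.2.symm) hY

lemma card_mem_nbh_le (y : ℕ) :
    ((range n).filter fun x => y ∈ nbh m X Y x).card ≤ deg m Y y := by
  refine (card_le_card (t := ((range m).filter fun e => Y e = y).image X) ?_).trans card_image_le
  intro x hx
  obtain ⟨e, he, h1, h2⟩ := mem_nbh.1 (mem_filter.1 hx).2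
  exact mem_image.2 ⟨e, mem_filter.2 ⟨mem_range.2 he, h2⟩, h1⟩

lemma Edges.card_mem_nbh (h : Edges n u m X Y) (y : ℕ) :
    ((range n).filter fun x => y ∈ nbh m X Y x).card = deg m Y y := by
  refine le_antisymm (card_mem_nbh_le y) ?_
  refine card_le_card_of_injOn X ?_ ?_
  · intro e he
    simp only [coe_filter, mem_range, Set.mem_ofPred_eq] at he ⊢
    exact ⟨h.X_lt e he.1, mem_nbh.2 ⟨e, he.1, rfl, he.2⟩⟩
  · intro e he e' he' hX
    simp only [coe_filter, mem_range, Set.mem_ofPred_eq] at he he'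
    exact h.inj e he.1 e' he'.1 hX (he.2.trans he'.2.symm)

lemma deg_succ (j : ℕ) (X : ℕ → ℕ) (x : ℕ) :
    deg (j + 1) X x = deg j X x + if X j = x then 1 else 0 := by
  rw [deg, range_add_one, filter_insert]
  split_ifs with h
  · rw [card_insert_of_notMem (by simp), deg]
  · rw [deg, add_zero]

lemma deg_le (m : ℕ) (X : ℕ → ℕ) (x : ℕ) : deg m X x ≤ m := (card_filter_le _ _).trans (by simp)

variable {V R W : ℕ} {τ : RamState}

def incP (a : ℕ) (i : BExpr) : BProg := .store a i ((BExpr.get a i).add (.const 1))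

/-- Degrees in array `3`, frequencies in array `4`. -/
def degreeP : BProg := .loop 100 (.reg 2)
  (.seq (incP 3 (.get 0 (.reg 100))) (incP 4 (.get 1 (.reg 100))))

lemma hoare_degreeP (h2 : τ.reg 2 = m) (hX : τ.arr 0 = X) (hY : τ.arr 1 = Y)
    (h3 : ∀ x, τ.arr 3 x = 0) (h4 : ∀ x, τ.arr 4 x = 0) (hW : m ≤ W) (hV : m ≤ V) :
    Hoare V R W degreeP τ fun τ' => (∀ x, τ'.arr 3 x = deg m X x) ∧ ∀ y, τ'.arr 4 y = deg m Y y := by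
  refine Hoare.loop (fun j τ' => τ'.arr 0 = X ∧ τ'.arr 1 = Y ∧ (∀ x, τ'.arr 3 x = deg j X x) ∧
    ∀ y, τ'.arr 4 y = deg j Y y) (Ev.reg' h2) (by simpa [BProg.loopBound] using hW)
    ⟨hX, hY, by simpa [deg] using h3, by simpa [deg] using h4⟩ ?_ (fun _ h => h.2.2)
  rintro j hj τ₁ ⟨g0, g1, g3, g4⟩
  have b1 := deg_le j X (X j)
  have b2 := deg_le j Y (Y j)
  refine Hoare.seq (Hoare.store (w := X j) (v := deg j X (X j) + 1)
    (Ev.get' (Ev.reg' (v := j) (by simp)) (by simp [g0]))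
    ((Ev.get' (Ev.get' (w := X j) (Ev.reg' (v := j) (by simp)) (by simp [g0]))
      (by simp [g3])).add Ev.const) (fun _ => by omega) ?_)
  refine Hoare.store (w := Y j) (v := deg j Y (Y j) + 1)
    (Ev.get' (Ev.reg' (v := j) (by simp)) (by simp [g1]))
    ((Ev.get' (Ev.get' (w := Y j) (Ev.reg' (v := j) (by simp)) (by simp [g1]))
      (by simp [g4])).add Ev.const) (fun _ => by omega) ⟨?_, ?_, fun x => ?_, fun y => ?_⟩
  · funext x; simp [g0]
  · funext x; simp [g1]
  · rw [deg_succ]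
    by_cases hx : X j = x
    · subst hx; simp
    · simp [hx, Ne.symm hx, g3]
  · rw [deg_succ]
    by_cases hx : Y j = y
    · subst hx; simp
    · simp [hx, Ne.symm hx, g4]

/-- The maximum of the first entries of array `a` in register `x`; their number is in register `b`. -/
def maxP (x b a : ℕ) : BProg := .loop 100 (.reg b)
  (.ite ((BExpr.reg x).lt (.get a (.reg 100))) (.assign x (.get a (.reg 100))) .skip)

lemma hoare_maxP {x b a l : ℕ} {f : ℕ → ℕ} (hb : τ.reg b = l) (ha : τ.arr a = f) (hx : τ.reg x = 0)
    (hx' : x ≠ 100) (hW : l ≤ W) :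
    Hoare V R W (maxP x b a) τ fun τ' => τ'.reg x = (range l).sup f := by
  refine Hoare.loop (fun j τ' => τ'.arr a = f ∧ τ'.reg x = (range j).sup f) (Ev.reg' hb)
    (by simpa [BProg.loopBound] using hW) ⟨ha, by simpa using hx⟩ ?_ (fun _ h => h.2)
  rintro j hj τ₁ ⟨g0, g1⟩
  have e : (BExpr.get a (.reg 100)).Ev R (τ₁.setReg 100 j) (f j) :=
    Ev.get' (Ev.reg' (v := j) (by simp)) (by simp [g0])
  have hs : (range (j + 1)).sup f = max (f j) ((range j).sup f) := by
    rw [range_add_one, sup_insert]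
  refine Hoare.ite (Tst.lt (Ev.reg' (v := (range j).sup f) (by simp [hx', g1])) e) (fun hlt => ?_)
    (fun hlt => ?_)
  · refine Hoare.assign e (fun hb => ?_) ⟨by simpa using g0, ?_⟩
    · have := hb.2 a j
      simpa [g0] using this
    · rw [hs, RamState.setReg_reg, if_pos rfl, max_eq_left hlt.le]
  · refine Hoare.skip ⟨by simpa using g0, ?_⟩
    rw [hs, RamState.setReg_reg, if_neg hx', g1, max_eq_right (not_lt.1 hlt)]

/-- The number of earlier indices with the same value. -/
def earlierEq (f : ℕ → ℕ) (x : ℕ) : ℕ := ((range x).filter fun x' => f x' = f x).card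

/-- Select the sets with few earlier ones of the same size; array `7` lists them and array `6` holds
the inverse, increased by one. -/
def selectP (k : ℕ) : BProg := .loop 100 (.reg 0)
  (.seq (.ite ((BExpr.get 5 (.get 3 (.reg 100))).le (((BExpr.const k).mul (.reg 3)).mul (.reg 4)))
    (.seq (.store 7 (.reg 5) (.reg 100)) (.seq (.assign 5 ((BExpr.reg 5).add (.const 1)))
      (.store 6 (.reg 100) (.reg 5)))) .skip)
    (incP 5 (.get 3 (.reg 100))))

/-- Array contents after the selection among the first `j` sets. -/
structure Selected (f : ℕ → ℕ) (b j np : ℕ) (sel inv : ℕ → ℕ) : Prop where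
  card : np = ((range j).filter fun x => earlierEq f x ≤ b).card
  sel_lt : ∀ i < np, sel i < j
  inv_sel : ∀ i < np, inv (sel i) = i + 1
  inv_le : ∀ x, inv x ≤ np
  sel_inv : ∀ x, inv x ≠ 0 → sel (inv x - 1) = x
  inv_ne : ∀ x, inv x ≠ 0 ↔ x < j ∧ earlierEq f x ≤ b

/-- Array `5`, indexed by size, counts the sets of each size seen so far. The number of earlier sets
of equal size is then a single lookup, and the selection takes linear time. -/
lemma hoare_selectP {k l ds df : ℕ} {f : ℕ → ℕ} (h0 : τ.reg 0 = l) (h3 : τ.reg 3 = ds)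
    (h4 : τ.reg 4 = df) (h5 : τ.reg 5 = 0) (hf : τ.arr 3 = f) (ha5 : ∀ x, τ.arr 5 x = 0)
    (ha6 : ∀ x, τ.arr 6 x = 0) (hW : l ≤ W) (hV : l ≤ V) :
    Hoare V R W (selectP k) τ fun τ' =>
      Selected f (k * ds * df) l (τ'.reg 5) (τ'.arr 7) (τ'.arr 6) := by
  refine Hoare.loop (fun j τ' => τ'.reg 3 = ds ∧ τ'.reg 4 = df ∧ τ'.arr 3 = f ∧
    (∀ d, τ'.arr 5 d = ((range j).filter fun x => f x = d).card) ∧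
    Selected f (k * ds * df) j (τ'.reg 5) (τ'.arr 7) (τ'.arr 6)) (Ev.reg' h0)
    (by simpa [BProg.loopBound] using hW)
    ⟨h3, h4, hf, by simpa using ha5, ⟨by simp [h5], by simp [h5], by simp [h5], by simp [ha6],
      by simp [ha6], by simp [ha6]⟩⟩ ?_ (fun _ h => h.2.2.2.2)
  rintro j hj τ₁ ⟨g1, g2, g3, g4, gs⟩
  have ecnt : (BExpr.get 5 (.get 3 (.reg 100))).Ev R (τ₁.setReg 100 j) (earlierEq f j) :=
    Ev.get' (v := f j) (Ev.get' (v := j) (Ev.reg' (by simp)) (by simp [g3])) (by simp [g4, earlierEq])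
  have hnp : τ₁.reg 5 ≤ j := by rw [gs.card]; exact (card_filter_le _ _).trans (by simp)
  have hinc : ∀ σ : RamState, σ.reg 100 = j → σ.reg 3 = ds → σ.reg 4 = df → σ.arr 3 = f →
      (∀ d, σ.arr 5 d = ((range j).filter fun x => f x = d).card) →
      Selected f (k * ds * df) (j + 1) (σ.reg 5) (σ.arr 7) (σ.arr 6) →
      Hoare V R W (incP 5 (.get 3 (.reg 100))) σ (fun τ' => τ'.reg 3 = ds ∧ τ'.reg 4 = df ∧
        τ'.arr 3 = f ∧ (∀ d, τ'.arr 5 d = ((range (j + 1)).filter fun x => f x = d).card) ∧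
        Selected f (k * ds * df) (j + 1) (τ'.reg 5) (τ'.arr 7) (τ'.arr 6)) := by
    intro σ e100 e3 e4 ef e5 es
    have efj : (BExpr.get 3 (.reg 100)).Ev R σ (f j) := Ev.get' (Ev.reg' e100) (by rw [ef])
    refine Hoare.store efj ((Ev.get' efj (e5 (f j))).add Ev.const) (fun _ => ?_)
      ⟨e3, e4, ?_, fun d => ?_, ?_⟩
    · have : ((range j).filter fun x => f x = f j).card ≤ j := (card_filter_le _ _).trans (by simp)
      omega
    · rw [RamState.setArr_arr_ne _ _ _ (by norm_num)]; exact ef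
    · rw [range_add_one, filter_insert]
      by_cases hd : f j = d
      · subst hd; simp
      · simp [hd, Ne.symm hd, e5]
    · rw [RamState.setArr_arr_ne _ _ _ (by norm_num), RamState.setArr_arr_ne _ _ _ (by norm_num)]
      exact es
  have hcard : ((range (j + 1)).filter fun x => earlierEq f x ≤ k * ds * df).card =
      τ₁.reg 5 + if earlierEq f j ≤ k * ds * df then 1 else 0 := by
    rw [range_add_one, filter_insert, gs.card]
    split_ifs with h
    · rw [card_insert_of_notMem (by simp)]
    · rfl
  have hinvj : τ₁.arr 6 j = 0 := by
    by_contra hc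
    have := ((gs.inv_ne j).1 hc).1
    omega
  refine Hoare.seq (Hoare.ite (Tst.le ecnt ((Ev.const.mul (Ev.reg' (v := ds) (by simp [g1]))).mul
    (Ev.reg' (v := df) (by simp [g2])))) (fun hle => ?_) (fun hgt => ?_))
  · rw [if_pos hle] at hcard
    refine Hoare.seq (Hoare.store (w := τ₁.reg 5) (v := j) (Ev.reg' (by simp)) (Ev.reg' (by simp))
      (fun _ => by omega) ?_)
    refine Hoare.seq (Hoare.assign (v := τ₁.reg 5 + 1) ((Ev.reg' (by simp)).add Ev.const)
      (fun _ => by omega) ?_)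
    refine Hoare.store (w := j) (v := τ₁.reg 5 + 1) (Ev.reg' (by simp)) (Ev.reg' (by simp))
      (fun _ => by omega) ?_
    refine hinc _ (by simp) (by simpa using g1) (by simpa using g2) ?_ ?_ ?_
    · funext x; simp [g3]
    · intro d; simp [g4]
    · refine ⟨by simp [hcard], ?_, ?_, ?_, ?_, ?_⟩
      · intro i hi
        simp at hi
        by_cases h : i = τ₁.reg 5
        · simp [h]
        · have := gs.sel_lt i (by omega)
          simp [h]; omega
      · intro i hi
        simp at hi
        by_cases h : i = τ₁.reg 5
        · simp [h]
        · have h1 := gs.sel_lt i (by omega)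
          have h2 := gs.inv_sel i (by omega)
          have h3 : τ₁.arr 7 i ≠ j := by omega
          simp [h, h3, h2]
      · intro x
        have := gs.inv_le x
        by_cases h : x = j
        · simp [h]
        · simp [h]; omega
      · intro x hx
        have h1 := gs.inv_le x
        by_cases h : x = j
        · simp [h]
        · simp [h] at hx ⊢
          have h2 := gs.sel_inv x hx
          have h3 : τ₁.arr 6 x - 1 ≠ τ₁.reg 5 := by omega
          simp [h3, h2]
      · intro x
        have h1 := gs.inv_ne x
        by_cases h : x = j
        · simp [h, hle]
        · simp [h]
          rw [← ne_eq, h1]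
          constructor
          · rintro ⟨a, b⟩; exact ⟨by omega, b⟩
          · rintro ⟨a, b⟩; exact ⟨by omega, b⟩
  · rw [if_neg hgt, add_zero] at hcard
    refine Hoare.skip (hinc _ (by simp) (by simpa using g1) (by simpa using g2) (by simpa using g3)
      (by simpa using g4) ?_)
    refine ⟨by simp [hcard], ?_, by simpa using gs.inv_sel, by simpa using gs.inv_le,
      by simpa using gs.sel_inv, ?_⟩
    · intro i hi
      have := gs.sel_lt i (by simpa using hi)
      simp; omega
    · intro x
      have h1 := gs.inv_ne x
      simp only [RamState.setReg_arr]
      rw [h1]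
      constructor
      · rintro ⟨a, b⟩; exact ⟨by omega, b⟩
      · rintro ⟨a, b⟩
        refine ⟨?_, b⟩
        rcases Nat.lt_succ_iff_lt_or_eq.1 a with a | rfl
        · exact a
        · exact absurd b hgt

/-- Renumber the elements of the selected sets (array `8`, increased by one) and store the adjacency
matrix of the kernel in array `9`. -/
def adjP : BProg := .loop 100 (.reg 2) (.ite (.get 6 (.get 0 (.reg 100)))
  (.seq (.ite (.get 8 (.get 1 (.reg 100))) .skip
    (.seq (.assign 6 ((BExpr.reg 6).add (.const 1))) (.store 8 (.get 1 (.reg 100)) (.reg 6))))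
    (.store 9 ((((BExpr.get 6 (.get 0 (.reg 100))).sub (.const 1)).mul (.reg 1)).add
      ((BExpr.get 8 (.get 1 (.reg 100))).sub (.const 1))) (.const 1))) .skip)

/-- Untouched memory contains `0`, so `0` has to mean that an element has no number or a set is not
selected; this is the reason for the shift by one in `inv` and `ym`. -/
structure Renumbered (u j : ℕ) (X Y inv : ℕ → ℕ) (up : ℕ) (ym adj : ℕ → ℕ) : Prop where
  le : ∀ y, ym y ≤ up
  inj : ∀ y y', ym y = ym y' → ym y ≠ 0 → y = y'
  surj : ∀ v < up, ∃ y < u, ym y = v + 1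
  ne : ∀ y, ym y ≠ 0 ↔ ∃ e < j, inv (X e) ≠ 0 ∧ Y e = y
  adj : ∀ i, adj i ≠ 0 ↔ ∃ e < j, inv (X e) ≠ 0 ∧ i = (inv (X e) - 1) * u + (ym (Y e) - 1)

lemma Renumbered.up_le {j up : ℕ} {inv ym adj : ℕ → ℕ} (h : Renumbered u j X Y inv up ym adj) :
    up ≤ u := by
  have := card_le_card_of_surjOn (s := range u) (t := range up) (fun y => ym y - 1) (by
    intro v hv
    obtain ⟨y, hy, h'⟩ := h.surj v (by simpa using hv)
    exact ⟨y, by simpa using hy, by simp [h']⟩)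
  simpa using this

lemma hoare_adjP {inv : ℕ → ℕ} (hE : Edges n u m X Y) (h1 : τ.reg 1 = u) (h2 : τ.reg 2 = m)
    (h6 : τ.reg 6 = 0) (hX : τ.arr 0 = X) (hY : τ.arr 1 = Y) (hinv : τ.arr 6 = inv)
    (ha8 : ∀ x, τ.arr 8 x = 0) (ha9 : ∀ x, τ.arr 9 x = 0) (hW : m ≤ W) (hV : u < V) :
    Hoare V R W adjP τ fun τ' =>
      Renumbered u m X Y inv (τ'.reg 6) (τ'.arr 8) (τ'.arr 9) := by
  refine Hoare.loop (fun j τ' => τ'.reg 1 = u ∧ τ'.arr 0 = X ∧ τ'.arr 1 = Y ∧ τ'.arr 6 = inv ∧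
    Renumbered u j X Y inv (τ'.reg 6) (τ'.arr 8) (τ'.arr 9)) (Ev.reg' h2)
    (by simpa [BProg.loopBound] using hW)
    ⟨h1, hX, hY, hinv, ⟨by simp [ha8], by simp [ha8], by simp [h6], by simp [ha8],
      by simp [ha9]⟩⟩ ?_ (fun _ h => h.2.2.2.2)
  rintro j hj τ₁ ⟨g1, g0, gY, g6, gr⟩
  have hup := gr.up_le
  have einv : ∀ σ : RamState, σ.reg 100 = j → σ.arr 0 = X → σ.arr 6 = inv →
      (BExpr.get 6 (.get 0 (.reg 100))).Ev R σ (inv (X j)) := by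
    intro σ e1 e2 e3
    exact Ev.get' (v := X j) (Ev.get' (v := j) (Ev.reg' e1) (by rw [e2])) (by rw [e3])
  have eY : ∀ σ : RamState, σ.reg 100 = j → σ.arr 1 = Y →
      (BExpr.get 1 (.reg 100)).Ev R σ (Y j) := by
    intro σ e1 e2
    exact Ev.get' (v := j) (Ev.reg' e1) (by rw [e2])
  refine Hoare.ite (Tst.ne_zero (einv _ (by simp) (by simpa using g0) (by simpa using g6)))
    (fun hne => ?_) (fun heq => ?_)
  · have hst : ∀ σ : RamState, σ.reg 100 = j → σ.reg 1 = u → σ.arr 0 = X → σ.arr 1 = Y →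
        σ.arr 6 = inv → σ.arr 9 = τ₁.arr 9 → (∀ y, τ₁.arr 8 y ≠ 0 → σ.arr 8 y = τ₁.arr 8 y) →
        (∀ y, σ.arr 8 y ≤ σ.reg 6) →
        (∀ y y', σ.arr 8 y = σ.arr 8 y' → σ.arr 8 y ≠ 0 → y = y') →
        (∀ v < σ.reg 6, ∃ y < u, σ.arr 8 y = v + 1) →
        (∀ y, σ.arr 8 y ≠ 0 ↔ τ₁.arr 8 y ≠ 0 ∨ y = Y j) →
        Hoare V R W (.store 9 ((((BExpr.get 6 (.get 0 (.reg 100))).sub (.const 1)).mul (.reg 1)).add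
          ((BExpr.get 8 (.get 1 (.reg 100))).sub (.const 1))) (.const 1)) σ
          (fun τ' => τ'.reg 1 = u ∧ τ'.arr 0 = X ∧ τ'.arr 1 = Y ∧ τ'.arr 6 = inv ∧
            Renumbered u (j + 1) X Y inv (τ'.reg 6) (τ'.arr 8) (τ'.arr 9)) := by
      intro σ e100 e1 e0 eY' e6 e9 e8 a1 a2 a3 a4
      refine Hoare.store ((((einv σ e100 e0 e6).sub Ev.const).mul (Ev.reg' e1)).add
        ((Ev.get (eY σ e100 eY')).sub Ev.const)) Ev.const (fun _ => by omega) ⟨e1, ?_, ?_, ?_, ?_⟩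
      · rw [RamState.setArr_arr_ne _ _ _ (by norm_num)]; exact e0
      · rw [RamState.setArr_arr_ne _ _ _ (by norm_num)]; exact eY'
      · rw [RamState.setArr_arr_ne _ _ _ (by norm_num)]; exact e6
      · rw [RamState.setArr_arr_ne _ _ _ (by norm_num)]
        refine ⟨a1, a2, a3, fun y => ?_, fun i => ?_⟩
        · rw [a4, gr.ne]
          constructor
          · rintro (⟨e, he, h⟩ | rfl)
            · exact ⟨e, by omega, h⟩
            · exact ⟨j, by omega, hne, rfl⟩
          · rintro ⟨e, he, h, rfl⟩
            rcases Nat.lt_succ_iff_lt_or_eq.1 he with he | rfl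
            · exact Or.inl ⟨e, he, h, rfl⟩
            · exact Or.inr rfl
        · have hold : ∀ e < j, inv (X e) ≠ 0 → σ.arr 8 (Y e) = τ₁.arr 8 (Y e) := fun e he hi =>
            e8 _ ((gr.ne _).2 ⟨e, he, hi, rfl⟩)
          simp only [RamState.setArr_arr, true_and]
          split_ifs with hi
          · simp only [ne_eq, one_ne_zero, not_false_eq_true, true_iff]
            exact ⟨j, by omega, hne, hi⟩
          · rw [e9, gr.adj]
            constructor
            · rintro ⟨e, he, h, h'⟩
              exact ⟨e, by omega, h, by rw [hold e he h]; exact h'⟩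
            · rintro ⟨e, he, h, h'⟩
              rcases Nat.lt_succ_iff_lt_or_eq.1 he with he | rfl
              · exact ⟨e, he, h, by rw [← hold e he h]; exact h'⟩
              · exact absurd h' hi
    refine Hoare.seq (Hoare.ite (Tst.ne_zero (Ev.get' (w := τ₁.arr 8 (Y j))
      (eY _ (by simp) (by simpa using gY)) (by simp))) (fun hy => ?_) (fun hy => ?_))
    · refine Hoare.skip (hst _ (by simp) (by simpa using g1) (by simpa using g0) (by simpa using gY)
        (by simpa using g6) (by simp) (by simp) (by simpa using gr.le) (by simpa using gr.inj)
        (by simpa using gr.surj) fun y => ?_)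
      simp only [RamState.setReg_arr]
      constructor
      · exact Or.inl
      · rintro (h | rfl)
        · exact h
        · exact hy
    · rw [not_not] at hy
      -- The numbers in use belong to different elements below `u`, and `Y j` is not among these.
      have hlt : τ₁.reg 6 < u := by
        by_contra hc
        have he : τ₁.reg 6 = u := by omega
        have hs : Set.SurjOn (fun y => τ₁.arr 8 y - 1) ((range u).erase (Y j) : Finset ℕ)
            (range (τ₁.reg 6) : Finset ℕ) := by
          intro v hv
          obtain ⟨y, hyu, h'⟩ := gr.surj v (by simpa using hv)
          refine ⟨y, ?_, by simp [h']⟩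
          simp only [coe_erase, coe_range, Set.mem_sdiff, Set.mem_Iio, Set.mem_singleton_iff]
          refine ⟨hyu, ?_⟩
          rintro rfl
          omega
        have h1 := card_le_card_of_surjOn _ hs
        rw [card_erase_of_mem (mem_range.2 (hE.Y_lt j hj)), card_range, card_range, he] at h1
        have := hE.Y_lt j hj
        omega
      refine Hoare.seq (Hoare.assign (v := τ₁.reg 6 + 1) ((Ev.reg' (by simp)).add Ev.const)
        (fun _ => by omega) ?_)
      refine Hoare.store (w := Y j) (v := τ₁.reg 6 + 1) (eY _ (by simp) (by simpa using gY))
        (Ev.reg' (by simp)) (fun _ => by omega) ?_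
      have hval : ∀ y, (((τ₁.setReg 100 j).setReg 6 (τ₁.reg 6 + 1)).setArr 8 (Y j)
          (τ₁.reg 6 + 1)).arr 8 y = if y = Y j then τ₁.reg 6 + 1 else τ₁.arr 8 y := by
        intro y; simp
      refine hst _ (by simp) (by simpa using g1) ?_ ?_ ?_ ?_ ?_ ?_ ?_ ?_ ?_
      · funext x; simp [g0]
      · funext x; simp [gY]
      · funext x; simp [g6]
      · funext x; simp
      · intro y hy'
        rw [hval, if_neg (by rintro rfl; exact hy' hy)]
      · intro y
        rw [hval]
        have := gr.le y
        split_ifs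
        · simp
        · simp; omega
      · intro y y' h hne'
        rw [hval] at h hne'
        rw [hval] at h
        have l1 := gr.le y
        have l2 := gr.le y'
        split_ifs at h hne' with c1 c2 c2
        · rw [c1, c2]
        · omega
        · omega
        · exact gr.inj y y' h hne'
      · intro v hv
        simp at hv
        rcases Nat.lt_or_eq_of_le hv with hv | rfl
        · obtain ⟨y, hyu, h'⟩ := gr.surj v hv
          refine ⟨y, hyu, ?_⟩
          rw [hval, if_neg (by rintro rfl; omega), h']
        · exact ⟨Y j, hE.Y_lt j hj, by rw [hval, if_pos rfl]⟩
      · intro y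
        rw [hval]
        by_cases hyj : y = Y j
        · simp [hyj]
        · simp [hyj]
  · refine Hoare.skip ⟨by simpa using g1, by simpa using g0, by simpa using gY, by simpa using g6,
      ⟨by simpa using gr.le, by simpa using gr.inj, by simpa using gr.surj, fun y => ?_, fun i => ?_⟩⟩
    · simp only [RamState.setReg_arr]
      rw [gr.ne]
      constructor
      · rintro ⟨e, he, h⟩; exact ⟨e, by omega, h⟩
      · rintro ⟨e, he, h, h'⟩
        rcases Nat.lt_succ_iff_lt_or_eq.1 he with he | rfl
        · exact ⟨e, he, h, h'⟩
        · exact absurd h heq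
    · simp only [RamState.setReg_arr]
      rw [gr.adj]
      constructor
      · rintro ⟨e, he, h⟩; exact ⟨e, by omega, h⟩
      · rintro ⟨e, he, h, h'⟩
        rcases Nat.lt_succ_iff_lt_or_eq.1 he with he | rfl
        · exact ⟨e, he, h, h'⟩
        · exact absurd h heq

end Cover

end

/-! ### From the graph to the kernel and back -/

section

open Finset BExpr

namespace Cover

variable {n u m k : ℕ} {X Y : ℕ → ℕ} {V R W : ℕ} {τ : RamState}

/-- The graph is stored in memory, and all other cells are zero. -/
structure Input (n u m : ℕ) (X Y : ℕ → ℕ) (τ : RamState) : Prop where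
  r0 : τ.reg 0 = n
  r1 : τ.reg 1 = u
  r2 : τ.reg 2 = m
  reg : ∀ x, 3 ≤ x → τ.reg x = 0
  a0 : τ.arr 0 = X
  a1 : τ.arr 1 = Y
  arr : ∀ a, 2 ≤ a → ∀ i, τ.arr a i = 0

/-- The instance `I` arises from the graph by restriction to the sets `sel 0, sel 1, …`. -/
structure Kernel (n u m k : ℕ) (X Y : ℕ → ℕ) (I : Inst) (sel : ℕ → ℕ) : Prop where
  n_eq : I.n = n
  u_eq : I.u = u
  ds_eq : I.ds = (range n).sup (deg m X)
  F_eq : I.F = (range u).sup (deg m Y)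
  exists_maps : ∃ inv ym, Selected (deg m X) (k * I.ds * I.F) n I.np sel inv ∧
    Renumbered u m X Y inv I.up ym I.adj

/-- Compute the kernel. -/
def kernelP (k : ℕ) : BProg :=
  .seq degreeP (.seq (maxP 3 0 3) (.seq (maxP 4 1 4) (.seq (selectP k) adjP)))

lemma hoare_kernelP (hE : Edges n u m X Y) (h : Input n u m X Y τ) (hW : n + u + m ≤ W)
    (hV : n + u + m < V) :
    Hoare V R W (kernelP k) τ fun τ' => ∃ I, Kernel n u m k X Y I (τ'.arr 7) ∧ I.Ctx τ' ∧
      τ'.reg 7 = 0 ∧ ∀ i, τ'.arr 12 i = 0 := by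
  refine Hoare.seq ((hoare_degreeP h.r2 h.a0 h.a1 (h.arr 3 (by norm_num)) (h.arr 4 (by norm_num))
    (by omega) (by omega)).frame.mono ?_)
  rintro τ₁ ⟨⟨hx, hy⟩, r1, a1⟩
  simp [degreeP, incP, BProg.wr, BProg.wa] at r1 a1
  have h1 : ∀ x ≠ 100, τ₁.reg x = τ.reg x := r1
  refine Hoare.seq ((hoare_maxP (l := n) (f := deg m X) (by rw [h1 0 (by norm_num), h.r0])
    (funext hx) (by rw [h1 3 (by norm_num), h.reg 3 le_rfl]) (by norm_num) (by omega)).frame.mono ?_)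
  rintro τ₂ ⟨hds, r2, a2⟩
  simp [maxP, BProg.wr, BProg.wa] at r2 a2
  have h2 : ∀ x, x ≠ 100 → x ≠ 3 → τ₂.reg x = τ.reg x := fun x e e' => by
    rw [r2 x e e', h1 x e]
  refine Hoare.seq ((hoare_maxP (l := u) (f := deg m Y) (by rw [h2 1 (by norm_num) (by norm_num), h.r1])
    (by rw [a2]; exact funext hy) (by rw [h2 4 (by norm_num) (by norm_num), h.reg 4 (by norm_num)])
    (by norm_num) (by omega)).frame.mono ?_)
  rintro τ₃ ⟨hF, r3, a3⟩
  simp [maxP, BProg.wr, BProg.wa] at r3 a3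
  have h3 : ∀ x, x ≠ 100 → x ≠ 3 → x ≠ 4 → τ₃.reg x = τ.reg x := fun x e e' e'' => by
    rw [r3 x e e'', h2 x e e']
  have b3 : ∀ a, a ≠ 3 → a ≠ 4 → τ₃.arr a = τ.arr a := fun a e e' => by
    rw [a3, a2, a1 a e e']
  have hds' : τ₃.reg 3 = (range n).sup (deg m X) := by
    rw [r3 3 (by norm_num) (by norm_num), hds]
  refine Hoare.seq ((hoare_selectP (k := k) (l := n) (f := deg m X)
    (by rw [h3 0 (by norm_num) (by norm_num) (by norm_num), h.r0]) hds' hF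
    (by rw [h3 5 (by norm_num) (by norm_num) (by norm_num), h.reg 5 (by norm_num)])
    (by rw [a3, a2]; exact funext hx) (by rw [b3 5 (by norm_num) (by norm_num)]; exact h.arr 5 (by norm_num))
    (by rw [b3 6 (by norm_num) (by norm_num)]; exact h.arr 6 (by norm_num)) (by omega)
    (by omega)).frame.mono ?_)
  rintro τ₄ ⟨hsel, r4, a4⟩
  simp [selectP, incP, BProg.wr, BProg.wa] at r4 a4
  have h4 : ∀ x, x ≠ 100 → x ≠ 3 → x ≠ 4 → x ≠ 5 → τ₄.reg x = τ.reg x := fun x e e3 e4 e5 => by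
    rw [r4 x e e5, h3 x e e3 e4]
  have b4 : ∀ a, a ≠ 3 → a ≠ 4 → a ≠ 5 → a ≠ 6 → a ≠ 7 → τ₄.arr a = τ.arr a :=
    fun a e3 e4 e5 e6 e7 => by rw [a4 a e7 e6 e5, b3 a e3 e4]
  have c4 : ∀ a, a = 0 ∨ a = 1 ∨ 8 ≤ a → τ₄.arr a = τ.arr a := fun a ha =>
    b4 a (by omega) (by omega) (by omega) (by omega) (by omega)
  refine (hoare_adjP hE (by rw [h4 1 (by norm_num) (by norm_num) (by norm_num) (by norm_num), h.r1])
    (by rw [h4 2 (by norm_num) (by norm_num) (by norm_num) (by norm_num), h.r2])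
    (by rw [h4 6 (by norm_num) (by norm_num) (by norm_num) (by norm_num), h.reg 6 (by norm_num)])
    (by rw [c4 0 (by norm_num), h.a0]) (by rw [c4 1 (by norm_num), h.a1]) rfl
    (by rw [c4 8 (by norm_num)]; exact h.arr 8 (by norm_num))
    (by rw [c4 9 (by norm_num)]; exact h.arr 9 (by norm_num)) (by omega) (by omega)).frame.mono ?_
  rintro τ₅ ⟨hadj, r5, a5⟩
  simp [adjP, BProg.wr, BProg.wa] at r5 a5
  have e3 : τ₅.reg 3 = (range n).sup (deg m X) := by
    rw [r5 3 (by norm_num) (by norm_num), r4 3 (by norm_num) (by norm_num), hds']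
  have e4 : τ₅.reg 4 = (range u).sup (deg m Y) := by
    rw [r5 4 (by norm_num) (by norm_num), r4 4 (by norm_num) (by norm_num), hF]
  have e5 : τ₅.reg 5 = τ₄.reg 5 := r5 5 (by norm_num) (by norm_num)
  have h5 : ∀ x, x ≠ 100 → x ≠ 3 → x ≠ 4 → x ≠ 5 → x ≠ 6 → τ₅.reg x = τ.reg x :=
    fun x e e3 e4 e5 e6 => by rw [r5 x e e6, h4 x e e3 e4 e5]
  refine ⟨⟨n, u, (range n).sup (deg m X), (range u).sup (deg m Y), τ₅.reg 5, τ₅.reg 6, τ₅.arr 9⟩,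
    ⟨rfl, rfl, rfl, rfl, τ₄.arr 6, τ₅.arr 8, ?_, hadj⟩,
    ⟨?_, ?_, e3, e4, rfl, rfl, rfl⟩, ?_, ?_⟩
  · rw [a5 7 (by norm_num) (by norm_num)]
    simpa only [e5] using hsel
  · rw [h5 0 (by norm_num) (by norm_num) (by norm_num) (by norm_num) (by norm_num), h.r0]
  · rw [h5 1 (by norm_num) (by norm_num) (by norm_num) (by norm_num) (by norm_num), h.r1]
  · rw [h5 7 (by norm_num) (by norm_num) (by norm_num) (by norm_num) (by norm_num),
      h.reg 7 (by norm_num)]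
  · rw [a5 12 (by norm_num) (by norm_num), c4 12 (by norm_num)]
    exact h.arr 12 (by norm_num)

/-! #### Properties of the kernel -/

namespace Kernel

variable {I : Inst} {sel : ℕ → ℕ}

lemma earlierEq_deg (hE : Edges n u m X Y) (x : ℕ) :
    earlierEq (deg m X) x = earlier (nbh m X Y) x := by
  simp only [earlierEq, earlier, hE.card_nbh]

lemma deg_le_ds (h : Kernel n u m k X Y I sel) {x : ℕ} (hx : x < n) : deg m X x ≤ I.ds := by
  rw [h.ds_eq]; exact le_sup (f := deg m X) (mem_range.2 hx)

lemma card_mem_le (h : Kernel n u m k X Y I sel) (hE : Edges n u m X Y) (y : ℕ) :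
    ((range n).filter fun x => y ∈ nbh m X Y x).card ≤ I.F := by
  rw [hE.card_mem_nbh, h.F_eq]
  by_cases hy : y < u
  · exact le_sup (f := deg m Y) (mem_range.2 hy)
  · rw [deg, filter_eq_empty_iff.2 fun e he (h' : Y e = y) => hy (h' ▸ hE.Y_lt e (mem_range.1 he))]
    simp

lemma np_le_n (h : Kernel n u m k X Y I sel) : I.np ≤ n := by
  obtain ⟨inv, ym, hs, -⟩ := h.exists_maps
  rw [hs.card]
  exact (card_filter_le _ _).trans (by simp)

lemma np_pos (h : Kernel n u m k X Y I sel) (hn : 0 < n) : 0 < I.np := by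
  obtain ⟨inv, ym, hs, -⟩ := h.exists_maps
  rw [hs.card, card_pos]
  exact ⟨0, mem_filter.2 ⟨mem_range.2 hn, by simp [earlierEq]⟩⟩

lemma np_le (h : Kernel n u m k X Y I sel) (hE : Edges n u m X Y) :
    I.np ≤ (I.ds + 1) * (k * I.ds * I.F + 1) := by
  obtain ⟨inv, ym, hs, -⟩ := h.exists_maps
  rw [hs.card]
  simp only [earlierEq_deg hE]
  exact card_earlier_le fun x hx => by rw [hE.card_nbh]; exact h.deg_le_ds hx

lemma sel_lt (h : Kernel n u m k X Y I sel) {j : ℕ} (hj : j < I.np) : sel j < n := by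
  obtain ⟨inv, ym, hs, -⟩ := h.exists_maps
  exact hs.sel_lt j hj

/-- The renumbering of the elements identifies the sets of the kernel. -/
lemma exists_map (h : Kernel n u m k X Y I sel) : ∃ φ : ℕ → ℕ,
    (∀ j < I.np, I.nb j = (nbh m X Y (sel j)).image φ) ∧
    (∀ j < I.np, ∀ j' < I.np, ∀ y ∈ nbh m X Y (sel j), ∀ y' ∈ nbh m X Y (sel j'),
      φ y = φ y' → y = y') ∧
    ∀ v < I.up, ∃ j < I.np, v ∈ I.nb j := by
  obtain ⟨inv, ym, hs, hr⟩ := h.exists_maps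
  have hup := hr.up_le
  have hym : ∀ j < I.np, ∀ y ∈ nbh m X Y (sel j), ym y ≠ 0 := by
    intro j hj y hy
    obtain ⟨e, he, hX, rfl⟩ := mem_nbh.1 hy
    exact (hr.ne _).2 ⟨e, he, by rw [hX, hs.inv_sel j hj]; omega, rfl⟩
  have hnb : ∀ j < I.np, I.nb j = (nbh m X Y (sel j)).image fun y => ym y - 1 := by
    intro j hj
    ext v
    simp only [Inst.nb, mem_filter, mem_range, mem_image, h.u_eq]
    constructor
    · rintro ⟨hv, ha⟩
      obtain ⟨e, he, hi, heq⟩ := (hr.adj _).1 ha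
      have h1 := (hr.ne (Y e)).2 ⟨e, he, hi, rfl⟩
      have h2 := hr.le (Y e)
      -- Both columns are below `up ≤ u`, so row and column can be recovered from the address by
      -- division by `u`.
      have h3 : j = inv (X e) - 1 ∧ v = ym (Y e) - 1 := by
        have hu : 0 < u := by omega
        have a : (j * u + v) / u = j := by
          rw [mul_comm, Nat.mul_add_div hu, Nat.div_eq_of_lt (by omega), add_zero]
        have b : (j * u + v) / u = inv (X e) - 1 := by
          rw [heq, mul_comm, Nat.mul_add_div hu, Nat.div_eq_of_lt (by omega), add_zero]
        have c : j = inv (X e) - 1 := a.symm.trans b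
        refine ⟨c, ?_⟩
        rw [← c] at heq
        omega
      refine ⟨Y e, mem_nbh.2 ⟨e, he, ?_, rfl⟩, h3.2.symm⟩
      rw [h3.1]; exact (hs.sel_inv _ hi).symm
    · rintro ⟨y, hy, rfl⟩
      have h1 := hym j hj y hy
      have h2 := hr.le y
      refine ⟨by omega, ?_⟩
      obtain ⟨e, he, hX, rfl⟩ := mem_nbh.1 hy
      have h3 : inv (X e) = j + 1 := by rw [hX]; exact hs.inv_sel j hj
      exact (hr.adj _).2 ⟨e, he, by omega, by rw [h3]; simp⟩
  refine ⟨fun y => ym y - 1, hnb, ?_, ?_⟩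
  · intro j hj j' hj' y hy y' hy' heq
    have h1 := hym j hj y hy
    have h2 := hym j' hj' y' hy'
    simp only at heq
    exact hr.inj y y' (by omega) h1
  · intro v hv
    obtain ⟨y, hy, hyv⟩ := hr.surj v hv
    obtain ⟨e, he, hi, rfl⟩ := (hr.ne y).1 (by omega)
    have hj : inv (X e) - 1 < I.np := by have := hs.inv_le (X e); omega
    refine ⟨inv (X e) - 1, hj, ?_⟩
    rw [hnb _ hj]
    exact mem_image.2 ⟨Y e, mem_nbh.2 ⟨e, he, (hs.sel_inv _ hi).symm, rfl⟩, by omega⟩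

lemma card_biUnion (h : Kernel n u m k X Y I sel) {T : Finset ℕ} (hT : T ⊆ range I.np) :
    (T.biUnion I.nb).card = ((T.image sel).biUnion (nbh m X Y)).card := by
  obtain ⟨φ, h1, h2, -⟩ := h.exists_map
  have hT' : ∀ j ∈ T, j < I.np := fun j hj => mem_range.1 (hT hj)
  have : T.biUnion I.nb = ((T.image sel).biUnion (nbh m X Y)).image φ := by
    rw [image_biUnion, biUnion_image]
    exact biUnion_congr rfl fun j hj => h1 j (hT' j hj)
  rw [this, card_image_of_injOn]
  intro y hy y' hy' heq
  simp only [coe_biUnion, Set.mem_iUnion, mem_coe, mem_image, exists_prop] at hy hy'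
  obtain ⟨_, ⟨j, hj, rfl⟩, hy⟩ := hy
  obtain ⟨_, ⟨j', hj', rfl⟩, hy'⟩ := hy'
  exact h2 j (hT' j hj) j' (hT' j' hj') y hy y' hy' heq

lemma card_nb_le (h : Kernel n u m k X Y I sel) (hE : Edges n u m X Y) {j : ℕ} (hj : j < I.np) :
    (I.nb j).card ≤ I.ds := by
  have := h.card_biUnion (T := {j}) (by simpa using hj)
  simp only [singleton_biUnion, image_singleton] at this
  rw [this, hE.card_nbh]
  exact h.deg_le_ds (h.sel_lt hj)

lemma card_mem_nb_le (h : Kernel n u m k X Y I sel) (hE : Edges n u m X Y) (v : ℕ) :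
    ((range I.np).filter fun x => v ∈ I.nb x).card ≤ I.F := by
  obtain ⟨φ, h1, h2, h3⟩ := h.exists_map
  obtain ⟨inv, -, hs, -⟩ := h.exists_maps
  by_cases hv : ∃ j < I.np, v ∈ I.nb j
  · obtain ⟨j, hj, hv⟩ := hv
    rw [h1 j hj, mem_image] at hv
    obtain ⟨y, hy, rfl⟩ := hv
    refine (card_le_card_of_injOn sel ?_ ?_).trans (h.card_mem_le hE y)
    · intro j' hj'
      have hj' := mem_filter.1 (mem_coe.1 hj')
      have hlt := mem_range.1 hj'.1
      have hm := hj'.2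
      rw [h1 j' hlt, mem_image] at hm
      obtain ⟨y', hy', heq⟩ := hm
      rw [h2 j' hlt j hj y' hy' y hy heq] at hy'
      exact mem_coe.2 (mem_filter.2 ⟨mem_range.2 (h.sel_lt hlt), hy'⟩)
    · intro a ha b hb hab
      have e1 := hs.inv_sel a (mem_range.1 (mem_filter.1 (mem_coe.1 ha)).1)
      have e2 := hs.inv_sel b (mem_range.1 (mem_filter.1 (mem_coe.1 hb)).1)
      rw [hab] at e1
      omega
  · rw [filter_eq_empty_iff.2 fun j hj h' => hv ⟨j, mem_range.1 hj, h'⟩]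
    simp

lemma up_le_u (h : Kernel n u m k X Y I sel) : I.up ≤ u := by
  obtain ⟨inv, ym, -, hr⟩ := h.exists_maps
  exact hr.up_le

/-- Only elements of selected sets receive a number, and each of these sets has at most `ds`
elements. -/
lemma up_le (h : Kernel n u m k X Y I sel) (hE : Edges n u m X Y) : I.up ≤ I.np * I.ds := by
  obtain ⟨φ, -, -, h3⟩ := h.exists_map
  calc I.up = (range I.up).card := by simp
    _ ≤ ((range I.np).biUnion I.nb).card := card_le_card fun v hv => by
        obtain ⟨j, hj, hv'⟩ := h3 v (mem_range.1 hv)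
        exact mem_biUnion.2 ⟨j, mem_range.2 hj, hv'⟩
    _ ≤ (range I.np).card * I.ds := card_biUnion_le_card_mul _ _ _ fun j hj =>
        h.card_nb_le hE (mem_range.1 hj)
    _ = _ := by simp

lemma sum_card_nb_le (h : Kernel n u m k X Y I sel) (hE : Edges n u m X Y) :
    ∑ j ∈ range I.np, (I.nb j).card ≤ u * I.F := by
  have h1 : ∀ j, (I.nb j).card = ((range I.up).filter fun v => v ∈ I.nb j).card := by
    intro j
    congr 1
    ext v
    simp only [mem_filter]
    exact ⟨fun hv => ⟨Inst.nb_subset _ hv, hv⟩, fun hv => hv.2⟩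
  calc _ = ∑ j ∈ range I.np, ∑ v ∈ range I.up, if v ∈ I.nb j then 1 else 0 := by
        refine sum_congr rfl fun j _ => ?_
        rw [h1 j, card_filter]
    _ = ∑ v ∈ range I.up, ∑ j ∈ range I.np, if v ∈ I.nb j then 1 else 0 := sum_comm
    _ ≤ ∑ v ∈ range I.up, I.F := sum_le_sum fun v _ => by
        rw [← card_filter]; exact h.card_mem_nb_le hE v
    _ ≤ u * I.F := by
        rw [sum_const, card_range, smul_eq_mul]; exact Nat.mul_le_mul_right _ h.up_le_u

/-- The kernel contains an optimal solution. -/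
lemma le_of_forall_isOpt (h : Kernel n u m k X Y I sel) (hE : Edges n u m X Y) {b : ℕ}
    (hb : ∀ T, IsOpt I.nb k I.np T → (T.biUnion I.nb).card ≤ b) {T : Finset ℕ} (hT : T ⊆ range n)
    (hk : T.card ≤ k) : (T.biUnion (nbh m X Y)).card ≤ b := by
  obtain ⟨T₀, hopt, hT₀⟩ := exists_opt_earlier_le (k := k) (h.card_mem_le hE)
    (fun x hx => (hE.card_nbh x).trans_le (h.deg_le_ds hx))
  obtain ⟨T₁, hT₁⟩ := exists_isOpt I.nb k I.np
  obtain ⟨inv, ym, hs, hr⟩ := h.exists_maps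
  have hinv : ∀ x ∈ T₀, inv x ≠ 0 := fun x hx => (hs.inv_ne x).2
    ⟨mem_range.1 (hopt.1 hx), by rw [earlierEq_deg hE]; exact hT₀ x hx⟩
  have hsub : T₀.image (fun x => inv x - 1) ⊆ range I.np := by
    intro j hj
    obtain ⟨x, hx, rfl⟩ := mem_image.1 hj
    have := hs.inv_le x
    have := hinv x hx
    exact mem_range.2 (by omega)
  have himg : (T₀.image fun x => inv x - 1).image sel = T₀ := by
    rw [image_image]
    conv_rhs => rw [← image_id (s := T₀)]
    exact image_congr fun x hx => hs.sel_inv x (hinv x hx)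
  calc _ ≤ (T₀.biUnion (nbh m X Y)).card := hopt.2.2 T hT hk
    _ = ((T₀.image fun x => inv x - 1).biUnion I.nb).card := by rw [h.card_biUnion hsub, himg]
    _ ≤ (T₁.biUnion I.nb).card := hT₁.2.2 _ hsub (card_image_le.trans hopt.2.1)
    _ ≤ b := hb T₁ hT₁

end Kernel

end Cover

end

section

open Finset BExpr

namespace Cover

variable {n u m k : ℕ} {X Y : ℕ → ℕ} {V R W : ℕ} {τ : RamState}

/-! ### Output -/

/-- The least number that does not occur among the first `k` entries of array `2`, if it is below
`k`. -/
def freshE (k : ℕ) : BExpr := .count 50 (.const k) (BExpr.sum 51 ((BExpr.reg 50).add (.const 1))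
  (BExpr.sum 52 (.const k) ((BExpr.get 2 (.reg 52)).eq (.reg 51))).not).not

/-- Pigeonhole: after one repetition, `k` entries take fewer than `k` values. -/
lemma exists_fresh {out : ℕ → ℕ} {i j : ℕ} (hij : i < j) (hj : j < k) (h : out i = out j) :
    ∃ v < k, ∀ i < k, out i ≠ v := by
  by_contra! hc
  have hsub : range k ⊆ ((range k).erase j).image out := by
    intro v hv
    obtain ⟨a, ha, rfl⟩ := hc v (mem_range.1 hv)
    by_cases haj : a = j
    · exact mem_image.2 ⟨i, by simp; omega, by rw [haj, h]⟩
    · exact mem_image.2 ⟨a, by simp; omega, rfl⟩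
  have h1 := (card_le_card hsub).trans card_image_le
  rw [card_erase_of_mem (mem_range.2 hj), card_range] at h1
  omega

/-- The numbers counted are those for which everything up to them occurs, and these form an initial
segment that ends just before the first missing number. -/
lemma ev_freshE (hR : k + 1 ≤ R) {i j : ℕ} (hij : i < j) (hj : j < k)
    (h : τ.arr 2 i = τ.arr 2 j) :
    ∃ v < k, (∀ i < k, τ.arr 2 i ≠ v) ∧ (freshE k).Ev R τ v := by
  classical
  have hex := exists_fresh hij hj h
  have hlt : Nat.find hex < k := (Nat.find_spec hex).1
  refine ⟨Nat.find hex, hlt, (Nat.find_spec hex).2, ?_⟩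
  refine (Ev.count (P := fun v => ¬ ∃ w < v + 1, ¬ ∃ a < k, τ.arr 2 a = w) Ev.const (by omega)
    fun v hv => ?_).congr ?_
  · refine (Tst.ex (n := v + 1) ((Ev.reg' (by simp)).add Ev.const) (by omega) fun w hw => ?_).not
    refine (Tst.ex Ev.const (by omega) fun a ha => ?_).not
    exact Tst.eq (Ev.get' (v := a) (Ev.reg' (by simp)) (by simp)) (Ev.reg' (by simp))
  · have : ((range k).filter fun v => ¬ ∃ w < v + 1, ¬ ∃ a < k, τ.arr 2 a = w) =
        range (Nat.find hex) := by
      ext v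
      simp only [mem_filter, mem_range]
      constructor
      · rintro ⟨hv, hall⟩
        by_contra hc
        refine hall ⟨Nat.find hex, by omega, ?_⟩
        rintro ⟨a, ha, h'⟩
        exact (Nat.find_spec hex).2 a ha h'
      · intro hv
        refine ⟨by omega, ?_⟩
        rintro ⟨w, hw, hno⟩
        refine Nat.find_min hex (m := w) (by omega) ⟨by omega, fun a ha h' => hno ⟨a, ha, h'⟩⟩
    rw [this, card_range]

/-- Translate the solution to the original graph, and replace repeated vertices. -/
def outputP (k : ℕ) : BProg :=
  .seq (.loop 31 (.const k) (.store 2 (.reg 31) (.get 7 (.get 12 (.reg 31)))))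
    (.ite ((BExpr.const k).le (.reg 0)) (.loop 31 (.const k)
      (.ite (.sum 50 (.reg 31) ((BExpr.get 2 (.reg 50)).eq (.get 2 (.reg 31))))
        (.store 2 (.reg 31) (freshE k)) .skip)) .skip)

/-- Array `2` lists `k` vertices, distinct if possible, among them those listed by `f`. -/
def Listed (n k : ℕ) (f : ℕ → ℕ) (τ : RamState) : Prop :=
  (∀ i < k, τ.arr 2 i < n) ∧ (k ≤ n → ∀ i < k, ∀ j < k, τ.arr 2 i = τ.arr 2 j → i = j) ∧
    ∀ i < k, ∃ j < k, τ.arr 2 j = f i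

/-- An entry is overwritten only if an earlier entry has the same value, so no vertex is lost. The
replacement is below `k ≤ n` and differs from all current entries; hence the entries up to it are
distinct. -/
lemma hoare_outputP {sel best : ℕ → ℕ} (h0 : τ.reg 0 = n) (h7 : τ.arr 7 = sel) (h12 : τ.arr 12 = best)
    (hlt : ∀ i < k, sel (best i) < n) (hR : k + 1 ≤ R) (hRV : R ≤ V) :
    Hoare V R W (outputP k) τ (Listed n k fun i => sel (best i)) := by
  have hcopy : Hoare V R W (.loop 31 (.const k) (.store 2 (.reg 31) (.get 7 (.get 12 (.reg 31))))) τ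
      fun τ' => ∀ i < k, τ'.arr 2 i = sel (best i) := by
    refine (Hoare.loop (fun j τ' => τ'.arr 7 = sel ∧ τ'.arr 12 = best ∧
      ∀ i < j, τ'.arr 2 i = sel (best i)) Ev.const (by simp [BProg.loopBound]; omega)
      ⟨h7, h12, by simp⟩ ?_ (fun _ h => h.2.2))
    rintro j hj τ₁ ⟨g7, g12, g2⟩
    refine Hoare.store (w := j) (v := sel (best j)) (Ev.reg' (by simp))
      (Ev.get' (v := best j) (Ev.get' (v := j) (Ev.reg' (by simp)) (by simp [g12])) (by simp [g7]))
      (fun hb => ?_) ⟨?_, ?_, fun i hi => ?_⟩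
    · have := hb.2 7 (best j)
      simpa [g7] using this
    · funext x; simp [g7]
    · funext x; simp [g12]
    · by_cases hij : i = j
      · simp [hij]
      · simp only [RamState.setArr_arr, hij, and_false, if_false, RamState.setReg_arr]
        exact g2 i (by omega)
  refine Hoare.seq (hcopy.frame.mono ?_)
  rintro τ₁ ⟨g2, r1, a1⟩
  have e0 : τ₁.reg 0 = n := by rw [r1 0 (by simp [BProg.wr]), h0]
  refine Hoare.ite (Tst.le Ev.const (Ev.reg' e0)) (fun hkn => ?_) (fun hkn => ?_)
  · refine Hoare.loop (fun j τ' => (∀ i < k, τ'.arr 2 i < n) ∧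
      (∀ i < j, ∀ i' < j, τ'.arr 2 i = τ'.arr 2 i' → i = i') ∧
      ∀ i < k, ∃ i' < k, τ'.arr 2 i' = sel (best i)) Ev.const (by simp [BProg.loopBound]; omega)
      ⟨fun i hi => by rw [g2 i hi]; exact hlt i hi, by simp, fun i hi => ⟨i, hi, g2 i hi⟩⟩ ?_
      (fun τ' h => ⟨h.1, fun _ => h.2.1, h.2.2⟩)
    rintro j hj τ₂ ⟨b1, b2, b3⟩
    refine Hoare.ite (P := ∃ i < j, τ₂.arr 2 i = τ₂.arr 2 j)
      (Tst.ex (Ev.reg' (by simp)) (by omega) fun i hi => Tst.eq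
        (Ev.get' (v := i) (Ev.reg' (by simp)) (by simp))
        (Ev.get' (v := j) (Ev.reg' (by simp)) (by simp))) ?_ (fun hno => ?_)
    · rintro ⟨i, hi, hij⟩
      obtain ⟨v, hv, hne, hev⟩ := ev_freshE (τ := τ₂.setReg 31 j) hR hi hj (by simpa using hij)
      simp only [RamState.setReg_arr] at hne
      have hval : ∀ a, ((τ₂.setReg 31 j).setArr 2 j v).arr 2 a =
          if a = j then v else τ₂.arr 2 a := fun a => by simp
      refine Hoare.store (w := j) (Ev.reg' (by simp)) hev (fun _ => by omega)
        ⟨fun a ha => ?_, fun a ha a' ha' h => ?_, fun a ha => ?_⟩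
      · rw [hval]
        split_ifs
        · omega
        · exact b1 a ha
      · rw [hval, hval] at h
        split_ifs at h with c1 c2 c2
        · omega
        · exact absurd h.symm (hne a' (by omega))
        · exact absurd h (hne a (by omega))
        · exact b2 a (by omega) a' (by omega) h
      · obtain ⟨a', ha', h⟩ := b3 a ha
        by_cases hc : a' = j
        · exact ⟨i, by omega, by rw [hval, if_neg (by omega), hij, ← hc, h]⟩
        · exact ⟨a', ha', by rw [hval, if_neg hc, h]⟩
    · refine Hoare.skip ⟨by simpa using b1, fun a ha a' ha' h => ?_, by simpa using b3⟩
      simp only [RamState.setReg_arr] at h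
      by_cases c1 : a = j
      · by_cases c2 : a' = j
        · omega
        · exact absurd ⟨a', by omega, by rw [← h, c1]⟩ hno
      · by_cases c2 : a' = j
        · exact absurd ⟨a, by omega, by rw [h, c2]⟩ hno
        · exact b2 a (by omega) a' (by omega) h
  · exact Hoare.skip ⟨fun i hi => by rw [g2 i hi]; exact hlt i hi, fun h => absurd h hkn,
      fun i hi => ⟨i, hi, g2 i hi⟩⟩

/-! ### The algorithm -/

def coverP (A : BilinearAlg) (k : ℕ) : BProg :=
  .seq (kernelP k) (.seq (.ite (.reg 3) (searchP A k) .skip) (outputP k))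

lemma sel_notMem_wa_enumP {leaf : BProg} (h : 7 ∉ leaf.wa) {i₁ : ℕ} :
    ∀ (w : List Kind) (i l : ℕ), 7 ∉ (enumP leaf k i₁ w i l).wa
  | [], _, _ => h
  | κ :: w, i, l => by
    have h1 := sel_notMem_wa_enumP h (i₁ := i₁) w i (l + 1)
    have h2 := sel_notMem_wa_enumP h (i₁ := i₁) w (i + 1) l
    cases κ <;> simp [enumP, BProg.wa, h1, h2]

/-- Array `7`, filled with the kernel, is needed afterwards to translate the solution back. -/
lemma sel_notMem_wa_searchP (A : BilinearAlg) (k : ℕ) : 7 ∉ (searchP A k).wa := by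
  rw [searchP]
  induction Plan.all k with
  | nil => simp [seqList, BProg.wa]
  | cons p l ih =>
    simp only [List.map_cons, seqList, BProg.wa, List.mem_append, not_or]
    refine ⟨sel_notMem_wa_enumP ?_ _ _ _, ih⟩
    simp [leafP, candP, powP, levelP, coreP, multP, fillP, idxP, transformP, findP, tryP, appendP,
      BProg.wa]

/-- Array `2` lists an optimal solution. -/
def Solution (n k m : ℕ) (X Y : ℕ → ℕ) (τ : RamState) : Prop :=
  (∀ i < k, τ.arr 2 i < n) ∧ (k ≤ n → ∀ i < k, ∀ j < k, τ.arr 2 i = τ.arr 2 j → i = j) ∧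
    ∀ T ⊆ range n, T.card ≤ k →
      (T.biUnion (nbh m X Y)).card ≤ (((range k).image (τ.arr 2)).biUnion (nbh m X Y)).card

/-- The search is guarded by `ds ≠ 0`: for a graph without edges the power of `ds * F` in the time
bound may vanish and leaves nothing to pay for a search. -/
theorem tri_coverP {A : BilinearAlg} {T : ℕ} (hE : Edges n u m X Y) (h : Input n u m X Y τ)
    (hn : 0 < n) (hk : 1 ≤ k) (hV : n + u + m < V) (hkV : k + 1 ≤ V)
    (hT : ∀ I sel, Kernel n u m k X Y I sel → I.ds ≠ 0 → ∃ R K₀ b₁ b₂,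
      SearchFit A I k V R K₀ b₁ b₂ ∧
        ((Plan.all k).map (planTime A I k R K₀ b₁ b₂)).sum ≤ T) :
    Tri V (coverP A k) τ ((kernelP k).time (k + 1) (n + u + m) + (T + 5) + (outputP k).time (k + 1) 1)
      (Solution n k m X Y) := by
  refine Tri.seq (T₁ := (kernelP k).time (k + 1) (n + u + m))
    (T₂ := (T + 5) + (outputP k).time (k + 1) 1)
    ((hoare_kernelP hE h le_rfl hV hkV hV.le).mono le_rfl ?_) (by omega)
  rintro τ₁ ⟨I, hI, hctx, h7, h12⟩
  have hnp := hI.np_pos hn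
  refine Tri.seq (T₁ := T + 5) (T₂ := (outputP k).time (k + 1) 1) (Tri.mono
    (Q := fun τ' => (τ'.reg 0 = n ∧ τ'.arr 7 = τ₁.arr 7) ∧ (∀ j < k, τ'.arr 12 j < I.np) ∧
      ∀ T ⊆ range n, T.card ≤ k → (T.biUnion (nbh m X Y)).card ≤
        (cvr I.nb ((List.range k).map (τ'.arr 12))).card) ?_ le_rfl ?_) le_rfl
  · have htst : (BExpr.reg 3).Tst (k + 1) τ₁ (I.ds ≠ 0) := Tst.ne_zero (Ev.reg' hctx.ds)
    refine Tri.ite (T₁ := T + 1) (k + 1) htst.1 hkV (fun hne => ?_) (fun heq => ?_)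
      (by simp [tb]; omega)
    · obtain ⟨R, K₀, b₁, b₂, hf, hle⟩ := hT I _ hI (htst.2.1 hne)
      have hinv : EnumInv I k [] [] τ₁ := ⟨hctx, ⟨fun j _ => by rw [h12]; exact hnp, by simp [h7]⟩,
        fun j hj => by simp at hj, fun j hj => by simp at hj⟩
      refine (tri_searchP hf hk hinv).frame.mono (by omega) ?_
      rintro τ₂ ⟨⟨g1, g2⟩, -, a2⟩
      exact ⟨⟨by rw [g1.ctx.n, hI.n_eq], a2 7 (sel_notMem_wa_searchP A k)⟩, g1.best.1,
        fun T' h1 h2 => (hI.le_of_forall_isOpt hE g2 h1 h2).trans g1.best.2⟩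
    -- Without edges every choice has coverage `0`, and the initial zeros in array `12` are a
    -- solution.
    · have hds : I.ds = 0 := by
        by_contra hc
        exact htst.2.2 hc heq
      refine Tri.skip (by omega) ⟨⟨by rw [hctx.n, hI.n_eq], rfl⟩, fun j _ => by rw [h12]; exact hnp,
        fun T' h1 _ => ?_⟩
      have : T'.biUnion (nbh m X Y) = ∅ := by
        refine eq_empty_of_forall_notMem fun y hy => ?_
        obtain ⟨x, hx, hy⟩ := mem_biUnion.1 hy
        have h2 := hI.deg_le_ds (mem_range.1 (h1 hx))
        rw [← hE.card_nbh] at h2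
        have := card_pos.2 ⟨y, hy⟩
        omega
      rw [this]; simp
  · rintro τ₂ ⟨⟨e0, e7⟩, hlt, hopt⟩
    refine ((hoare_outputP (W := 1) (sel := τ₁.arr 7) (best := τ₂.arr 12) e0 e7 rfl
      (fun i hi => hI.sel_lt (hlt i hi)) le_rfl hkV) hkV (by omega)).mono le_rfl ?_
    rintro τ₃ ⟨c1, c2, c3⟩
    refine ⟨c1, c2, fun T' h1 h2 => (hopt T' h1 h2).trans ?_⟩
    have hsub : ((List.range k).map (τ₂.arr 12)).toFinset ⊆ range I.np := by
      intro x hx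
      simp only [List.mem_toFinset, List.mem_map, List.mem_range] at hx
      obtain ⟨j, hj, rfl⟩ := hx
      exact mem_range.2 (hlt j hj)
    rw [cvr, hI.card_biUnion hsub]
    refine card_le_card (biUnion_subset_biUnion_of_subset_left _ ?_)
    intro x hx
    simp only [mem_image, List.mem_toFinset, List.mem_map, List.mem_range] at hx
    obtain ⟨_, ⟨j, hj, rfl⟩, rfl⟩ := hx
    obtain ⟨i, hi, h'⟩ := c3 j hj
    exact mem_image.2 ⟨i, mem_range.2 hi, h'⟩

end Cover

end

section

open Finset

namespace Cover

/-! ### Sizes -/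

/-- A bound for the number of sets that exhaustive search has to consider at each step. -/
noncomputable def Inst.bruteSize (I : Inst) : ℝ :=
  min (I.n : ℝ) ((I.F : ℝ) * min ((I.u : ℝ) ^ (1 / 3 : ℝ)) (Real.sqrt (I.ds : ℝ)))

/-- A bound for the number of candidates. -/
noncomputable def Inst.candSize (I : Inst) : ℝ :=
  min (I.n : ℝ) ((I.F : ℝ) * min (Real.sqrt (I.u : ℝ)) (I.ds : ℝ))

namespace Kernel

variable {n u m k : ℕ} {X Y : ℕ → ℕ} {I : Inst} {sel : ℕ → ℕ}

lemma ds_le (h : Kernel n u m k X Y I sel) : I.ds ≤ m := by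
  rw [h.ds_eq]; exact Finset.sup_le fun x _ => deg_le m X x

lemma F_le (h : Kernel n u m k X Y I sel) (hE : Edges n u m X Y) : I.F ≤ n := by
  rw [h.F_eq]
  refine Finset.sup_le fun y _ => ?_
  rw [← hE.card_mem_nbh]
  exact (card_filter_le _ _).trans (by simp)

lemma exists_edge (h : Kernel n u m k X Y I sel) (hds : I.ds ≠ 0) : 0 < m := by
  have := h.ds_le
  omega

lemma u_pos (h : Kernel n u m k X Y I sel) (hE : Edges n u m X Y) (hds : I.ds ≠ 0) : 0 < u :=
  (Nat.zero_le _).trans_lt (hE.Y_lt 0 (h.exists_edge hds))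

lemma F_pos (h : Kernel n u m k X Y I sel) (hE : Edges n u m X Y) (hds : I.ds ≠ 0) : 0 < I.F := by
  have hm := h.exists_edge hds
  rw [h.F_eq]
  refine lt_of_lt_of_le ?_ (le_sup (f := deg m Y) (mem_range.2 (hE.Y_lt 0 hm)))
  exact card_pos.2 ⟨0, by simp [hm]⟩

lemma sm_le_ds (h : Kernel n u m k X Y I sel) (hE : Edges n u m X Y) (S : List ℕ) :
    sm I.nb I.np S ≤ I.ds :=
  Finset.sup_le fun _ hx => (card_le_card sdiff_subset).trans (h.card_nb_le hE (mem_range.1 hx))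

/-! ### Comparison with the two bases of the time bound -/

section sizes

variable (h : Kernel n u m k X Y I sel) (hE : Edges n u m X Y) (hds : I.ds ≠ 0)
include h hE hds

/-- This makes choices of overlapping sets affordable: there are `2 * k * F` of them, so `2 * k *
bruteSize` at most. -/
lemma F_le_bruteSize : (I.F : ℝ) ≤ I.bruteSize := by
  have h1 : (1 : ℝ) ≤ (I.u : ℝ) ^ (1 / 3 : ℝ) :=
    Real.one_le_rpow (by rw [h.u_eq]; exact_mod_cast h.u_pos hE hds) (by norm_num)
  have h2 : (1 : ℝ) ≤ Real.sqrt (I.ds : ℝ) := by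
    rw [Real.one_le_sqrt]; exact_mod_cast Nat.one_le_iff_ne_zero.2 hds
  refine le_min (by rw [h.n_eq]; exact_mod_cast h.F_le hE) ?_
  exact le_mul_of_one_le_right (by positivity) (le_min h1 h2)

lemma F_le_candSize : (I.F : ℝ) ≤ I.candSize := by
  have h1 : (1 : ℝ) ≤ Real.sqrt (I.u : ℝ) := by
    rw [Real.one_le_sqrt, h.u_eq]; exact_mod_cast h.u_pos hE hds
  have h2 : (1 : ℝ) ≤ (I.ds : ℝ) := by exact_mod_cast Nat.one_le_iff_ne_zero.2 hds
  refine le_min (by rw [h.n_eq]; exact_mod_cast h.F_le hE) ?_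
  exact le_mul_of_one_le_right (by positivity) (le_min h1 h2)

lemma one_le_bruteSize : 1 ≤ I.bruteSize :=
  le_trans (by exact_mod_cast h.F_pos hE hds) (h.F_le_bruteSize hE hds)

lemma one_le_candSize : 1 ≤ I.candSize :=
  le_trans (by exact_mod_cast h.F_pos hE hds) (h.F_le_candSize hE hds)

omit h hE hds in
lemma candSize_le : I.candSize ≤ (I.ds : ℝ) * I.F := by
  refine (min_le_right _ _).trans ?_
  rw [mul_comm]
  exact mul_le_mul_of_nonneg_right (min_le_right _ _) (by positivity)

omit hds in
/-- The number of sets of large residual size. -/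
lemma card_large_mul_le (S : List ℕ) :
    (((range I.np).filter fun x => sm I.nb I.np S < 2 * rs I.nb S x).card : ℝ) *
      sm I.nb I.np S ≤ 2 * ((I.u : ℝ) * I.F) := by
  have := Cover.card_large_mul_le (h.sum_card_nb_le hE) S
  rw [← h.u_eq] at this
  exact_mod_cast this

omit hE hds in
lemma card_filter_le_n (p : ℕ → Prop) [DecidablePred p] : (((range I.np).filter p).card : ℝ) ≤ I.n := by
  rw [h.n_eq]
  exact_mod_cast ((card_filter_le _ _).trans (by simp)).trans h.np_le_n

/-- Up to `s = √u` the rank bound `k s F + 1` is good enough, with `s ≤ ds` for the other term of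
the minimum. Beyond `√u` the size bound `2 u F / s` is below `2 F √u`. If `n` is the minimum, the
trivial bound serves. -/
lemma cand_le (hk : 1 ≤ k) (S : List ℕ) : k * sm I.nb I.np S * I.F + 1 ≤ ⌊2 * k * I.candSize⌋₊ ∨
    ((range I.np).filter fun x => sm I.nb I.np S < 2 * rs I.nb S x).card ≤ ⌊2 * k * I.candSize⌋₊ := by
  have hk' : (1 : ℝ) ≤ k := by exact_mod_cast hk
  have h1 := h.one_le_candSize hE hds
  have hF : (0 : ℝ) < I.F := by exact_mod_cast h.F_pos hE hds
  have hsd : (sm I.nb I.np S : ℝ) ≤ I.ds := by exact_mod_cast h.sm_le_ds hE S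
  have hu : Real.sqrt (I.u : ℝ) * Real.sqrt I.u = I.u := Real.mul_self_sqrt (by positivity)
  have hu0 : 0 ≤ Real.sqrt (I.u : ℝ) := Real.sqrt_nonneg _
  have hc := h.card_large_mul_le hE S
  have hn := h.card_filter_le_n fun x => sm I.nb I.np S < 2 * rs I.nb S x
  generalize hcard : ((range I.np).filter fun x => sm I.nb I.np S < 2 * rs I.nb S x).card = c at hc hn ⊢
  generalize sm I.nb I.np S = s at hsd hc ⊢
  by_cases hs : (s : ℝ) ≤ Real.sqrt I.u
  · rcases le_total (I.n : ℝ) (I.F * min (Real.sqrt I.u) I.ds) with hle | hle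
    · right
      refine Nat.le_floor (hn.trans ?_)
      have : I.candSize = I.n := min_eq_left hle
      rw [this] at h1 ⊢
      nlinarith
    · left
      refine Nat.le_floor ?_
      have : I.candSize = I.F * min (Real.sqrt I.u) I.ds := min_eq_right hle
      have h2 : (s : ℝ) * I.F ≤ I.candSize := by
        rw [this, mul_comm]; exact mul_le_mul_of_nonneg_left (le_min hs hsd) hF.le
      push_cast
      nlinarith
  · right
    push Not at hs
    refine Nat.le_floor ?_
    have hc' : (c : ℝ) ≤ 2 * (I.F * Real.sqrt I.u) := by
      have hs0 : (0 : ℝ) < s := hu0.trans_lt hs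
      refine le_of_mul_le_mul_right (hc.trans ?_) hs0
      nlinarith [mul_nonneg (mul_nonneg hF.le hu0) (sub_nonneg.2 hs.le)]
    -- Here `√u < s ≤ ds`, so the inner minimum is `√u`.
    have h2 : (c : ℝ) ≤ 2 * I.candSize := by
      rw [Inst.candSize, min_eq_left (hs.le.trans hsd), mul_min_of_nonneg _ _ (by norm_num)]
      exact le_min (by linarith) hc'
    nlinarith

/-- If `n` is below both other terms, it is the minimum and bounds everything. Otherwise `s > u ^ (2
/ 3)`, and `2 u F / s` is below both `2 F u ^ (1 / 3)` and `2 F √ds`. -/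
lemma large_le {S : List ℕ} (hb : I.Brute S) :
    ((range I.np).filter fun x => sm I.nb I.np S < 2 * rs I.nb S x).card ≤ ⌊2 * I.bruteSize⌋₊ := by
  refine Nat.le_floor ?_
  have hF : (0 : ℝ) < I.F := by exact_mod_cast h.F_pos hE hds
  have hsd : (sm I.nb I.np S : ℝ) ≤ I.ds := by exact_mod_cast h.sm_le_ds hE S
  have hc := h.card_large_mul_le hE S
  have hn := h.card_filter_le_n fun x => sm I.nb I.np S < 2 * rs I.nb S x
  unfold Inst.Brute at hb
  generalize hcard : ((range I.np).filter fun x => sm I.nb I.np S < 2 * rs I.nb S x).card = c at hc hn ⊢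
  generalize sm I.nb I.np S = s at hsd hc hb ⊢
  obtain ⟨U, hU⟩ : ∃ U, U = (I.u : ℝ) ^ (1 / 3 : ℝ) := ⟨_, rfl⟩
  have hU0 : 0 ≤ U := by rw [hU]; positivity
  have hU3 : U ^ 3 = I.u := by
    rw [hU, ← Real.rpow_natCast, ← Real.rpow_mul (by positivity)]; norm_num
  obtain ⟨E, hE'⟩ : ∃ E, E = Real.sqrt (I.ds : ℝ) := ⟨_, rfl⟩
  have hE0 : 0 ≤ E := by rw [hE']; positivity
  have hE2 : E ^ 2 = I.ds := by rw [hE', Real.sq_sqrt (by positivity)]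
  rw [Inst.bruteSize, ← hU, ← hE']
  rcases hb with ⟨hb1, hb2⟩ | hb
  · have h1 : (I.n : ℝ) ≤ I.F * U := by
      refine le_of_pow_le_pow_left₀ (n := 3) (by norm_num) (by positivity) ?_
      rw [mul_pow, hU3]
      have : ((I.n * I.n * I.n : ℕ) : ℝ) ≤ ((I.F * I.F * I.F * I.u : ℕ) : ℝ) := by exact_mod_cast hb1
      push_cast at this
      nlinarith
    have h2 : (I.n : ℝ) ≤ I.F * E := by
      refine le_of_pow_le_pow_left₀ (n := 2) (by norm_num) (by positivity) ?_
      rw [mul_pow, hE2]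
      have : ((I.n * I.n : ℕ) : ℝ) ≤ ((I.F * I.F * I.ds : ℕ) : ℝ) := by exact_mod_cast hb2
      push_cast at this
      nlinarith
    rw [mul_min_of_nonneg _ _ hF.le, min_eq_left (le_min h1 h2)]
    linarith [(Nat.cast_nonneg I.n : (0 : ℝ) ≤ I.n)]
  · have hb' : (I.u : ℝ) * I.u < s * s * s := by exact_mod_cast hb
    have hs0 : (0 : ℝ) < s := by
      by_contra hc0
      have : (s : ℝ) = 0 := le_antisymm (not_lt.1 hc0) (by positivity)
      rw [this] at hb'
      nlinarith [mul_self_nonneg (I.u : ℝ)]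
    have h1 : (c : ℝ) ≤ 2 * (I.F * U) := by
      have hsU : U ^ 2 ≤ s := by
        refine le_of_pow_le_pow_left₀ (n := 3) (by norm_num) hs0.le ?_
        calc (U ^ 2) ^ 3 = U ^ 3 * U ^ 3 := by ring
          _ = (I.u : ℝ) * I.u := by rw [hU3]
          _ ≤ (s : ℝ) ^ 3 := by nlinarith
      refine le_of_mul_le_mul_right (hc.trans ?_) hs0
      rw [← hU3]
      nlinarith [mul_nonneg (mul_nonneg hF.le hU0) (sub_nonneg.2 hsU)]
    have h2 : (c : ℝ) ≤ 2 * (I.F * E) := by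
      -- From `u ^ 2 < s ^ 3` and `s ≤ ds` follows `u ^ 2 ≤ s ^ 2 * ds`.
      have hsE : (I.u : ℝ) ≤ s * E := by
        refine le_of_pow_le_pow_left₀ (n := 2) (by norm_num) (by positivity) ?_
        rw [mul_pow, hE2]
        nlinarith [mul_nonneg (mul_self_nonneg (s : ℝ)) (sub_nonneg.2 hsd)]
      refine le_of_mul_le_mul_right (hc.trans ?_) hs0
      nlinarith [mul_nonneg hF.le (sub_nonneg.2 hsE)]
    rw [mul_min_of_nonneg _ _ hF.le, mul_min_of_nonneg _ _ (by norm_num),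
      mul_min_of_nonneg _ _ (by norm_num)]
    exact le_min (by linarith) (le_min h1 h2)

/-- When exhaustive search is not used, `n` does not determine the minimum, so `bruteSize / F` is
the smaller of `u ^ (1 / 3)` and `√ds`. Its square bounds `s`, because `s ^ 3 ≤ u ^ 2` and `s ≤ ds`.
-/
lemma elem_le {S : List ℕ} (hb : ¬ I.Brute S) :
    sm I.nb I.np S ≤ ⌊I.bruteSize ^ 2 / (I.F : ℝ) ^ 2⌋₊ := by
  refine Nat.le_floor ?_
  have hF : (0 : ℝ) < I.F := by exact_mod_cast h.F_pos hE hds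
  have hsd : (sm I.nb I.np S : ℝ) ≤ I.ds := by exact_mod_cast h.sm_le_ds hE S
  unfold Inst.Brute at hb
  generalize sm I.nb I.np S = s at hsd hb ⊢
  obtain ⟨U, hU⟩ : ∃ U, U = (I.u : ℝ) ^ (1 / 3 : ℝ) := ⟨_, rfl⟩
  have hU0 : 0 ≤ U := by rw [hU]; positivity
  have hU3 : U ^ 3 = I.u := by
    rw [hU, ← Real.rpow_natCast, ← Real.rpow_mul (by positivity)]; norm_num
  obtain ⟨E, hE'⟩ : ∃ E, E = Real.sqrt (I.ds : ℝ) := ⟨_, rfl⟩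
  have hE0 : 0 ≤ E := by rw [hE']; positivity
  have hE2 : E ^ 2 = I.ds := by rw [hE', Real.sq_sqrt (by positivity)]
  push Not at hb
  obtain ⟨hb1, hb2⟩ := hb
  have hsU : (s : ℝ) ≤ U ^ 2 := by
    refine le_of_pow_le_pow_left₀ (n := 3) (by norm_num) (by positivity) ?_
    calc (s : ℝ) ^ 3 = s * s * s := by ring
      _ ≤ I.u * I.u := by exact_mod_cast hb2
      _ = (U ^ 2) ^ 3 := by rw [← hU3]; ring
  -- One of the two comparisons for `n` in `Inst.Brute` fails, so `n` exceeds one of the other terms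
  -- and therefore their minimum.
  have hmin : I.bruteSize = I.F * min U E := by
    rw [Inst.bruteSize, ← hU, ← hE']
    refine min_eq_right ?_
    rw [mul_min_of_nonneg _ _ hF.le]
    by_cases hc : I.n * I.n * I.n ≤ I.F * I.F * I.F * I.u
    · refine (min_le_right _ _).trans ?_
      refine le_of_pow_le_pow_left₀ (n := 2) (by norm_num) (by positivity) ?_
      rw [mul_pow, hE2]
      have : ((I.F * I.F * I.ds : ℕ) : ℝ) ≤ ((I.n * I.n : ℕ) : ℝ) := by exact_mod_cast (hb1 hc).le
      push_cast at this
      nlinarith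
    · refine (min_le_left _ _).trans ?_
      refine le_of_pow_le_pow_left₀ (n := 3) (by norm_num) (by positivity) ?_
      rw [mul_pow, hU3]
      have : ((I.F * I.F * I.F * I.u : ℕ) : ℝ) ≤ ((I.n * I.n * I.n : ℕ) : ℝ) := by
        exact_mod_cast (not_le.1 hc).le
      push_cast at this
      nlinarith
  rw [hmin, mul_pow, mul_div_cancel_left₀ _ (by positivity)]
  rcases le_total U E with hc | hc
  · rw [min_eq_left hc]; exact hsU
  · rw [min_eq_right hc, hE2]; exact hsd

end sizes

end Kernel

end Cover

end

section

open Finset BExpr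

namespace Cover

/-! ### Time bounds -/

/-- All caps are at least one, so the overhead of an outer level may be charged to the product of
all caps. -/
lemma enumTime_le {R E T : ℕ} {b : Kind → ℕ} (hb : ∀ κ, 1 ≤ b κ) (w : List Kind) :
    enumTime R E T b w ≤ (w.map b).prod * (T + w.length * (18 + R * (E + 13))) := by
  induction w with
  | nil => simp [enumTime]
  | cons κ w ih =>
    have h1 := hb κ
    have h2 : 1 ≤ (w.map b).prod := List.one_le_prod_of_one_le (by simp [hb])
    simp only [enumTime, List.map_cons, List.prod_cons, List.length_cons]
    have h3 := Nat.mul_le_mul_right (18 + R * (E + 13)) h2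
    calc 8 + R * (E + 13) + b κ * (10 + enumTime R E T b w)
        ≤ b κ * (18 + R * (E + 13) + enumTime R E T b w) := by
          have := Nat.mul_le_mul_right (8 + R * (E + 13)) h1
          nlinarith
      _ ≤ b κ * ((w.map b).prod * (18 + R * (E + 13)) +
          (w.map b).prod * (T + w.length * (18 + R * (E + 13)))) :=
          Nat.mul_le_mul_left _ (by omega)
      _ = _ := by ring

/-- The nesting of short loops and sums in a leaf does not grow with `k` or with the plan. This is
one source of an exponent `c` independent of `k`; the number itself is generous. -/
lemma rd_leafP (A : BilinearAlg) (k i₁ i g₁ g₂ g : ℕ) : (leafP A k i₁ i g₁ g₂ g).rd ≤ 13 := by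
  have h : ∀ m n c e, e.depth = 0 → (coefE m n c e (.reg 61)).depth = 0 :=
    fun m n c e he => depth_coefE he rfl
  simp [leafP, candP, powP, levelP, coreP, multP, fillP, idxP, transformP, findP, tryP, appendP,
    BProg.rd, inKE, bigE, rankE, smE, rsE, adjE, covE, depth, testAC, testCB, pValE, qValE, rValE,
    decodedE, rowE, colE, h]

lemma wd_leafP (A : BilinearAlg) (k i₁ i g₁ g₂ g : ℕ) : (leafP A k i₁ i g₁ g₂ g).wd ≤ 1 := by
  simp [leafP, candP, powP, levelP, coreP, multP, fillP, idxP, transformP, findP, tryP, appendP,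
    BProg.wd]

lemma depth_testE (κ : Kind) : (κ.testE 0 0 0 0).depth ≤ 12 := by cases κ <;> decide

lemma testTime_le {R : ℕ} (hR : 1 ≤ R) : testTime R ≤ testTime 1 * R ^ 12 := by
  have h : ∀ κ : Kind, (κ.testE 0 0 0 0).tb R ≤ (κ.testE 0 0 0 0).tb 1 * R ^ 12 := fun κ =>
    (tb_le hR _).trans (Nat.mul_le_mul_left _ (Nat.pow_le_pow_right hR (depth_testE κ)))
  simp only [testTime, add_mul]
  have h1 := h .overlap
  have h2 := h .large
  have h3 := h .start
  have h4 := h .elem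
  have h5 := h .hit
  omega

lemma overhead_le {R : ℕ} (hR : 1 ≤ R) :
    18 + R * (testTime R + 13) ≤ R ^ 13 * (31 + testTime 1) := by
  have h1 := testTime_le hR
  have h2 : 1 ≤ R ^ 12 := Nat.one_le_pow _ _ hR
  have h3 : 1 ≤ R ^ 13 := Nat.one_le_pow _ _ hR
  generalize testTime 1 = c at h1 ⊢
  have h4 : R * (testTime R + 13) ≤ R * (c * R ^ 12 + 13 * R ^ 12) :=
    Nat.mul_le_mul_left _ (by omega)
  have h5 : R * (c * R ^ 12 + 13 * R ^ 12) = R ^ 13 * (c + 13) := by ring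
  have h6 : R ^ 13 * (31 + c) = 18 * R ^ 13 + R ^ 13 * (c + 13) := by ring
  omega

lemma pow_clog_le {q x : ℕ} (hq : 2 ≤ q) (hx : 1 ≤ x) : q ^ Nat.clog q x ≤ q * x := by
  rcases hx.eq_or_lt with rfl | hx
  · simp; omega
  · have h1 := Nat.pow_pred_clog_lt_self (b := q) (by omega) hx
    have h2 : 0 < Nat.clog q x := Nat.clog_pos (by omega) hx
    calc q ^ Nat.clog q x = q * q ^ (Nat.clog q x).pred := by
          rw [← pow_succ', Nat.pred_eq_sub_one, Nat.sub_add_cancel h2]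
      _ ≤ _ := Nat.mul_le_mul_left _ h1.le

/-- The cost of a product of matrices in terms of the exponent. -/
lemma leafWidth_le {A : BilinearAlg} {ρ M : ℝ} (hρ : 0 ≤ ρ) (hr : (A.r : ℝ) ≤ (A.q : ℝ) ^ ρ)
    {K₀ g : ℕ} (h1 : 1 ≤ K₀) (hM : (K₀ : ℝ) ≤ M) :
    (leafWidth A K₀ g : ℝ) ≤ (A.q : ℝ) ^ ρ * M ^ ((g : ℝ) * ρ) := by
  have hK : (1 : ℝ) ≤ K₀ := by exact_mod_cast h1
  have hM0 : 0 ≤ M := by linarith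
  have hc := pow_clog_le A.two_le (Nat.one_le_pow g K₀ h1)
  rw [leafWidth]
  push_cast
  calc (A.r : ℝ) ^ Nat.clog A.q (K₀ ^ g) ≤ ((A.q : ℝ) ^ ρ) ^ Nat.clog A.q (K₀ ^ g) :=
        pow_le_pow_left₀ (by positivity) hr _
    _ = ((A.q : ℝ) ^ Nat.clog A.q (K₀ ^ g)) ^ ρ := by
        rw [← Real.rpow_natCast, ← Real.rpow_natCast, ← Real.rpow_mul (by positivity),
          ← Real.rpow_mul (by positivity), mul_comm]
    _ ≤ ((A.q : ℝ) * M ^ g) ^ ρ := by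
        refine Real.rpow_le_rpow (by positivity) ?_ hρ
        calc ((A.q : ℝ) ^ Nat.clog A.q (K₀ ^ g)) ≤ (A.q : ℝ) * (K₀ : ℝ) ^ g := by exact_mod_cast hc
          _ ≤ _ := mul_le_mul_of_nonneg_left (pow_le_pow_left₀ (by positivity) hM g) (by positivity)
    _ = _ := by
        rw [Real.mul_rpow (by positivity) (by positivity), ← Real.rpow_natCast,
          ← Real.rpow_mul hM0]

/-- Three choices `elem`, `hit`, `hit` give two sets and cost at most `M ^ 2`, so every set but the
first costs `M`. The start of the chain costs `P` and is not charged to `M`. -/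
lemma prod_chainWord_le {b : Kind → ℝ} {M P : ℝ} (hb : ∀ κ, 0 ≤ b κ) (hM : 1 ≤ M) (hP : 1 ≤ P)
    (hs : b .start ≤ P) (he : b .elem * b .hit ^ 2 ≤ M ^ 2) (c : ℕ) :
    ((chainWord c).map b).prod ≤ P * M ^ (2 * c - 1) := by
  cases c with
  | zero => simpa [chainWord] using hP
  | succ c =>
    have h : ∀ c, ((List.replicate c [Kind.elem, .hit, .hit]).flatten.map b).prod =
        (b .elem * b .hit ^ 2) ^ c := by
      intro c
      induction c with
      | zero => simp
      | succ c ih =>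
        rw [List.replicate_succ, List.flatten_cons, List.map_append, List.prod_append, ih]
        simp; ring
    simp only [chainWord, List.map_cons, List.prod_cons, h]
    have h0 : 0 ≤ b .elem * b .hit ^ 2 := mul_nonneg (hb _) (pow_nonneg (hb _) _)
    refine mul_le_mul hs ?_ (pow_nonneg h0 _) (by linarith)
    calc (b .elem * b .hit ^ 2) ^ c ≤ (M ^ 2) ^ c := pow_le_pow_left₀ h0 he c
      _ = M ^ (2 * c) := by rw [pow_mul]
      _ ≤ _ := pow_le_pow_right₀ hM (by omega)

lemma Plan.prod_word_le {b : Kind → ℝ} {M P : ℝ} (hb : ∀ κ, 0 ≤ b κ) (hM : 1 ≤ M) (hP : 1 ≤ P)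
    (ho : b .overlap ≤ M) (hl : b .large ≤ M) (hs : b .start ≤ P)
    (he : b .elem * b .hit ^ 2 ≤ M ^ 2) (p : Plan) :
    (p.word.map b).prod ≤ M ^ p.sets * P ^ 2 := by
  have hP0 : 0 ≤ P := by linarith
  have hM0 : 0 ≤ M := by linarith
  have hn : ∀ w : List Kind, 0 ≤ (w.map b).prod := fun w => by
    induction w with
    | nil => simp
    | cons κ w ih => simpa using mul_nonneg (hb κ) ih
  simp only [word, List.map_append, List.prod_append, List.map_replicate, List.prod_replicate, sets,
    pow_add]
  have h1 := prod_chainWord_le hb hM hP hs he p.c₁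
  have h2 := prod_chainWord_le hb hM hP hs he p.c₂
  calc b .overlap ^ p.i₁ * (b .large ^ p.i₂ * (((chainWord p.c₁).map b).prod *
        ((chainWord p.c₂).map b).prod))
      ≤ M ^ p.i₁ * (M ^ p.i₂ * ((P * M ^ (2 * p.c₁ - 1)) * (P * M ^ (2 * p.c₂ - 1)))) := by
        have := hb .overlap
        have := hb .large
        have := hn (chainWord p.c₁)
        have := hn (chainWord p.c₂)
        gcongr
    _ = _ := by ring

/-! #### Parameters of the search -/

/-- The constant in the bound for short loops. -/
def shortConst (A : BilinearAlg) (k : ℕ) : ℕ := 5 * k + 2 * k * k + A.r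

/-- The constant in the time bound for a plan. -/
noncomputable def planConst (A : BilinearAlg) (k : ℕ) (ρ : ℝ) (p : Plan) : ℝ :=
  (2 * k) ^ p.sets * (4 * k) ^ 2 * ((shortConst A k) ^ 13 *
    ((leafP A k p.i₁ p.sets p.g₁ p.g₂ p.g).time 1 1 * ((A.q : ℝ) ^ ρ * (2 * k) ^ ((p.g : ℝ) * ρ)) +
      p.word.length * (31 + testTime 1)))

/-- The exponent of the bound for the contents of memory cells. -/
def cellExp (A : BilinearAlg) (k : ℕ) : ℕ :=
  k + (shortConst A k + 6) + (A.q + k * (2 * k + 1)) * (A.r + A.d + 1) + 1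

/-! ### The search parameters fit, and their cost -/

section numeric

variable {n u m k : ℕ} {X Y : ℕ → ℕ} {I : Inst} {sel : ℕ → ℕ} {A : BilinearAlg}

lemma Kernel.np_le_sq (h : Kernel n u m k X Y I sel) (hE : Edges n u m X Y) (hds : I.ds ≠ 0)
    (hk : 1 ≤ k) : I.np ≤ 4 * k * (I.ds * I.F) ^ 2 := by
  have hF := h.F_pos hE hds
  have hd : 1 ≤ I.ds := Nat.one_le_iff_ne_zero.2 hds
  have hD : I.ds ≤ I.ds * I.F := Nat.le_mul_of_pos_right _ hF
  have hkD : 1 ≤ k * (I.ds * I.F) := Nat.one_le_iff_ne_zero.2 (by positivity)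
  calc I.np ≤ (I.ds + 1) * (k * I.ds * I.F + 1) := h.np_le hE
    _ ≤ (2 * (I.ds * I.F)) * (2 * (k * (I.ds * I.F))) := by
        refine Nat.mul_le_mul (by omega) ?_
        rw [mul_assoc k]; omega
    _ = _ := by ring

lemma Kernel.searchFit (h : Kernel n u m k X Y I sel) (hE : Edges n u m X Y) (hds : I.ds ≠ 0)
    (hn : 0 < n) (hk : 1 ≤ k) {V : ℕ} (hV : (n + u + m + 2) ^ cellExp A k ≤ V) :
    SearchFit A I k V (shortConst A k * (I.ds * I.F) ^ 3) ⌊2 * k * I.candSize⌋₊ ⌊2 * I.bruteSize⌋₊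
      ⌊I.bruteSize ^ 2 / (I.F : ℝ) ^ 2⌋₊ := by
  have hF := h.F_pos hE hds
  obtain ⟨D, hD⟩ : ∃ D, D = I.ds * I.F := ⟨_, rfl⟩
  have hD1 : 1 ≤ D := by rw [hD]; exact Nat.one_le_iff_ne_zero.2 (by positivity)
  obtain ⟨N, hN⟩ : ∃ N, N = n + u + m + 2 := ⟨_, rfl⟩
  have hDN : D ≤ N ^ 2 := by
    have h1 := h.ds_le
    have h2 := h.F_le hE
    rw [hD, pow_two]
    exact Nat.mul_le_mul (by omega) (by omega)
  have hN2 : 2 ≤ N := by omega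
  have two : ∀ a, a ≤ N ^ a := fun a => (Nat.lt_two_pow_self).le.trans (Nat.pow_le_pow_left hN2 a)
  have hk' : (1 : ℝ) ≤ k := by exact_mod_cast hk
  obtain ⟨K, hK⟩ : ∃ K, K = ⌊2 * k * I.candSize⌋₊ := ⟨_, rfl⟩
  have hM := h.one_le_candSize hE hds
  have hK1 : 1 ≤ K := by
    rw [hK]; refine Nat.le_floor ?_
    push_cast; nlinarith
  have hKr : (K : ℝ) ≤ 2 * k * I.candSize := by
    rw [hK]; exact Nat.floor_le (by positivity)
  have hKn : K ≤ 2 * k * n := by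
    have : (K : ℝ) ≤ 2 * k * n := hKr.trans (by
      have : I.candSize ≤ n := by rw [← h.n_eq]; exact min_le_left _ _
      gcongr)
    exact_mod_cast this
  have hKD : K ≤ 2 * k * D := by
    have : (K : ℝ) ≤ 2 * k * D := hKr.trans (by
      have := Kernel.candSize_le (I := I)
      rw [hD]; push_cast
      gcongr)
    exact_mod_cast this
  have hKN : K ≤ N ^ (2 * k + 1) := hKn.trans (by
    rw [pow_succ]; exact Nat.mul_le_mul (two _) (by omega))
  have hRV : shortConst A k * D ^ 3 ≤ N ^ (shortConst A k + 6) := by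
    rw [pow_add]
    refine Nat.mul_le_mul (two _) ?_
    calc D ^ 3 ≤ (N ^ 2) ^ 3 := Nat.pow_le_pow_left hDN 3
      _ = _ := by rw [← pow_mul]
  have hmono : ∀ a, a ≤ cellExp A k → N ^ a ≤ V := fun a ha =>
    (Nat.pow_le_pow_right (by omega) ha).trans (by rw [hN]; exact hV)
  have hD3 : D ≤ D ^ 3 := Nat.le_self_pow (by norm_num) D
  have hD23 : D ^ 2 ≤ D ^ 3 := Nat.pow_le_pow_right hD1 (by norm_num)
  have hnp := h.np_le_sq hE hds hk
  rw [← hD] at hnp ⊢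
  rw [← hK]
  have hkD : k ≤ k * D ^ 3 := Nat.le_mul_of_pos_right _ (by positivity)
  have hkD2 : k * D ^ 2 ≤ k * D ^ 3 := Nat.mul_le_mul_left _ hD23
  have hkkD : k * k * D ≤ k * k * D ^ 3 := Nat.mul_le_mul_left _ hD3
  have hrD : A.r ≤ A.r * D ^ 3 := Nat.le_mul_of_pos_right _ (by positivity)
  have hR : shortConst A k * D ^ 3 = 5 * (k * D ^ 3) + 2 * (k * k * D ^ 3) + A.r * D ^ 3 := by
    rw [shortConst]; ring
  refine ⟨h.np_pos hn, h.card_mem_nb_le hE, ⟨?_, ?_, ?_⟩, ?_, ?_, ?_, ?_, ?_⟩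
  · rw [hR]
    rw [mul_assoc] at hnp
    omega
  · have h1 := h.up_le hE
    have h2 : I.np * I.ds ≤ 4 * (k * D ^ 3) := by
      calc I.np * I.ds ≤ (4 * k * D ^ 2) * D :=
            Nat.mul_le_mul hnp (by rw [hD]; exact Nat.le_mul_of_pos_right _ hF)
        _ = _ := by ring
    rw [hR]
    omega
  · rw [hR]; omega
  · have := h.np_le_n
    refine le_trans ?_ (hmono k (by unfold cellExp; omega))
    exact Nat.pow_le_pow_left (by omega) k
  · intro S; rw [hK]; exact h.cand_le hE hds hk S
  · exact fun S hS => h.large_le hE hds hS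
  · exact fun S hS => h.elem_le hE hds hS
  · intro g hg
    have hKg : K ^ g ≤ K ^ k := Nat.pow_le_pow_right hK1 hg
    have hc := pow_clog_le A.two_le (Nat.one_le_pow g K hK1)
    obtain ⟨e, he⟩ : ∃ e, e = A.q + k * (2 * k + 1) := ⟨_, rfl⟩
    have hqL : A.q ^ Nat.clog A.q (K ^ g) ≤ N ^ e := by
      refine hc.trans ?_
      rw [he, pow_add]
      refine Nat.mul_le_mul (two _) (hKg.trans ?_)
      calc K ^ k ≤ (N ^ (2 * k + 1)) ^ k := Nat.pow_le_pow_left hKN k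
        _ = _ := by rw [← pow_mul, mul_comm]
    -- From `a ≤ q ^ a` an `L`-th power of any fixed number is at most the `a`-th power of `q ^ L`,
    -- hence polynomial in the input size.
    have hb : ∀ a, a ^ Nat.clog A.q (K ^ g) ≤ N ^ (e * a) := by
      intro a
      calc a ^ Nat.clog A.q (K ^ g) ≤ (A.q ^ a) ^ Nat.clog A.q (K ^ g) :=
            Nat.pow_le_pow_left ((Nat.lt_two_pow_self).le.trans (Nat.pow_le_pow_left A.two_le a)) _
        _ = (A.q ^ Nat.clog A.q (K ^ g)) ^ a := by rw [← pow_mul, ← pow_mul, mul_comm]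
        _ ≤ (N ^ e) ^ a := Nat.pow_le_pow_left hqL a
        _ = _ := by rw [← pow_mul]
    have hexp : cellExp A k = k + (shortConst A k + 6) + (e * A.r + e * A.d + e) + 1 := by
      rw [cellExp, he]; ring
    refine ⟨?_, ?_, ?_, ?_, le_rfl, ?_⟩
    -- The number of levels is logarithmic, but the crude bound `K * k` already lies within the
    -- range of short loops.
    · have hL : Nat.clog A.q (K ^ g) ≤ K * k := by
        refine Nat.clog_le_of_le_pow ?_
        calc K ^ g ≤ K ^ k := hKg
          _ ≤ (A.q ^ K) ^ k := Nat.pow_le_pow_left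
              ((Nat.lt_two_pow_self).le.trans (Nat.pow_le_pow_left A.two_le K)) _
          _ = _ := by rw [← pow_mul]
      refine hL.trans ?_
      calc K * k ≤ (2 * k * D) * k := Nat.mul_le_mul_right _ hKD
        _ = 2 * (k * k * D) := by ring
        _ ≤ _ := by rw [hR]; omega
    · rw [hR]; omega
    · exact (hb A.r).trans (hmono _ (by omega))
    · exact hRV.trans (hmono _ (by omega))
    · calc A.d ^ Nat.clog A.q (K ^ g) * A.q ^ Nat.clog A.q (K ^ g) + 1
          ≤ N ^ (e * A.d) * N ^ e + N ^ (e * A.d) * N ^ e := by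
            refine Nat.add_le_add (Nat.mul_le_mul (hb A.d) hqL) ?_
            exact Nat.one_le_iff_ne_zero.2 (by positivity)
        _ = 2 * N ^ (e * A.d + e) := by rw [pow_add]; ring
        _ ≤ N ^ (e * A.d + e + 1) := by
            rw [pow_succ, mul_comm]; exact Nat.mul_le_mul_left _ hN2
        _ ≤ V := hmono _ (by omega)

/-- The exponent `43` is `13 * 3 + 2 * 2`: the range of short loops is a constant times `D ^ 3` and
enters with exponent `13`, and each of the two chains starts with one of at most `4 * k * D ^ 2`
sets, where `D = ds * F`. -/
lemma Kernel.planTime_le (h : Kernel n u m k X Y I sel) (hE : Edges n u m X Y) (hds : I.ds ≠ 0)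
    (hn : 0 < n) (hk : 1 ≤ k) {ρ : ℝ} (hρ : 0 ≤ ρ) (hr : (A.r : ℝ) ≤ (A.q : ℝ) ^ ρ) (p : Plan) :
    (planTime A I k (shortConst A k * (I.ds * I.F) ^ 3) ⌊2 * k * I.candSize⌋₊ ⌊2 * I.bruteSize⌋₊
      ⌊I.bruteSize ^ 2 / (I.F : ℝ) ^ 2⌋₊ p : ℝ) ≤
    planConst A k ρ p * (I.bruteSize ^ p.sets * I.candSize ^ ((p.g : ℝ) * ρ) *
      ((I.ds : ℝ) * I.F) ^ 43) := by
  have hF := h.F_pos hE hds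
  have hF' : (0 : ℝ) < I.F := by exact_mod_cast hF
  have hd : 1 ≤ I.ds := Nat.one_le_iff_ne_zero.2 hds
  have hk' : (1 : ℝ) ≤ k := by exact_mod_cast hk
  have hM1 := h.one_le_bruteSize hE hds
  have hM2 := h.one_le_candSize hE hds
  have hFM := h.F_le_bruteSize hE hds
  have hnp := h.np_le_sq hE hds hk
  have hnp1 := h.np_pos hn
  obtain ⟨D, hD⟩ : ∃ D, D = I.ds * I.F := ⟨_, rfl⟩
  have hD1 : 1 ≤ D := by rw [hD]; exact Nat.one_le_iff_ne_zero.2 (by positivity)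
  have hDr : ((I.ds : ℝ) * I.F) = D := by rw [hD]; push_cast; ring
  rw [hDr, ← hD]
  rw [← hD] at hnp
  generalize hM1' : I.bruteSize = M₁ at *
  generalize hM2' : I.candSize = M₂ at *
  obtain ⟨R, hR⟩ : ∃ R, R = shortConst A k * D ^ 3 := ⟨_, rfl⟩
  have hR1 : 1 ≤ R := by
    rw [hR]; exact Nat.one_le_iff_ne_zero.2 (by rw [shortConst]; positivity)
  have hRr : (R : ℝ) = shortConst A k * (D : ℝ) ^ 3 := by rw [hR]; push_cast; ring
  rw [← hR]
  obtain ⟨K, hK⟩ : ∃ K, K = ⌊2 * k * M₂⌋₊ := ⟨_, rfl⟩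
  have hK1 : 1 ≤ K := by
    rw [hK]; refine Nat.le_floor ?_
    push_cast; nlinarith
  have hKr : (K : ℝ) ≤ 2 * k * M₂ := by
    rw [hK]; exact Nat.floor_le (by positivity)
  rw [← hK]
  obtain ⟨b, hb⟩ : ∃ b, b = Kind.cap I k ⌊2 * M₁⌋₊ ⌊M₁ ^ 2 / (I.F : ℝ) ^ 2⌋₊ := ⟨_, rfl⟩
  have hb₁ : (⌊2 * M₁⌋₊ : ℝ) ≤ 2 * M₁ := Nat.floor_le (by positivity)
  have hb₂ : (⌊M₁ ^ 2 / (I.F : ℝ) ^ 2⌋₊ : ℝ) ≤ M₁ ^ 2 / (I.F : ℝ) ^ 2 := Nat.floor_le (by positivity)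
  have hcap : ∀ κ, 1 ≤ b κ := by
    have e1 : 1 ≤ ⌊2 * M₁⌋₊ := Nat.le_floor (by push_cast; linarith)
    have e2 : 1 ≤ ⌊M₁ ^ 2 / (I.F : ℝ) ^ 2⌋₊ := by
      refine Nat.le_floor ?_
      rw [Nat.cast_one, one_le_div (by positivity)]
      exact pow_le_pow_left₀ hF'.le hFM 2
    intro κ
    rw [hb]
    cases κ <;> simp only [Kind.cap]
    · exact Nat.one_le_iff_ne_zero.2 (by positivity)
    · exact e1
    · exact hnp1
    · exact Nat.one_le_iff_ne_zero.2 (by positivity)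
    · exact hF
  have hprod : (((p.word.map b).prod : ℕ) : ℝ) ≤ (2 * k * M₁) ^ p.sets * (4 * k * (D : ℝ) ^ 2) ^ 2 := by
    have e : (((p.word.map b).prod : ℕ) : ℝ) = (p.word.map fun κ => (b κ : ℝ)).prod := by
      rw [Nat.cast_list_prod, List.map_map]; rfl
    rw [e]
    have hDr1 : (1 : ℝ) ≤ D := by exact_mod_cast hD1
    refine p.prod_word_le (fun κ => by positivity) ?_ ?_ ?_ ?_ ?_ ?_
    · nlinarith
    · have : (1 : ℝ) ≤ (D : ℝ) ^ 2 := one_le_pow₀ hDr1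
      nlinarith
    · simp only [hb, Kind.cap]; push_cast
      gcongr
    · simp only [hb, Kind.cap]
      refine hb₁.trans ?_
      nlinarith
    · simp only [hb, Kind.cap]
      exact_mod_cast hnp
    · simp only [hb, Kind.cap]; push_cast
      calc (k : ℝ) * (⌊M₁ ^ 2 / (I.F : ℝ) ^ 2⌋₊ : ℝ) * (I.F : ℝ) ^ 2
          ≤ k * (M₁ ^ 2 / (I.F : ℝ) ^ 2) * (I.F : ℝ) ^ 2 := by gcongr
        _ = k * M₁ ^ 2 := by field_simp
        _ ≤ (2 * k * M₁) ^ 2 := by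
          rw [mul_pow]
          refine mul_le_mul_of_nonneg_right ?_ (by positivity)
          nlinarith
  obtain ⟨W, hW⟩ : ∃ W, W = leafWidth A K p.g := ⟨_, rfl⟩
  have hr1 : 1 ≤ A.r := by
    have := A.sq_le; have := A.two_le; nlinarith
  have hW1 : 1 ≤ W := by rw [hW]; exact Nat.one_le_pow _ _ hr1
  have hWr : (W : ℝ) ≤ (A.q : ℝ) ^ ρ * ((2 * k) ^ ((p.g : ℝ) * ρ) * M₂ ^ ((p.g : ℝ) * ρ)) := by
    rw [hW, ← Real.mul_rpow (by positivity) (by positivity)]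
    exact leafWidth_le hρ hr hK1 hKr
  have hM2p : (1 : ℝ) ≤ M₂ ^ ((p.g : ℝ) * ρ) := Real.one_le_rpow hM2 (by positivity)
  obtain ⟨t, ht⟩ : ∃ t, t = (leafP A k p.i₁ p.sets p.g₁ p.g₂ p.g).time 1 1 := ⟨_, rfl⟩
  have hleaf : (leafP A k p.i₁ p.sets p.g₁ p.g₂ p.g).time R W ≤ R ^ 13 * (t * W) := by
    have := (leafP A k p.i₁ p.sets p.g₁ p.g₂ p.g).time_le hR1 hW1 (rd_leafP ..) (wd_leafP ..)
    rw [← ht, pow_one] at this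
    exact this.trans (le_of_eq (by ring))
  obtain ⟨o, ho⟩ : ∃ o, o = testTime 1 := ⟨_, rfl⟩
  have htest := overhead_le hR1
  rw [← ho] at htest
  have hnat : planTime A I k R K ⌊2 * M₁⌋₊ ⌊M₁ ^ 2 / (I.F : ℝ) ^ 2⌋₊ p ≤
      (p.word.map b).prod * (R ^ 13 * (t * W + p.word.length * (31 + o))) := by
    rw [planTime, ← hb, ← hW]
    refine (enumTime_le hcap p.word).trans (Nat.mul_le_mul_left _ ?_)
    calc _ ≤ R ^ 13 * (t * W) + p.word.length * (R ^ 13 * (31 + o)) :=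
          Nat.add_le_add hleaf (Nat.mul_le_mul_left _ htest)
      _ = _ := by ring
  have hreal : (planTime A I k R K ⌊2 * M₁⌋₊ ⌊M₁ ^ 2 / (I.F : ℝ) ^ 2⌋₊ p : ℝ) ≤
      ((p.word.map b).prod : ℕ) *
        ((R : ℝ) ^ 13 * (t * W + p.word.length * (31 + o))) := by exact_mod_cast hnat
  refine hreal.trans ?_
  have hin : (t : ℝ) * W + p.word.length * (31 + o) ≤
      (t * ((A.q : ℝ) ^ ρ * (2 * k) ^ ((p.g : ℝ) * ρ)) + p.word.length * (31 + o)) *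
        M₂ ^ ((p.g : ℝ) * ρ) := by
    rw [add_mul]
    refine add_le_add ?_ (le_mul_of_one_le_right (by positivity) hM2p)
    calc (t : ℝ) * W ≤ t * ((A.q : ℝ) ^ ρ * ((2 * k) ^ ((p.g : ℝ) * ρ) * M₂ ^ ((p.g : ℝ) * ρ))) :=
          mul_le_mul_of_nonneg_left hWr (by positivity)
      _ = _ := by ring
  calc _ ≤ ((2 * k * M₁) ^ p.sets * (4 * k * (D : ℝ) ^ 2) ^ 2) * ((R : ℝ) ^ 13 *
        ((t * ((A.q : ℝ) ^ ρ * (2 * k) ^ ((p.g : ℝ) * ρ)) + p.word.length * (31 + o)) *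
          M₂ ^ ((p.g : ℝ) * ρ))) := by
        gcongr
    _ = _ := by
        rw [hRr, planConst, ← ht, ← ho]
        ring

end numeric

end Cover

end

section

open Finset BExpr

namespace Cover

/-! ### The total time -/

/-- The number of sets found by exhaustive search is traded for the size of the matrices. -/
lemma mul_rpow_le_add {M₁ M₂ ω : ℝ} (h1 : 1 ≤ M₁) (h2 : 1 ≤ M₂) {s k : ℕ} (hs : s ≤ k) :
    M₁ ^ s * M₂ ^ (((k : ℝ) - s) * ω / 3) ≤ M₁ ^ k + M₂ ^ ((k : ℝ) * ω / 3) := by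
  have h10 : 0 ≤ M₁ := by linarith
  have h20 : 0 ≤ M₂ := by linarith
  have hM : M₂ ^ (((k : ℝ) - s) * ω / 3) = (M₂ ^ (ω / 3)) ^ (k - s) := by
    rw [← Real.rpow_natCast, ← Real.rpow_mul h20, Nat.cast_sub hs]
    congr 1; ring
  have hM' : M₂ ^ ((k : ℝ) * ω / 3) = (M₂ ^ (ω / 3)) ^ k := by
    rw [← Real.rpow_natCast, ← Real.rpow_mul h20]
    congr 1; ring
  have hp : 0 ≤ M₂ ^ (ω / 3) := Real.rpow_nonneg h20 _
  rw [hM, hM']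
  rcases le_total M₁ (M₂ ^ (ω / 3)) with h | h
  · calc M₁ ^ s * (M₂ ^ (ω / 3)) ^ (k - s) ≤ (M₂ ^ (ω / 3)) ^ s * (M₂ ^ (ω / 3)) ^ (k - s) := by
          gcongr
      _ = (M₂ ^ (ω / 3)) ^ k := by rw [← pow_add, Nat.add_sub_cancel' hs]
      _ ≤ _ := by linarith [pow_nonneg h10 k]
  · calc M₁ ^ s * (M₂ ^ (ω / 3)) ^ (k - s) ≤ M₁ ^ s * M₁ ^ (k - s) := by gcongr
      _ = M₁ ^ k := by rw [← pow_add, Nat.add_sub_cancel' hs]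
      _ ≤ _ := by linarith [pow_nonneg hp k]

/-- Rounding in `g ≤ (k - s + 2) / 3` and the slack `1 / k` in the exponent of matrix multiplication
cost a power of `M₂` with exponent at most `2 ω / 3 + 1`, independent of `k`. Since `M₂ ≤ D`, it is
absorbed in the power of `D`. -/
lemma mul_rpow_mul_pow_le {M₁ M₂ D ω : ℝ} (h1 : 1 ≤ M₁) (h2 : 1 ≤ M₂) (hD : M₂ ≤ D) {s g k : ℕ}
    (hk : 1 ≤ k) (hs : s ≤ k) (hg : s + 3 * g ≤ k + 2) (hω : 0 ≤ ω + 1 / k) (a : ℕ) :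
    M₁ ^ s * M₂ ^ ((g : ℝ) * (ω + 1 / k)) * D ^ a ≤
      (M₁ ^ k + M₂ ^ ((k : ℝ) * ω / 3)) * D ^ (a + ⌈2 * ω / 3 + 1⌉₊) := by
  have h10 : 0 ≤ M₁ := by linarith
  have h20 : 0 < M₂ := by linarith
  have hk' : (1 : ℝ) ≤ k := by exact_mod_cast hk
  have hg' : (s : ℝ) + 3 * g ≤ k + 2 := by exact_mod_cast hg
  -- The slack contributes at most `(k - s + 2) / (3 k) ≤ 1`.
  have hexp : (g : ℝ) * (ω + 1 / k) ≤ ((k : ℝ) - s) * ω / 3 + (2 * ω / 3 + 1) := by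
    have e1 : (g : ℝ) * (ω + 1 / k) ≤ ((k : ℝ) - s + 2) / 3 * (ω + 1 / k) :=
      mul_le_mul_of_nonneg_right (by linarith) hω
    have e2 : ((k : ℝ) - s + 2) / 3 * (1 / k) ≤ 1 := by
      rw [mul_one_div, div_le_one (by linarith)]
      have : (0 : ℝ) ≤ s := by positivity
      linarith
    calc _ ≤ _ := e1
      _ = ((k : ℝ) - s) * ω / 3 + (2 * ω / 3 + ((k : ℝ) - s + 2) / 3 * (1 / k)) := by ring
      _ ≤ _ := by linarith
  calc M₁ ^ s * M₂ ^ ((g : ℝ) * (ω + 1 / k)) * D ^ a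
      ≤ M₁ ^ s * (M₂ ^ (((k : ℝ) - s) * ω / 3) * D ^ ⌈2 * ω / 3 + 1⌉₊) * D ^ a := by
        have : M₂ ^ ((g : ℝ) * (ω + 1 / k)) ≤ M₂ ^ (((k : ℝ) - s) * ω / 3) * D ^ ⌈2 * ω / 3 + 1⌉₊ := by
          calc _ ≤ M₂ ^ (((k : ℝ) - s) * ω / 3 + (2 * ω / 3 + 1)) :=
                Real.rpow_le_rpow_of_exponent_le h2 hexp
            _ = M₂ ^ (((k : ℝ) - s) * ω / 3) * M₂ ^ (2 * ω / 3 + 1) := Real.rpow_add h20 _ _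
            _ ≤ _ := by
              refine mul_le_mul_of_nonneg_left ?_ (Real.rpow_nonneg h20.le _)
              calc M₂ ^ (2 * ω / 3 + 1) ≤ M₂ ^ ((⌈2 * ω / 3 + 1⌉₊ : ℕ) : ℝ) :=
                    Real.rpow_le_rpow_of_exponent_le h2 (Nat.le_ceil _)
                _ = M₂ ^ ⌈2 * ω / 3 + 1⌉₊ := Real.rpow_natCast _ _
                _ ≤ _ := pow_le_pow_left₀ h20.le hD _
        have hD0 : 0 ≤ D := by linarith
        gcongr
    _ = (M₁ ^ s * M₂ ^ (((k : ℝ) - s) * ω / 3)) * D ^ (a + ⌈2 * ω / 3 + 1⌉₊) := by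
        rw [pow_add]; ring
    _ ≤ _ := by
        refine mul_le_mul_of_nonneg_right (mul_rpow_le_add h1 h2 hs) (pow_nonneg (by linarith) _)

noncomputable def searchConst (A : BilinearAlg) (k : ℕ) (ρ : ℝ) : ℝ :=
  ((Plan.all k).map (planConst A k ρ)).sum

lemma sum_map_le {α : Type*} {f : α → ℕ} {g : α → ℝ} {Z : ℝ} (l : List α)
    (h : ∀ p ∈ l, (f p : ℝ) ≤ g p * Z) : (((l.map f).sum : ℕ) : ℝ) ≤ (l.map g).sum * Z := by
  induction l with
  | nil => simp
  | cons p l ih =>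
    simp only [List.map_cons, List.sum_cons, Nat.cast_add, add_mul]
    exact add_le_add (h p List.mem_cons_self) (ih fun q hq => h q (List.mem_cons_of_mem _ hq))

lemma planConst_nonneg (A : BilinearAlg) (k : ℕ) (ρ : ℝ) (p : Plan) : 0 ≤ planConst A k ρ p := by
  unfold planConst
  generalize testTime 1 = o
  positivity

lemma searchConst_nonneg (A : BilinearAlg) (k : ℕ) (ρ : ℝ) : 0 ≤ searchConst A k ρ := by
  refine List.sum_nonneg fun x hx => ?_
  obtain ⟨p, -, rfl⟩ := List.mem_map.1 hx
  exact planConst_nonneg A k ρ p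

lemma Kernel.exists_searchFit {n u m k : ℕ} {X Y : ℕ → ℕ} {I : Inst} {sel : ℕ → ℕ} {A : BilinearAlg}
    {ω : ℝ} {V : ℕ} (h : Kernel n u m k X Y I sel) (hE : Edges n u m X Y) (hds : I.ds ≠ 0)
    (hn : 0 < n) (hk : 1 ≤ k) (hω : 0 ≤ ω + 1 / k) (hr : (A.r : ℝ) ≤ (A.q : ℝ) ^ (ω + 1 / k))
    (hV : (n + u + m + 2) ^ cellExp A k ≤ V) :
    ∃ R K₀ b₁ b₂, SearchFit A I k V R K₀ b₁ b₂ ∧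
      ((((Plan.all k).map (planTime A I k R K₀ b₁ b₂)).sum : ℕ) : ℝ) ≤
        searchConst A k (ω + 1 / k) * ((I.bruteSize ^ k + I.candSize ^ ((k : ℝ) * ω / 3)) *
          ((I.ds : ℝ) * I.F) ^ (43 + ⌈2 * ω / 3 + 1⌉₊)) := by
  refine ⟨_, _, _, _, h.searchFit hE hds hn hk hV, sum_map_le _ fun p hp => ?_⟩
  obtain ⟨h1, h2, h3, h4, h5⟩ := Plan.mem_all.1 hp
  refine (h.planTime_le hE hds hn hk hω hr p).trans
    (mul_le_mul_of_nonneg_left ?_ (planConst_nonneg _ _ _ _))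
  exact mul_rpow_mul_pow_le (h.one_le_bruteSize hE hds) (h.one_le_candSize hE hds)
    Kernel.candSize_le hk (by omega) (by omega) hω 43

/-- No short loops or sums and no nesting of long loops: hence linear time. -/
lemma time_kernelP_le (k R W : ℕ) (hR : 1 ≤ R) (hW : 1 ≤ W) :
    (kernelP k).time R W ≤ (kernelP k).time 1 1 * W := by
  have h1 : (kernelP k).rd ≤ 0 := by
    simp [kernelP, degreeP, incP, maxP, selectP, adjP, BProg.rd, depth]
  have h2 : (kernelP k).wd ≤ 1 := by
    simp [kernelP, degreeP, incP, maxP, selectP, adjP, BProg.wd]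
  simpa using (kernelP k).time_le hR hW h1 h2

/-- The infimum need not be attained, but `k` is fixed before the program, so an algorithm with
exponent at most `ω + 1 / k` may be built into it. The exponent is nonnegative because `r ≥ 1` while
`q > 1`. -/
lemma exists_bilinearAlg {k : ℕ} (hk : 1 ≤ k) : ∃ A : BilinearAlg,
    0 ≤ matMulExponent + 1 / k ∧ (A.r : ℝ) ≤ (A.q : ℝ) ^ (matMulExponent + 1 / k) := by
  have hk' : (0 : ℝ) < k := by exact_mod_cast hk
  obtain ⟨q, r, hq, hM, hr⟩ := exists_matMulRankLE (δ := 1 / (k : ℝ)) (by positivity)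
  obtain ⟨d, α, β, γ, hd, hA⟩ := hM.exists_bilinearAlg
  have hsq := hM.mul_self_le
  refine ⟨⟨q, r, d, α, β, γ, hq, hd, hsq, hA⟩, ?_, hr⟩
  by_contra hc
  have h1 : (q : ℝ) ^ (matMulExponent + 1 / k) < 1 :=
    Real.rpow_lt_one_of_one_lt_of_neg (by exact_mod_cast hq) (not_le.1 hc)
  have h2 : (1 : ℝ) ≤ r := by exact_mod_cast (by nlinarith : 1 ≤ r)
  linarith

/-! ### The input -/

section input

variable {n u : ℕ} {G : BipartiteGraph n u} {es : List (Fin n × Fin u)}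

/-- The endpoints in `X` of the listed edges. -/
def leftEnd (es : List (Fin n × Fin u)) (i : ℕ) : ℕ := (es.map fun e => (e.1 : ℕ)).getD i 0

/-- The endpoints in `Y` of the listed edges. -/
def rightEnd (es : List (Fin n × Fin u)) (i : ℕ) : ℕ := (es.map fun e => (e.2 : ℕ)).getD i 0

lemma leftEnd_eq {i : ℕ} (hi : i < es.length) : leftEnd es i = (es[i].1 : ℕ) := by
  simp [leftEnd, hi]

lemma rightEnd_eq {i : ℕ} (hi : i < es.length) : rightEnd es i = (es[i].2 : ℕ) := by
  simp [rightEnd, hi]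

lemma edges_of_isEdgeList (h : G.IsEdgeList es) :
    Edges n u es.length (leftEnd es) (rightEnd es) := by
  refine ⟨fun e he => ?_, fun e he => ?_, fun e he e' he' hX hY => ?_⟩
  · rw [leftEnd_eq he]; exact Fin.is_lt _
  · rw [rightEnd_eq he]; exact Fin.is_lt _
  · rw [leftEnd_eq he, leftEnd_eq he'] at hX
    rw [rightEnd_eq he, rightEnd_eq he'] at hY
    exact (List.Nodup.getElem_inj_iff h.1).1 (Prod.ext (Fin.ext hX) (Fin.ext hY))

lemma length_eq_card (h : G.IsEdgeList es) : es.length = G.edges.card := by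
  rw [← h.2, List.toFinset_card_of_nodup h.1]

lemma mem_nbh_iff (h : G.IsEdgeList es) (x : Fin n) (y : ℕ) :
    y ∈ nbh es.length (leftEnd es) (rightEnd es) x ↔ ∃ y' ∈ G.nbrX x, (y' : ℕ) = y := by
  rw [mem_nbh]
  simp only [BipartiteGraph.nbrX, mem_filter, mem_univ, true_and, ← h.2, List.mem_toFinset]
  constructor
  · rintro ⟨e, he, hX, rfl⟩
    rw [leftEnd_eq he] at hX
    refine ⟨es[e].2, ?_, (rightEnd_eq he).symm⟩
    have : (x, es[e].2) = es[e] := Prod.ext (Fin.ext hX.symm) rfl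
    rw [this]; exact List.getElem_mem he
  · rintro ⟨y', hy, rfl⟩
    obtain ⟨e, he, heq⟩ := List.getElem_of_mem hy
    exact ⟨e, he, by rw [leftEnd_eq he, heq], by rw [rightEnd_eq he, heq]⟩

lemma nbh_eq (h : G.IsEdgeList es) (x : Fin n) :
    nbh es.length (leftEnd es) (rightEnd es) x = (G.nbrX x).image Fin.val := by
  ext y
  rw [mem_nbh_iff h, mem_image]

lemma sup_univ_eq {n : ℕ} {f : Fin n → ℕ} {g : ℕ → ℕ} (h : ∀ x : Fin n, f x = g x) :
    univ.sup f = (range n).sup g := by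
  refine le_antisymm (Finset.sup_le fun x _ => ?_) (Finset.sup_le fun x hx => ?_)
  · rw [h x]; exact le_sup (f := g) (mem_range.2 x.2)
  · exact (h ⟨x, mem_range.1 hx⟩).symm.trans_le (le_sup (f := f) (mem_univ _))

lemma maxSetSize_eq (h : G.IsEdgeList es) :
    G.maxSetSize = (range n).sup (deg es.length (leftEnd es)) := by
  refine sup_univ_eq fun x => ?_
  rw [← (edges_of_isEdgeList h).card_nbh, nbh_eq h, card_image_of_injective _ Fin.val_injective]

lemma maxFrequency_eq (h : G.IsEdgeList es) :
    G.maxFrequency = (range u).sup (deg es.length (rightEnd es)) := by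
  refine sup_univ_eq fun y => ?_
  rw [← (edges_of_isEdgeList h).card_mem_nbh, ← card_image_of_injective _ Fin.val_injective]
  congr 1
  ext x
  simp only [mem_image, mem_filter, mem_range, BipartiteGraph.nbrY, mem_univ, true_and]
  constructor
  · rintro ⟨x, hx, rfl⟩
    exact ⟨x.2, (mem_nbh_iff h x _).2 ⟨y, by simpa [BipartiteGraph.nbrX] using hx, rfl⟩⟩
  · rintro ⟨hx, hy⟩
    obtain ⟨y', hy', heq⟩ := (mem_nbh_iff h ⟨x, hx⟩ _).1 hy
    obtain rfl : y' = y := Fin.ext heq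
    exact ⟨⟨x, hx⟩, by simpa [BipartiteGraph.nbrX] using hy', rfl⟩

lemma coverage_eq (h : G.IsEdgeList es) {k : ℕ} (x : Fin k → Fin n) : G.coverage x =
    ((univ.image fun i => (x i : ℕ)).biUnion (nbh es.length (leftEnd es) (rightEnd es))).card := by
  rw [BipartiteGraph.coverage, ← card_image_of_injective _ Fin.val_injective, image_biUnion,
    biUnion_image]
  congr 1
  ext y
  simp only [mem_biUnion, mem_univ, true_and, mem_image, mem_nbh_iff h]

lemma input_coverInput (es : List (Fin n × Fin u)) :
    Input n u es.length (leftEnd es) (rightEnd es) (coverInput es).vars := by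
  refine ⟨rfl, rfl, rfl, fun x hx => ?_, rfl, rfl, fun a ha i => ?_⟩
  · have : varReg x = 2 * x := if_neg (by omega)
    simp only [RamState.vars_reg, this, coverInput]
    rw [if_neg (by omega), if_neg (by omega), if_neg (by omega)]
  · simp only [RamState.vars_arr, coverInput]
    rw [if_neg (by omega), if_neg (by omega)]

lemma Input.bdd {m V : ℕ} {X Y : ℕ → ℕ} {τ : RamState} (h : Input n u m X Y τ)
    (hX : ∀ i, X i ≤ V) (hY : ∀ i, Y i ≤ V) (hV : n + u + m ≤ V) : τ.Bdd V := by
  refine ⟨fun x => ?_, fun a i => ?_⟩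
  · by_cases hx : 3 ≤ x
    · rw [h.reg x hx]; omega
    · have h0 := h.r0
      have h1 := h.r1
      have h2 := h.r2
      interval_cases x <;> omega
  · by_cases ha : 2 ≤ a
    · rw [h.arr a ha]; omega
    · have h0 := h.a0
      have h1 := h.a1
      interval_cases a
      · rw [h0]; exact hX i
      · rw [h1]; exact hY i

lemma leftEnd_le (es : List (Fin n × Fin u)) (i : ℕ) : leftEnd es i ≤ n := by
  by_cases hi : i < es.length
  · rw [leftEnd_eq hi]; exact (Fin.is_lt _).le
  · rw [leftEnd, List.getD_eq_default _ _ (by simpa using hi)]; omega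

lemma rightEnd_le (es : List (Fin n × Fin u)) (i : ℕ) : rightEnd es i ≤ u := by
  by_cases hi : i < es.length
  · rw [rightEnd_eq hi]; exact (Fin.is_lt _).le
  · rw [rightEnd, List.getD_eq_default _ _ (by simpa using hi)]; omega

end input

end Cover

end

/-- Max-`k`-Cover on bipartite graphs `G = (X ∪ Y, E)` with `|X| = n`, `|Y| = u`: the program (for
fixed `k`, with words of `O(log(input size))` bits) leaves an optimal `x₁, …, x_k` in cells
`0, …, k - 1` of array `2`. -/
theorem mainTheorem2 :
    ∃ c : ℕ, ∀ k : ℕ, 1 ≤ k →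
      ∃ (P : RamProg) (κ : ℕ) (C : ℝ),
        ∀ (n u : ℕ) (G : BipartiteGraph n u) (es : List (Fin n × Fin u)),
          0 < n → G.IsEdgeList es →
          ∃ (σ : RamState) (t : ℕ),
            RamExec ((G.inputSize + 2) ^ κ) P (coverInput es) σ t ∧
            (t : ℝ) ≤ C * ((G.inputSize : ℝ) +
              ((min (n : ℝ) ((G.maxFrequency : ℝ) *
                    min ((u : ℝ) ^ (1 / 3 : ℝ)) (Real.sqrt (G.maxSetSize : ℝ)))) ^ k +
                (min (n : ℝ) ((G.maxFrequency : ℝ) *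
                    min (Real.sqrt (u : ℝ)) (G.maxSetSize : ℝ))) ^
                  ((k : ℝ) * matMulExponent / 3)) *
              ((G.maxSetSize : ℝ) * (G.maxFrequency : ℝ)) ^ c) ∧
            ∃ x : Fin k → Fin n,
              (∀ i : Fin k, σ.arr 2 (i : ℕ) = (x i : ℕ)) ∧
              (k ≤ n → Function.Injective x) ∧
              ∀ x' : Fin k → Fin n, G.coverage x' ≤ G.coverage x := by
  -- The two summands come from `Cover.Kernel.planTime_le` and from rounding in
  -- `Cover.mul_rpow_mul_pow_le`.
  refine ⟨43 + ⌈2 * matMulExponent / 3 + 1⌉₊, fun k hk => ?_⟩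
  obtain ⟨A, hω, hr⟩ := Cover.exists_bilinearAlg hk
  refine ⟨(Cover.coverP A k).compile 0,
    -- Memory cells stay at most `V`, the power of the input size plus two with the first factor as
    -- exponent; intermediate values stay below `V ^ (deg + 1)`, which gives the second factor.
    (Cover.cellExp A k + k + 1) * ((Cover.coverP A k).deg + 1),
    (Cover.kernelP k).time 1 1 + 5 + (Cover.outputP k).time (k + 1) 1 +
      Cover.searchConst A k (matMulExponent + 1 / k), fun n u G es hn hes => ?_⟩
  have hE := Cover.edges_of_isEdgeList hes
  have hin := Cover.input_coverInput es
  have hsize : G.inputSize = n + u + es.length := by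
    rw [BipartiteGraph.inputSize, Cover.length_eq_card hes]
  obtain ⟨V, hV⟩ : ∃ V, V = (G.inputSize + 2) ^ (Cover.cellExp A k + k + 1) := ⟨_, rfl⟩
  have hb : 2 ≤ G.inputSize + 2 := by omega
  have hVN : G.inputSize + 2 ≤ V := by
    rw [hV]; exact Nat.le_self_pow (by omega) _
  have hVk : k + 1 ≤ V := by
    rw [hV]
    calc k + 1 ≤ 2 ^ (k + 1) := Nat.lt_two_pow_self.le
      _ ≤ (G.inputSize + 2) ^ (k + 1) := Nat.pow_le_pow_left hb _
      _ ≤ _ := Nat.pow_le_pow_right (by omega) (by omega)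
  have hVc : (n + u + es.length + 2) ^ Cover.cellExp A k ≤ V := by
    rw [hV, hsize]; exact Nat.pow_le_pow_right (by omega) (by omega)
  obtain ⟨Z, hZ⟩ : ∃ Z : ℝ, Z =
      ((min (n : ℝ) ((G.maxFrequency : ℝ) *
          min ((u : ℝ) ^ (1 / 3 : ℝ)) (Real.sqrt (G.maxSetSize : ℝ)))) ^ k +
        (min (n : ℝ) ((G.maxFrequency : ℝ) * min (Real.sqrt (u : ℝ)) (G.maxSetSize : ℝ))) ^
          ((k : ℝ) * matMulExponent / 3)) *
      ((G.maxSetSize : ℝ) * (G.maxFrequency : ℝ)) ^ (43 + ⌈2 * matMulExponent / 3 + 1⌉₊) := ⟨_, rfl⟩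
  have hZ0 : 0 ≤ Z := by rw [hZ]; positivity
  have hC0 := Cover.searchConst_nonneg A k (matMulExponent + 1 / k)
  obtain ⟨σ, t, hex, ht, ⟨hlt, hinj, hopt⟩, -, -⟩ := Cover.tri_coverP (A := A) (V := V)
    (T := ⌊Cover.searchConst A k (matMulExponent + 1 / k) * Z⌋₊) hE hin hn hk (by omega) hVk (by
      intro I sel hI hds
      obtain ⟨R, K₀, b₁, b₂, hf, hle⟩ := hI.exists_searchFit hE hds hn hk hω hr hVc
      refine ⟨R, K₀, b₁, b₂, hf, Nat.le_floor (hle.trans_eq ?_)⟩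
      rw [hZ, Cover.Inst.bruteSize, Cover.Inst.candSize, hI.n_eq, hI.u_eq, hI.ds_eq, hI.F_eq,
        Cover.maxSetSize_eq hes, Cover.maxFrequency_eq hes])
    (by omega)
    (hin.bdd (fun i => (Cover.leftEnd_le es i).trans (by omega))
      (fun i => (Cover.rightEnd_le es i).trans (by omega)) (by omega))
    _ le_rfl 0 _ rfl
  refine ⟨σ, t, ?_, ?_, fun i => ⟨σ.arr 2 i, hlt i i.2⟩, fun _ => rfl, fun hkn i j hij => ?_,
    fun x' => ?_⟩
  · rw [hV, ← pow_mul] at hex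
    exact hex
  · rw [← hZ]
    have hN : 1 ≤ n + u + es.length := by omega
    have h1 := Cover.time_kernelP_le k (k + 1) (n + u + es.length) (by omega) hN
    rw [← hsize] at h1 hN
    have h2 : (⌊Cover.searchConst A k (matMulExponent + 1 / k) * Z⌋₊ : ℝ) ≤
        Cover.searchConst A k (matMulExponent + 1 / k) * Z := Nat.floor_le (by positivity)
    have h3 : (t : ℝ) ≤ (Cover.kernelP k).time 1 1 * G.inputSize +
        (⌊Cover.searchConst A k (matMulExponent + 1 / k) * Z⌋₊ + 5) +
          (Cover.outputP k).time (k + 1) 1 := by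
      rw [← hsize] at ht
      exact_mod_cast ht.trans (by omega)
    have hN' : (1 : ℝ) ≤ G.inputSize := by exact_mod_cast hN
    generalize (Cover.kernelP k).time 1 1 = a at h3 ⊢
    generalize (Cover.outputP k).time (k + 1) 1 = b at h3 ⊢
    generalize Cover.searchConst A k (matMulExponent + 1 / k) = c at h2 h3 hC0 ⊢
    have ha : (0 : ℝ) ≤ a := by positivity
    have hb : (0 : ℝ) ≤ b := by positivity
    nlinarith [mul_nonneg ha hZ0, mul_nonneg hb hZ0, mul_nonneg hb (sub_nonneg.2 hN'),
      mul_nonneg hC0 (by linarith : (0 : ℝ) ≤ G.inputSize)]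
  · exact Fin.ext (hinj hkn i i.2 j j.2 (Fin.ext_iff.1 hij))
  · rw [Cover.coverage_eq hes, Cover.coverage_eq hes]
    refine (hopt _ ?_ ?_).trans_eq ?_
    · intro v hv
      obtain ⟨i, -, rfl⟩ := Finset.mem_image.1 hv
      exact Finset.mem_range.2 (x' i).2
    · exact Finset.card_image_le.trans (by simp)
    · congr 2
      ext v
      simp only [Finset.mem_image, Finset.mem_range, Finset.mem_univ, true_and]
      exact ⟨fun ⟨i, hi, h⟩ => ⟨⟨i, hi⟩, h⟩, fun ⟨i, h⟩ => ⟨i, i.2, h⟩⟩
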